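/- **Polytope complexes.** A polytope complex $\mathcal C$ is a double category such that: the vertical category $\mathcal C_v$ is a preorder with a unique initial object $\emptyset$, it has pullbacks, and it carries a Grothendieck topology; the horizontal category is a groupoid; a square is determined by its boundary; vertical morphisms pull back uniquely along horizontal ones, and covering families pull back to covering families; an initial member of a covering family may be omitted from it. Two objects are disjoint if they have no noninitial common lower bound. $\mathcal C^{id}$ has as objects the finite families of noninitial objects of $\mathcal C$ any two distinct members of which are disjoint and lie below a common object; its vertical morphisms are the sub-maps (maps of index sets with vertical components), its horizontal morphisms are the bijections of index sets with horizontal components, and its topology is pointwise. A morphism $\mathcal C\to\mathcal D$ of polytope complexes is a polytope functor $\mathcal C\to\mathcal D^{id}$ (a double functor that preserves $\emptyset$, vertical pullbacks and covering families), with the Kleisli composition given by unions of families. The wedge $\bigvee$ is the disjoint union with the objects $\emptyset$ identified. **The category $SC(\mathcal C)$.** Its objects are the finite families of noninitial objects of $\mathcal C$. A morphism $A\to B$ is an isomorphism class of spans $A\leftarrow A'\to B$, where $A'\to A$ is a sub-map for which distinct members of $A'$ over the same member of $A$ are disjoint, and $A'\to B$ is a shuffle, i.e. a map of index sets with horizontal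 components; composition is by pullback. The morphism is a cofibration if $A'$ covers every member of $A$ and $A'\to B$ is injective on indices, and a weak equivalence if moreover $A'\to B$ is bijective on indices. $SC$ is a functor on polytope complexes. Families are taken in a labelled form in which the functors induced by morphisms $\mathcal C\to\mathcal D$ and all unions below are strictly functorial. A cofibration $A\rightarrowtail B$ has the canonical cofiber $B/A$, the subfamily of the members of $B$ outside the image of $A$; it is also a summand of $B$. **The simplicial polytope complex $s_\bullet\mathcal C$.** For $m\ge1$ the noninitial objects of $f_m\mathcal C$ are the diagrams $A_1\leftarrow A_2\leftarrow\cdots\leftarrow A_m$ of covering sub-maps in $\mathcal C^{id}$ with $A_1$ a singleton; vertical and horizontal morphisms, squares and covering families are levelwise. Put $s_n\mathcal C=\bigvee_{m=1}^n f_m\mathcal C$, and index an object of $f_m\mathcal C\subseteq s_n\mathcal C$ as $A_b\leftarrow\cdots\leftarrow A_n$ with $b=n-m+1$. For $i\ge1$ the face $\partial_i$ skips $A_i$ if $b\leq i$ and is the identity on $f_m\mathcal C$ if $i<b$; when $i=b$, what remains is split into the fibres over the members of $A_{b+1}$ (and is $\emptyset$ if $b=n$). The face $\partial_0$ is $0$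 on $f_n\mathcal C$ and the identity on $f_m\mathcal C$ for $m<n$. The degeneracy $\sigma_i$ repeats $A_i$ if $b\le i$ and is the identity on $f_m\mathcal C$ if $i<b$. **The simplicial category $L_\bullet SC(\mathcal C)$.** Let $F_nSC(\mathcal C)$ be the category of sequences of cofibrations $A_1\rightarrowtail\cdots\rightarrowtail A_n$ in $SC(\mathcal C)$, with the levelwise weak equivalences, and with cofibrations those $A\to B$ for which all $B_{i-1}\cup_{A_{i-1}}A_i\to B_i$ are cofibrations ($1\le i\le n$, $A_0=B_0=0$). A morphism $f:A\to B$ is layered if for all $1\le i<k\le n$ the two composites $A_k/A_i\to A_k\to B_k$ and $A_k/A_i\to B_k/B_i\to B_k$ agree. $L_nSC(\mathcal C)\subseteq F_nSC(\mathcal C)$ is the subcategory of all objects and the layered morphisms, with the cofibrations and weak equivalences of $F_nSC(\mathcal C)$ that it contains. Its faces skip $A_i$ for $i\ge1$, and $\partial_0$ takes $A$ to $A_2/A_1\rightarrowtail\cdots\rightarrowtail A_n/A_1$; its degeneracies repeat $A_i$, and $\sigma_0$ prepends the zero object. Let $L_\bullet SC(\mathcal C)\to S_\bullet SC(\mathcal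 C)$ be the functor to Waldhausen's construction that adds the canonical subquotients $A_j/A_i$. **The functor $F_\bullet$.** $F_n:SC(s_n\mathcal C)\to L_nSC(\mathcal C)$ takes levelwise unions: the $l$-th term of $F_n(X)$ is the union, over the members $A$ of the family $X$, of the families $A_l$ (empty for $l<b$). **Proposition.** Let $\mathcal C$ be a polytope complex. 1. $SC(s_\bullet\mathcal C)$ and $L_\bullet SC(\mathcal C)$ are simplicial Waldhausen categories: every level is a Waldhausen category and the structure maps are exact. 2. $F_\bullet:SC(s_\bullet\mathcal C)\to L_\bullet SC(\mathcal C)$ is an exact equivalence of simplicial Waldhausen categories. That is, the $F_n$ commute strictly with the simplicial structure maps and are exact, every $F_n$ is an equivalence of categories with an exact inverse $G_n$, and the $G_n$ commute with the simplicial structure maps up to natural isomorphisms compatible with the equivalences $F_n\dashv G_n$. 3. The functors $L_nSC(\mathcal C)\to S_nSC(\mathcal C)$ are exact, and $SC(s_\bullet\mathcal C)$ computes the $K$-theory of $\mathcal C$: for every $q\ge0$ the functors $SC(s_\bullet\mathcal C)\to L_\bullet SC(\mathcal C)$ and $SC(s_\bullet\mathcal C)\to L_\bullet SC(\mathcal C)\to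 S_\bullet SC(\mathcal C)$ induce homotopy equivalences of geometric realizations $$|N w S_\bullet^{(q)}SC(s_\bullet\mathcal C)|\simeq|N w S_\bullet^{(q)}L_\bullet SC(\mathcal C)|\quad\text{and}\quad |N w S_\bullet^{(q)}SC(s_\bullet\mathcal C)|\simeq|N w S_\bullet^{(q+1)}SC(\mathcal C)| .$$ -/

import Mathlib

open CategoryTheory

universe u v w

/-- The sieve on `a` generated by the set of objects `X` of a preorder: the `w ≤ a` lying below
some element of `X`. -/
def sieveOf {P : Type u} [Preorder P] (X : Set P) (a : P) : Sieve a where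
  arrows w _ := ∃ x ∈ X, w ≤ x
  downward_closed := by
    rintro w w' _ ⟨x, hx, h⟩ g
    exact ⟨x, hx, g.le.trans h⟩

/-- A polytope complex, presented by its noninitial objects. A polytope complex is a double category
`C` whose vertical category `C_v` is a preorder with a unique initial object `∅`, closed under
pullbacks and carrying a Grothendieck topology, whose horizontal category is a groupoid, such that
vertical morphisms pull back uniquely along horizontal ones (together with the covering families),
and such that an initial member of a covering family may be omitted from it. The dictionary is:

* `P` is the set of noninitial objects with the vertical preorder, so `C_v` is `P` with a least
  element `∅` adjoined;
* `J` is the topology. As copies of `∅` may be added to and removed from a covering family, it is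
  determined by the covering families of noninitial objects by noninitial objects (a noninitial
  object may have the empty family, or equivalently `∅`, as a covering family);
* `Hor a b` is the set of horizontal morphisms. Pulling `∅` back shows that no noninitial object is
  horizontally isomorphic to `∅`;
* `Sq t s` says that there is a square with top `t`, bottom `s` and vertical sides. It is unique,
  as the boundary of a square determines it;
* `meet` says that the pullback of `x` and `y` over `z` exists: it is `∅` if `x` and `y` have no
  common lower bound in `P`, and their greatest lower bound in `P` otherwise. -/
structure PolytopeComplex where
  /-- the noninitial objects -/
  P : Type u
  [pre : Preorder P]
  /-- the topology of the vertical category -/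
  J : GrothendieckTopology P
  /-- the horizontal groupoid -/
  Hor : P → P → Type v
  hid : ∀ a, Hor a a
  hcomp : ∀ {a b c}, Hor a b → Hor b c → Hor a c
  hinv : ∀ {a b}, Hor a b → Hor b a
  id_hcomp : ∀ {a b} (s : Hor a b), hcomp (hid a) s = s
  hcomp_id : ∀ {a b} (s : Hor a b), hcomp s (hid b) = s
  hassoc : ∀ {a b c d} (s : Hor a b) (t : Hor b c) (r : Hor c d),
    hcomp (hcomp s t) r = hcomp s (hcomp t r)
  hcomp_inv : ∀ {a b} (s : Hor a b), hcomp s (hinv s) = hid a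
  inv_hcomp : ∀ {a b} (s : Hor a b), hcomp (hinv s) s = hid b
  /-- `Sq t s`: there is a square with top `t : a' → b'` and bottom `s : a → b`, where `a' ≤ a` and
  `b' ≤ b` -/
  Sq : ∀ {a' b' a b}, Hor a' b' → Hor a b → Prop
  sq_left : ∀ {a' b' a b} {t : Hor a' b'} {s : Hor a b}, Sq t s → a' ≤ a
  sq_right : ∀ {a' b' a b} {t : Hor a' b'} {s : Hor a b}, Sq t s → b' ≤ b
  sq_refl : ∀ {a b} (s : Hor a b), Sq s s
  sq_trans : ∀ {a'' b'' a' b' a b} {r : Hor a'' b''} {t : Hor a' b'} {s : Hor a b},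
    Sq r t → Sq t s → Sq r s
  sq_hid : ∀ {a' a}, a' ≤ a → Sq (hid a') (hid a)
  sq_hcomp : ∀ {a' b' c' a b c} {t : Hor a' b'} {t' : Hor b' c'} {s : Hor a b} {s' : Hor b c},
    Sq t s → Sq t' s' → Sq (hcomp t t') (hcomp s s')
  /-- the vertical category has pullbacks -/
  meet : ∀ {x y z w : P}, x ≤ z → y ≤ z → w ≤ x → w ≤ y → ∃ m, IsGLB {x, y} m
  /-- vertical morphisms pull back uniquely along horizontal ones -/
  sq_exists : ∀ {a b b'} (s : Hor a b), b' ≤ b → ∃ a', ∃ t : Hor a' b', Sq t s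
  sq_unique : ∀ {a b b' a₁ a₂} {s : Hor a b} {t₁ : Hor a₁ b'} {t₂ : Hor a₂ b'},
    Sq t₁ s → Sq t₂ s → (⟨a₁, t₁⟩ : Σ x, Hor x b') = ⟨a₂, t₂⟩
  /-- covering families pull back to covering families along horizontal morphisms -/
  cover_hor : ∀ {a b} (s : Hor a b) (S : Sieve b), S ∈ J b →
    sieveOf {a' | ∃ b', ∃ t : Hor a' b', (∃ f : b' ⟶ b, S f) ∧ Sq t s} a ∈ J a

attribute [instance] PolytopeComplex.pre

namespace PolytopeComplex

variable {C D : PolytopeComplex.{u, v}}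

/-- `x` and `y` have no noninitial common lower bound, i.e. their product is the initial object. -/
def Disj (x y : C.P) : Prop := ∀ w, w ≤ x → w ≤ y → False

/-- `x` and `y` are disjoint inside some object that contains both: the condition on two distinct
members of an object of `C^id`. -/
def Sep (x y : C.P) : Prop := (∃ z, x ≤ z ∧ y ≤ z) ∧ Disj x y

lemma sq_inv {a' b' a b : C.P} {t : C.Hor a' b'} {s : C.Hor a b} (h : C.Sq t s) :
    C.Sq (C.hinv t) (C.hinv s) := by
  obtain ⟨b'', r, hr⟩ := C.sq_exists (C.hinv s) (C.sq_left h)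
  have h1 := C.sq_hcomp hr h
  rw [C.inv_hcomp] at h1
  have h2 := C.sq_unique h1 (C.sq_hid (C.sq_right h))
  obtain rfl : b'' = b' := congrArg Sigma.fst h2
  have h3 : C.hcomp r t = C.hid _ := eq_of_heq (Sigma.mk.inj h2).2
  have : r = C.hinv t := by
    rw [← C.hcomp_id r, ← C.hcomp_inv t, ← C.hassoc, h3, C.id_hcomp]
  rwa [← this]

lemma hinv_hinv {a b : C.P} (s : C.Hor a b) : C.hinv (C.hinv s) = s := by
  rw [← C.hcomp_id (C.hinv (C.hinv s)), ← C.inv_hcomp s, ← C.hassoc, C.inv_hcomp, C.id_hcomp]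

lemma sq_exists' {a b a' : C.P} (s : C.Hor a b) (h : a' ≤ a) :
    ∃ b', ∃ t : C.Hor a' b', C.Sq t s := by
  obtain ⟨b', t, ht⟩ := C.sq_exists (C.hinv s) h
  exact ⟨b', C.hinv t, by simpa [hinv_hinv] using sq_inv ht⟩

lemma sq_unique' {a b a' b₁ b₂ : C.P} {s : C.Hor a b} {t₁ : C.Hor a' b₁} {t₂ : C.Hor a' b₂}
    (h₁ : C.Sq t₁ s) (h₂ : C.Sq t₂ s) : (⟨b₁, t₁⟩ : Σ x, C.Hor a' x) = ⟨b₂, t₂⟩ := by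
  have h := C.sq_unique (sq_inv h₁) (sq_inv h₂)
  obtain rfl : b₁ = b₂ := congrArg Sigma.fst h
  have h3 : C.hinv t₁ = C.hinv t₂ := eq_of_heq (Sigma.mk.inj h).2
  rw [← hinv_hinv t₁, h3, hinv_hinv]

lemma sq_of_le {a b a₁ b₁ a₂ b₂ : C.P} {s : C.Hor a b} {t₁ : C.Hor a₁ b₁} {t₂ : C.Hor a₂ b₂}
    (h₁ : C.Sq t₁ s) (h₂ : C.Sq t₂ s) (h : b₁ ≤ b₂) : C.Sq t₁ t₂ := by
  obtain ⟨a', t, ht⟩ := C.sq_exists t₂ h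
  have := C.sq_unique h₁ (C.sq_trans ht h₂)
  obtain rfl : a₁ = a' := congrArg Sigma.fst this
  obtain rfl : t₁ = t := eq_of_heq (Sigma.mk.inj this).2
  exact ht

lemma sq_of_le' {a b a₁ b₁ a₂ b₂ : C.P} {s : C.Hor a b} {t₁ : C.Hor a₁ b₁} {t₂ : C.Hor a₂ b₂}
    (h₁ : C.Sq t₁ s) (h₂ : C.Sq t₂ s) (h : a₁ ≤ a₂) : C.Sq t₁ t₂ := by
  simpa [hinv_hinv] using sq_inv (sq_of_le (sq_inv h₁) (sq_inv h₂) h)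

/-! ### The category `SC(C)` -/

/-- An object of `SC(C)`: a finite family of noninitial objects of `C`, given as a finite set of pairs
of a label and an object. All labels may be distinct, so every finite family is represented up to
isomorphism. A label may be shared by members that are pairwise disjoint within a common object; this
makes the functors below strictly functorial, as replacing a member by a family of pairwise disjoint
parts of it needs no new labels. -/
@[ext]
structure SC (C : PolytopeComplex.{u, v}) : Type (max u v) where
  carrier : Set (ℕ × C.P)
  finite : carrier.Finite
  sep : ∀ i ∈ carrier, ∀ j ∈ carrier, i ≠ j → i.1 = j.1 → Sep i.2 j.2

/-- A piece of a morphism of `SC(C)`: the object `dom`, which lies below the member `src` of the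
source, is carried by the horizontal morphism `hor` to the member `tgt` of the target. -/
structure Piece (C : PolytopeComplex.{u, v}) where
  src : ℕ × C.P
  tgt : ℕ × C.P
  dom : C.P
  hor : C.Hor dom tgt.2

namespace SC

/-- A morphism `A → B` of `SC(C)`: an isomorphism class of spans `A ← A' → B` of a sub-map `A' → A`
(vertical on each member, with pairwise disjoint members of `A'` over each member of `A`) and a
shuffle `A' → B` (horizontal on each member). The members of `A'` are noninitial, and those over the
same member of `A` are disjoint, so the class of the span is the set of its pieces. -/
@[ext]
structure Hom (A B : SC C) where
  pieces : Set (Piece C)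
  finite : pieces.Finite
  src_mem : ∀ p ∈ pieces, p.src ∈ A.carrier
  tgt_mem : ∀ p ∈ pieces, p.tgt ∈ B.carrier
  dom_le : ∀ p ∈ pieces, p.dom ≤ p.src.2
  disj : ∀ p ∈ pieces, ∀ q ∈ pieces, p ≠ q → p.src = q.src → Disj p.dom q.dom

def Hom.id (A : SC C) : Hom A A where
  pieces := {p | ∃ i ∈ A.carrier, p = ⟨i, i, i.2, C.hid i.2⟩}
  finite := (A.finite.image fun i => (⟨i, i, i.2, C.hid i.2⟩ : Piece C)).subset (by
    rintro _ ⟨i, hi, rfl⟩; exact ⟨i, hi, rfl⟩)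
  src_mem := by rintro _ ⟨i, hi, rfl⟩; exact hi
  tgt_mem := by rintro _ ⟨i, hi, rfl⟩; exact hi
  dom_le := by rintro _ ⟨i, hi, rfl⟩; exact le_rfl
  disj := by rintro _ ⟨i, hi, rfl⟩ _ ⟨j, hj, rfl⟩ h h'; exact absurd (by cases h'; rfl) h

/-- Composition of spans: pull the sub-map of the second one back along the shuffle of the first. -/
def compPieces (S T : Set (Piece C)) : Set (Piece C) :=
  {r | ∃ p ∈ S, ∃ q ∈ T, p.tgt = q.src ∧ ∃ x, ∃ t : C.Hor x q.dom, C.Sq t p.hor ∧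
    r = ⟨p.src, q.tgt, x, C.hcomp t q.hor⟩}

def Hom.comp {A B D : SC C} (f : Hom A B) (g : Hom B D) : Hom A D where
  pieces := compPieces f.pieces g.pieces
  finite := by
    have : compPieces f.pieces g.pieces ⊆ ⋃ p ∈ f.pieces, ⋃ q ∈ g.pieces,
        {r | ∃ x, ∃ t : C.Hor x q.dom, C.Sq t p.hor ∧
          r = ⟨p.src, q.tgt, x, C.hcomp t q.hor⟩} := by
      rintro r ⟨p, hp, q, hq, -, h⟩
      simp only [Set.mem_iUnion]
      exact ⟨p, hp, q, hq, h⟩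
    refine Set.Finite.subset (f.finite.biUnion fun p _ => g.finite.biUnion fun q _ => ?_) this
    refine Set.Subsingleton.finite ?_
    rintro _ ⟨x, t, ht, rfl⟩ _ ⟨y, r, hr, rfl⟩
    have := C.sq_unique ht hr
    obtain rfl : x = y := congrArg Sigma.fst this
    obtain rfl : t = r := eq_of_heq (Sigma.mk.inj this).2
    rfl
  src_mem := by rintro _ ⟨p, hp, q, hq, -, x, t, -, rfl⟩; exact f.src_mem p hp
  tgt_mem := by rintro _ ⟨p, hp, q, hq, -, x, t, -, rfl⟩; exact g.tgt_mem q hq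
  dom_le := by
    rintro _ ⟨p, hp, q, hq, -, x, t, h, rfl⟩
    exact (C.sq_left h).trans (f.dom_le p hp)
  disj := by
    rintro _ ⟨p, hp, q, hq, e, x, t, h, rfl⟩ _ ⟨p', hp', q', hq', e', x', t', h', rfl⟩ hne hs w hw hw'
    simp only at hs hw hw'
    by_cases hpp : p = p'
    · subst hpp
      by_cases hqq : q = q'
      · subst hqq
        refine hne ?_
        have := C.sq_unique h h'
        obtain rfl : x = x' := congrArg Sigma.fst this
        obtain rfl : t = t' := eq_of_heq (Sigma.mk.inj this).2
        rfl
      · obtain ⟨d, r, hr⟩ := sq_exists' t hw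
        obtain ⟨d', r', hr'⟩ := sq_exists' t' hw'
        have := sq_unique' (C.sq_trans hr h) (C.sq_trans hr' h')
        obtain rfl : d = d' := congrArg Sigma.fst this
        exact g.disj q hq q' hq' hqq (e.symm.trans e') d (C.sq_right hr) (C.sq_right hr')
    · exact f.disj p hp p' hp' hpp hs w (hw.trans (C.sq_left h)) (hw'.trans (C.sq_left h'))

instance : Category (SC C) where
  Hom := Hom
  id := Hom.id
  comp := Hom.comp
  id_comp := by
    intro A B f
    apply Hom.ext
    ext r
    constructor
    · rintro ⟨_, ⟨i, hi, rfl⟩, q, hq, e, x, t, h, rfl⟩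
      have e : i = q.src := e
      subst e
      have := C.sq_unique h (C.sq_hid (f.dom_le q hq))
      obtain rfl : x = q.dom := congrArg Sigma.fst this
      obtain rfl : t = C.hid _ := eq_of_heq (Sigma.mk.inj this).2
      rw [C.id_hcomp]; exact hq
    · intro hr
      exact ⟨_, ⟨r.src, f.src_mem r hr, rfl⟩, r, hr, rfl, r.dom, C.hid _,
        C.sq_hid (f.dom_le r hr), by rw [C.id_hcomp]⟩
  comp_id := by
    intro A B f
    apply Hom.ext
    ext r
    constructor
    · rintro ⟨p, hp, _, ⟨i, hi, rfl⟩, e, x, t, h, rfl⟩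
      have e : p.tgt = i := e
      subst e
      have := C.sq_unique h (C.sq_refl p.hor)
      obtain rfl : x = p.dom := congrArg Sigma.fst this
      obtain rfl : t = p.hor := eq_of_heq (Sigma.mk.inj this).2
      simp only [C.hcomp_id]; exact hp
    · intro hr
      exact ⟨r, hr, _, ⟨r.tgt, f.tgt_mem r hr, rfl⟩, rfl, r.dom, r.hor, C.sq_refl _,
        by simp only [C.hcomp_id]⟩
  assoc := by
    intro A B D E f g h
    apply Hom.ext
    ext r
    constructor
    · rintro ⟨_, ⟨p, hp, q, hq, e, x, t, ht, rfl⟩, r, hr, e', y, t', ht', rfl⟩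
      simp only at e' ht'
      obtain ⟨z, w, hw⟩ := C.sq_exists q.hor (e' ▸ h.dom_le r hr : r.dom ≤ q.tgt.2)
      obtain ⟨y', t'', h''⟩ := C.sq_exists t (C.sq_left hw)
      have := C.sq_unique ht' (C.sq_hcomp h'' hw)
      obtain rfl : y = y' := congrArg Sigma.fst this
      obtain rfl : t' = C.hcomp t'' w := eq_of_heq (Sigma.mk.inj this).2
      exact ⟨p, hp, _, ⟨q, hq, r, hr, e', z, w, hw, rfl⟩, e, y, t'', C.sq_trans h'' ht, by
        simp only [C.hassoc]⟩
    · rintro ⟨p, hp, _, ⟨q, hq, r, hr, e', z, w, hw, rfl⟩, e, y, t, ht, rfl⟩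
      simp only at e ht t
      obtain ⟨x, t', ht'⟩ := C.sq_exists p.hor (e ▸ g.dom_le q hq : q.dom ≤ p.tgt.2)
      have h1 := sq_of_le ht ht' (C.sq_left hw)
      exact ⟨_, ⟨p, hp, q, hq, e, x, t', ht', rfl⟩, r, hr, e', y, C.hcomp t w,
        C.sq_hcomp h1 hw, by simp only [C.hassoc]⟩

lemma hom_ext {A B : SC C} {f g : A ⟶ B} (h : Hom.pieces f = Hom.pieces g) : f = g :=
  Hom.ext h

/-- The cofibrations `A ← A' → B` of `SC(C)`: the sub-map `A' → A` is a covering family of each member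
of `A`, and the shuffle `A' → B` is injective on indices. -/
def cof (C : PolytopeComplex.{u, v}) : MorphismProperty (SC C) := fun A _ f =>
  (∀ i ∈ A.carrier, sieveOf {x | ∃ p ∈ Hom.pieces f, p.src = i ∧ p.dom = x} i.2 ∈ C.J i.2) ∧
  ∀ p ∈ Hom.pieces f, ∀ q ∈ Hom.pieces f, p.tgt = q.tgt → p = q

/-- The weak equivalences `A ← A' → B` of `SC(C)`: the sub-map `A' → A` is a covering family of each
member of `A`, and the shuffle `A' → B` is bijective on indices. -/
def weq (C : PolytopeComplex.{u, v}) : MorphismProperty (SC C) := fun _ B f =>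
  cof C f ∧ ∀ j ∈ B.carrier, ∃ p ∈ Hom.pieces f, p.tgt = j

end SC
end PolytopeComplex

namespace PolytopeComplex

variable {C D E : PolytopeComplex.{u, v}}

/-- A horizontal morphism together with its source and target. -/
structure HArrow (C : PolytopeComplex.{u, v}) where
  dom : C.P
  cod : C.P
  hor : C.Hor dom cod

/-- A morphism from `C` to `D` in the category of polytope complexes, the Kleisli category of the
monad `(-)^id`: a polytope functor from `C` to `D^id`. An object of `D^id` is a finite family of
noninitial objects any two of which are disjoint within a common object, so it is a finite set of
objects `obj x`; a vertical morphism of `D^id` is a sub-map (`mono`), and a horizontal one is a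
bijection of index sets with horizontal components, which is given by its set of components `hor s`.
The last three conditions say that squares, vertical pullbacks and covering families (which are
pointwise in `D^id`) are preserved. -/
@[ext]
structure PolyMap (C D : PolytopeComplex.{u, v}) where
  obj : C.P → Set D.P
  hor : ∀ {x y : C.P}, C.Hor x y → Set (HArrow D)
  finite : ∀ x, (obj x).Finite
  sep : ∀ x, ∀ u ∈ obj x, ∀ u' ∈ obj x, u ≠ u' → Sep u u'
  mono : ∀ {x y}, x ≤ y → ∀ u ∈ obj x, ∃ w ∈ obj y, u ≤ w
  hor_dom_mem : ∀ {x y} (s : C.Hor x y), ∀ p ∈ hor s, p.dom ∈ obj x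
  hor_cod_mem : ∀ {x y} (s : C.Hor x y), ∀ p ∈ hor s, p.cod ∈ obj y
  hor_dom : ∀ {x y} (s : C.Hor x y), ∀ u ∈ obj x, ∃! p, p ∈ hor s ∧ p.dom = u
  hor_cod : ∀ {x y} (s : C.Hor x y), ∀ w ∈ obj y, ∃! p, p ∈ hor s ∧ p.cod = w
  hor_id : ∀ x, ∀ u ∈ obj x, (⟨u, u, D.hid u⟩ : HArrow D) ∈ hor (C.hid x)
  hor_comp : ∀ {x y z} (s : C.Hor x y) (t : C.Hor y z) {a b c : D.P} (p : D.Hor a b)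
    (q : D.Hor b c), ⟨a, b, p⟩ ∈ hor s → ⟨b, c, q⟩ ∈ hor t → ⟨a, c, D.hcomp p q⟩ ∈ hor (C.hcomp s t)
  hor_sq : ∀ {x' y' x y} {t : C.Hor x' y'} {s : C.Hor x y}, C.Sq t s →
    ∀ p ∈ hor t, ∀ q ∈ hor s, p.dom ≤ q.dom → D.Sq p.hor q.hor
  meet : ∀ {x y z}, x ≤ z → y ≤ z → ∀ u ∈ obj x, ∀ w ∈ obj y, ∀ r, r ≤ u → r ≤ w →
    ∃ m, m ≤ x ∧ m ≤ y ∧ ∃ n ∈ obj m, r ≤ n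
  cover : ∀ {x} (S : Sieve x), S ∈ C.J x → ∀ u ∈ obj x,
    sieveOf {w | ∃ x', (∃ f : x' ⟶ x, S f) ∧ w ∈ obj x'} u ∈ D.J u

namespace PolyMap

variable (g : PolyMap C D)

lemma hor_ext_dom {x y : C.P} {s : C.Hor x y} {p q : HArrow D} (hp : p ∈ g.hor s)
    (hq : q ∈ g.hor s) (h : p.dom = q.dom) : p = q :=
  (g.hor_dom s p.dom (g.hor_dom_mem s p hp)).unique ⟨hp, rfl⟩ ⟨hq, h.symm⟩

lemma hor_ext_cod {x y : C.P} {s : C.Hor x y} {p q : HArrow D} (hp : p ∈ g.hor s)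
    (hq : q ∈ g.hor s) (h : p.cod = q.cod) : p = q :=
  (g.hor_cod s p.cod (g.hor_cod_mem s p hp)).unique ⟨hp, rfl⟩ ⟨hq, h.symm⟩

lemma hor_finite {x y : C.P} (s : C.Hor x y) : (g.hor s).Finite :=
  Set.Finite.of_finite_image (f := HArrow.dom) ((g.finite x).subset (by
    rintro _ ⟨p, hp, rfl⟩; exact g.hor_dom_mem s p hp))
    fun _ hp _ hq h => g.hor_ext_dom hp hq h

lemma eq_of_le {x : C.P} {u u' r : D.P} (hu : u ∈ g.obj x) (hu' : u' ∈ g.obj x) (h : r ≤ u)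
    (h' : r ≤ u') : u = u' := by
  by_contra hne
  exact (g.sep x u hu u' hu' hne).2 r h h'

lemma disj {x y : C.P} (h : Sep x y) {u w : D.P} (hu : u ∈ g.obj x) (hw : w ∈ g.obj y) :
    Disj u w := by
  intro r hr hr'
  obtain ⟨⟨z, hz, hz'⟩, hd⟩ := h
  obtain ⟨m, hm, hm', -⟩ := g.meet hz hz' u hu w hw r hr hr'
  exact hd m hm hm'

lemma sep_of_sep {x y : C.P} (h : Sep x y) {u w : D.P} (hu : u ∈ g.obj x) (hw : w ∈ g.obj y) :
    Sep u w := by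
  refine ⟨?_, g.disj h hu hw⟩
  obtain ⟨⟨z, hz, hz'⟩, -⟩ := h
  obtain ⟨u', hu', h1⟩ := g.mono hz u hu
  obtain ⟨w', hw', h2⟩ := g.mono hz' w hw
  by_cases e : u' = w'
  · subst e; exact ⟨u', h1, h2⟩
  · obtain ⟨⟨r, hr, hr'⟩, -⟩ := g.sep z u' hu' w' hw' e
    exact ⟨r, h1.trans hr, h2.trans hr'⟩

/-- The unit of the monad `(-)^id`. -/
def id (C : PolytopeComplex.{u, v}) : PolyMap C C where
  obj x := {x}
  hor {x y} s := {⟨x, y, s⟩}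
  finite x := Set.finite_singleton x
  sep := by rintro x _ rfl _ rfl h; exact absurd rfl h
  mono := by rintro x y h _ rfl; exact ⟨y, rfl, h⟩
  hor_dom_mem := by rintro x y s _ rfl; rfl
  hor_cod_mem := by rintro x y s _ rfl; rfl
  hor_dom := by rintro x y s _ rfl; exact ⟨_, ⟨rfl, rfl⟩, fun _ h => h.1⟩
  hor_cod := by rintro x y s _ rfl; exact ⟨_, ⟨rfl, rfl⟩, fun _ h => h.1⟩
  hor_id := by rintro x _ rfl; rfl
  hor_comp := by
    rintro x y z s t a b c p q h h'
    cases h; cases h'; rfl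
  hor_sq := by rintro x' y' x y t s h _ rfl _ rfl _; exact h
  meet := by rintro x y z _ _ _ rfl _ rfl r h h'; exact ⟨r, h, h', r, rfl, le_rfl⟩
  cover := by
    rintro x S hS _ rfl
    refine C.J.superset_covering ?_ hS
    intro w f hf
    exact ⟨w, ⟨w, ⟨f, hf⟩, rfl⟩, le_rfl⟩

/-- Composition in the Kleisli category: unions of families. -/
def comp (g : PolyMap C D) (h : PolyMap D E) : PolyMap C E where
  obj x := {w | ∃ u ∈ g.obj x, w ∈ h.obj u}
  hor s := {r | ∃ p ∈ g.hor s, r ∈ h.hor p.hor}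
  finite x := ((g.finite x).biUnion fun u _ => h.finite u).subset (by
    rintro w ⟨u, hu, hw⟩; simp only [Set.mem_iUnion]; exact ⟨u, hu, hw⟩)
  sep := by
    rintro x w ⟨u, hu, hw⟩ w' ⟨u', hu', hw'⟩ hne
    by_cases e : u = u'
    · subst e; exact h.sep u w hw w' hw' hne
    · exact h.sep_of_sep (g.sep x u hu u' hu' e) hw hw'
  mono := by
    rintro x y hxy w ⟨u, hu, hw⟩
    obtain ⟨u', hu', h1⟩ := g.mono hxy u hu
    obtain ⟨w', hw', h2⟩ := h.mono h1 w hw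
    exact ⟨w', ⟨u', hu', hw'⟩, h2⟩
  hor_dom_mem := by
    rintro x y s r ⟨p, hp, hr⟩
    exact ⟨p.dom, g.hor_dom_mem s p hp, h.hor_dom_mem _ r hr⟩
  hor_cod_mem := by
    rintro x y s r ⟨p, hp, hr⟩
    exact ⟨p.cod, g.hor_cod_mem s p hp, h.hor_cod_mem _ r hr⟩
  hor_dom := by
    rintro x y s w ⟨u, hu, hw⟩
    obtain ⟨p, ⟨hp, rfl⟩, -⟩ := g.hor_dom s u hu
    obtain ⟨r, ⟨hr, rfl⟩, -⟩ := h.hor_dom p.hor w hw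
    refine ⟨r, ⟨⟨p, hp, hr⟩, rfl⟩, ?_⟩
    rintro r' ⟨⟨p', hp', hr'⟩, e⟩
    have e1 : p'.dom = p.dom := by
      by_contra hne
      refine (h.sep_of_sep (g.sep x _ (g.hor_dom_mem s p' hp') _ (g.hor_dom_mem s p hp) hne)
        (h.hor_dom_mem _ r' hr') (h.hor_dom_mem _ r hr)).2 r.dom e.ge le_rfl
    obtain rfl := g.hor_ext_dom hp' hp e1
    exact h.hor_ext_dom hr' hr e
  hor_cod := by
    rintro x y s w ⟨u, hu, hw⟩
    obtain ⟨p, ⟨hp, rfl⟩, -⟩ := g.hor_cod s u hu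
    obtain ⟨r, ⟨hr, rfl⟩, -⟩ := h.hor_cod p.hor w hw
    refine ⟨r, ⟨⟨p, hp, hr⟩, rfl⟩, ?_⟩
    rintro r' ⟨⟨p', hp', hr'⟩, e⟩
    have e1 : p'.cod = p.cod := by
      by_contra hne
      refine (h.sep_of_sep (g.sep y _ (g.hor_cod_mem s p' hp') _ (g.hor_cod_mem s p hp) hne)
        (h.hor_cod_mem _ r' hr') (h.hor_cod_mem _ r hr)).2 r.cod e.ge le_rfl
    obtain rfl := g.hor_ext_cod hp' hp e1
    exact h.hor_ext_cod hr' hr e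
  hor_id := by
    rintro x w ⟨u, hu, hw⟩
    exact ⟨_, g.hor_id x u hu, h.hor_id u w hw⟩
  hor_comp := by
    rintro x y z s t a b c p q ⟨⟨u, u', i⟩, hi, hp⟩ ⟨⟨w, w', j⟩, hj, hq⟩
    simp only at hp hq
    have e : u' = w := by
      by_contra hne
      exact (h.sep_of_sep (g.sep y _ (g.hor_cod_mem s _ hi) _ (g.hor_dom_mem t _ hj) hne)
        (h.hor_cod_mem _ _ hp) (h.hor_dom_mem _ _ hq)).2 b le_rfl le_rfl
    subst e
    exact ⟨_, g.hor_comp s t i j hi hj, h.hor_comp i j p q hp hq⟩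
  hor_sq := by
    rintro x' y' x y t s hts r ⟨p, hp, hr⟩ r' ⟨p', hp', hr'⟩ hle
    obtain ⟨u, hu, hpu⟩ := g.mono (C.sq_left hts) p.dom (g.hor_dom_mem t p hp)
    have e : u = p'.dom := by
      obtain ⟨w, hw, hrw⟩ := h.mono hpu r.dom (h.hor_dom_mem _ r hr)
      by_contra hne
      exact (h.sep_of_sep (g.sep x _ hu _ (g.hor_dom_mem s p' hp') hne) hw
        (h.hor_dom_mem _ r' hr')).2 r.dom hrw hle
    exact h.hor_sq (g.hor_sq hts p hp p' hp' (e ▸ hpu)) r hr r' hr' hle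
  meet := by
    rintro x y z hx hy w ⟨u, hu, hw⟩ w' ⟨u', hu', hw'⟩ r hr hr'
    obtain ⟨a, ha, hua⟩ := g.mono hx u hu
    obtain ⟨b, hb, hub⟩ := g.mono hy u' hu'
    obtain ⟨c, hac, hbc⟩ : ∃ c, a ≤ c ∧ b ≤ c := by
      by_cases e : a = b
      · exact ⟨a, le_rfl, e.ge⟩
      · exact (g.sep z a ha b hb e).1
    obtain ⟨m, hm, hm', n, hn, hrn⟩ := h.meet (hua.trans hac) (hub.trans hbc) w hw w' hw' r hr hr'
    obtain ⟨k, hk, hk', l, hl, hml⟩ := g.meet hx hy u hu u' hu' m hm hm'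
    obtain ⟨i, hi, hni⟩ := h.mono hml n hn
    exact ⟨k, hk, hk', i, ⟨l, hl, hi⟩, hrn.trans hni⟩
  cover := by
    rintro x S hS w ⟨u, hu, hw⟩
    refine E.J.superset_covering ?_ (h.cover _ (g.cover S hS u hu) w hw)
    rintro r f ⟨q, ⟨b, ⟨_, c, ⟨a, ha, hc⟩, hbc⟩, hq⟩, hrq⟩
    obtain ⟨i, hi, hqi⟩ := h.mono hbc q hq
    exact ⟨i, ⟨a, ha, c, hc, hi⟩, hrq.trans hqi⟩

end PolyMap

/-- The category of polytope complexes. -/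
instance : Category PolytopeComplex.{u, v} where
  Hom := PolyMap
  id := PolyMap.id
  comp := PolyMap.comp
  id_comp := by
    intro C D g
    apply PolyMap.ext
    · funext x; ext w
      exact ⟨by rintro ⟨_, rfl, h⟩; exact h, fun h => ⟨x, rfl, h⟩⟩
    · funext x y s; ext w
      exact ⟨by rintro ⟨_, rfl, h⟩; exact h, fun h => ⟨_, rfl, h⟩⟩
  comp_id := by
    intro C D g
    apply PolyMap.ext
    · funext x; ext w
      exact ⟨by rintro ⟨_, h, rfl⟩; exact h, fun h => ⟨_, h, rfl⟩⟩
    · funext x y s; ext w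
      exact ⟨by rintro ⟨_, h, rfl⟩; exact h, fun h => ⟨_, h, rfl⟩⟩
  assoc := by
    intro A B C D f g h
    apply PolyMap.ext
    · funext x; ext w
      exact ⟨by rintro ⟨a, ⟨b, hb, ha⟩, h⟩; exact ⟨b, hb, a, ha, h⟩,
        by rintro ⟨b, hb, a, ha, h⟩; exact ⟨a, ⟨b, hb, ha⟩, h⟩⟩
    · funext x y s; ext w
      exact ⟨by rintro ⟨a, ⟨b, hb, ha⟩, h⟩; exact ⟨b, hb, a, ha, h⟩,
        by rintro ⟨b, hb, a, ha, h⟩; exact ⟨a, ⟨b, hb, ha⟩, h⟩⟩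

namespace SC

lemma pieces_comp {A B D : SC C} (f : A ⟶ B) (g : B ⟶ D) :
    Hom.pieces (f ≫ g) = compPieces (Hom.pieces f) (Hom.pieces g) := rfl

lemma pieces_eqToHom_comp {A A' B : SC C} (h : A = A') (f : A' ⟶ B) :
    Hom.pieces (eqToHom h ≫ f) = Hom.pieces f := by
  subst h; simp

lemma pieces_comp_eqToHom {A B B' : SC C} (h : B = B') (f : A ⟶ B) :
    Hom.pieces (f ≫ eqToHom h) = Hom.pieces f := by
  subst h; simp

/-- Replace each member `x` of a family by the members of `g x`. -/
def mapObj (g : PolyMap C D) (A : SC C) : SC D where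
  carrier := {j | ∃ x, (j.1, x) ∈ A.carrier ∧ j.2 ∈ g.obj x}
  finite := by
    refine (A.finite.biUnion fun i _ => (g.finite i.2).image fun u => (i.1, u)).subset ?_
    rintro ⟨l, u⟩ ⟨x, hx, hu⟩
    simp only [Set.mem_iUnion]
    exact ⟨(l, x), hx, u, hu, rfl⟩
  sep := by
    rintro ⟨l, u⟩ ⟨x, hx, hu⟩ ⟨l', u'⟩ ⟨x', hx', hu'⟩ hne (rfl : l = l')
    by_cases e : x = x'
    · subst e
      exact g.sep x u hu u' hu' fun h => hne (by rw [h])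
    · exact g.sep_of_sep (A.sep _ hx _ hx' (fun h => e (Prod.ext_iff.1 h).2) rfl) hu hu'

def mapPieces (g : PolyMap C D) (S : Set (Piece C)) : Set (Piece D) :=
  {r | ∃ p ∈ S, ∃ u ∈ g.obj p.src.2, ∃ q ∈ g.hor p.hor, q.dom ≤ u ∧
    r = ⟨(p.src.1, u), (p.tgt.1, q.cod), q.dom, q.hor⟩}

def mapHom (g : PolyMap C D) {A B : SC C} (f : A ⟶ B) : mapObj g A ⟶ mapObj g B where
  pieces := mapPieces g (Hom.pieces f)
  finite := by
    refine ((Hom.finite f).biUnion fun p _ => (g.finite p.src.2).biUnion fun u _ =>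
      (g.hor_finite p.hor).image fun q =>
        (⟨(p.src.1, u), (p.tgt.1, q.cod), q.dom, q.hor⟩ : Piece D)).subset ?_
    rintro _ ⟨p, hp, u, hu, q, hq, -, rfl⟩
    simp only [Set.mem_iUnion]
    exact ⟨p, hp, u, hu, q, hq, rfl⟩
  src_mem := by
    rintro _ ⟨p, hp, u, hu, q, hq, -, rfl⟩
    exact ⟨_, Hom.src_mem f p hp, hu⟩
  tgt_mem := by
    rintro _ ⟨p, hp, u, hu, q, hq, -, rfl⟩
    exact ⟨_, Hom.tgt_mem f p hp, g.hor_cod_mem _ q hq⟩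
  dom_le := by
    rintro _ ⟨p, hp, u, hu, q, hq, h, rfl⟩
    exact h
  disj := by
    rintro _ ⟨p, hp, u, hu, q, hq, h, rfl⟩ _ ⟨p', hp', u', hu', q', hq', h', rfl⟩ hne hs
    obtain ⟨h1, h2⟩ := Prod.ext_iff.1 hs
    simp only at h1 h2
    subst h2
    by_cases e : p = p'
    · subst e
      by_cases e' : q.dom = q'.dom
      · obtain rfl := g.hor_ext_dom hq hq' e'
        exact absurd rfl hne
      · exact (g.sep _ _ (g.hor_dom_mem _ q hq) _ (g.hor_dom_mem _ q' hq') e').2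
    · have es : p.src = p'.src := by
        by_contra hs'
        refine (g.sep_of_sep (A.sep _ (Hom.src_mem f p hp) _ (Hom.src_mem f p' hp') hs' h1)
          hu hu').2 u le_rfl le_rfl
      refine g.disj ⟨⟨p.src.2, Hom.dom_le f p hp, es ▸ Hom.dom_le f p' hp'⟩,
        Hom.disj f p hp p' hp' e es⟩ (g.hor_dom_mem _ q hq) (g.hor_dom_mem _ q' hq')

/-- The functor `SC(C) → SC(D)` induced by a morphism of polytope complexes, i.e. the composite
`SC(C) → SC(D^id) → SC(D)` whose second functor flattens families of families. -/
def map (g : PolyMap C D) : SC C ⥤ SC D where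
  obj := mapObj g
  map f := mapHom g f
  map_id A := by
    apply hom_ext
    ext r
    constructor
    · rintro ⟨_, ⟨i, hi, rfl⟩, u, hu, ⟨a, b, k⟩, hq, h, rfl⟩
      simp only at hu hq h
      obtain rfl := g.eq_of_le (g.hor_dom_mem _ _ hq) hu le_rfl h
      have e := g.hor_ext_dom hq (g.hor_id i.2 a hu) rfl
      cases e
      exact ⟨_, ⟨i.2, hi, hu⟩, rfl⟩
    · rintro ⟨⟨l, u⟩, ⟨x, hx, hu⟩, rfl⟩
      exact ⟨_, ⟨(l, x), hx, rfl⟩, u, hu, _, g.hor_id x u hu, le_rfl, rfl⟩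
  map_comp {A B E} f f' := by
    apply hom_ext
    ext r
    constructor
    · rintro ⟨_, ⟨p, hp, q, hq, e, x, t, ht, rfl⟩, u, hu, ⟨r1, r2, r3⟩, hr, h, rfl⟩
      simp only at hu h hr
      have hdm : r1 ∈ g.obj x := g.hor_dom_mem _ _ hr
      obtain ⟨⟨a, b, k⟩, ⟨hk, e1⟩, -⟩ := g.hor_dom t r1 hdm
      obtain ⟨⟨b', c, k'⟩, ⟨hk', e2⟩, -⟩ := g.hor_dom q.hor b (g.hor_cod_mem _ _ hk)
      simp only at e1 e2
      subst e1; subst e2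
      have e0 := g.hor_ext_dom hr (g.hor_comp t q.hor k k' hk hk') rfl
      cases e0
      -- the piece of `p` containing it
      obtain ⟨a', ha', haa'⟩ := g.mono (C.sq_left ht) _ hdm
      obtain ⟨⟨_, d, l⟩, ⟨hl, rfl⟩, -⟩ := g.hor_dom p.hor a' ha'
      obtain ⟨a'', ha'', haa''⟩ := g.mono (Hom.dom_le f p hp) _ ha'
      obtain rfl := g.eq_of_le hu ha'' h (haa'.trans haa'')
      have hsq := g.hor_sq ht _ hk _ hl haa'
      have hd : d ∈ g.obj p.tgt.2 := g.hor_cod_mem _ _ hl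
      refine ⟨_, ⟨p, hp, u, hu, _, hl, haa'', rfl⟩, _,
        ⟨q, hq, d, by rw [← e]; exact hd, _, hk', D.sq_right hsq, rfl⟩, ?_, _, k, hsq, rfl⟩
      exact Prod.ext (by simp only [e]) rfl
    · rintro ⟨_, ⟨p, hp, u, hu, q, hq, h, rfl⟩, _, ⟨p', hp', u', hu', q', hq', h', rfl⟩, e, y, t, ht,
        rfl⟩
      obtain ⟨e1, e2⟩ := Prod.ext_iff.1 e
      simp only at e1 e2 ht t
      subst e2
      have est : p.tgt = p'.src := by
        by_contra hne
        exact (g.sep_of_sep (B.sep _ (Hom.tgt_mem f p hp) _ (Hom.src_mem f' p' hp') hne e1)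
          (g.hor_cod_mem _ q hq) hu').2 _ le_rfl le_rfl
      obtain ⟨x, r, hr⟩ := C.sq_exists p.hor (est ▸ Hom.dom_le f' p' hp' : p'.dom ≤ p.tgt.2)
      obtain ⟨⟨a, b, k⟩, ⟨hk, e3⟩, -⟩ := g.hor_cod r q'.dom (g.hor_dom_mem _ q' hq')
      simp only at e3
      subst e3
      obtain ⟨a', ha', haa'⟩ := g.mono (C.sq_left hr) a (g.hor_dom_mem _ _ hk)
      obtain ⟨⟨a'', d, k'⟩, ⟨hk', e4⟩, -⟩ := g.hor_dom p.hor a' ha'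
      simp only at e4
      subst e4
      have hsq := g.hor_sq hr _ hk _ hk' haa'
      simp only at hsq
      have hd : d = q.cod := g.eq_of_le (g.hor_cod_mem _ _ hk') (g.hor_cod_mem _ q hq)
        (D.sq_right hsq) h'
      obtain rfl := g.hor_ext_cod hk' hq hd
      have := D.sq_unique ht hsq
      obtain rfl : y = a := congrArg Sigma.fst this
      obtain rfl : t = k := eq_of_heq (Sigma.mk.inj this).2
      exact ⟨_, ⟨p, hp, p', hp', est, x, r, hr, rfl⟩, u, hu, _, g.hor_comp r p'.hor t q'.hor hk hq',
        (D.sq_left ht).trans h, rfl⟩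

lemma functor_ext {X : Type*} [Category X] {F G : X ⥤ SC C}
    (hobj : ∀ A, (F.obj A).carrier = (G.obj A).carrier)
    (hmap : ∀ {A B : X} (f : A ⟶ B), Hom.pieces (F.map f) = Hom.pieces (G.map f)) : F = G := by
  refine CategoryTheory.Functor.ext (fun A => SC.ext (hobj A)) fun A B f => hom_ext ?_
  rw [pieces_eqToHom_comp, pieces_comp_eqToHom, hmap]

lemma map_id (C : PolytopeComplex.{u, v}) : map (PolyMap.id C) = 𝟭 (SC C) := by
  refine functor_ext (fun A => ?_) fun {A B} f => ?_
  · ext ⟨l, u⟩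
    exact ⟨by rintro ⟨x, hx, rfl⟩; exact hx, fun h => ⟨u, h, rfl⟩⟩
  · ext r
    constructor
    · rintro ⟨p, hp, _, rfl, _, rfl, -, rfl⟩; exact hp
    · intro hr; exact ⟨r, hr, _, rfl, _, rfl, Hom.dom_le f r hr, rfl⟩

lemma map_comp (g : PolyMap C D) (h : PolyMap D E) : map (g.comp h) = map g ⋙ map h := by
  refine functor_ext (fun A => ?_) fun {A B} f => ?_
  · ext ⟨l, u⟩
    exact ⟨by rintro ⟨x, hx, y, hy, hu⟩; exact ⟨y, ⟨x, hx, hy⟩, hu⟩,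
      by rintro ⟨y, ⟨x, hx, hy⟩, hu⟩; exact ⟨x, hx, y, hy, hu⟩⟩
  · ext r
    constructor
    · rintro ⟨p, hp, w, ⟨u, hu, hw⟩, q, ⟨k, hk, hq⟩, hle, rfl⟩
      obtain ⟨a, ha, hka⟩ := g.mono (Hom.dom_le f p hp) _ (g.hor_dom_mem _ k hk)
      obtain ⟨b, hb, hqb⟩ := h.mono hka _ (h.hor_dom_mem _ q hq)
      have e : a = u := by
        by_contra hne
        exact (h.sep_of_sep (g.sep _ _ ha _ hu hne) hb hw).2 _ hqb hle
      subst e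
      exact ⟨_, ⟨p, hp, a, hu, k, hk, hka, rfl⟩, w, hw, q, hq, hle, rfl⟩
    · rintro ⟨_, ⟨p, hp, u, hu, k, hk, hle, rfl⟩, w, hw, q, hq, hle', rfl⟩
      exact ⟨p, hp, w, ⟨u, hu, hw⟩, q, ⟨k, hk, hq⟩, hle', rfl⟩

/-- `SC` as a functor from polytope complexes to categories. -/
def functor : PolytopeComplex.{u, v} ⥤ Cat.{max u v, max u v} where
  obj C := Cat.of (SC C)
  map g := (map g).toCatHom
  map_id C := congrArg Functor.toCatHom (map_id C)
  map_comp g h := congrArg Functor.toCatHom (map_comp g h)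

end SC
end PolytopeComplex

namespace PolytopeComplex

variable {C D E : PolytopeComplex.{u, v}}

/-! ### The polytope complex `f_n C` -/

/-- A noninitial object of `f_n C` (`1 ≤ n`): a diagram `A_1 ← A_2 ← ⋯ ← A_n` of covering sub-maps in
`C^id` with `A_1` a singleton `{root}`. Here `lev k` is the set of members of `A_{k+1}`, and
`lev k` is empty for `n ≤ k`. The members of each `A_i` are pairwise disjoint, so the
sub-maps are determined by the sets. -/
structure Filtered (C : PolytopeComplex.{u, v}) (n : ℕ) where
  root : C.P
  lev : ℕ → Set C.P
  lev_zero : lev 0 = {root}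
  lev_out : ∀ k, n ≤ k → lev k = ∅
  finite : ∀ k, (lev k).Finite
  sep : ∀ k, ∀ x ∈ lev k, ∀ y ∈ lev k, x ≠ y → Sep x y
  le : ∀ k, k + 1 < n → ∀ y ∈ lev (k + 1), ∃ x ∈ lev k, y ≤ x
  cover : ∀ k, k + 1 < n → ∀ x ∈ lev k, sieveOf (lev (k + 1)) x ∈ C.J x

namespace Filtered

variable {n : ℕ} {T T' : Filtered C n}

lemma ext' (h : ∀ k, T.lev k = T'.lev k) : T = T' := by
  obtain ⟨r, l, h0, _, _, _, _, _⟩ := T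
  obtain ⟨r', l', h0', _, _, _, _, _⟩ := T'
  obtain rfl : l = l' := funext h
  obtain rfl : r = r' := by
    rw [h0] at h0'; exact Set.singleton_injective h0'
  rfl

/-- Vertical morphisms of `f_n C` are levelwise sub-maps. They commute with the structure maps of the
diagrams by disjointness. -/
instance : Preorder (Filtered C n) where
  le T T' := ∀ k, ∀ y ∈ T.lev k, ∃ y' ∈ T'.lev k, y ≤ y'
  le_refl T k y hy := ⟨y, hy, le_rfl⟩
  le_trans T T' T'' h h' k y hy := by
    obtain ⟨y', hy', h1⟩ := h k y hy
    obtain ⟨z, hz, h2⟩ := h' k y' hy'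
    exact ⟨z, hz, h1.trans h2⟩

lemma root_mem (T : Filtered C n) : T.root ∈ T.lev 0 := by rw [T.lev_zero]; rfl

lemma root_le (h : T ≤ T') : T.root ≤ T'.root := by
  obtain ⟨y, hy, h1⟩ := h 0 _ T.root_mem
  rw [T'.lev_zero] at hy
  obtain rfl := hy
  exact h1

lemma lt_of_mem {k : ℕ} {y : C.P} (h : y ∈ T.lev k) : k < n := by
  by_contra hk
  rw [T.lev_out k (not_lt.1 hk)] at h
  exact h

lemma le_level {j : ℕ} (d : ℕ) : ∀ {y : C.P}, y ∈ T.lev (j + d) → ∃ x ∈ T.lev j, y ≤ x := by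
  induction d with
  | zero => intro y hy; exact ⟨y, hy, le_rfl⟩
  | succ d ih =>
    intro y hy
    obtain ⟨x, hx, h⟩ := T.le (j + d) (lt_of_mem hy) y hy
    obtain ⟨z, hz, h'⟩ := ih hx
    exact ⟨z, hz, h.trans h'⟩

lemma exists_le {j k : ℕ} (hjk : j ≤ k) {y : C.P} (hy : y ∈ T.lev k) : ∃ x ∈ T.lev j, y ≤ x := by
  obtain ⟨d, rfl⟩ := Nat.exists_eq_add_of_le hjk
  exact le_level d hy

lemma le_root {k : ℕ} {y : C.P} (hy : y ∈ T.lev k) : y ≤ T.root := by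
  obtain ⟨x, hx, h⟩ := exists_le (Nat.zero_le k) hy
  rw [T.lev_zero] at hx
  obtain rfl := hx
  exact h

lemma eq_of_le {k : ℕ} {x y w : C.P} (hx : x ∈ T.lev k) (hy : y ∈ T.lev k) (h : w ≤ x)
    (h' : w ≤ y) : x = y := by
  by_contra hne
  exact (T.sep k x hx y hy hne).2 w h h'

lemma cover_level {j : ℕ} (d : ℕ) : j + d < n → ∀ x ∈ T.lev j, sieveOf (T.lev (j + d)) x ∈ C.J x := by
  induction d with
  | zero =>
    intro _ x hx
    refine C.J.superset_covering ?_ (C.J.top_mem x)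
    intro w f _
    exact ⟨x, hx, f.le⟩
  | succ d ih =>
    intro h x hx
    refine C.J.transitive (ih (by omega) x hx) _ ?_
    rintro w f ⟨y, hy, hwy⟩
    have := C.J.pullback_stable (homOfLE hwy) (T.cover (j + d) (by omega) y hy)
    refine C.J.superset_covering ?_ this
    rintro r g ⟨z, hz, hr⟩
    exact ⟨z, hz, hr⟩

lemma cover' {j k : ℕ} (hjk : j ≤ k) (hk : k < n) {x : C.P} (hx : x ∈ T.lev j) :
    sieveOf (T.lev k) x ∈ C.J x := by
  obtain ⟨d, rfl⟩ := Nat.exists_eq_add_of_le hjk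
  exact cover_level d hk x hx

/-- A chosen greatest lower bound. -/
noncomputable def glb (x y : C.P) : C.P :=
  open Classical in if h : ∃ m, IsGLB {x, y} m then h.choose else x

lemma glb_spec {x y z w : C.P} (hx : x ≤ z) (hy : y ≤ z) (hwx : w ≤ x) (hwy : w ≤ y) :
    IsGLB {x, y} (glb x y) := by
  have h := C.meet hx hy hwx hwy
  rw [glb, dif_pos h]
  exact h.choose_spec

/-- The levelwise pullback of two objects of `f_n C` over a common one. -/
noncomputable def inter (T T' : Filtered C n) (h : ∃ z, T.root ≤ z ∧ T'.root ≤ z)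
    (h' : ∃ w, w ≤ T.root ∧ w ≤ T'.root) : Filtered C n where
  root := glb T.root T'.root
  lev k := {z | ∃ y ∈ T.lev k, ∃ y' ∈ T'.lev k, (∃ w, w ≤ y ∧ w ≤ y') ∧ z = glb y y'}
  lev_zero := by
    rw [T.lev_zero, T'.lev_zero]
    ext z
    simp only [Set.mem_singleton_iff, exists_eq_left, Set.mem_ofPred_eq]
    exact ⟨fun h => h.2, fun e => ⟨h', e⟩⟩
  lev_out k hk := by
    ext z; simp [T.lev_out k hk]
  finite k := by
    refine ((T.finite k).biUnion fun y _ => (T'.finite k).image fun y' => glb y y').subset ?_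
    rintro z ⟨y, hy, y', hy', -, rfl⟩
    simp only [Set.mem_iUnion]
    exact ⟨y, hy, y', hy', rfl⟩
  sep k := by
    obtain ⟨z, hz, hz'⟩ := h
    rintro _ ⟨x, hx, x', hx', ⟨w, hw, hw'⟩, rfl⟩ _ ⟨y, hy, y', hy', ⟨r, hr, hr'⟩, rfl⟩ hne
    have h1 := glb_spec ((le_root hx).trans hz) ((le_root hx').trans hz') hw hw'
    have h2 := glb_spec ((le_root hy).trans hz) ((le_root hy').trans hz') hr hr'
    have a1 : glb x x' ≤ x := h1.1 (by simp)
    have a2 : glb x x' ≤ x' := h1.1 (by simp)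
    have b1 : glb y y' ≤ y := h2.1 (by simp)
    have b2 : glb y y' ≤ y' := h2.1 (by simp)
    refine ⟨⟨z, (a1.trans (le_root hx)).trans hz, (b1.trans (le_root hy)).trans hz⟩, ?_⟩
    intro q hq hq'
    obtain rfl := eq_of_le hx hy (hq.trans a1) (hq'.trans b1)
    obtain rfl := eq_of_le hx' hy' (hq.trans a2) (hq'.trans b2)
    exact hne rfl
  le k hk := by
    obtain ⟨z, hz, hz'⟩ := h
    rintro _ ⟨x, hx, x', hx', ⟨w, hw, hw'⟩, rfl⟩
    obtain ⟨y, hy, hxy⟩ := T.le k hk x hx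
    obtain ⟨y', hy', hxy'⟩ := T'.le k hk x' hx'
    have h1 := glb_spec ((le_root hx).trans hz) ((le_root hx').trans hz') hw hw'
    have h2 := glb_spec ((le_root hy).trans hz) ((le_root hy').trans hz') (hw.trans hxy)
      (hw'.trans hxy')
    refine ⟨_, ⟨y, hy, y', hy', ⟨w, hw.trans hxy, hw'.trans hxy'⟩, rfl⟩, h2.2 ?_⟩
    intro q hq
    rcases hq with rfl | rfl
    · exact (h1.1 (by simp)).trans hxy
    · exact (h1.1 (by simp)).trans hxy'
  cover k hk := by
    obtain ⟨z, hz, hz'⟩ := h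
    rintro _ ⟨x, hx, x', hx', ⟨w, hw, hw'⟩, rfl⟩
    have h1 := glb_spec ((le_root hx).trans hz) ((le_root hx').trans hz') hw hw'
    have a1 : glb x x' ≤ x := h1.1 (by simp)
    have a2 : glb x x' ≤ x' := h1.1 (by simp)
    have c1 := C.J.pullback_stable (homOfLE a1) (T.cover k hk x hx)
    have c2 := C.J.pullback_stable (homOfLE a2) (T'.cover k hk x' hx')
    refine C.J.superset_covering ?_ (C.J.intersection_covering c1 c2)
    rintro r f ⟨⟨y, hy, hry⟩, ⟨y', hy', hry'⟩⟩
    have h2 := glb_spec ((le_root hy).trans hz) ((le_root hy').trans hz') hry hry'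
    refine ⟨_, ⟨y, hy, y', hy', ⟨r, hry, hry'⟩, rfl⟩, h2.2 ?_⟩
    intro q hq
    rcases hq with rfl | rfl
    · exact hry
    · exact hry'

lemma inter_le {h : ∃ z, T.root ≤ z ∧ T'.root ≤ z} {h' : ∃ w, w ≤ T.root ∧ w ≤ T'.root} :
    inter T T' h h' ≤ T := by
  obtain ⟨z, hz, hz'⟩ := h
  rintro k _ ⟨x, hx, x', hx', ⟨w, hw, hw'⟩, rfl⟩
  exact ⟨x, hx, (glb_spec ((le_root hx).trans hz) ((le_root hx').trans hz') hw hw').1 (by simp)⟩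

lemma inter_le' {h : ∃ z, T.root ≤ z ∧ T'.root ≤ z} {h' : ∃ w, w ≤ T.root ∧ w ≤ T'.root} :
    inter T T' h h' ≤ T' := by
  obtain ⟨z, hz, hz'⟩ := h
  rintro k _ ⟨x, hx, x', hx', ⟨w, hw, hw'⟩, rfl⟩
  exact ⟨x', hx', (glb_spec ((le_root hx).trans hz) ((le_root hx').trans hz') hw hw').1 (by simp)⟩

lemma le_inter_lev {h : ∃ z, T.root ≤ z ∧ T'.root ≤ z} {h' : ∃ w, w ≤ T.root ∧ w ≤ T'.root}
    {k : ℕ} {y y' w : C.P} (hy : y ∈ T.lev k) (hy' : y' ∈ T'.lev k) (hw : w ≤ y) (hw' : w ≤ y') :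
    ∃ r ∈ (inter T T' h h').lev k, w ≤ r := by
  obtain ⟨z, hz, hz'⟩ := h
  refine ⟨_, ⟨y, hy, y', hy', ⟨w, hw, hw'⟩, rfl⟩, ?_⟩
  refine (glb_spec ((le_root hy).trans hz) ((le_root hy').trans hz') hw hw').2 ?_
  intro q hq
  rcases hq with rfl | rfl
  · exact hw
  · exact hw'

lemma le_inter {h : ∃ z, T.root ≤ z ∧ T'.root ≤ z} {h' : ∃ w, w ≤ T.root ∧ w ≤ T'.root}
    {R : Filtered C n} (h1 : R ≤ T) (h2 : R ≤ T') : R ≤ inter T T' h h' := by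
  intro k w hw
  obtain ⟨y, hy, hwy⟩ := h1 k w hw
  obtain ⟨y', hy', hwy'⟩ := h2 k w hw
  exact le_inter_lev hy hy' hwy hwy'

/-- A family covers in `f_n C` if it does so levelwise. -/
def topology (C : PolytopeComplex.{u, v}) (n : ℕ) : GrothendieckTopology (Filtered C n) where
  sieves T := {S | ∀ k, ∀ x ∈ T.lev k,
    sieveOf {y | ∃ T', (∃ f : T' ⟶ T, S f) ∧ y ∈ T'.lev k} x ∈ C.J x}
  top_mem' T k x hx := by
    refine C.J.superset_covering ?_ (C.J.top_mem x)
    intro w f _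
    exact ⟨x, ⟨T, ⟨𝟙 T, trivial⟩, hx⟩, f.le⟩
  pullback_stable' := by
    intro T R S f hS k x hx
    obtain ⟨x', hx', hxx'⟩ := f.le k x hx
    refine C.J.superset_covering ?_ (C.J.pullback_stable (homOfLE hxx') (hS k x' hx'))
    rintro w g ⟨y, ⟨T', ⟨f', hf'⟩, hy⟩, hwy⟩
    have hb : ∃ z, T'.root ≤ z ∧ R.root ≤ z := ⟨T.root, root_le f'.le, root_le f.le⟩
    have hb' : ∃ w, w ≤ T'.root ∧ w ≤ R.root :=
      ⟨w, hwy.trans (le_root hy), g.le.trans (le_root hx)⟩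
    obtain ⟨r, hr, hwr⟩ := le_inter_lev (h := hb) (h' := hb') hy hx hwy g.le
    refine ⟨r, ⟨inter T' R hb hb', ⟨homOfLE inter_le', ?_⟩, hr⟩, hwr⟩
    exact S.downward_closed hf' (homOfLE inter_le)
  transitive' := by
    intro T S hS R hR k x hx
    refine C.J.transitive (hS k x hx) _ ?_
    rintro w f ⟨y, ⟨T', ⟨f', hf'⟩, hy⟩, hwy⟩
    refine C.J.superset_covering ?_ (C.J.pullback_stable (homOfLE hwy) (hR hf' k y hy))
    rintro r g ⟨z, ⟨T'', ⟨f'', hf''⟩, hz⟩, hrz⟩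
    exact ⟨z, ⟨T'', ⟨f'' ≫ f', hf''⟩, hz⟩, hrz⟩

/-- `s` restricts to a bijection between the `k`-th levels for all `k`. -/
def Carries (T T' : Filtered C n) (s : C.Hor T.root T'.root) : Prop :=
  ∀ k, (∀ y ∈ T.lev k, ∃ y' ∈ T'.lev k, ∃ t : C.Hor y y', C.Sq t s) ∧
    ∀ y' ∈ T'.lev k, ∃ y ∈ T.lev k, ∃ t : C.Hor y y', C.Sq t s

lemma Carries.hid (T : Filtered C n) : Carries T T (C.hid _) := fun _ =>
  ⟨fun y hy => ⟨y, hy, C.hid y, C.sq_hid (le_root hy)⟩,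
    fun y hy => ⟨y, hy, C.hid y, C.sq_hid (le_root hy)⟩⟩

lemma Carries.hcomp {T T' T'' : Filtered C n} {s : C.Hor T.root T'.root}
    {s' : C.Hor T'.root T''.root} (h : Carries T T' s) (h' : Carries T' T'' s') :
    Carries T T'' (C.hcomp s s') := by
  refine fun k => ⟨fun y hy => ?_, fun y hy => ?_⟩
  · obtain ⟨y', hy', t, ht⟩ := (h k).1 y hy
    obtain ⟨y'', hy'', t', ht'⟩ := (h' k).1 y' hy'
    exact ⟨y'', hy'', _, C.sq_hcomp ht ht'⟩
  · obtain ⟨y', hy', t, ht⟩ := (h' k).2 y hy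
    obtain ⟨y'', hy'', t', ht'⟩ := (h k).2 y' hy'
    exact ⟨y'', hy'', _, C.sq_hcomp ht' ht⟩

lemma Carries.hinv {T T' : Filtered C n} {s : C.Hor T.root T'.root} (h : Carries T T' s) :
    Carries T' T (C.hinv s) := by
  refine fun k => ⟨fun y hy => ?_, fun y hy => ?_⟩
  · obtain ⟨y', hy', t, ht⟩ := (h k).2 y hy
    exact ⟨y', hy', _, sq_inv ht⟩
  · obtain ⟨y', hy', t, ht⟩ := (h k).1 y hy
    exact ⟨y', hy', _, sq_inv ht⟩

/-- The pullback of `R ≤ T'` along a horizontal morphism `T → T'`. -/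
def pull {T T' R : Filtered C n} (s : C.Hor T.root T'.root) (hR : R ≤ T') {a : C.P}
    (t : C.Hor a R.root) (ht : C.Sq t s) : Filtered C n where
  root := a
  lev k := {y | ∃ y' ∈ R.lev k, ∃ r : C.Hor y y', C.Sq r s}
  lev_zero := by
    rw [R.lev_zero]
    ext y
    constructor
    · rintro ⟨_, rfl, r, hr⟩
      exact congrArg Sigma.fst (C.sq_unique hr ht)
    · rintro rfl
      exact ⟨_, rfl, t, ht⟩
  lev_out k hk := by ext z; simp [R.lev_out k hk]
  finite k := by
    have : {y | ∃ y' ∈ R.lev k, ∃ r : C.Hor y y', C.Sq r s} =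
        ⋃ y' ∈ R.lev k, {y | ∃ r : C.Hor y y', C.Sq r s} := by ext; simp
    rw [this]
    refine (R.finite k).biUnion fun y' _ => Set.Subsingleton.finite ?_
    rintro y ⟨r, hr⟩ z ⟨r', hr'⟩
    exact congrArg Sigma.fst (C.sq_unique hr hr')
  sep k := by
    rintro x ⟨x', hx', r, hr⟩ y ⟨y', hy', q, hq⟩ hne
    refine ⟨⟨T.root, C.sq_left hr, C.sq_left hq⟩, fun w hw hw' => hne ?_⟩
    obtain ⟨b, m, hm⟩ := sq_exists' r hw
    obtain ⟨b', m', hm'⟩ := sq_exists' q hw'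
    have := sq_unique' (C.sq_trans hm hr) (C.sq_trans hm' hq)
    obtain rfl : b = b' := congrArg Sigma.fst this
    obtain rfl := eq_of_le hx' hy' (C.sq_right hm) (C.sq_right hm')
    exact congrArg Sigma.fst (C.sq_unique hr hq)
  le k hk := by
    rintro y ⟨y', hy', r, hr⟩
    obtain ⟨x', hx', hle⟩ := R.le k hk y' hy'
    obtain ⟨x, q, hq⟩ := C.sq_exists s ((le_root hx').trans (root_le hR))
    exact ⟨x, ⟨x', hx', q, hq⟩, C.sq_left (sq_of_le hr hq hle)⟩
  cover k hk := by
    rintro x ⟨x', hx', r, hr⟩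
    refine C.J.superset_covering ?_ (C.cover_hor r _ (R.cover k hk x' hx'))
    rintro w f ⟨z, ⟨z', m, ⟨g, y', hy', hle⟩, hm⟩, hwz⟩
    obtain ⟨y, q, hq⟩ := C.sq_exists s ((le_root hy').trans (root_le hR))
    exact ⟨y, ⟨y', hy', q, hq⟩, hwz.trans (C.sq_left (sq_of_le (C.sq_trans hm hr) hq hle))⟩

end Filtered

open Filtered in
/-- The polytope complex `f_n C` of diagrams `A_1 ← A_2 ← ⋯ ← A_n` of covering sub-maps in `C^id` with
`A_1` a singleton (and an initial object adjoined), with levelwise vertical and horizontal morphisms,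
squares and covering families. A horizontal morphism of diagrams is determined by its component at
the root: its other components are the restrictions of that one, so it amounts to a horizontal
morphism of the roots that carries each level bijectively to the corresponding level. -/
def filtered (n : ℕ) (C : PolytopeComplex.{u, v}) : PolytopeComplex.{u, v} where
  P := Filtered C n
  J := topology C n
  Hor T T' := {s : C.Hor T.root T'.root // Carries T T' s}
  hid T := ⟨C.hid _, Carries.hid T⟩
  hcomp s t := ⟨C.hcomp s.1 t.1, s.2.hcomp t.2⟩
  hinv s := ⟨C.hinv s.1, s.2.hinv⟩
  id_hcomp s := Subtype.ext (C.id_hcomp _)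
  hcomp_id s := Subtype.ext (C.hcomp_id _)
  hassoc s t r := Subtype.ext (C.hassoc _ _ _)
  hcomp_inv s := Subtype.ext (C.hcomp_inv _)
  inv_hcomp s := Subtype.ext (C.inv_hcomp _)
  Sq {R R' T T'} t s := R ≤ T ∧ R' ≤ T' ∧ C.Sq t.1 s.1
  sq_left h := h.1
  sq_right h := h.2.1
  sq_refl s := ⟨le_rfl, le_rfl, C.sq_refl _⟩
  sq_trans h h' := ⟨h.1.trans h'.1, h.2.1.trans h'.2.1, C.sq_trans h.2.2 h'.2.2⟩
  sq_hid h := ⟨h, h, C.sq_hid (root_le h)⟩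
  sq_hcomp h h' := ⟨h.1, h'.2.1, C.sq_hcomp h.2.2 h'.2.2⟩
  meet {T T' Z R} h h' hR hR' := by
    refine ⟨inter T T' ⟨_, root_le h, root_le h'⟩ ⟨_, root_le hR, root_le hR'⟩, ?_, ?_⟩
    · rintro q (rfl | rfl)
      · exact inter_le
      · exact inter_le'
    · intro q hq
      exact le_inter (hq (by simp)) (hq (by simp))
  sq_exists {T T' R} s hR := by
    obtain ⟨a, t, ht⟩ := C.sq_exists s.1 (root_le hR)
    have hle : ∀ k, ∀ y' ∈ R.lev k, y' ≤ T'.root := fun k y' hy' =>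
      (le_root hy').trans (root_le hR)
    refine ⟨pull s.1 hR t ht, ⟨t, fun k => ⟨?_, ?_⟩⟩, ?_, hR, ht⟩
    · rintro y ⟨y', hy', r, hr⟩
      exact ⟨y', hy', r, sq_of_le hr ht (le_root hy')⟩
    · intro y' hy'
      obtain ⟨y, r, hr⟩ := C.sq_exists s.1 (hle k y' hy')
      exact ⟨y, ⟨y', hy', r, hr⟩, r, sq_of_le hr ht (le_root hy')⟩
    · rintro k y ⟨y', hy', r, hr⟩
      obtain ⟨z', hz', hyz⟩ := hR k y' hy'
      obtain ⟨z, hz, q, hq⟩ := (s.2 k).2 z' hz'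
      exact ⟨z, hz, C.sq_left (sq_of_le hr hq hyz)⟩
  sq_unique := by
    rintro T T' R T₁ T₂ s ⟨t₁, c₁⟩ ⟨t₂, c₂⟩ ⟨-, -, h₁⟩ ⟨-, -, h₂⟩
    have key : ∀ {T₁ T₂ : Filtered C n} {t₁ : C.Hor T₁.root R.root} {t₂ : C.Hor T₂.root R.root}
        (_ : Carries T₁ R t₁) (_ : Carries T₂ R t₂) (_ : C.Sq t₁ s.1) (_ : C.Sq t₂ s.1) (k : ℕ),
        T₁.lev k ⊆ T₂.lev k := by
      intro T₁ T₂ t₁ t₂ c₁ c₂ h₁ h₂ k y hy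
      obtain ⟨y', hy', r, hr⟩ := (c₁ k).1 y hy
      obtain ⟨z, hz, q, hq⟩ := (c₂ k).2 y' hy'
      have : y = z := congrArg Sigma.fst (C.sq_unique (C.sq_trans hr h₁) (C.sq_trans hq h₂))
      exact this ▸ hz
    obtain rfl : T₁ = T₂ :=
      ext' fun k => (key c₁ c₂ h₁ h₂ k).antisymm (key c₂ c₁ h₂ h₁ k)
    obtain rfl : t₁ = t₂ := eq_of_heq (Sigma.mk.inj (C.sq_unique h₁ h₂)).2
    rfl
  cover_hor := by
    rintro T T' s S hS k x hx
    obtain ⟨x', hx', r, hr⟩ := (s.2 k).1 x hx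
    refine C.J.superset_covering ?_ (C.cover_hor r _ (hS k x' hx'))
    rintro w f ⟨z, ⟨z', m, ⟨g, y', ⟨R, ⟨e, he⟩, hy'⟩, hle⟩, hm⟩, hwz⟩
    obtain ⟨a, t, ht⟩ := C.sq_exists s.1 (root_le e.le)
    obtain ⟨y, q, hq⟩ := C.sq_exists s.1 ((le_root hy').trans (root_le e.le))
    refine ⟨y, ⟨pull s.1 e.le t ht, ⟨homOfLE ?_, _, ⟨R, ⟨t, fun k => ⟨?_, ?_⟩⟩, ⟨e, he⟩, ?_, e.le, ht⟩,
      le_rfl⟩, ⟨y', hy', q, hq⟩⟩, hwz.trans (C.sq_left (sq_of_le (C.sq_trans hm hr) hq hle))⟩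
    · rintro k y ⟨y', hy', r, hr⟩
      obtain ⟨z', hz', hyz⟩ := e.le k y' hy'
      obtain ⟨z, hz, q, hq⟩ := (s.2 k).2 z' hz'
      exact ⟨z, hz, C.sq_left (sq_of_le hr hq hyz)⟩
    · rintro y ⟨y', hy', r, hr⟩
      exact ⟨y', hy', r, sq_of_le hr ht (le_root hy')⟩
    · intro y' hy'
      obtain ⟨y, r, hr⟩ := C.sq_exists s.1 ((le_root hy').trans (root_le e.le))
      exact ⟨y, ⟨y', hy', r, hr⟩, r, sq_of_le hr ht (le_root hy')⟩
    · rintro k y ⟨y', hy', r, hr⟩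
      obtain ⟨z', hz', hyz⟩ := e.le k y' hy'
      obtain ⟨z, hz, q, hq⟩ := (s.2 k).2 z' hz'
      exact ⟨z, hz, C.sq_left (sq_of_le hr hq hyz)⟩

end PolytopeComplex

namespace PolytopeComplex

/-! ### Wedges -/

namespace Wedge

/-- The disjoint union of the sets of noninitial objects. -/
structure Obj {ι : Type} (X : ι → PolytopeComplex.{u, v}) where
  idx : ι
  val : (X idx).P

variable {ι : Type} {X : ι → PolytopeComplex.{u, v}}

/-- The order of a disjoint union. -/
inductive Le : Obj X → Obj X → Prop
  | mk {i : ι} {a b : (X i).P} (h : a ≤ b) : Le ⟨i, a⟩ ⟨i, b⟩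

instance : Preorder (Obj X) where
  le := Le
  le_refl x := ⟨le_rfl⟩
  le_trans := by
    rintro _ _ _ ⟨h⟩ ⟨h'⟩
    exact ⟨h.trans h'⟩

lemma le_iff {i : ι} {a b : (X i).P} : (⟨i, a⟩ : Obj X) ≤ ⟨i, b⟩ ↔ a ≤ b :=
  ⟨by rintro ⟨h⟩; exact h, fun h => ⟨h⟩⟩

/-- Horizontal morphisms within a summand. -/
def Hor (x y : Obj X) : Type v := (e : x.idx = y.idx) ×' (X y.idx).Hor (e ▸ x.val) y.val

/-- The inclusion of the horizontal morphisms of a summand. -/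
def Hor.mk {i : ι} {a b : (X i).P} (s : (X i).Hor a b) : Hor (X := X) ⟨i, a⟩ ⟨i, b⟩ := ⟨rfl, s⟩

lemma Hor.cases {motive : ∀ {x y : Obj X}, Hor x y → Prop}
    (h : ∀ {i} {a b : (X i).P} (s : (X i).Hor a b), motive (Hor.mk s)) {x y : Obj X}
    (s : Hor x y) : motive s := by
  obtain ⟨i, a⟩ := x
  obtain ⟨j, b⟩ := y
  obtain ⟨e, s⟩ := s
  obtain rfl : i = j := e
  exact h s

/-- Composition within a summand. -/
def comp : ∀ {x y z : Obj X}, Hor x y → Hor y z → Hor x z := by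
  rintro ⟨i, a⟩ ⟨j, b⟩ ⟨k, c⟩ ⟨e, s⟩ ⟨e', t⟩
  change i = j at e
  change j = k at e'
  subst e
  subst e'
  exact ⟨rfl, (X _).hcomp s t⟩

/-- Inverses within a summand. -/
def inv : ∀ {x y : Obj X}, Hor x y → Hor y x := by
  rintro ⟨i, a⟩ ⟨j, b⟩ ⟨e, s⟩
  change i = j at e
  subst e
  exact ⟨rfl, (X _).hinv s⟩

/-- Squares within a summand. -/
inductive Sq : ∀ {x' y' x y : Obj X}, Hor x' y' → Hor x y → Prop
  | mk {i : ι} {a' b' a b : (X i).P} {t : (X i).Hor a' b'} {s : (X i).Hor a b}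
      (h : (X i).Sq t s) : Sq (Hor.mk t) (Hor.mk s)

/-- The sieve on an object of a summand induced by a sieve in the wedge. -/
def res {i : ι} {a : (X i).P} (S : Sieve (⟨i, a⟩ : Obj X)) : Sieve a where
  arrows b _ := ∃ f : (⟨i, b⟩ : Obj X) ⟶ ⟨i, a⟩, S f
  downward_closed := by
    rintro b c f ⟨g, hg⟩ h
    exact ⟨homOfLE (Le.mk h.le) ≫ g, S.downward_closed hg _⟩

/-- The topology of a disjoint union. -/
def topology (X : ι → PolytopeComplex.{u, v}) : GrothendieckTopology (Obj X) where
  sieves x := {S | res S ∈ (X x.idx).J x.val}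
  top_mem' := by
    rintro ⟨i, a⟩
    refine (X i).J.superset_covering ?_ ((X i).J.top_mem a)
    intro b f _
    exact ⟨homOfLE (Le.mk f.le), trivial⟩
  pullback_stable' := by
    rintro ⟨i, a⟩ ⟨j, b⟩ S f hS
    have hf := f.le
    obtain ⟨hf⟩ := hf
    refine (X i).J.superset_covering ?_ ((X i).J.pullback_stable (homOfLE hf) hS)
    rintro c g ⟨k, hk⟩
    exact ⟨homOfLE (Le.mk g.le), hk⟩
  transitive' := by
    rintro ⟨i, a⟩ S hS R hR
    refine (X i).J.transitive hS _ ?_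
    rintro b f ⟨g, hg⟩
    refine (X i).J.superset_covering ?_ (hR hg)
    rintro c h ⟨k, hk⟩
    exact ⟨k ≫ g, hk⟩

end Wedge

open Wedge in
/-- The wedge of polytope complexes: the disjoint union with the initial objects identified. -/
def wedge {ι : Type} (X : ι → PolytopeComplex.{u, v}) : PolytopeComplex.{u, v} where
  P := Obj X
  J := topology X
  Hor := Wedge.Hor
  hid x := .mk ((X x.idx).hid x.val)
  hcomp := comp
  hinv := inv
  id_hcomp s := by
    induction s using Hor.cases with | _ s
    exact congrArg Hor.mk ((X _).id_hcomp s)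
  hcomp_id s := by
    induction s using Hor.cases with | _ s
    exact congrArg Hor.mk ((X _).hcomp_id s)
  hassoc := by
    rintro ⟨i, a⟩ ⟨j, b⟩ ⟨k, c⟩ ⟨l, d⟩ ⟨e, s⟩ ⟨e', t⟩ ⟨e'', r⟩
    change i = j at e
    subst e
    change _ = k at e'
    subst e'
    change _ = l at e''
    subst e''
    exact congrArg Hor.mk ((X _).hassoc s t r)
  hcomp_inv s := by
    induction s using Hor.cases with | _ s
    exact congrArg Hor.mk ((X _).hcomp_inv s)
  inv_hcomp s := by
    induction s using Hor.cases with | _ s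
    exact congrArg Hor.mk ((X _).inv_hcomp s)
  Sq := Wedge.Sq
  sq_left := by rintro _ _ _ _ _ _ ⟨h⟩; exact le_iff.2 ((X _).sq_left h)
  sq_right := by rintro _ _ _ _ _ _ ⟨h⟩; exact le_iff.2 ((X _).sq_right h)
  sq_refl s := by
    induction s using Hor.cases with | _ s
    exact ⟨(X _).sq_refl s⟩
  sq_trans := by
    rintro ⟨i, _⟩ ⟨i', _⟩ ⟨j, _⟩ ⟨j', _⟩ ⟨k, _⟩ ⟨k', _⟩ ⟨e, r⟩ ⟨e', t⟩ ⟨e'', s⟩ h h'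
    change i = i' at e
    subst e
    change j = j' at e'
    subst e'
    change k = k' at e''
    subst e''
    cases h with | mk h
    cases h' with | mk h'
    exact ⟨(X _).sq_trans h h'⟩
  sq_hid := by
    rintro _ _ ⟨h⟩
    exact ⟨(X _).sq_hid h⟩
  sq_hcomp := by
    rintro ⟨i, _⟩ ⟨i', _⟩ ⟨i'', _⟩ ⟨j, _⟩ ⟨j', _⟩ ⟨j'', _⟩ ⟨e, t⟩ ⟨e', t'⟩ ⟨d, s⟩ ⟨d', s'⟩ h h'
    change i = i' at e
    subst e
    change _ = i'' at e'
    subst e'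
    change j = j' at d
    subst d
    change _ = j'' at d'
    subst d'
    cases h with | mk h
    cases h' with | mk h'
    exact ⟨(X _).sq_hcomp h h'⟩
  meet := by
    rintro ⟨i, x⟩ ⟨_, y⟩ ⟨_, z⟩ ⟨_, w⟩ ⟨hx⟩ ⟨hy⟩ ⟨hw⟩ hwy
    obtain ⟨m, hm⟩ := (X i).meet hx hy hw (le_iff.1 hwy)
    refine ⟨⟨i, m⟩, ?_, ?_⟩
    · rintro _ (rfl | rfl)
      · exact le_iff.2 (hm.1 (by simp))
      · exact le_iff.2 (hm.1 (by simp))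
    · intro q hq
      have h1 : q ≤ ⟨i, x⟩ := hq (by simp)
      have h2 : q ≤ ⟨i, y⟩ := hq (by simp)
      obtain ⟨_, q⟩ := q
      obtain ⟨h1⟩ := h1
      refine le_iff.2 (hm.2 ?_)
      rintro r (rfl | rfl)
      · exact h1
      · exact le_iff.1 h2
  sq_exists := by
    rintro ⟨i, a⟩ ⟨k, b⟩ ⟨j, b'⟩ ⟨e, s⟩ h
    change i = k at e
    subst e
    obtain ⟨h⟩ := h
    obtain ⟨a', t, ht⟩ := (X _).sq_exists s h
    exact ⟨⟨_, a'⟩, .mk t, ⟨ht⟩⟩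
  sq_unique := by
    rintro ⟨i, a⟩ ⟨i', b⟩ ⟨j, b'⟩ ⟨k, a₁⟩ ⟨l, a₂⟩ ⟨e, s⟩ ⟨e', t₁⟩ ⟨e'', t₂⟩ h h'
    change i = i' at e
    subst e
    cases h with | mk h
    change l = i at e''
    subst e''
    cases h' with | mk h'
    have := (X _).sq_unique h h'
    obtain rfl : a₁ = a₂ := congrArg Sigma.fst this
    have e := eq_of_heq (Sigma.mk.inj this).2
    subst e
    rfl
  cover_hor := by
    rintro ⟨i, a⟩ ⟨j, b⟩ ⟨e, s⟩ S hS
    change i = j at e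
    subst e
    refine (X _).J.superset_covering ?_ ((X _).cover_hor s _ hS)
    rintro w f ⟨a', ⟨b', t, ⟨g, f', hf'⟩, ht⟩, hw⟩
    exact ⟨homOfLE (le_iff.2 f.le), ⟨_, a'⟩, ⟨⟨_, b'⟩, .mk t, ⟨f', hf'⟩, ⟨ht⟩⟩, le_iff.2 hw⟩

/-- `s_n C = f_1 C ∨ ⋯ ∨ f_n C` -/
def s (n : ℕ) (C : PolytopeComplex.{u, v}) : PolytopeComplex.{u, v} :=
  wedge fun i : Fin n => filtered (i + 1) C

end PolytopeComplex

namespace PolytopeComplex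

/-! ### The levels of an object of `s_n C`

An object of the summand `f_m C` of `s_n C` is a diagram `A_b ← A_{b+1} ← ⋯ ← A_n` of `m` families,
indexed by the last `m` elements of `{1, …, n}`, so that `b = n - m + 1`. -/

namespace Forest

open Filtered Wedge

variable {C : PolytopeComplex.{u, v}} {n : ℕ}

/-- The index `b` of the first family of the diagram `A_b ← A_{b+1} ← ⋯ ← A_n`. -/
def born (T : (s n C).P) : ℕ := n - (T.idx : ℕ)

/-- The member of the singleton `A_b`. -/
def root (T : (s n C).P) : C.P := Filtered.root T.val

/-- The set of members of `A_l`, which is empty unless `b ≤ l ≤ n`. -/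
def lev (T : (s n C).P) (l : ℕ) : Set C.P :=
  {y | born T ≤ l ∧ y ∈ Filtered.lev T.val (l - born T)}

variable {T T' R : (s n C).P}

lemma one_le_born (T : (s n C).P) : 1 ≤ born T := by
  have := T.idx.2
  unfold born; omega

lemma born_le (T : (s n C).P) : born T ≤ n := Nat.sub_le _ _

lemma idx_eq_of_born (h : born T = born T') : T.idx = T'.idx := by
  have := T.idx.2
  have := T'.idx.2
  apply Fin.ext
  unfold born at h; omega

lemma lev_born (T : (s n C).P) : lev T (born T) = {root T} := by
  ext y
  have h := Set.ext_iff.1 (Filtered.lev_zero T.val) y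
  simp only [lev, le_refl, true_and, Nat.sub_self, Set.mem_ofPred_eq]
  exact h

lemma root_mem (T : (s n C).P) : root T ∈ lev T (born T) := by rw [lev_born]; rfl

lemma born_le_of_mem {l : ℕ} {y : C.P} (h : y ∈ lev T l) : born T ≤ l := h.1

lemma le_of_mem {l : ℕ} {y : C.P} (h : y ∈ lev T l) : l ≤ n := by
  have h1 := Filtered.lt_of_mem h.2
  have h2 := h.1
  have := T.idx.2
  unfold born at h1 h2; omega

lemma lev_finite (T : (s n C).P) (l : ℕ) : (lev T l).Finite :=
  (Filtered.finite T.val _).subset fun _ h => h.2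

lemma lev_sep {l : ℕ} {x y : C.P} (hx : x ∈ lev T l) (hy : y ∈ lev T l) (h : x ≠ y) : Sep x y :=
  Filtered.sep T.val _ x hx.2 y hy.2 h

lemma eq_of_le {l : ℕ} {x y w : C.P} (hx : x ∈ lev T l) (hy : y ∈ lev T l) (h : w ≤ x)
    (h' : w ≤ y) : x = y := Filtered.eq_of_le hx.2 hy.2 h h'

lemma exists_le {j k : ℕ} (hj : born T ≤ j) (hjk : j ≤ k) {y : C.P} (hy : y ∈ lev T k) :
    ∃ x ∈ lev T j, y ≤ x := by
  obtain ⟨x, hx, h⟩ := Filtered.exists_le (show j - born T ≤ k - born T by omega) hy.2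
  exact ⟨x, ⟨hj, hx⟩, h⟩

lemma le_root {l : ℕ} {y : C.P} (hy : y ∈ lev T l) : y ≤ root T := Filtered.le_root hy.2

lemma lev_cover {j k : ℕ} (hjk : j ≤ k) (hk : k ≤ n) {x : C.P} (hx : x ∈ lev T j) :
    sieveOf (lev T k) x ∈ C.J x := by
  have h := Filtered.cover' (T := T.val) (show j - born T ≤ k - born T by omega) (by
    have := T.idx.2
    have := hx.1
    unfold born at *; omega) hx.2
  refine C.J.superset_covering ?_ h
  rintro w f ⟨y, hy, hwy⟩
  exact ⟨y, ⟨hx.1.trans hjk, hy⟩, hwy⟩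

lemma ext (h : ∀ l, lev T l = lev T' l) : T = T' := by
  have hb : born T = born T' := by
    apply le_antisymm
    · exact born_le_of_mem ((h _).symm ▸ root_mem T' : root T' ∈ lev T (born T'))
    · exact born_le_of_mem ((h _) ▸ root_mem T : root T ∈ lev T' (born T))
  have hi := idx_eq_of_born hb
  obtain ⟨i, a⟩ := T
  obtain ⟨j, b⟩ := T'
  obtain rfl : i = j := hi
  obtain rfl : a = b := by
    apply Filtered.ext'
    intro k
    have h1 := h (n - i + k)
    ext y
    have h2 := Set.ext_iff.1 h1 y
    simpa [lev, born] using h2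
  rfl

lemma le_iff : T ≤ T' ↔ born T = born T' ∧ ∀ l, ∀ y ∈ lev T l, ∃ y' ∈ lev T' l, y ≤ y' := by
  constructor
  · rintro ⟨h⟩
    refine ⟨rfl, fun l y hy => ?_⟩
    obtain ⟨y', hy', h'⟩ := h _ y hy.2
    exact ⟨y', ⟨hy.1, hy'⟩, h'⟩
  · rintro ⟨hb, h⟩
    have hi := idx_eq_of_born hb
    obtain ⟨i, a⟩ := T
    obtain ⟨j, b⟩ := T'
    obtain rfl : i = j := hi
    refine ⟨fun k y hy => ?_⟩
    obtain ⟨y', hy', h'⟩ := h (n - i + k) y (by simpa [lev, born] using hy)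
    exact ⟨y', by simpa [lev, born] using hy', h'⟩

lemma root_le (h : T ≤ T') : root T ≤ root T' := by
  obtain ⟨hb, h⟩ := le_iff.1 h
  obtain ⟨y, hy, hle⟩ := h _ _ (root_mem T)
  exact hle.trans (le_root hy)

/-- An object of `s_n C` from its levels. -/
def ofLev (b : ℕ) (hb : 1 ≤ b) (hbn : b ≤ n) (r : C.P) (L : ℕ → Set C.P) (hr : L b = {r})
    (fin : ∀ l, (L l).Finite) (sep : ∀ l, ∀ x ∈ L l, ∀ y ∈ L l, x ≠ y → Sep x y)
    (le : ∀ l, b ≤ l → ∀ y ∈ L (l + 1), ∃ x ∈ L l, y ≤ x)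
    (cov : ∀ l, b ≤ l → l < n → ∀ x ∈ L l, sieveOf (L (l + 1)) x ∈ C.J x) : (s n C).P where
  idx := ⟨n - b, by omega⟩
  val :=
    { root := r
      lev := fun k => {y | k ≤ n - b ∧ y ∈ L (b + k)}
      lev_zero := by
        rw [← hr]; ext y; simp
      lev_out := by
        intro k hk
        ext y
        simp only [Set.mem_ofPred_eq, Set.mem_empty_iff_false, iff_false]
        rintro ⟨h, -⟩
        exact absurd hk (by simp; omega)
      finite := fun k => (fin (b + k)).subset fun _ h => h.2
      sep := fun k x hx y hy h => sep _ x hx.2 y hy.2 h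
      le := by
        rintro k hk y ⟨h1, h2⟩
        obtain ⟨x, hx, h⟩ := le (b + k) (by omega) y h2
        exact ⟨x, ⟨by omega, hx⟩, h⟩
      cover := by
        rintro k hk x ⟨h1, h2⟩
        simp only at hk
        refine C.J.superset_covering ?_ (cov (b + k) (by omega) (by omega) x h2)
        rintro w f ⟨y, hy, hwy⟩
        exact ⟨y, ⟨by omega, hy⟩, hwy⟩ }

section
variable {b : ℕ} {hb : 1 ≤ b} {hbn : b ≤ n} {r : C.P} {L : ℕ → Set C.P} {hr : L b = {r}}
    {fin : ∀ l, (L l).Finite} {sep : ∀ l, ∀ x ∈ L l, ∀ y ∈ L l, x ≠ y → Sep x y}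
    {le : ∀ l, b ≤ l → ∀ y ∈ L (l + 1), ∃ x ∈ L l, y ≤ x}
    {cov : ∀ l, b ≤ l → l < n → ∀ x ∈ L l, sieveOf (L (l + 1)) x ∈ C.J x}

@[simp] lemma born_ofLev : born (ofLev b hb hbn r L hr fin sep le cov) = b := by
  simp only [born, ofLev]; omega

@[simp] lemma root_ofLev : root (ofLev b hb hbn r L hr fin sep le cov) = r := rfl

lemma mem_lev_ofLev {l : ℕ} {y : C.P} :
    y ∈ lev (ofLev b hb hbn r L hr fin sep le cov) l ↔ b ≤ l ∧ l ≤ n ∧ y ∈ L l := by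
  simp only [lev, born_ofLev, Set.mem_ofPred_eq]
  simp only [ofLev, Set.mem_ofPred_eq]
  constructor
  · rintro ⟨h1, h2, h3⟩
    rw [Nat.add_sub_cancel' h1] at h3
    exact ⟨h1, by omega, h3⟩
  · rintro ⟨h1, h2, h3⟩
    rw [Nat.add_sub_cancel' h1]
    exact ⟨h1, by omega, h3⟩
end

/-- The horizontal morphism of `C` between the roots. -/
def under : ∀ {T T' : (s n C).P}, (s n C).Hor T T' → C.Hor (root T) (root T') := by
  rintro ⟨i, a⟩ ⟨j, b⟩ ⟨e, t⟩
  change i = j at e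
  subst e
  exact t.1

lemma born_eq_of_hor (h : (s n C).Hor T T') : born T = born T' := by
  obtain ⟨i, a⟩ := T
  obtain ⟨j, b⟩ := T'
  obtain ⟨e, t⟩ := h
  change i = j at e
  subst e
  rfl

lemma under_inj {h h' : (s n C).Hor T T'} (e : under h = under h') : h = h' := by
  obtain ⟨i, a⟩ := T
  obtain ⟨j, b⟩ := T'
  obtain ⟨d, t⟩ := h
  change i = j at d
  subst d
  obtain ⟨d', t'⟩ := h'
  have : t = t' := Subtype.ext e
  subst this
  rfl

lemma under_hid (T : (s n C).P) : under ((s n C).hid T) = C.hid (root T) := rfl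

lemma under_hcomp {T T' R : (s n C).P} (h : (s n C).Hor T T') (h' : (s n C).Hor T' R) :
    under ((s n C).hcomp h h') = C.hcomp (under h) (under h') := by
  obtain ⟨i, a⟩ := T
  obtain ⟨j, b⟩ := T'
  obtain ⟨k, c⟩ := R
  obtain ⟨e, t⟩ := h
  change i = j at e
  subst e
  obtain ⟨e, t'⟩ := h'
  change i = k at e
  subst e
  rfl

lemma under_hinv {T T' : (s n C).P} (h : (s n C).Hor T T') :
    under ((s n C).hinv h) = C.hinv (under h) := by
  obtain ⟨i, a⟩ := T
  obtain ⟨j, b⟩ := T'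
  obtain ⟨e, t⟩ := h
  change i = j at e
  subst e
  rfl

lemma carries (h : (s n C).Hor T T') (l : ℕ) {y : C.P} (hy : y ∈ lev T l) :
    ∃ y' ∈ lev T' l, ∃ t : C.Hor y y', C.Sq t (under h) := by
  obtain ⟨i, a⟩ := T
  obtain ⟨j, b⟩ := T'
  obtain ⟨e, t⟩ := h
  change i = j at e
  subst e
  obtain ⟨y', hy', r⟩ := (t.2 _).1 y hy.2
  exact ⟨y', ⟨hy.1, hy'⟩, r⟩

lemma carries' (h : (s n C).Hor T T') (l : ℕ) {y' : C.P} (hy : y' ∈ lev T' l) :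
    ∃ y ∈ lev T l, ∃ t : C.Hor y y', C.Sq t (under h) := by
  obtain ⟨y, hy, t, ht⟩ := carries ((s n C).hinv h) l hy
  rw [under_hinv] at ht
  exact ⟨y, hy, C.hinv t, by simpa [hinv_hinv] using sq_inv ht⟩

lemma exists_hor (hb : born T = born T') (t : C.Hor (root T) (root T'))
    (h1 : ∀ l, ∀ y ∈ lev T l, ∃ y' ∈ lev T' l, ∃ r : C.Hor y y', C.Sq r t)
    (h2 : ∀ l, ∀ y' ∈ lev T' l, ∃ y ∈ lev T l, ∃ r : C.Hor y y', C.Sq r t) :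
    ∃ h : (s n C).Hor T T', under h = t := by
  have hi := idx_eq_of_born hb
  obtain ⟨i, a⟩ := T
  obtain ⟨j, b⟩ := T'
  obtain rfl : i = j := hi
  refine ⟨Hor.mk ⟨t, fun k => ⟨fun y hy => ?_, fun y hy => ?_⟩⟩, rfl⟩
  · obtain ⟨y', hy', h⟩ := h1 (n - i + k) y (by simpa [lev, born] using hy)
    exact ⟨y', by simpa [lev, born] using hy', h⟩
  · obtain ⟨y', hy', h⟩ := h2 (n - i + k) y (by simpa [lev, born] using hy)
    exact ⟨y', by simpa [lev, born] using hy', h⟩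

lemma sq_iff {R R' : (s n C).P} {t : (s n C).Hor R R'} {h : (s n C).Hor T T'} :
    (s n C).Sq t h ↔ R ≤ T ∧ R' ≤ T' ∧ C.Sq (under t) (under h) := by
  constructor
  · rintro ⟨h1, h2, h3⟩
    exact ⟨Wedge.le_iff.2 h1, Wedge.le_iff.2 h2, h3⟩
  · rintro ⟨h1, h2, h3⟩
    obtain ⟨i, a⟩ := T
    obtain ⟨j, b⟩ := T'
    obtain ⟨e, h⟩ := h
    change i = j at e
    subst e
    obtain ⟨h1⟩ := h1
    obtain ⟨h2⟩ := h2
    obtain ⟨e', t⟩ := t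
    exact ⟨⟨h1, h2, h3⟩⟩

lemma exists_inter {Z : (s n C).P} (h : T ≤ Z) (h' : T' ≤ Z)
    (hb' : ∃ w, w ≤ root T ∧ w ≤ root T') :
    ∃ M : (s n C).P, M ≤ T ∧ M ≤ T' ∧ ∀ l y y' w, y ∈ lev T l → y' ∈ lev T' l → w ≤ y → w ≤ y' →
      ∃ m ∈ lev M l, w ≤ m := by
  obtain ⟨h⟩ := h
  obtain ⟨h'⟩ := h'
  have hb : ∃ z, _ ≤ z ∧ _ ≤ z := ⟨_, Filtered.root_le h, Filtered.root_le h'⟩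
  refine ⟨⟨_, inter _ _ hb hb'⟩, Wedge.le_iff.2 inter_le,
    Wedge.le_iff.2 inter_le', ?_⟩
  intro l y y' w hy hy' hw hw'
  obtain ⟨m, hm, h⟩ := le_inter_lev (h := hb) (h' := hb') hy.2 hy'.2 hw hw'
  exact ⟨m, ⟨hy.1, hm⟩, h⟩

lemma mem_J_iff {S : Sieve T} : S ∈ (s n C).J T ↔ ∀ l, ∀ x ∈ lev T l,
    sieveOf {y | ∃ T', (∃ f : T' ⟶ T, S f) ∧ y ∈ lev T' l} x ∈ C.J x := by
  obtain ⟨i, a⟩ := T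
  constructor
  · intro h l x hx
    refine C.J.superset_covering ?_ (h _ x hx.2)
    rintro w f ⟨y, ⟨R, ⟨g, ⟨k, hk⟩⟩, hy⟩, hwy⟩
    exact ⟨y, ⟨_, ⟨k, hk⟩, ⟨hx.1, hy⟩⟩, hwy⟩
  · intro h k x hx
    refine C.J.superset_covering ?_ (h (n - i + k) x (by simpa [lev, born] using hx))
    rintro w f ⟨y, ⟨R, ⟨g, hg⟩, hy⟩, hwy⟩
    obtain ⟨j, b⟩ := R
    have hle := g.le
    obtain ⟨hle⟩ := hle
    exact ⟨y, ⟨b, ⟨homOfLE hle, g, hg⟩, by simpa [lev, born] using hy⟩, hwy⟩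

end Forest
end PolytopeComplex

namespace PolytopeComplex

namespace Forest

variable {C : PolytopeComplex.{u, v}} {n k m : ℕ}

/-- A monotone map `{0, …, k} → {0, …, n}`, extended by `n + 1`. -/
def extend (θ : Fin (k + 1) →o Fin (n + 1)) (j : ℕ) : ℕ :=
  if h : j < k + 1 then θ ⟨j, h⟩ else n + 1

lemma extend_le (θ : Fin (k + 1) →o Fin (n + 1)) {j : ℕ} (h : j ≤ k) : extend θ j ≤ n := by
  rw [extend, dif_pos (by omega)]
  exact Nat.lt_succ_iff.1 (θ _).2

lemma extend_gt (θ : Fin (k + 1) →o Fin (n + 1)) {j : ℕ} (h : k < j) : extend θ j = n + 1 := by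
  rw [extend, dif_neg (by omega)]

lemma extend_mono (θ : Fin (k + 1) →o Fin (n + 1)) {i j : ℕ} (h : i ≤ j) :
    extend θ i ≤ extend θ j := by
  by_cases hj : j ≤ k
  · rw [extend, extend, dif_pos (by omega), dif_pos (by omega)]
    exact θ.monotone h
  · rw [extend_gt θ (show k < j by omega)]
    by_cases hi : i ≤ k
    · exact (extend_le θ hi).trans (Nat.le_succ n)
    · rw [extend_gt θ (by omega)]

/-- `R` is a member of the restriction of `T` along the monotone map `θ : {0, …, k} → {0, …, n}`.
With `A_l` for the families of `T` (empty for `l` less than `b = born T`), the restriction has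
`A_{θ j}` in place `j`. Let `j₀` be the first `j` with `b ≤ θ j`. If there is no such `j`, or if
`j₀ = 0`, then the restriction is `0`. Otherwise it is split into the fibres over the members `r` of
`A_{θ j₀}`: they are the diagrams with root `r`, born at `j₀`, whose `j`-th family is the part of
`A_{θ j}` below `r`.

For the injection of `{0, …, n-1}` that skips `i` this is the `i`-th face map: it skips the family
`A_i`, splitting the rest into fibres over `A_{i+1}` if `i = b`; it is `0` on the diagrams born at `1`
and the identity on the others if `i = 0`. For the surjection that takes the value `i` twice it is the
`i`-th degeneracy, which repeats the family `A_i`, and is the identity if `i < b`. -/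
def IsPiece (θ : Fin (k + 1) →o Fin (n + 1)) (T : (s n C).P) (R : (s k C).P) : Prop :=
  extend θ (born R - 1) < born T ∧ root R ∈ lev T (extend θ (born R)) ∧
    ∀ j, born R ≤ j → lev R j = {y ∈ lev T (extend θ j) | y ≤ root R}

variable {θ : Fin (k + 1) →o Fin (n + 1)} {T T' : (s n C).P} {R R' : (s k C).P}

lemma IsPiece.born_le (h : IsPiece θ T R) {j : ℕ} (hj : born R ≤ j) : born T ≤ extend θ j :=
  (born_le_of_mem h.2.1).trans (extend_mono θ hj)

lemma IsPiece.born_eq (h : IsPiece θ T R) (h' : IsPiece θ T' R') (e : born T = born T') :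
    born R = born R' := by
  have key : ∀ {T T' : (s n C).P} {R R' : (s k C).P}, IsPiece θ T R → IsPiece θ T' R' →
      born T = born T' → born R ≤ born R' := by
    intro T T' R R' h h' e
    by_contra hlt
    have h1 := extend_mono θ (show born R' ≤ born R - 1 by omega)
    have h2 := h'.born_le le_rfl
    have := h.1
    omega
  exact (key h h' e).antisymm (key h' h e.symm)

lemma IsPiece.lev_sub (h : IsPiece θ T R) {j : ℕ} {y : C.P} (hy : y ∈ lev R j) :
    y ∈ lev T (extend θ j) ∧ y ≤ root R := by
  rw [h.2.2 j (born_le_of_mem hy)] at hy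
  exact hy

lemma IsPiece.mem_lev (h : IsPiece θ T R) {j : ℕ} (hj : born R ≤ j) {y : C.P}
    (hy : y ∈ lev T (extend θ j)) (hle : y ≤ root R) : y ∈ lev R j := by
  rw [h.2.2 j hj]; exact ⟨hy, hle⟩

/-- If `y` lies in the right level and meets `root R`, then it lies below it. -/
lemma IsPiece.le_root (h : IsPiece θ T R) {j : ℕ} (hj : born R ≤ j) {y w : C.P}
    (hy : y ∈ lev T (extend θ j)) (hw : w ≤ y) (hw' : w ≤ root R) : y ≤ root R := by
  obtain ⟨x, hx, hle⟩ := exists_le (born_le_of_mem h.2.1) (extend_mono θ hj) hy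
  obtain rfl := eq_of_le hx h.2.1 (hw.trans hle) hw'
  exact hle

lemma IsPiece.ext (h : IsPiece θ T R) (h' : IsPiece θ T R') (e : root R = root R') : R = R' := by
  have hb := h.born_eq h' rfl
  apply Forest.ext
  intro l
  by_cases hl : born R ≤ l
  · rw [h.2.2 l hl, h'.2.2 l (hb ▸ hl), e]
  · ext y
    exact ⟨fun hy => absurd (born_le_of_mem hy) (hb ▸ hl), fun hy => absurd (born_le_of_mem hy)
      (hb ▸ hl)⟩

lemma exists_piece {b : ℕ} (hb : 1 ≤ b) (hT : extend θ (b - 1) < born T) {r : C.P}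
    (hr : r ∈ lev T (extend θ b)) : ∃ R : (s k C).P, IsPiece θ T R ∧ born R = b ∧ root R = r := by
  have hbk : b ≤ k := by
    by_contra h
    have := le_of_mem hr
    rw [extend_gt θ (by omega)] at this
    omega
  have hbT := born_le_of_mem hr
  refine ⟨ofLev b hb hbk r (fun j => {y ∈ lev T (extend θ j) | y ≤ r}) ?_
    (fun l => (lev_finite T _).subset fun _ h => h.1)
    (fun l x hx y hy => lev_sep hx.1 hy.1) ?_ ?_, ⟨?_, ?_, ?_⟩, ?_, ?_⟩
  · ext y
    constructor
    · rintro ⟨h1, h2⟩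
      exact eq_of_le h1 hr le_rfl h2
    · rintro rfl
      exact ⟨hr, le_rfl⟩
  · rintro l hl y ⟨hy, hyr⟩
    obtain ⟨x, hx, hle⟩ := exists_le (hbT.trans (extend_mono θ hl)) (extend_mono θ l.le_succ) hy
    obtain ⟨z, hz, hle'⟩ := exists_le hbT (extend_mono θ hl) hx
    obtain rfl := eq_of_le hz hr (hle.trans hle') hyr
    exact ⟨x, ⟨hx, hle'⟩, hle⟩
  · rintro l hl hlk x ⟨hx, hxr⟩
    refine C.J.superset_covering ?_ (lev_cover (extend_mono θ l.le_succ) (extend_le θ hlk) hx)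
    rintro w f ⟨y, hy, hwy⟩
    obtain ⟨z, hz, hle'⟩ := exists_le hbT (extend_mono θ (hl.trans l.le_succ)) hy
    obtain rfl := eq_of_le hz hr (hwy.trans hle') (f.le.trans hxr)
    exact ⟨y, ⟨hy, hle'⟩, hwy⟩
  · rw [born_ofLev]; exact hT
  · rw [born_ofLev]; exact hr
  · intro j hj
    rw [born_ofLev] at hj
    ext y
    rw [mem_lev_ofLev, root_ofLev]
    constructor
    · rintro ⟨-, -, h⟩; exact h
    · intro h
      refine ⟨hj, ?_, h⟩
      by_contra hk
      have := le_of_mem h.1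
      rw [extend_gt θ (by omega)] at this
      omega
  · exact born_ofLev
  · exact root_ofLev

lemma IsPiece.finite (θ : Fin (k + 1) →o Fin (n + 1)) (T : (s n C).P) :
    {R | IsPiece θ T R}.Finite := by
  refine Set.Finite.of_finite_image (f := root) ?_ fun R hR R' hR' e => IsPiece.ext hR hR' e
  refine ((Set.finite_Iic k).biUnion fun j _ => lev_finite T (extend θ j)).subset ?_
  rintro _ ⟨R, hR, rfl⟩
  simp only [Set.mem_iUnion]
  exact ⟨born R, Forest.born_le R, hR.2.1⟩

lemma IsPiece.sep (h : IsPiece θ T R) (h' : IsPiece θ T R') (hne : R ≠ R') : Sep R R' := by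
  have hb := h.born_eq h' rfl
  have hd : Sep (root R) (root R') := lev_sep h.2.1 (hb ▸ h'.2.1) fun e => hne (h.ext h' e)
  constructor
  · have hrb := (h.born_le le_rfl)
    let L : ℕ → Set C.P := fun j => if j = born R then {root T} else lev T (extend θ j)
    have hLb : L (born R) = {root T} := if_pos rfl
    have hL : ∀ j, j ≠ born R → L j = lev T (extend θ j) := fun j hj => if_neg hj
    let Z : (s k C).P := ofLev (born R) (one_le_born R) (Forest.born_le R) (root T) L hLb
      (by
        intro l
        by_cases hl : l = born R
        · rw [hl, hLb]; exact Set.finite_singleton _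
        · rw [hL l hl]; exact lev_finite T _)
      (by
        intro l x hx y hy hxy
        by_cases hl : l = born R
        · rw [hl, hLb] at hx hy
          exact absurd (hx.trans hy.symm) hxy
        · rw [hL l hl] at hx hy
          exact lev_sep hx hy hxy)
      (by
        intro l hl y hy
        rw [hL _ (by omega)] at hy
        by_cases hl' : l = born R
        · rw [hl', hLb]
          exact ⟨_, rfl, Forest.le_root hy⟩
        · rw [hL l hl']
          exact exists_le (hrb.trans (extend_mono θ hl)) (extend_mono θ l.le_succ) hy)
      (by
        intro l hl hlk x hx
        rw [hL _ (by omega)]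
        by_cases hl' : l = born R
        · rw [hl', hLb] at hx
          obtain rfl := hx
          exact lev_cover (hrb.trans (extend_mono θ (by omega))) (extend_le θ hlk) (root_mem T)
        · rw [hL l hl'] at hx
          exact lev_cover (extend_mono θ l.le_succ) (extend_le θ hlk) hx)
    have key : ∀ {R' : (s k C).P}, IsPiece θ T R' → born R = born R' → R' ≤ Z := by
      intro R' h' hb
      refine le_iff.2 ⟨hb.symm.trans born_ofLev.symm, fun l y hy => ?_⟩
      obtain ⟨hy1, hy2⟩ := h'.lev_sub hy
      have hl := born_le_of_mem hy
      by_cases hl' : l = born R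
      · exact ⟨root T, mem_lev_ofLev.2 ⟨hl'.ge, le_of_mem hy, by rw [hl', hLb]; rfl⟩,
          Forest.le_root hy1⟩
      · exact ⟨y, mem_lev_ofLev.2 ⟨by omega, le_of_mem hy, by rw [hL l hl']; exact hy1⟩, le_rfl⟩
    exact ⟨Z, key h rfl, key h' hb⟩
  · intro W hW hW'
    exact hd.2 _ (root_le hW) (root_le hW')

lemma IsPiece.le (h : IsPiece θ T R) (h' : IsPiece θ T' R') (hT : T ≤ T') {w : C.P}
    (hw : w ≤ root R) (hw' : w ≤ root R') : R ≤ R' := by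
  obtain ⟨hb, hT⟩ := le_iff.1 hT
  have hb' := h.born_eq h' hb
  have hroot : root R ≤ root R' := by
    obtain ⟨x, hx, hle⟩ := hT _ _ h.2.1
    rw [hb'] at hx
    obtain rfl := eq_of_le hx h'.2.1 (hw.trans hle) hw'
    exact hle
  refine le_iff.2 ⟨hb', fun l y hy => ?_⟩
  obtain ⟨hy1, hy2⟩ := h.lev_sub hy
  obtain ⟨x, hx, hle⟩ := hT _ _ hy1
  have hl := born_le_of_mem hy
  exact ⟨x, h'.mem_lev (hb' ▸ hl) hx (h'.le_root (hb' ▸ hl) hx hle (hy2.trans hroot)), hle⟩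

/-- The restriction of a horizontal morphism: the horizontal morphisms between members of the
restrictions that are restrictions of it. -/
def restrHor (θ : Fin (k + 1) →o Fin (n + 1)) {T T' : (s n C).P} (h : (s n C).Hor T T') :
    Set (HArrow (s k C)) :=
  {p | IsPiece θ T p.dom ∧ IsPiece θ T' p.cod ∧ C.Sq (under p.hor) (under h)}

lemma existsUnique_restrHor (h : (s n C).Hor T T') (hR : IsPiece θ T R) :
    ∃! p, p ∈ restrHor θ h ∧ p.dom = R := by
  obtain ⟨y, hy, t, ht⟩ := carries h _ hR.2.1
  obtain ⟨R', hR', hb, rfl⟩ := exists_piece (one_le_born R)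
    (by rw [← born_eq_of_hor h]; exact hR.1) hy
  obtain ⟨q, hq⟩ := exists_hor (T := R) (T' := R') hb.symm t
    (by
      intro l z hz
      obtain ⟨hz1, hz2⟩ := hR.lev_sub hz
      obtain ⟨z', hz', r, hr⟩ := carries h _ hz1
      have hs := sq_of_le' hr ht hz2
      exact ⟨z', hR'.mem_lev (hb ▸ born_le_of_mem hz) hz' (C.sq_right hs), r, hs⟩)
    (by
      intro l z hz
      obtain ⟨hz1, hz2⟩ := hR'.lev_sub hz
      obtain ⟨z', hz', r, hr⟩ := carries' h _ hz1
      have hs := sq_of_le hr ht hz2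
      exact ⟨z', hR.mem_lev (hb ▸ born_le_of_mem hz) hz' (C.sq_left hs), r, hs⟩)
  refine ⟨⟨R, R', q⟩, ⟨⟨hR, hR', by rw [hq]; exact ht⟩, rfl⟩, ?_⟩
  rintro ⟨_, P, q'⟩ ⟨⟨h1, h2, h3⟩, rfl⟩
  simp only at q' h2 h3
  have h4 := sq_unique' h3 (hq ▸ ht)
  obtain rfl := h2.ext hR' (congrArg Sigma.fst h4)
  have : q' = q := under_inj (eq_of_heq (Sigma.mk.inj h4).2)
  rw [this]

lemma restrHor_inv {h : (s n C).Hor T T'} {R R' : (s k C).P} {q : (s k C).Hor R R'}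
    (hq : ⟨R, R', q⟩ ∈ restrHor θ h) :
    (⟨R', R, (s k C).hinv q⟩ : HArrow (s k C)) ∈ restrHor θ ((s n C).hinv h) := by
  obtain ⟨h1, h2, h3⟩ := hq
  refine ⟨h2, h1, ?_⟩
  rw [under_hinv, under_hinv]
  exact sq_inv h3

/-- The structure map `s_n C → s_k C` of `s_• C` for a monotone map `{0, …, k} → {0, …, n}`. -/
def restr (θ : Fin (k + 1) →o Fin (n + 1)) (C : PolytopeComplex.{u, v}) :
    PolyMap (s n C) (s k C) where
  obj T := {R | IsPiece θ T R}
  hor h := restrHor θ h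
  finite T := IsPiece.finite θ T
  sep T R hR R' hR' hne := hR.sep hR' hne
  mono {T T'} hT R hR := by
    obtain ⟨hb, hT'⟩ := le_iff.1 hT
    obtain ⟨y, hy, hle⟩ := hT' _ _ hR.2.1
    obtain ⟨R', hR', -, rfl⟩ := exists_piece (one_le_born R) (hb ▸ hR.1) hy
    exact ⟨R', hR', hR.le hR' hT le_rfl hle⟩
  hor_dom_mem h p hp := hp.1
  hor_cod_mem h p hp := hp.2.1
  hor_dom h R hR := existsUnique_restrHor h hR
  hor_cod {T T'} h R hR := by
    obtain ⟨⟨_, R', q⟩, ⟨hq, rfl⟩, -⟩ := existsUnique_restrHor ((s n C).hinv h) hR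
    have h2 := restrHor_inv hq
    rw [hinv_hinv] at h2
    refine ⟨_, ⟨h2, rfl⟩, ?_⟩
    rintro ⟨P, P', q'⟩ ⟨hq', rfl⟩
    have h3 := restrHor_inv hq'
    have h4 := (existsUnique_restrHor ((s n C).hinv h) hR).unique ⟨hq, rfl⟩ ⟨h3, rfl⟩
    cases h4
    rw [hinv_hinv]
  hor_id T R hR := ⟨hR, hR, C.sq_hid (Forest.le_root hR.2.1)⟩
  hor_comp {T T' T''} h h' R R' R'' p q hp hq := by
    refine ⟨hp.1, hq.2.1, ?_⟩
    rw [under_hcomp, under_hcomp]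
    exact C.sq_hcomp hp.2.2 hq.2.2
  hor_sq {U U' T T' t h} hs := by
    rintro ⟨P, P', p⟩ hp ⟨Q, Q', q⟩ hq hle
    simp only at hle p q
    obtain ⟨h1, h2, h3⟩ := sq_iff.1 hs
    have hsq := sq_of_le' (C.sq_trans hp.2.2 h3) hq.2.2 (root_le hle)
    refine sq_iff.2 ⟨hle, ?_, hsq⟩
    exact hp.2.1.le hq.2.1 h2 le_rfl (C.sq_right hsq)
  meet {T T' Z} hT hT' R hR R' hR' W hW hW' := by
    have hbT := (le_iff.1 hT).1
    have hbT' := (le_iff.1 hT').1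
    have hb := hR.born_eq hR' (hbT.trans hbT'.symm)
    have hw := root_le hW
    have hw' := root_le hW'
    obtain ⟨M, hM, hM', hint⟩ := exists_inter hT hT' ⟨root W, hw.trans (Forest.le_root hR.2.1),
      hw'.trans (Forest.le_root hR'.2.1)⟩
    obtain ⟨y, hy, hwy⟩ := hint _ _ _ _ hR.2.1 (hb ▸ hR'.2.1) hw hw'
    have hbM := (le_iff.1 hM).1
    obtain ⟨N, hN, hbN, rfl⟩ := exists_piece (one_le_born R) (hbM ▸ hR.1) hy
    refine ⟨M, hM, hM', N, hN, le_iff.2 ⟨(le_iff.1 hW).1.trans hbN.symm, fun l z hz => ?_⟩⟩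
    obtain ⟨a, ha, hza⟩ := (le_iff.1 hW).2 l z hz
    obtain ⟨b, hb, hzb⟩ := (le_iff.1 hW').2 l z hz
    obtain ⟨m, hm, hzm⟩ := hint _ _ _ _ (hR.lev_sub ha).1 (hR'.lev_sub hb).1 hza hzb
    have hl : born N ≤ l := hbN ▸ born_le_of_mem ha
    exact ⟨m, hN.mem_lev hl hm (hN.le_root hl hm hzm ((Forest.le_root hz).trans hwy)), hzm⟩
  cover {T} S hS R hR := by
    rw [mem_J_iff] at hS ⊢
    intro l x hx
    obtain ⟨hx1, hx2⟩ := hR.lev_sub hx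
    refine C.J.superset_covering ?_ (hS _ x hx1)
    rintro w f ⟨y, ⟨T', ⟨g, hg⟩, hy⟩, hwy⟩
    have hb := (le_iff.1 g.le).1
    have hl := born_le_of_mem hx
    obtain ⟨y0, hy0, hle⟩ := exists_le (T := T') (hb ▸ hR.born_le le_rfl) (extend_mono θ hl) hy
    obtain ⟨U, hU, hbU, rfl⟩ := exists_piece (one_le_born R) (hb ▸ hR.1) hy0
    have hUR : U ≤ R := hU.le hR g.le (hwy.trans hle) (f.le.trans hx2)
    exact ⟨y, ⟨U, ⟨homOfLE hUR, U, ⟨T', ⟨g, hg⟩, hU⟩, le_rfl⟩, hU.mem_lev (hbU ▸ hl) hy hle⟩, hwy⟩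

lemma restr_id (n : ℕ) (C : PolytopeComplex.{u, v}) :
    restr (OrderHom.id : Fin (n + 1) →o Fin (n + 1)) C = PolyMap.id (s n C) := by
  have hid : ∀ j, j ≤ n → extend (OrderHom.id : Fin (n + 1) →o Fin (n + 1)) j = j := by
    intro j hj
    rw [extend, dif_pos (by omega)]; rfl
  have key : ∀ T R : (s n C).P, IsPiece OrderHom.id T R ↔ R = T := by
    intro T R
    constructor
    · intro h
      have h1 := h.1
      have h2 := h.born_le le_rfl
      rw [hid _ (by have := Forest.born_le R; omega)] at h1
      rw [hid _ (Forest.born_le R)] at h2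
      have hb : born R = born T := by omega
      have hr : root R = root T := by
        have h3 := h.2.1
        rw [hid _ (Forest.born_le R), hb, lev_born] at h3
        exact h3
      apply Forest.ext
      intro l
      ext y
      constructor
      · intro hy
        have := (h.lev_sub hy).1
        rwa [hid _ (le_of_mem hy)] at this
      · intro hy
        have hl := born_le_of_mem hy
        exact h.mem_lev (hb ▸ hl) (by rwa [hid _ (le_of_mem hy)]) (hr ▸ Forest.le_root hy)
    · rintro rfl
      refine ⟨?_, ?_, fun j hj => ?_⟩
      · have := one_le_born R
        rw [hid _ (by have := Forest.born_le R; omega)]; omega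
      · rw [hid _ (Forest.born_le R)]; exact root_mem R
      · ext y
        by_cases hjn : j ≤ n
        · rw [hid _ hjn]
          exact ⟨fun h => ⟨h, Forest.le_root h⟩, fun h => h.1⟩
        · constructor
          · intro hy; exact absurd (le_of_mem hy) hjn
          · rintro ⟨hy, -⟩
            have := le_of_mem hy
            rw [extend_gt _ (by omega)] at this; omega
  apply PolyMap.ext
  · funext T
    ext R
    exact key T R
  · funext T T' h
    ext ⟨R, R', q⟩
    constructor
    · rintro ⟨h1, h2, h3⟩
      obtain rfl := (key _ _).1 h1
      obtain rfl := (key _ _).1 h2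
      have := C.sq_unique h3 (C.sq_refl _)
      have : q = h := under_inj (eq_of_heq (Sigma.mk.inj this).2)
      rw [this]; rfl
    · rintro e
      cases e
      exact ⟨(key _ _).2 rfl, (key _ _).2 rfl, C.sq_refl _⟩

lemma extend_comp (φ : Fin (m + 1) →o Fin (k + 1)) (θ : Fin (k + 1) →o Fin (n + 1)) (j : ℕ) :
    extend θ (extend φ j) = extend (θ.comp φ) j := by
  by_cases hj : j ≤ m
  · have hj' : j < m + 1 := by omega
    have e : extend φ j = φ ⟨j, hj'⟩ := dif_pos hj'
    have h1 : extend (θ.comp φ) j = θ (φ ⟨j, hj'⟩) := dif_pos hj'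
    rw [h1, e]
    exact dif_pos (φ ⟨j, hj'⟩).2
  · rw [extend_gt φ (by omega), extend_gt _ (by omega), extend_gt _ (by omega)]

lemma restr_comp (φ : Fin (m + 1) →o Fin (k + 1)) (θ : Fin (k + 1) →o Fin (n + 1))
    (C : PolytopeComplex.{u, v}) :
    restr (θ.comp φ) C = (restr θ C).comp (restr φ C) := by
  -- a piece of a piece is a piece
  have key : ∀ (T : (s n C).P) (R : (s k C).P) (Q : (s m C).P), IsPiece θ T R → IsPiece φ R Q →
      IsPiece (θ.comp φ) T Q := by
    intro T R Q h h'
    refine ⟨?_, ?_, fun j hj => ?_⟩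
    · rw [← extend_comp]
      have h1 := h'.1
      exact (extend_mono θ (by omega)).trans_lt h.1
    · rw [← extend_comp]; exact (h.lev_sub h'.2.1).1
    · rw [← extend_comp]
      ext y
      constructor
      · intro hy
        obtain ⟨h1, h2⟩ := h'.lev_sub hy
        exact ⟨(h.lev_sub h1).1, h2⟩
      · rintro ⟨h1, h2⟩
        exact h'.mem_lev hj (h.mem_lev (h'.born_le hj) h1 (h2.trans (Forest.le_root h'.2.1))) h2
  have key' : ∀ (T : (s n C).P) (Q : (s m C).P), IsPiece (θ.comp φ) T Q →
      ∃ R : (s k C).P, IsPiece θ T R ∧ IsPiece φ R Q := by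
    intro T Q h
    -- the level at which the intermediate piece is born
    have hex : ∃ b, born T ≤ extend θ b := ⟨extend φ (born Q), by
      rw [extend_comp]; exact h.born_le le_rfl⟩
    classical
    let b := Nat.find hex
    have hb : born T ≤ extend θ b := Nat.find_spec hex
    have hmin : ∀ j, j < b → extend θ j < born T := fun j hj =>
      not_le.1 (Nat.find_min hex hj)
    have hφ : extend φ (born Q - 1) < b := by
      by_contra hc
      have h1 := h.1
      rw [← extend_comp] at h1
      have := extend_mono θ (not_lt.1 hc)
      omega
    have hφ' : b ≤ extend φ (born Q) := Nat.find_min' hex (by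
      rw [extend_comp]; exact h.born_le le_rfl)
    have hr := h.2.1
    rw [← extend_comp] at hr
    obtain ⟨r, hr', hle⟩ := exists_le hb (extend_mono θ hφ') hr
    obtain ⟨R, hR, hbR, rfl⟩ := exists_piece (by omega) (hmin (b - 1) (by omega)) hr'
    refine ⟨R, hR, ?_, ?_, fun j hj => ?_⟩
    · rw [hbR]; exact hφ
    · exact hR.mem_lev (hbR ▸ hφ') hr hle
    · ext y
      constructor
      · intro hy
        obtain ⟨h1, h2⟩ := h.lev_sub hy
        rw [← extend_comp] at h1
        exact ⟨hR.mem_lev (hbR ▸ hφ'.trans (extend_mono φ hj)) h1 (h2.trans hle), h2⟩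
      · rintro ⟨h1, h2⟩
        exact h.mem_lev hj (by rw [← extend_comp]; exact (hR.lev_sub h1).1) h2
  apply PolyMap.ext
  · funext T
    ext Q
    exact ⟨fun h => by obtain ⟨R, h1, h2⟩ := key' T Q h; exact ⟨R, h1, h2⟩,
      by rintro ⟨R, h1, h2⟩; exact key T R Q h1 h2⟩
  · funext T T' h
    ext ⟨Q, Q', q⟩
    constructor
    · rintro ⟨h1, h2, h3⟩
      obtain ⟨R, hR, hRQ⟩ := key' _ _ h1
      obtain ⟨⟨_, R', r⟩, ⟨hr, rfl⟩, -⟩ := existsUnique_restrHor h hR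
      refine ⟨_, hr, hRQ, ?_, ?_⟩
      · obtain ⟨⟨_, Q'', q'⟩, ⟨hq', rfl⟩, -⟩ := existsUnique_restrHor r hRQ
        have h4 := sq_unique' h3 (C.sq_trans hq'.2.2 hr.2.2)
        obtain rfl : Q' = Q'' := h2.ext (key _ _ _ hr.2.1 hq'.2.1) (congrArg Sigma.fst h4)
        exact hq'.2.1
      · exact sq_of_le' h3 hr.2.2 ((Forest.le_root hRQ.2.1))
    · rintro ⟨⟨R, R', r⟩, ⟨h1, h2, h3⟩, h1', h2', h3'⟩
      exact ⟨key _ _ _ h1 h1', key _ _ _ h2 h2', C.sq_trans h3' h3⟩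

end Forest

open Opposite

/-- The simplicial polytope complex `s_• C`. -/
def sSimplicial (C : PolytopeComplex.{u, v}) : SimplexCategoryᵒᵖ ⥤ PolytopeComplex.{u, v} where
  obj X := s X.unop.len C
  map f := Forest.restr f.unop.toOrderHom C
  map_id _ := Forest.restr_id _ C
  map_comp f g := Forest.restr_comp g.unop.toOrderHom f.unop.toOrderHom C

/-- The simplicial category `SC(s_• C)`. -/
def SCs (C : PolytopeComplex.{u, v}) : SimplexCategoryᵒᵖ ⥤ Cat.{max u v, max u v} :=
  sSimplicial C ⋙ SC.functor

end PolytopeComplex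

namespace PolytopeComplex

variable {C : PolytopeComplex.{u, v}}

namespace SC

/-! ### Cofibers in `SC(C)` -/

/-- The elements of `B` hit by `f`. -/
def im {A B : SC C} (f : A ⟶ B) : Set (ℕ × C.P) := {j | ∃ p ∈ Hom.pieces f, p.tgt = j}

/-- The canonical cofiber `B/A` of `f : A → B`: the members of `B` not hit by `f`. -/
def cofiber {A B : SC C} (f : A ⟶ B) : SC C where
  carrier := B.carrier \ im f
  finite := B.finite.subset Set.sdiff_subset
  sep i hi j hj := B.sep i hi.1 j hj.1

/-- The identity pieces. -/
def idPieces (S : Set (ℕ × C.P)) : Set (Piece C) := {p | ∃ i ∈ S, p = ⟨i, i, i.2, C.hid i.2⟩}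

/-- The canonical projection `B → B/A`, given by the inclusion of a subfamily as a sub-map. -/
def proj {A B : SC C} (f : A ⟶ B) : B ⟶ cofiber f where
  pieces := idPieces (cofiber f).carrier
  finite := Hom.finite (𝟙 (cofiber f))
  src_mem := by rintro _ ⟨i, hi, rfl⟩; exact hi.1
  tgt_mem := by rintro _ ⟨i, hi, rfl⟩; exact hi
  dom_le := by rintro _ ⟨i, hi, rfl⟩; exact le_rfl
  disj := Hom.disj (𝟙 (cofiber f))

/-- The canonical inclusion `B/A → B`, given by the inclusion of a subfamily as a shuffle. -/
def incl {A B : SC C} (f : A ⟶ B) : cofiber f ⟶ B where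
  pieces := idPieces (cofiber f).carrier
  finite := Hom.finite (𝟙 (cofiber f))
  src_mem := by rintro _ ⟨i, hi, rfl⟩; exact hi
  tgt_mem := by rintro _ ⟨i, hi, rfl⟩; exact hi.1
  dom_le := by rintro _ ⟨i, hi, rfl⟩; exact le_rfl
  disj := Hom.disj (𝟙 (cofiber f))

lemma compPieces_id {A B : SC C} (g : A ⟶ B) (S : Set (ℕ × C.P)) :
    compPieces (Hom.pieces g) (idPieces S) = {p ∈ Hom.pieces g | p.tgt ∈ S} := by
  ext r
  constructor
  · rintro ⟨p, hp, _, ⟨i, hi, rfl⟩, e, x, t, h, rfl⟩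
    have e : p.tgt = i := e
    subst e
    have := C.sq_unique h (C.sq_refl p.hor)
    obtain rfl : x = p.dom := congrArg Sigma.fst this
    obtain rfl : t = p.hor := eq_of_heq (Sigma.mk.inj this).2
    simp only [C.hcomp_id]; exact ⟨hp, hi⟩
  · rintro ⟨hr, h⟩
    exact ⟨r, hr, _, ⟨r.tgt, h, rfl⟩, rfl, r.dom, r.hor, C.sq_refl _,
      by simp only [C.hcomp_id]⟩

lemma compPieces_id' {A B : SC C} (g : A ⟶ B) (S : Set (ℕ × C.P)) :
    compPieces (idPieces S) (Hom.pieces g) = {p ∈ Hom.pieces g | p.src ∈ S} := by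
  ext r
  constructor
  · rintro ⟨_, ⟨i, hi, rfl⟩, q, hq, e, x, t, h, rfl⟩
    have e : i = q.src := e
    subst e
    have := C.sq_unique h (C.sq_hid (Hom.dom_le g q hq))
    obtain rfl : x = q.dom := congrArg Sigma.fst this
    obtain rfl : t = C.hid _ := eq_of_heq (Sigma.mk.inj this).2
    rw [C.id_hcomp]; exact ⟨hq, hi⟩
  · rintro ⟨hr, h⟩
    exact ⟨_, ⟨r.src, h, rfl⟩, r, hr, rfl, r.dom, C.hid _,
      C.sq_hid (Hom.dom_le g r hr), by rw [C.id_hcomp]⟩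

variable {A B D : SC C} {f : A ⟶ B}

lemma pieces_comp_proj (g : D ⟶ B) :
    Hom.pieces (g ≫ proj f) = {p ∈ Hom.pieces g | p.tgt ∉ im f} := by
  rw [pieces_comp]
  refine (compPieces_id g _).trans ?_
  ext p
  exact ⟨fun h => ⟨h.1, h.2.2⟩, fun h => ⟨h.1, Hom.tgt_mem g p h.1, h.2⟩⟩

lemma pieces_incl_comp (g : B ⟶ D) :
    Hom.pieces (incl f ≫ g) = {p ∈ Hom.pieces g | p.src ∉ im f} := by
  rw [pieces_comp]
  refine (compPieces_id' g _).trans ?_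
  ext p
  exact ⟨fun h => ⟨h.1, h.2.2⟩, fun h => ⟨h.1, Hom.src_mem g p h.1, h.2⟩⟩

lemma pieces_comp_incl (g : D ⟶ cofiber f) : Hom.pieces (g ≫ incl f) = Hom.pieces g := by
  rw [pieces_comp]
  refine (compPieces_id g _).trans ?_
  ext p
  exact ⟨fun h => h.1, fun h => ⟨h, Hom.tgt_mem g p h⟩⟩

lemma pieces_proj_comp (g : cofiber f ⟶ D) : Hom.pieces (proj f ≫ g) = Hom.pieces g := by
  rw [pieces_comp]
  refine (compPieces_id' g _).trans ?_
  ext p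
  exact ⟨fun h => h.1, fun h => ⟨h, Hom.src_mem g p h⟩⟩

lemma incl_proj : incl f ≫ proj f = 𝟙 (cofiber f) := by
  apply hom_ext
  rw [pieces_incl_comp]
  ext p
  constructor
  · rintro ⟨h, -⟩; exact h
  · rintro ⟨i, hi, rfl⟩; exact ⟨⟨i, hi, rfl⟩, hi.2⟩

/-- The map induced on canonical cofibers by `g : B → D`. -/
def quot {A' : SC C} (f : A ⟶ B) (f' : A' ⟶ D) (g : B ⟶ D) : cofiber f ⟶ cofiber f' :=
  incl f ≫ g ≫ proj f'

lemma pieces_quot {A' : SC C} {f' : A' ⟶ D} (g : B ⟶ D) :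
    Hom.pieces (quot f f' g) = {p ∈ Hom.pieces g | p.src ∉ im f ∧ p.tgt ∉ im f'} := by
  rw [quot, pieces_incl_comp, pieces_comp_proj]
  ext p
  exact ⟨fun h => ⟨h.1.1, h.2, h.1.2⟩, fun h => ⟨⟨h.1, h.2.2⟩, h.2.1⟩⟩

/-- A piece starting in the image of `f` ends in the image of `f ≫ g`. -/
lemma tgt_mem_im_comp {g : B ⟶ D} {q : Piece C} (hq : q ∈ Hom.pieces g) (h : q.src ∈ im f) :
    q.tgt ∈ im (f ≫ g) := by
  obtain ⟨p, hp, e⟩ := h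
  obtain ⟨x, t, ht⟩ := C.sq_exists p.hor (e ▸ Hom.dom_le g q hq : q.dom ≤ p.tgt.2)
  exact ⟨_, ⟨p, hp, q, hq, e, x, t, ht, rfl⟩, rfl⟩

lemma im_comp (f : A ⟶ B) (g : B ⟶ D) :
    im (f ≫ g) = {j | ∃ q ∈ Hom.pieces g, q.src ∈ im f ∧ q.tgt = j} := by
  ext j
  constructor
  · rintro ⟨_, ⟨p, hp, q, hq, e, x, t, ht, rfl⟩, rfl⟩
    exact ⟨q, hq, ⟨p, hp, e⟩, rfl⟩
  · rintro ⟨q, hq, h, rfl⟩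
    exact tgt_mem_im_comp hq h

lemma im_comp_subset (f : A ⟶ B) (g : B ⟶ D) : im (f ≫ g) ⊆ im g := by
  rw [im_comp]
  rintro _ ⟨q, hq, -, rfl⟩
  exact ⟨q, hq, rfl⟩

/-- The induced maps on cofibers commute with the projections. -/
lemma proj_quot {A' : SC C} {x : A ⟶ A'} {f' : A' ⟶ D} {g : B ⟶ D} (h : f ≫ g = x ≫ f') :
    proj f ≫ quot f f' g = g ≫ proj f' := by
  apply hom_ext
  rw [pieces_proj_comp, pieces_quot, pieces_comp_proj]
  ext p
  refine ⟨fun h => ⟨h.1, h.2.2⟩, fun hp => ⟨hp.1, fun hs => hp.2 ?_, hp.2⟩⟩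
  have := tgt_mem_im_comp hp.1 hs
  rw [h] at this
  exact im_comp_subset _ _ this

lemma quot_comp {A' A'' E : SC C} {x : A' ⟶ A''} {f' : A' ⟶ D} {f'' : A'' ⟶ E}
    {g : B ⟶ D} {g' : D ⟶ E} (h : f' ≫ g' = x ≫ f'') :
    quot f f' g ≫ quot f' f'' g' = quot f f'' (g ≫ g') := by
  have := proj_quot h
  simp only [quot, Category.assoc] at this ⊢
  rw [this]

lemma quot_id : quot f f (𝟙 B) = 𝟙 (cofiber f) := by
  rw [quot, Category.id_comp, incl_proj]

lemma cof_inj {g : B ⟶ D} (hg : cof C g) {p q : Piece C} (hp : p ∈ Hom.pieces g)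
    (hq : q ∈ Hom.pieces g) (h : p.tgt = q.tgt) : p = q := hg.2 p hp q hq h

/-- If `g` is injective then only pieces starting in the image of `f` end in that of `f ≫ g`. -/
lemma src_mem_im {g : B ⟶ D} (hg : cof C g) {q : Piece C} (hq : q ∈ Hom.pieces g)
    (h : q.tgt ∈ im (f ≫ g)) : q.src ∈ im f := by
  rw [im_comp] at h
  obtain ⟨q', hq', h1, h2⟩ := h
  rwa [← cof_inj hg hq' hq h2]

lemma cof_quot {g : B ⟶ D} (hg : cof C g) : cof C (quot f (f ≫ g) g) := by
  constructor
  · intro i hi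
    refine C.J.superset_covering ?_ (hg.1 i hi.1)
    rintro w _ ⟨_, ⟨p, hp, rfl, rfl⟩, hw⟩
    refine ⟨_, ⟨p, ?_, rfl, rfl⟩, hw⟩
    rw [pieces_quot]
    exact ⟨hp, hi.2, fun h => hi.2 (src_mem_im hg hp h)⟩
  · intro p hp q hq h
    rw [pieces_quot] at hp hq
    exact cof_inj hg hp.1 hq.1 h

/-- Objects with no elements are zero objects. -/
lemma isZero_of_carrier {A : SC C} (h : A.carrier = ∅) : Limits.IsZero A := by
  have hs : ∀ {B : SC C} (g : A ⟶ B), Hom.pieces g = ∅ := fun g =>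
    Set.eq_empty_of_forall_notMem fun p hp => by
      have := Hom.src_mem g p hp
      rw [h] at this
      exact this
  have ht : ∀ {B : SC C} (g : B ⟶ A), Hom.pieces g = ∅ := fun g =>
    Set.eq_empty_of_forall_notMem fun p hp => by
      have := Hom.tgt_mem g p hp
      rw [h] at this
      exact this
  refine ⟨fun B => ⟨⟨⟨⟨∅, Set.finite_empty, ?_, ?_, ?_, ?_⟩⟩, fun g => ?_⟩⟩,
    fun B => ⟨⟨⟨⟨∅, Set.finite_empty, ?_, ?_, ?_, ?_⟩⟩, fun g => ?_⟩⟩⟩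
  all_goals first
    | exact fun p hp => False.elim hp
    | exact hom_ext (hs g)
    | exact hom_ext (ht g)

lemma carrier_of_isZero {Z : SC C} (hZ : Limits.IsZero Z) : Z.carrier = ∅ := by
  let E : SC C := ⟨∅, Set.finite_empty, fun i hi => False.elim hi⟩
  have h : 𝟙 Z = hZ.to_ E ≫ hZ.from_ E := hZ.eq_of_src _ _
  refine Set.eq_empty_of_forall_notMem fun i hi => ?_
  have h1 : (⟨i, i, i.2, C.hid i.2⟩ : Piece C) ∈ Hom.pieces (𝟙 Z) := ⟨i, hi, rfl⟩
  rw [h, pieces_comp] at h1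
  obtain ⟨p, hp, -⟩ := h1
  exact Hom.tgt_mem (hZ.to_ E) p hp

lemma isPushout_proj {Z : SC C} (hZ : Z.carrier = ∅) (l : A ⟶ Z) (b : Z ⟶ cofiber f) :
    IsPushout f l (proj f) b := by
  have hZ := isZero_of_carrier hZ
  have hfp : f ≫ proj f = l ≫ b := by
    apply hom_ext
    rw [pieces_comp_proj]
    ext p
    constructor
    · rintro ⟨hp, h⟩; exact absurd ⟨p, hp, rfl⟩ h
    · rw [pieces_comp]
      rintro ⟨p, hp, -⟩
      have := Hom.tgt_mem l p hp
      rw [carrier_of_isZero hZ] at this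
      exact False.elim this
  refine ⟨⟨hfp⟩, ⟨Limits.PushoutCocone.IsColimit.mk _ (fun s => incl f ≫ s.inl) ?_ ?_ ?_⟩⟩
  · intro s
    apply hom_ext
    rw [pieces_proj_comp, pieces_incl_comp]
    ext p
    refine ⟨fun h => h.1, fun hp => ⟨hp, fun hs => ?_⟩⟩
    obtain ⟨q, hq, -⟩ := tgt_mem_im_comp hp hs
    rw [s.condition, pieces_comp] at hq
    obtain ⟨r, hr, -⟩ := hq
    have := Hom.tgt_mem l r hr
    rw [carrier_of_isZero hZ] at this
    exact this
  · intro s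
    exact hZ.eq_of_src _ _
  · intro s m h1 _
    rw [← h1, ← Category.assoc, incl_proj, Category.id_comp]

lemma isPushout_quot (f : A ⟶ B) (g : B ⟶ D) (l : cofiber f ⟶ cofiber (𝟙 B))
    (b : cofiber (𝟙 B) ⟶ cofiber g) :
    IsPushout (quot f (f ≫ g) g) l (quot (f ≫ g) g (𝟙 D)) b := by
  have e : cofiber g = cofiber (quot f (f ≫ g) g) := by
    apply SC.ext
    ext j
    constructor
    · rintro ⟨h1, h2⟩
      refine ⟨⟨h1, fun h => h2 (im_comp_subset _ _ h)⟩, ?_⟩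
      rintro ⟨p, hp, rfl⟩
      rw [pieces_quot] at hp
      exact h2 ⟨p, hp.1, rfl⟩
    · rintro ⟨⟨h1, h2⟩, h3⟩
      refine ⟨h1, ?_⟩
      rintro ⟨p, hp, rfl⟩
      refine h3 ⟨p, ?_, rfl⟩
      rw [pieces_quot]
      exact ⟨hp, fun h => h2 (tgt_mem_im_comp hp h), h2⟩
  have hZ : (cofiber (𝟙 B)).carrier = ∅ := by
    refine Set.eq_empty_of_forall_notMem fun i hi => hi.2 ⟨_, ⟨i, hi.1, rfl⟩, rfl⟩
  have key : ∀ {V : SC C} (e : V = cofiber (quot f (f ≫ g) g)) (r : cofiber (f ≫ g) ⟶ V)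
      (b : cofiber (𝟙 B) ⟶ V), Hom.pieces r = idPieces V.carrier →
      IsPushout (quot f (f ≫ g) g) l r b := by
    rintro V rfl r b h
    obtain rfl : r = proj _ := hom_ext h
    exact isPushout_proj hZ _ _
  refine key e _ _ ?_
  rw [pieces_quot]
  ext p
  constructor
  · rintro ⟨⟨i, hi, rfl⟩, h1, h2⟩
    exact ⟨i, ⟨hi, h2⟩, rfl⟩
  · rintro ⟨i, hi, rfl⟩
    exact ⟨⟨i, hi.1, rfl⟩, fun h => hi.2 (im_comp_subset _ _ h), hi.2⟩

end SC

/-! ### The simplicial category `L_• SC(C)` -/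

/-- An object of `F_n SC(C)` and of `L_n SC(C)`: a sequence of cofibrations `A_1 ↣ ⋯ ↣ A_n`, written
with `A_0` equal to the empty family in front. -/
structure LObj (C : PolytopeComplex.{u, v}) (n : ℕ) : Type (max u v) where
  F : Fin (n + 1) ⥤ SC C
  zero : (F.obj 0).carrier = ∅
  cof : ∀ {i j : Fin (n + 1)} (h : i ≤ j), SC.cof C (F.map (homOfLE h))

namespace LObj

open SC

variable {n k m : ℕ}

/-- The cofibration `A_i ↣ A_j`. -/
def map (A : LObj C n) {i j : Fin (n + 1)} (h : i ≤ j) : A.F.obj i ⟶ A.F.obj j :=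
  A.F.map (homOfLE h)

lemma map_comp (A : LObj C n) {i j l : Fin (n + 1)} (h : i ≤ j) (h' : j ≤ l) :
    A.map h ≫ A.map h' = A.map (h.trans h') := by
  rw [map, map, ← A.F.map_comp]; rfl

lemma map_refl (A : LObj C n) (i : Fin (n + 1)) : A.map (le_refl i) = 𝟙 _ := A.F.map_id i

/-- A morphism `φ : A → B` of sequences of cofibrations is layered if for all `i ≤ k` the composite
`A_k/A_i → A_k → B_k` agrees with `A_k/A_i → B_k/B_i → B_k`. -/
def Layered {A B : LObj C n} (φ : A.F ⟶ B.F) : Prop :=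
  ∀ (i k : Fin (n + 1)) (h : i ≤ k),
    incl (A.map h) ≫ φ.app k = quot (A.map h) (B.map h) (φ.app k) ≫ incl (B.map h)

lemma layered_iff {A B : LObj C n} {φ : A.F ⟶ B.F} : Layered φ ↔
    ∀ (i k : Fin (n + 1)) (h : i ≤ k), ∀ p ∈ Hom.pieces (φ.app k), p.src ∉ im (A.map h) →
      p.tgt ∉ im (B.map h) := by
  refine forall₃_congr fun i k h => ?_
  constructor
  · intro e p hp hs
    have h1 : p ∈ Hom.pieces (incl (A.map h) ≫ φ.app k) := by
      rw [pieces_incl_comp]; exact ⟨hp, hs⟩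
    rw [e, pieces_comp_incl, pieces_quot] at h1
    exact h1.2.2
  · intro H
    apply hom_ext
    rw [pieces_incl_comp, pieces_comp_incl, pieces_quot]
    ext p
    exact ⟨fun hp => ⟨hp.1, hp.2, H p hp.1 hp.2⟩, fun hp => ⟨hp.1, hp.2.1⟩⟩

/-- The category `L_n SC(C)` of sequences of cofibrations and layered morphisms, a subcategory of
`F_n SC(C)` with the same objects. -/
instance : Category (LObj C n) where
  Hom A B := {φ : A.F ⟶ B.F // Layered φ}
  id A := ⟨𝟙 _, layered_iff.2 (by
    rintro i k h _ ⟨j, hj, rfl⟩ hs; exact hs)⟩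
  comp f g := ⟨f.1 ≫ g.1, layered_iff.2 (by
    rintro i k h _ ⟨p, hp, q, hq, e, x, t, ht, rfl⟩ hs
    exact layered_iff.1 g.2 i k h q hq (e ▸ layered_iff.1 f.2 i k h p hp hs))⟩
  id_comp f := Subtype.ext (Category.id_comp _)
  comp_id f := Subtype.ext (Category.comp_id _)
  assoc f g h := Subtype.ext (Category.assoc _ _ _)

/-- The component of a morphism -/
def app {A B : LObj C n} (φ : A ⟶ B) (i : Fin (n + 1)) : A.F.obj i ⟶ B.F.obj i := φ.1.app i

lemma app_comp {A B D : LObj C n} (φ : A ⟶ B) (ψ : B ⟶ D) (i : Fin (n + 1)) :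
    app (φ ≫ ψ) i = app φ i ≫ app ψ i := rfl

lemma app_id (A : LObj C n) (i : Fin (n + 1)) : app (𝟙 A) i = 𝟙 _ := rfl

lemma naturality {A B : LObj C n} (φ : A ⟶ B) {i j : Fin (n + 1)} (h : i ≤ j) :
    A.map h ≫ app φ j = app φ i ≫ B.map h := φ.1.naturality _

lemma hom_ext {A B : LObj C n} {φ ψ : A ⟶ B} (h : ∀ i, app φ i = app ψ i) : φ = ψ :=
  Subtype.ext (NatTrans.ext (funext h))

variable (θ : Fin (k + 1) →o Fin (n + 1))

lemma zero_le (j : Fin (k + 1)) : θ 0 ≤ θ j := θ.monotone (Fin.zero_le j)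

/-- The functor underlying `θ^* A`. -/
def restrFunctor (A : LObj C n) : Fin (k + 1) ⥤ SC C where
  obj j := cofiber (A.map (zero_le θ j))
  map {j l} h := quot _ _ (A.map (θ.monotone h.le))
  map_id j := by rw [map_refl, quot_id]
  map_comp {i j l} h h' := by
    rw [quot_comp (x := 𝟙 _) (by rw [map_comp, Category.id_comp]), map_comp]

lemma im_map_id {A : SC C} : im (𝟙 A) = A.carrier := by
  ext j
  constructor
  · rintro ⟨_, ⟨i, hi, rfl⟩, rfl⟩; exact hi
  · intro hj; exact ⟨_, ⟨j, hj, rfl⟩, rfl⟩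

lemma cofiber_id_carrier {A : SC C} : (cofiber (𝟙 A)).carrier = ∅ :=
  Set.eq_empty_of_forall_notMem fun _ hi => hi.2 (im_map_id ▸ hi.1)

/-- `θ^* A` is `A_{θ 0}/A_{θ 0} ↣ A_{θ 1}/A_{θ 0} ↣ ⋯ ↣ A_{θ k}/A_{θ 0}` -/
def restrObj (A : LObj C n) : LObj C k where
  F := restrFunctor θ A
  zero := by
    change (cofiber (A.map (le_refl (θ 0)))).carrier = ∅
    rw [map_refl, cofiber_id_carrier]
  cof {i j} h := by
    change SC.cof C (quot (A.map (zero_le θ i)) (A.map (zero_le θ j)) (A.map (θ.monotone h)))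
    rw [← map_comp A (zero_le θ i) (θ.monotone h)]
    exact cof_quot (A.cof _)

lemma im_restr (A : LObj C n) {i j : Fin (k + 1)} (h : i ≤ j) :
    im ((restrObj θ A).map h) = im (A.map (θ.monotone h)) \ im (A.map (zero_le θ j)) := by
  change im (quot _ _ _) = _
  ext x
  constructor
  · rintro ⟨p, hp, rfl⟩
    rw [pieces_quot] at hp
    exact ⟨⟨p, hp.1, rfl⟩, hp.2.2⟩
  · rintro ⟨⟨p, hp, rfl⟩, h2⟩
    refine ⟨p, ?_, rfl⟩
    rw [pieces_quot]
    refine ⟨hp, fun hs => h2 ?_, h2⟩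
    rw [← map_comp A (zero_le θ i) (θ.monotone h)]
    exact tgt_mem_im_comp hp hs

/-- `θ^*` on morphisms -/
def restrMap {A B : LObj C n} (φ : A ⟶ B) : restrObj θ A ⟶ restrObj θ B :=
  ⟨{ app := fun j => quot (A.map (zero_le θ j)) (B.map (zero_le θ j)) (app φ (θ j))
     naturality := by
      intro i j h
      change quot _ _ (A.map (θ.monotone h.le)) ≫ quot _ _ _ = quot _ _ _ ≫ quot _ _ (B.map _)
      rw [quot_comp (x := app φ (θ 0)) (naturality φ _), quot_comp (x := 𝟙 _)
        (by rw [map_comp, Category.id_comp]), naturality] },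
   layered_iff.2 (by
    intro i j h p hp hs
    change p ∈ Hom.pieces (quot _ _ _) at hp
    rw [pieces_quot] at hp
    rw [im_restr] at hs ⊢
    intro ht
    exact layered_iff.1 φ.2 _ _ (θ.monotone h) p hp.1 (fun h' => hs ⟨h', hp.2.1⟩) ht.1)⟩

/-- The functor `θ^* : L_n SC(C) → L_k SC(C)` for a monotone map `θ : {0, …, k} → {0, …, n}`, defined
through the canonical cofibers. -/
def restr (θ : Fin (k + 1) →o Fin (n + 1)) : LObj C n ⥤ LObj C k where
  obj := restrObj θ
  map := restrMap θ
  map_id _ := hom_ext fun _ => quot_id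
  map_comp _ ψ := hom_ext fun _ => (quot_comp (x := app ψ (θ 0)) (naturality ψ _)).symm

end LObj

end PolytopeComplex

namespace PolytopeComplex

variable {C : PolytopeComplex.{u, v}}

namespace LObj

open SC

variable {n k m : ℕ}

lemma ext' {A B : LObj C n} (h : ∀ i, (A.F.obj i).carrier = (B.F.obj i).carrier)
    (h' : ∀ {i j} (hij : i ≤ j), Hom.pieces (A.map hij) = Hom.pieces (B.map hij)) : A = B := by
  obtain ⟨F, hF, hF'⟩ := A
  obtain ⟨G, hG, hG'⟩ := B
  obtain rfl : F = G := SC.functor_ext h fun f => h' f.le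
  rfl

lemma app_eqToHom {A B : LObj C n} (h : A = B) (i : Fin (n + 1)) :
    app (eqToHom h) i = eqToHom (by rw [h]) := by
  subst h; rfl

lemma functor_ext {X : Type*} [Category X] {G H : X ⥤ LObj C n}
    (hobj : ∀ A i, ((G.obj A).F.obj i).carrier = ((H.obj A).F.obj i).carrier)
    (hmap : ∀ A {i j} (h : i ≤ j), Hom.pieces ((G.obj A).map h) = Hom.pieces ((H.obj A).map h))
    (happ : ∀ {A B : X} (f : A ⟶ B) i, Hom.pieces (app (G.map f) i) = Hom.pieces (app (H.map f) i)) :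
    G = H := by
  refine CategoryTheory.Functor.ext (fun A => ext' (hobj A) (hmap A)) fun A B f =>
    hom_ext fun i => SC.hom_ext ?_
  rw [app_comp, app_comp, app_eqToHom, app_eqToHom, pieces_eqToHom_comp, pieces_comp_eqToHom, happ]

lemma pieces_restrObj_map (θ : Fin (k + 1) →o Fin (n + 1)) (A : LObj C n) {i j : Fin (k + 1)}
    (h : i ≤ j) : Hom.pieces ((restrObj θ A).map h) = {p ∈ Hom.pieces (A.map (θ.monotone h)) |
      p.src ∉ im (A.map (zero_le θ i)) ∧ p.tgt ∉ im (A.map (zero_le θ j))} :=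
  pieces_quot _

lemma pieces_restr_map (θ : Fin (k + 1) →o Fin (n + 1)) {A B : LObj C n} (φ : A ⟶ B)
    (j : Fin (k + 1)) : Hom.pieces (app ((restr θ).map φ) j) = {p ∈ Hom.pieces (app φ (θ j)) |
      p.src ∉ im (A.map (zero_le θ j)) ∧ p.tgt ∉ im (B.map (zero_le θ j))} :=
  pieces_quot _

lemma im_zero (A : LObj C n) (j : Fin (n + 1)) : im (A.map (Fin.zero_le j)) = ∅ := by
  refine Set.eq_empty_of_forall_notMem ?_
  rintro _ ⟨p, hp, rfl⟩
  have := Hom.src_mem _ p hp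
  rw [A.zero] at this
  exact this

lemma restr_id : restr (C := C) (OrderHom.id : Fin (n + 1) →o Fin (n + 1)) = 𝟭 _ := by
  have h0 : ∀ (A : LObj C n) j, im (A.map (zero_le OrderHom.id j)) = ∅ := im_zero
  refine functor_ext (fun A i => ?_) (fun A i j h => ?_) fun {A B} f i => ?_
  · change (A.F.obj i).carrier \ im (A.map (zero_le OrderHom.id i)) = _
    rw [h0, Set.sdiff_empty]; rfl
  · refine (pieces_restrObj_map _ A h).trans ?_
    rw [h0, h0]
    ext p
    exact ⟨fun hp => hp.1, fun hp => ⟨hp, fun h => h, fun h => h⟩⟩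
  · refine (pieces_restr_map _ f i).trans ?_
    rw [h0, h0]
    ext p
    exact ⟨fun hp => hp.1, fun hp => ⟨hp, fun h => h, fun h => h⟩⟩

lemma im_mono (A : LObj C n) {i j l : Fin (n + 1)} (h : i ≤ j) (h' : j ≤ l) :
    im (A.map (h.trans h')) ⊆ im (A.map h') := by
  rw [← map_comp A h h']
  exact im_comp_subset _ _

lemma restr_comp (φ : Fin (m + 1) →o Fin (k + 1)) (θ : Fin (k + 1) →o Fin (n + 1)) :
    restr (C := C) (θ.comp φ) = restr θ ⋙ restr φ := by
  have h0 : ∀ (A : LObj C n) (j : Fin (m + 1)) x, x ∉ im (A.map (zero_le (θ.comp φ) j)) ↔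
      x ∉ im (A.map (zero_le θ (φ j))) ∧ x ∉ im ((restrObj θ A).map (zero_le φ j)) := by
    intro A j x
    rw [im_restr]
    constructor
    · intro h
      exact ⟨fun h' => h (im_mono A (zero_le θ (φ 0)) (θ.monotone (zero_le φ j)) h'), fun h' => h h'.1⟩
    · rintro ⟨h1, h2⟩ h
      exact h2 ⟨h, h1⟩
  refine functor_ext (fun A i => ?_) (fun A i j h => ?_) fun {A B} f i => ?_
  · ext x
    constructor
    · rintro ⟨h1, h2⟩
      exact ⟨⟨h1, ((h0 A i x).1 h2).1⟩, ((h0 A i x).1 h2).2⟩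
    · rintro ⟨⟨h1, h2⟩, h3⟩
      exact ⟨h1, (h0 A i x).2 ⟨h2, h3⟩⟩
  · refine (pieces_restrObj_map _ A h).trans (Eq.trans ?_ (pieces_restrObj_map φ _ h).symm)
    ext p
    simp only [Set.mem_ofPred_eq]
    rw [h0, h0]
    have := Set.ext_iff.1 (pieces_restrObj_map θ A (φ.monotone h)) p
    constructor
    · rintro ⟨h1, ⟨h2, h3⟩, h4, h5⟩
      exact ⟨this.2 ⟨h1, h2, h4⟩, h3, h5⟩
    · rintro ⟨h1, h3, h5⟩
      obtain ⟨h1, h2, h4⟩ := this.1 h1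
      exact ⟨h1, ⟨h2, h3⟩, h4, h5⟩
  · refine (pieces_restr_map _ f i).trans (Eq.trans ?_ (pieces_restr_map φ _ i).symm)
    ext p
    simp only [Set.mem_ofPred_eq]
    rw [h0, h0]
    have := Set.ext_iff.1 (pieces_restr_map θ f (φ i)) p
    constructor
    · rintro ⟨h1, ⟨h2, h3⟩, h4, h5⟩
      exact ⟨this.2 ⟨h1, h2, h4⟩, h3, h5⟩
    · rintro ⟨h1, h3, h5⟩
      obtain ⟨h1, h2, h4⟩ := this.1 h1
      exact ⟨h1, ⟨h2, h3⟩, h4, h5⟩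

end LObj

/-- The simplicial category `L_• SC(C)`. Its `i`-th face map skips `A_i` for `1 ≤ i`, and its `0`-th
face map takes `A_1 ↣ ⋯ ↣ A_n` to `A_2/A_1 ↣ ⋯ ↣ A_n/A_1`. -/
def LSimplicial (C : PolytopeComplex.{u, v}) : SimplexCategoryᵒᵖ ⥤ Cat.{max u v, max u v} where
  obj X := Cat.of (LObj C X.unop.len)
  map f := (LObj.restr f.unop.toOrderHom).toCatHom
  map_id _ := congrArg Functor.toCatHom LObj.restr_id
  map_comp f g := congrArg Functor.toCatHom (LObj.restr_comp g.unop.toOrderHom f.unop.toOrderHom)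

/-! ### The functor `F_•` -/

namespace Forest

variable {n k m : ℕ}

lemma disj_root {T T' : (s n C).P} (h : Sep T T') : Disj (root T) (root T') := by
  intro w hw hw'
  obtain ⟨⟨Z, hZ, hZ'⟩, hd⟩ := h
  obtain ⟨M, hM, hM', -⟩ := exists_inter hZ hZ' ⟨w, hw, hw'⟩
  exact hd M hM hM'

/-- The polytope functor `s_n C → C^id` taking a diagram to its `l`-th level. -/
def level (n : ℕ) (C : PolytopeComplex.{u, v}) (l : ℕ) : PolyMap (s n C) C where
  obj T := lev T l
  hor {T T'} h := {p | p.dom ∈ lev T l ∧ p.cod ∈ lev T' l ∧ C.Sq p.hor (under h)}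
  finite T := lev_finite T l
  sep T x hx y hy h := lev_sep hx hy h
  mono h y hy := (le_iff.1 h).2 l y hy
  hor_dom_mem h p hp := hp.1
  hor_cod_mem h p hp := hp.2.1
  hor_dom h y hy := by
    obtain ⟨y', hy', t, ht⟩ := carries h l hy
    refine ⟨⟨y, y', t⟩, ⟨⟨hy, hy', ht⟩, rfl⟩, ?_⟩
    rintro ⟨_, z, r⟩ ⟨⟨h1, h2, h3⟩, rfl⟩
    have := sq_unique' h3 ht
    obtain rfl : z = y' := congrArg Sigma.fst this
    obtain rfl : r = t := eq_of_heq (Sigma.mk.inj this).2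
    rfl
  hor_cod h y hy := by
    obtain ⟨y', hy', t, ht⟩ := carries' h l hy
    refine ⟨⟨y', y, t⟩, ⟨⟨hy', hy, ht⟩, rfl⟩, ?_⟩
    rintro ⟨z, _, r⟩ ⟨⟨h1, h2, h3⟩, rfl⟩
    have := C.sq_unique h3 ht
    obtain rfl : z = y' := congrArg Sigma.fst this
    obtain rfl : r = t := eq_of_heq (Sigma.mk.inj this).2
    rfl
  hor_id T y hy := ⟨hy, hy, C.sq_hid (le_root hy)⟩
  hor_comp h h' a b c p q hp hq := ⟨hp.1, hq.2.1, by
    rw [under_hcomp]; exact C.sq_hcomp hp.2.2 hq.2.2⟩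
  hor_sq hs p hp q hq hle := sq_of_le' (C.sq_trans hp.2.2 (sq_iff.1 hs).2.2) hq.2.2 hle
  meet h h' y hy y' hy' r hr hr' := by
    obtain ⟨M, hM, hM', hint⟩ := exists_inter h h' ⟨r, hr.trans (le_root hy), hr'.trans (le_root hy')⟩
    exact ⟨M, hM, hM', hint _ _ _ _ hy hy' hr hr'⟩
  cover S hS y hy := by
    have := mem_J_iff.1 hS l y hy
    refine C.J.superset_covering ?_ this
    rintro w f ⟨z, ⟨R, hR, hz⟩, hle⟩
    exact ⟨z, ⟨R, hR, hz⟩, hle⟩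

/-- The union over the members `T` of a family in `s_n C` of the `l`-th families of `T`. -/
def union (n : ℕ) (C : PolytopeComplex.{u, v}) (l : ℕ) : SC (s n C) ⥤ SC C := SC.map (level n C l)

lemma mem_union {A : SC (s n C)} {l i : ℕ} {x : C.P} :
    (i, x) ∈ ((union n C l).obj A).carrier ↔ ∃ T, (i, T) ∈ A.carrier ∧ x ∈ lev T l := Iff.rfl

lemma mem_union_map {A B : SC (s n C)} (f : A ⟶ B) {l : ℕ} {r : Piece C} :
    r ∈ SC.Hom.pieces ((union n C l).map f) ↔ ∃ p ∈ SC.Hom.pieces f, ∃ x ∈ lev p.src.2 l,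
      ∃ a ∈ lev p.dom l, ∃ b ∈ lev p.tgt.2 l, ∃ t : C.Hor a b, C.Sq t (under p.hor) ∧ a ≤ x ∧
        r = ⟨(p.src.1, x), (p.tgt.1, b), a, t⟩ := by
  constructor
  · rintro ⟨p, hp, x, hx, ⟨a, b, t⟩, ⟨ha, hb, ht⟩, hle, rfl⟩
    exact ⟨p, hp, x, hx, a, ha, b, hb, t, ht, hle, rfl⟩
  · rintro ⟨p, hp, x, hx, a, ha, b, hb, t, ht, hle, rfl⟩
    exact ⟨p, hp, x, hx, ⟨a, b, t⟩, ⟨ha, hb, ht⟩, hle, rfl⟩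

lemma label_unique {A : SC (s n C)} {i : ℕ} {T T' : (s n C).P} (h : (i, T) ∈ A.carrier)
    (h' : (i, T') ∈ A.carrier) {w : C.P} (hw : w ≤ root T) (hw' : w ≤ root T') : T = T' := by
  by_contra hne
  exact disj_root (A.sep _ h _ h' (fun e => hne (Prod.ext_iff.1 e).2) rfl) w hw hw'

/-- The pieces of the transition map. -/
def transPieces (A : SC (s n C)) (l l' : ℕ) : Set (Piece C) :=
  {p | ∃ i T, (i, T) ∈ A.carrier ∧ ∃ x ∈ lev T l, ∃ y ∈ lev T l', y ≤ x ∧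
    p = ⟨(i, x), (i, y), y, C.hid y⟩}

/-- The cofibration from the union of the `l`-th levels to that of the `l'`-th levels, `l ≤ l'`. -/
def trans (A : SC (s n C)) (l l' : ℕ) : (union n C l).obj A ⟶ (union n C l').obj A where
  pieces := transPieces A l l'
  finite := by
    refine (((union n C l).obj A).finite.biUnion fun x _ =>
      ((union n C l').obj A).finite.image fun y => (⟨x, y, y.2, C.hid y.2⟩ : Piece C)).subset ?_
    rintro _ ⟨i, T, hT, x, hx, y, hy, -, rfl⟩
    simp only [Set.mem_iUnion]
    exact ⟨(i, x), mem_union.2 ⟨T, hT, hx⟩, (i, y), mem_union.2 ⟨T, hT, hy⟩, rfl⟩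
  src_mem := by rintro _ ⟨i, T, hT, x, hx, y, hy, -, rfl⟩; exact mem_union.2 ⟨T, hT, hx⟩
  tgt_mem := by rintro _ ⟨i, T, hT, x, hx, y, hy, -, rfl⟩; exact mem_union.2 ⟨T, hT, hy⟩
  dom_le := by rintro _ ⟨i, T, hT, x, hx, y, hy, h, rfl⟩; exact h
  disj := by
    rintro _ ⟨i, T, hT, x, hx, y, hy, h, rfl⟩ _ ⟨i', T', hT', x', hx', y', hy', h', rfl⟩ hne e w hw hw'
    obtain ⟨rfl, rfl⟩ := Prod.ext_iff.1 e
    obtain rfl := label_unique hT hT' (hw.trans (le_root hy)) (hw'.trans (le_root hy'))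
    obtain rfl := eq_of_le hy hy' hw hw'
    exact hne rfl

lemma trans_id (A : SC (s n C)) (l : ℕ) : trans A l l = 𝟙 _ := by
  apply SC.hom_ext
  ext p
  constructor
  · rintro ⟨i, T, hT, x, hx, y, hy, h, rfl⟩
    obtain rfl := eq_of_le hx hy h le_rfl
    exact ⟨(i, x), mem_union.2 ⟨T, hT, hx⟩, rfl⟩
  · rintro ⟨⟨i, x⟩, ⟨T, hT, hx⟩, rfl⟩
    exact ⟨i, T, hT, x, hx, x, hx, le_rfl, rfl⟩

lemma trans_comp (A : SC (s n C)) {l l' l'' : ℕ} (h : l ≤ l') (h' : l' ≤ l'') :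
    trans A l l' ≫ trans A l' l'' = trans A l l'' := by
  apply SC.hom_ext
  ext p
  constructor
  · rintro ⟨_, ⟨i, T, hT, x, hx, y, hy, hle, rfl⟩, _, ⟨i', T', hT', x', hx', y', hy', hle', rfl⟩, e, z, t,
      ht, rfl⟩
    simp only at e ht t
    obtain ⟨rfl, rfl⟩ := Prod.ext_iff.1 e
    obtain rfl := label_unique hT hT' (le_root hy) (le_root hx')
    have := C.sq_unique ht (C.sq_hid hle')
    obtain rfl : z = y' := congrArg Sigma.fst this
    obtain rfl : t = C.hid z := eq_of_heq (Sigma.mk.inj this).2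
    refine ⟨i, T, hT, x, hx, z, hy', hle'.trans hle, ?_⟩
    simp only [C.id_hcomp]
  · rintro ⟨i, T, hT, x, hx, y, hy, hle, rfl⟩
    obtain ⟨z, hz, hyz⟩ := exists_le ((born_le_of_mem hx).trans h) h' hy
    obtain ⟨x', hx', hzx⟩ := exists_le (born_le_of_mem hx) h hz
    obtain rfl := eq_of_le hx hx' hle (hyz.trans hzx)
    exact ⟨_, ⟨i, T, hT, x, hx, z, hz, hzx, rfl⟩, _, ⟨i, T, hT, z, hz, y, hy, hyz, rfl⟩, rfl, y,
      C.hid y, C.sq_hid hyz, by simp only [C.id_hcomp]⟩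

lemma trans_cof (A : SC (s n C)) {l l' : ℕ} (h : l ≤ l') (hl' : l' ≤ n) :
    SC.cof C (trans A l l') := by
  constructor
  · rintro ⟨i, x⟩ ⟨T, hT, hx⟩
    refine C.J.superset_covering ?_ (lev_cover h hl' hx)
    rintro w f ⟨y, hy, hwy⟩
    obtain ⟨x', hx', hyx⟩ := exists_le (born_le_of_mem hx) h hy
    obtain rfl := eq_of_le hx hx' f.le (hwy.trans hyx)
    exact ⟨y, ⟨_, ⟨i, T, hT, x, hx, y, hy, hyx, rfl⟩, rfl, rfl⟩, hwy⟩
  · rintro _ ⟨i, T, hT, x, hx, y, hy, hle, rfl⟩ _ ⟨i', T', hT', x', hx', y', hy', hle', rfl⟩ e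
    obtain ⟨rfl, rfl⟩ := Prod.ext_iff.1 e
    obtain rfl := label_unique hT hT' (le_root hy) (le_root hy')
    obtain rfl := eq_of_le hx hx' hle hle'
    rfl

/-- The cofibrations are natural. -/
lemma trans_naturality {A B : SC (s n C)} (f : A ⟶ B) {l l' : ℕ} (h : l ≤ l') :
    trans A l l' ≫ (union n C l').map f = (union n C l).map f ≫ trans B l l' := by
  apply SC.hom_ext
  ext r
  constructor
  · rintro ⟨_, ⟨i, T, hT, x, hx, y, hy, hle, rfl⟩, q, hq, e, z, t', ht', rfl⟩
    obtain ⟨p, hp, u, hu, a, ha, b, hb, t, ht, hau, rfl⟩ := (mem_union_map f).1 hq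
    simp only at e ht' t'
    obtain ⟨e1, e2⟩ := Prod.mk.inj e
    subst e1
    subst e2
    obtain rfl := label_unique hT (SC.Hom.src_mem f p hp) (le_root hy) (le_root hu)
    have := C.sq_unique ht' (C.sq_hid hau)
    obtain rfl : z = a := congrArg Sigma.fst this
    obtain rfl : t' = C.hid z := eq_of_heq (Sigma.mk.inj this).2
    have hdom := le_iff.1 (SC.Hom.dom_le f p hp)
    obtain ⟨a0, ha0, hza⟩ := exists_le (T := p.dom) (hdom.1 ▸ born_le_of_mem hx) h ha
    obtain ⟨b0, hb0, t0, ht0⟩ := carries p.hor l ha0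
    have hs := sq_of_le' ht ht0 hza
    obtain ⟨x', hx', hax⟩ := hdom.2 _ _ ha0
    obtain rfl := eq_of_le hx hx' (hau.trans hle) (hza.trans hax)
    refine ⟨_, (mem_union_map f).2 ⟨p, hp, x, hx, a0, ha0, b0, hb0, t0, ht0, hax, rfl⟩, _,
      ⟨_, _, SC.Hom.tgt_mem f p hp, b0, hb0, b, hb, C.sq_right hs, rfl⟩, rfl, z, t, hs, ?_⟩
    simp only [C.id_hcomp, C.hcomp_id]
  · rintro ⟨q, hq, _, ⟨i, T, hT, x', hx', y, hy, hle, rfl⟩, e, z, t', ht', rfl⟩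
    obtain ⟨p, hp, x, hx, a, ha, b, hb, t, ht, hax, rfl⟩ := (mem_union_map f).1 hq
    simp only at e ht' t'
    obtain ⟨e1, e2⟩ := Prod.mk.inj e
    subst e1
    subst e2
    obtain rfl := label_unique hT (SC.Hom.tgt_mem f p hp) (le_root hx') (le_root hb)
    obtain ⟨a', ha', r, hr⟩ := carries' p.hor l' hy
    have := C.sq_unique (C.sq_trans ht' ht) hr
    obtain rfl : z = a' := congrArg Sigma.fst this
    obtain rfl : t' = r := eq_of_heq (Sigma.mk.inj this).2
    obtain ⟨u, hu, hzu⟩ := (le_iff.1 (SC.Hom.dom_le f p hp)).2 _ _ ha'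
    obtain ⟨x'', hx'', hux⟩ := exists_le (born_le_of_mem hx) h hu
    obtain rfl := eq_of_le hx hx'' ((C.sq_left ht').trans hax) (hzu.trans hux)
    refine ⟨_, ⟨_, _, SC.Hom.src_mem f p hp, x, hx, u, hu, hux, rfl⟩, _,
      (mem_union_map f).2 ⟨p, hp, u, hu, z, ha', y, hy, t', hr, hzu, rfl⟩, rfl, z, C.hid z,
      C.sq_hid hzu, ?_⟩
    simp only [C.id_hcomp, C.hcomp_id]

/-- An element of the `l'`-th level is new after level `l` iff its diagram is born after `l`. -/
lemma mem_im_trans {A : SC (s n C)} {l l' : ℕ} (h : l ≤ l') {i : ℕ} {T : (s n C).P}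
    (hT : (i, T) ∈ A.carrier) {y : C.P} (hy : y ∈ lev T l') :
    (i, y) ∈ SC.im (trans A l l') ↔ born T ≤ l := by
  constructor
  · rintro ⟨_, ⟨i', T', hT', x, hx, y', hy', hle, rfl⟩, e⟩
    obtain ⟨rfl, rfl⟩ := Prod.ext_iff.1 e
    obtain rfl := label_unique hT hT' (le_root hy) (le_root hy')
    exact born_le_of_mem hx
  · intro hb
    obtain ⟨x, hx, hle⟩ := exists_le hb h hy
    exact ⟨_, ⟨i, T, hT, x, hx, y, hy, hle, rfl⟩, rfl⟩

/-- The functor `F_n` on objects: the sequence of the levelwise unions. -/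
def combObj (A : SC (s n C)) : LObj C n where
  F :=
    { obj := fun l => (union n C l).obj A
      map := fun {l l'} _ => trans A l l'
      map_id := fun l => trans_id A l
      map_comp := fun h h' => (trans_comp A h.le h'.le).symm }
  zero := by
    refine Set.eq_empty_of_forall_notMem ?_
    rintro ⟨i, x⟩ h
    obtain ⟨T, -, hx⟩ := mem_union.1 h
    have h1 := born_le_of_mem hx
    have h2 := one_le_born T
    change born T ≤ 0 at h1
    omega
  cof {l l'} h := trans_cof A h (Nat.lt_succ_iff.1 l'.2)

/-- The functor `F_n : SC(s_n C) → L_n SC(C)` of levelwise unions. -/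
def comb (n : ℕ) (C : PolytopeComplex.{u, v}) : SC (s n C) ⥤ LObj C n where
  obj := combObj
  map {A B} f := ⟨{ app := fun l => (union n C l).map f
                    naturality := fun _ _ h => trans_naturality f h.le },
    LObj.layered_iff.2 (by
      intro l l' h r hr hs
      obtain ⟨p, hp, x, hx, a, ha, b, hb, t, ht, hax, rfl⟩ := (mem_union_map f).1 hr
      have h1 := mem_im_trans h (SC.Hom.src_mem f p hp) hx
      have h2 := mem_im_trans h (SC.Hom.tgt_mem f p hp) hb
      have h3 : born p.src.2 = born p.tgt.2 :=
        (le_iff.1 (SC.Hom.dom_le f p hp)).1.symm.trans (born_eq_of_hor p.hor)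
      exact fun h' => hs (h1.2 (h3 ▸ h2.1 h')))⟩
  map_id A := LObj.hom_ext fun l => (union n C l).map_id A
  map_comp f g := LObj.hom_ext fun l => (union n C l).map_comp f g

lemma exists_isPiece (θ : Fin (k + 1) →o Fin (n + 1)) {T : (s n C).P} {j : ℕ}
    (h0 : extend θ 0 < born T) {y : C.P} (hy : y ∈ lev T (extend θ j)) :
    ∃ R : (s k C).P, IsPiece θ T R ∧ y ∈ lev R j := by
  have hex : ∃ b, born T ≤ extend θ b := ⟨j, born_le_of_mem hy⟩
  classical
  let b := Nat.find hex
  have hb : born T ≤ extend θ b := Nat.find_spec hex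
  have hmin : ∀ i, i < b → extend θ i < born T := fun i hi => not_le.1 (Nat.find_min hex hi)
  have hbj : b ≤ j := Nat.find_min' hex (born_le_of_mem hy)
  have hb1 : 1 ≤ b := by
    by_contra hc
    have : b = 0 := by omega
    rw [this] at hb
    omega
  obtain ⟨r, hr, hle⟩ := exists_le hb (extend_mono θ hbj) hy
  obtain ⟨R, hR, hbR, rfl⟩ := exists_piece hb1 (hmin (b - 1) (by omega)) hr
  exact ⟨R, hR, hR.mem_lev (hbR ▸ hbj) hy hle⟩

lemma extend_val (θ : Fin (k + 1) →o Fin (n + 1)) (j : Fin (k + 1)) : extend θ j = θ j :=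
  dif_pos j.2

lemma IsPiece.extend_lt {θ : Fin (k + 1) →o Fin (n + 1)} {T : (s n C).P} {R : (s k C).P}
    (h : IsPiece θ T R) : extend θ 0 < born T := (extend_mono θ (Nat.zero_le _)).trans_lt h.1

lemma comb_naturality (θ : Fin (k + 1) →o Fin (n + 1)) :
    SC.map (restr θ C) ⋙ comb k C = comb n C ⋙ LObj.restr θ := by
  have h0 : ∀ {A : SC (s n C)} {i : ℕ} {T : (s n C).P} (_ : (i, T) ∈ A.carrier) {j : Fin (k + 1)}
      {y : C.P} (_ : y ∈ lev T (extend θ j)),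
      (i, y) ∉ SC.im (((comb n C).obj A).map (LObj.zero_le θ j)) ↔ extend θ 0 < born T := by
    intro A i T hT j y hy
    rw [extend_val] at hy
    have h1 := mem_im_trans (l := θ 0) (LObj.zero_le θ j) hT hy
    rw [← extend_val θ 0] at h1
    rw [← not_le]
    exact not_congr (extend_val θ 0 ▸ h1)
  refine LObj.functor_ext (fun A j => ?_) (fun A j l h => ?_) fun {A B} f j => ?_
  · ext ⟨i, y⟩
    constructor
    · rintro ⟨R, ⟨T, hT, hR⟩, hy⟩
      have hy' := (IsPiece.lev_sub hR hy).1
      refine ⟨mem_union.2 ⟨T, hT, by rw [← extend_val]; exact hy'⟩, (h0 hT hy').2 hR.extend_lt⟩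
    · rintro ⟨h1, h2⟩
      obtain ⟨T, hT, hy⟩ := mem_union.1 h1
      rw [← extend_val] at hy
      obtain ⟨R, hR, hyR⟩ := exists_isPiece θ ((h0 hT hy).1 h2) hy
      exact ⟨R, ⟨T, hT, hR⟩, hyR⟩
  · refine Eq.trans ?_ (LObj.pieces_restrObj_map θ _ h).symm
    ext r
    constructor
    · rintro ⟨i, R, ⟨T, hT, hR⟩, x, hx, y, hy, hle, rfl⟩
      have hx' := (IsPiece.lev_sub hR hx).1
      have hy' := (IsPiece.lev_sub hR hy).1
      refine ⟨⟨i, T, hT, x, ?_, y, ?_, hle, rfl⟩, (h0 hT hx').2 hR.extend_lt,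
        (h0 hT hy').2 hR.extend_lt⟩
      · rw [← extend_val]; exact hx'
      · rw [← extend_val]; exact hy'
    · rintro ⟨⟨i, T, hT, x, hx, y, hy, hle, rfl⟩, h1, h2⟩
      rw [← extend_val] at hx hy
      obtain ⟨R, hR, hxR⟩ := exists_isPiece θ ((h0 hT hx).1 h1) hx
      exact ⟨i, R, ⟨T, hT, hR⟩, x, hxR, y, hR.mem_lev ((born_le_of_mem hxR).trans h) hy
        (hle.trans (le_root hxR)), hle, rfl⟩
  · refine Eq.trans ?_ (LObj.pieces_restr_map θ _ j).symm
    ext r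
    constructor
    · intro hr
      obtain ⟨_, ⟨p, hp, R, hR, ⟨Q, Q', t⟩, hq, hle, rfl⟩, x, hx, a, ha, b, hb, t', ht', hax, rfl⟩ :=
        (mem_union_map _).1 hr
      obtain ⟨hQ, hQ', hs⟩ := hq
      have hx' := (IsPiece.lev_sub hR hx).1
      have ha' := (IsPiece.lev_sub hQ ha).1
      have hb' := (IsPiece.lev_sub hQ' hb).1
      refine ⟨(mem_union_map f).2 ⟨p, hp, x, ?_, a, ?_, b, ?_, t', C.sq_trans ht' hs, hax, rfl⟩,
        (h0 (SC.Hom.src_mem f p hp) hx').2 (IsPiece.extend_lt hR),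
        (h0 (SC.Hom.tgt_mem f p hp) hb').2 (IsPiece.extend_lt hQ')⟩
      · rw [← extend_val]; exact hx'
      · rw [← extend_val]; exact ha'
      · rw [← extend_val]; exact hb'
    · rintro ⟨hr, h1, h2⟩
      obtain ⟨p, hp, x, hx, a, ha, b, hb, t, ht, hax, rfl⟩ := (mem_union_map f).1 hr
      rw [← extend_val] at hx ha hb
      have hlt := (h0 (SC.Hom.src_mem f p hp) hx).1 h1
      have hdom := SC.Hom.dom_le f p hp
      obtain ⟨R, hR, hxR⟩ := exists_isPiece θ hlt hx
      obtain ⟨Q, hQ, haQ⟩ := exists_isPiece θ ((le_iff.1 hdom).1 ▸ hlt) ha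
      obtain ⟨⟨_, Q', q⟩, ⟨hq, rfl⟩, -⟩ := existsUnique_restrHor p.hor hQ
      obtain ⟨b', hb', t', ht'⟩ := carries q j haQ
      have := sq_unique' (C.sq_trans ht' hq.2.2) ht
      obtain rfl : b' = b := congrArg Sigma.fst this
      obtain rfl : t' = t := eq_of_heq (Sigma.mk.inj this).2
      exact (mem_union_map _).2 ⟨_, ⟨p, hp, R, hR, _, hq, hQ.le hR hdom (le_root haQ)
        (hax.trans (le_root hxR)), rfl⟩, x, hxR, a, haQ, b', hb', t', ht', hax, rfl⟩

end Forest

/-- The functor `F_• : SC(s_• C) → L_• SC(C)` of simplicial categories. -/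
def combSimplicial (C : PolytopeComplex.{u, v}) : SCs C ⟶ LSimplicial C where
  app X := (Forest.comb X.unop.len C).toCatHom
  naturality _ _ f := congrArg Functor.toCatHom (Forest.comb_naturality f.unop.toOrderHom)

end PolytopeComplex

/-! ### Waldhausen categories and the `S_•`-construction -/

/-- The standard axioms of a Waldhausen category for classes `cof` of cofibrations and `weq` of
weak equivalences: there is a zero object; isomorphisms are cofibrations and weak equivalences, both
classes are closed under composition, the maps out of zero objects are cofibrations, pushouts along
cofibrations exist and are cofibrations, and the gluing lemma holds. -/
structure IsWaldhausen {E : Type*} [Category E] (cof weq : MorphismProperty E) : Prop where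
  exists_zero : ∃ Z : E, Limits.IsZero Z
  cof_of_isIso : ∀ {A B : E} (f : A ⟶ B), IsIso f → cof f
  cof_comp : ∀ {A B D : E} (f : A ⟶ B) (g : B ⟶ D), cof f → cof g → cof (f ≫ g)
  cof_of_isZero : ∀ {Z A : E} (f : Z ⟶ A), Limits.IsZero Z → cof f
  exists_pushout : ∀ {A B A' : E} (f : A ⟶ B) (g : A ⟶ A'), cof f →
    ∃ (B' : E) (g' : B ⟶ B') (f' : A' ⟶ B'), IsPushout f g g' f'
  cof_pushout : ∀ {A B A' B' : E} {f : A ⟶ B} {g : A ⟶ A'} {g' : B ⟶ B'} {f' : A' ⟶ B'},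
    IsPushout f g g' f' → cof f → cof f'
  weq_of_isIso : ∀ {A B : E} (f : A ⟶ B), IsIso f → weq f
  weq_comp : ∀ {A B D : E} (f : A ⟶ B) (g : B ⟶ D), weq f → weq g → weq (f ≫ g)
  gluing : ∀ {A₁ B₁ C₁ D₁ A₂ B₂ C₂ D₂ : E} {i₁ : A₁ ⟶ B₁} {k₁ : A₁ ⟶ C₁} {r₁ : B₁ ⟶ D₁}
    {s₁ : C₁ ⟶ D₁} {i₂ : A₂ ⟶ B₂} {k₂ : A₂ ⟶ C₂} {r₂ : B₂ ⟶ D₂} {s₂ : C₂ ⟶ D₂}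
    {a : A₁ ⟶ A₂} {b : B₁ ⟶ B₂} {c : C₁ ⟶ C₂} {d : D₁ ⟶ D₂},
    IsPushout i₁ k₁ r₁ s₁ → IsPushout i₂ k₂ r₂ s₂ → cof i₁ → cof i₂ →
    i₁ ≫ b = a ≫ i₂ → k₁ ≫ c = a ≫ k₂ → r₁ ≫ d = b ≫ r₂ → s₁ ≫ d = c ≫ s₂ →
    weq a → weq b → weq c → weq d

/-- The data of a Waldhausen category which the `S_•`-construction uses: the zero objects, the
cofibrations, the weak equivalences, and the pushout squares along cofibrations, where
`po f g g' f'` is about a square with top `f : A → B`, which has to be a cofibration, left side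
`g : A → A'`, right side `g' : B → B'` and bottom `f' : A' → B'`. -/
structure WaldData (E : Type*) [Category E] where
  zero : E → Prop
  cof : MorphismProperty E
  weq : MorphismProperty E
  po : ∀ {A B A' B' : E}, (A ⟶ B) → (A ⟶ A') → (B ⟶ B') → (A' ⟶ B') → Prop

/-- The zero objects and the pushout squares along cofibrations of a category with given classes of
cofibrations and weak equivalences. -/
def WaldData.of {E : Type*} [Category E] (cof weq : MorphismProperty E) : WaldData E where
  zero := Limits.IsZero
  cof := cof
  weq := weq
  po f g g' f' := cof f ∧ IsPushout f g g' f'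

/-- Exact functors preserve zero objects, cofibrations, weak equivalences and pushouts along
cofibrations. -/
structure IsExact {E E' : Type*} [Category E] [Category E'] (W : WaldData E) (W' : WaldData E')
    (F : E ⥤ E') : Prop where
  zero : ∀ {A : E}, W.zero A → W'.zero (F.obj A)
  cof : ∀ {A B : E} (f : A ⟶ B), W.cof f → W'.cof (F.map f)
  weq : ∀ {A B : E} (f : A ⟶ B), W.weq f → W'.weq (F.map f)
  po : ∀ {A B A' B' : E} (f : A ⟶ B) (g : A ⟶ A') (g' : B ⟶ B') (f' : A' ⟶ B'),
    W.po f g g' f' → W'.po (F.map f) (F.map g) (F.map g') (F.map f')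


/-- Categories with zero objects, cofibrations, weak equivalences and pushout squares. -/
structure Wald where
  carrier : Type w
  [cat : Category.{w} carrier]
  data : WaldData carrier

attribute [instance] Wald.cat

namespace Wald

/-- The category whose morphisms are the exact functors. -/
instance : Category Wald.{w} where
  Hom E E' := {F : E.carrier ⥤ E'.carrier // IsExact E.data E'.data F}
  id E := ⟨𝟭 _, ⟨fun h => h, fun _ h => h, fun _ h => h, fun _ _ _ _ h => h⟩⟩
  comp F G := ⟨F.1 ⋙ G.1, ⟨fun h => G.2.zero (F.2.zero h), fun _ h => G.2.cof _ (F.2.cof _ h),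
    fun _ h => G.2.weq _ (F.2.weq _ h), fun _ _ _ _ h => G.2.po _ _ _ _ (F.2.po _ _ _ _ h)⟩⟩

/-- The poset of pairs `i ≤ j` in `{0, …, n}`. -/
abbrev Ar (n : ℕ) : Type := {p : Fin (n + 1) × Fin (n + 1) // p.1 ≤ p.2}

namespace Ar

variable {n k m : ℕ}

abbrev mk {i j : Fin (n + 1)} (h : i ≤ j) : Ar n := ⟨(i, j), h⟩

/-- The inequality `(i, j) ≤ (i', j')` as a morphism. -/
abbrev hom {i j i' j' : Fin (n + 1)} {h : i ≤ j} {h' : i' ≤ j'} (hi : i ≤ i') (hj : j ≤ j') :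
    mk h ⟶ mk h' := homOfLE ⟨hi, hj⟩

/-- The functor `(i, j) ↦ (θ i, θ j)`. -/
def map (θ : Fin (k + 1) →o Fin (n + 1)) : Ar k ⥤ Ar n :=
  Monotone.functor (f := fun p => mk (θ.monotone p.2)) fun _ _ h => ⟨θ.monotone h.1, θ.monotone h.2⟩

end Ar

/-- An object of Waldhausen's category `S_n E`: a diagram of objects `A_{ij}` for `0 ≤ i ≤ j ≤ n` with
`A_{ii} = 0` and cofiber sequences `A_{ij} ↣ A_{ik} → A_{jk}` for `i ≤ j ≤ k`, i.e. pushout squares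
along cofibrations with fourth vertex `A_{jj}`. -/
structure SObj (E : Wald.{w}) (n : ℕ) where
  F : Ar n ⥤ E.carrier
  zero : ∀ i, E.data.zero (F.obj (.mk (le_refl i)))
  po : ∀ {i j k : Fin (n + 1)} (h : i ≤ j) (h' : j ≤ k),
    E.data.po (F.map (Ar.hom (h := h) (h' := h.trans h') le_rfl h'))
      (F.map (Ar.hom (h := h) (h' := le_refl j) h le_rfl))
      (F.map (Ar.hom (h := h.trans h') (h' := h') h le_rfl))
      (F.map (Ar.hom (h := le_refl j) (h' := h') le_rfl h'))

namespace SObj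

variable {E E' : Wald.{w}} {n k m : ℕ}

/-- Morphisms of `S_n E` are natural transformations. -/
instance : Category (SObj E n) where
  Hom A B := A.F ⟶ B.F
  id A := 𝟙 A.F
  comp φ ψ := NatTrans.vcomp φ ψ
  id_comp φ := Category.id_comp (X := _) φ
  comp_id φ := Category.comp_id (X := _) φ
  assoc φ ψ χ := Category.assoc (W := _) φ ψ χ

/-- The component `A_{ij} → B_{ij}`. -/
def app {A B : SObj E n} (φ : A ⟶ B) (x : Ar n) : A.F.obj x ⟶ B.F.obj x := NatTrans.app φ x

/-- The cofibrations of `S_n E`: the morphisms `A → B` for which the induced morphisms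
`B_{ij} ∪_{A_{ij}} A_{ik} → B_{ik}` are cofibrations for all `i ≤ j ≤ k`. -/
def cof : MorphismProperty (SObj E n) := fun A B φ =>
  ∀ {i j k : Fin (n + 1)} (h : i ≤ j) (h' : j ≤ k),
    ∃ (Q : E.carrier) (r : A.F.obj (.mk (h.trans h')) ⟶ Q) (s : B.F.obj (.mk h) ⟶ Q)
      (d : Q ⟶ B.F.obj (.mk (h.trans h'))),
      E.data.po (A.F.map (Ar.hom le_rfl h')) (app φ (.mk h)) r s ∧
        r ≫ d = app φ (.mk (h.trans h')) ∧ s ≫ d = B.F.map (Ar.hom le_rfl h') ∧ E.data.cof d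

/-- The Waldhausen structure of `S_n E`. Zero objects, weak equivalences, and pushouts along
cofibrations are levelwise. -/
def data (E : Wald.{w}) (n : ℕ) : WaldData (SObj E n) where
  zero A := ∀ x, E.data.zero (A.F.obj x)
  cof := cof
  weq := fun _ _ φ => ∀ x, E.data.weq (app φ x)
  po f g g' f' := cof f ∧ ∀ x, E.data.po (app f x) (app g x) (app g' x) (app f' x)

/-- The functor `S_n E → S_k E'` induced by a monotone map `{0, …, k} → {0, …, n}` and an exact functor
`E → E'`. -/
def map (θ : Fin (k + 1) →o Fin (n + 1)) (G : E ⟶ E') : SObj E n ⥤ SObj E' k where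
  obj A :=
    { F := Ar.map θ ⋙ A.F ⋙ G.1
      zero := fun i => G.2.zero (A.zero (θ i))
      po := fun h h' => G.2.po _ _ _ _ (A.po (θ.monotone h) (θ.monotone h')) }
  map φ := Functor.whiskerLeft (Ar.map θ) (Functor.whiskerRight φ G.1)
  map_id A := by
    refine NatTrans.ext ?_
    funext x
    exact G.1.map_id _
  map_comp φ ψ := by
    refine NatTrans.ext ?_
    funext x
    exact G.1.map_comp _ _

lemma isExact_map (θ : Fin (k + 1) →o Fin (n + 1)) (G : E ⟶ E') :
    IsExact (data E n) (data E' k) (map θ G) := by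
  have hcof : ∀ {A B : SObj E n} (φ : A ⟶ B), cof φ → cof ((map θ G).map φ) := by
    intro A B φ H i j l h h'
    obtain ⟨Q, r, s, d, h1, h2, h3, h4⟩ := H (θ.monotone h) (θ.monotone h')
    refine ⟨_, G.1.map r, G.1.map s, G.1.map d, G.2.po _ _ _ _ h1, ?_, ?_, G.2.cof _ h4⟩
    · exact (G.1.map_comp _ _).symm.trans (congrArg G.1.map h2)
    · exact (G.1.map_comp _ _).symm.trans (congrArg G.1.map h3)
  exact ⟨fun h x => G.2.zero (h _), hcof, fun φ h x => G.2.weq _ (h _),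
    fun f g g' f' h => ⟨hcof f h.1, fun x => G.2.po _ _ _ _ (h.2 _)⟩⟩

end SObj

open Opposite

/-- `S_n E` as a functor of `n` and `E`. -/
def sFunctor : SimplexCategoryᵒᵖ × Wald.{w} ⥤ Wald.{w} where
  obj X := ⟨SObj X.2 X.1.unop.len, SObj.data X.2 X.1.unop.len⟩
  map f := ⟨SObj.map f.1.unop.toOrderHom f.2, SObj.isExact_map _ _⟩
  map_id _ := rfl
  map_comp _ _ := rfl

/-- Waldhausen's `S_•`-construction for a simplicial Waldhausen category `X_•`, made simplicial through
the diagonal: `(S X)_n = S_n (X_n)`. -/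
def S : (SimplexCategoryᵒᵖ ⥤ Wald.{w}) ⥤ (SimplexCategoryᵒᵖ ⥤ Wald.{w}) where
  obj X := Functor.prod' (𝟭 _) X ⋙ sFunctor
  map {X Y} α :=
    { app := fun n => sFunctor.map (X := (n, X.obj n)) (Y := (n, Y.obj n)) (𝟙 n, α.app n)
      naturality := fun n m f => by
        change sFunctor.map _ ≫ sFunctor.map _ = sFunctor.map _ ≫ sFunctor.map _
        rw [← sFunctor.map_comp, ← sFunctor.map_comp]
        congr 1
        exact Prod.ext ((Category.comp_id _).trans (Category.id_comp _).symm) (α.naturality f) }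
  map_id X := by
    ext n
    exact sFunctor.map_id _
  map_comp α β := by
    ext n
    change _ = sFunctor.map _ ≫ sFunctor.map _
    rw [← sFunctor.map_comp]
    rfl

/-- The `q`-fold iterated `S_•`-construction (again in its diagonal form). -/
def iterS : ℕ → ((SimplexCategoryᵒᵖ ⥤ Wald.{w}) ⥤ (SimplexCategoryᵒᵖ ⥤ Wald.{w}))
  | 0 => 𝟭 _
  | q + 1 => S ⋙ iterS q

/-- The chains of `p` composable weak equivalences of `E`, i.e. the `p`-simplices of the nerve `N w E`
of the category of weak equivalences, as a functor of `p` and `E`. -/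
def nwFunctor : SimplexCategoryᵒᵖ × Wald.{w} ⥤ Type w where
  obj X := {F : Fin (X.1.unop.len + 1) ⥤ X.2.carrier //
    ∀ {i j} (h : i ⟶ j), X.2.data.weq (F.map h)}
  map f := ↾fun F => ⟨f.1.unop.toOrderHom.monotone.functor ⋙ F.1 ⋙ f.2.1,
    fun _ => f.2.2.weq _ (F.2 _)⟩
  map_id _ := rfl
  map_comp _ _ := rfl

/-- The diagonal of the bisimplicial set `N w X_•`, where `X_•` is a simplicial Waldhausen category.
The `K`-theory of `X_•` is the spectrum with `q`-th space the realization of `N w S_•^{(q)} X_•`, and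
the realization of a multisimplicial set is that of its diagonal. -/
def nw : (SimplexCategoryᵒᵖ ⥤ Wald.{w}) ⥤ SSet.{w} where
  obj X := Functor.prod' (𝟭 _) X ⋙ nwFunctor
  map {X Y} α :=
    { app := fun n => nwFunctor.map (X := (n, X.obj n)) (Y := (n, Y.obj n)) (𝟙 n, α.app n)
      naturality := fun n m f => by
        change nwFunctor.map _ ≫ nwFunctor.map _ = nwFunctor.map _ ≫ nwFunctor.map _
        rw [← nwFunctor.map_comp, ← nwFunctor.map_comp]
        congr 1
        exact Prod.ext ((Category.comp_id _).trans (Category.id_comp _).symm) (α.naturality f) }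
  map_id X := by
    refine NatTrans.ext (funext fun n => ?_)
    exact nwFunctor.map_id _
  map_comp α β := by
    refine NatTrans.ext (funext fun n => ?_)
    change _ = nwFunctor.map _ ≫ nwFunctor.map _
    rw [← nwFunctor.map_comp]
    rfl

end Wald

/-- A map `X → Y` of simplicial sets is a weak homotopy equivalence, i.e. it induces a homotopy
equivalence of geometric realizations, if composition with it gives a bijection from homotopy classes
of maps `Y → Z` to homotopy classes of maps `X → Z` for all Kan complexes `Z`. -/
def IsWeakHomotopyEquiv {X Y : SSet.{w}} (f : X ⟶ Y) : Prop :=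
  ∀ (Z : SSet.{w}) [SSet.KanComplex Z],
    (∀ g : X ⟶ Z, ∃ h : Y ⟶ Z, Nonempty (SSet.Homotopy (f ≫ h) g)) ∧
      ∀ h h' : Y ⟶ Z, Nonempty (SSet.Homotopy (f ≫ h) (f ≫ h')) → Nonempty (SSet.Homotopy h h')

namespace PolytopeComplex

variable {C : PolytopeComplex.{u, v}}

namespace SC

/-- The Waldhausen structure of `SC(C)`. -/
def waldData (C : PolytopeComplex.{u, v}) : WaldData (SC C) := .of (cof C) (weq C)

/-- The Waldhausen category `SC(C)`. -/
def wald (C : PolytopeComplex.{u, v}) : Wald.{max u v} := ⟨SC C, waldData C⟩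

end SC

namespace LObj

open SC

variable {n k m : ℕ}

/-- The cofibrations of `F_n SC(C)` that lie in `L_n SC(C)`: the layered morphisms `A → B` for which
`B_i ∪_{A_i} A_{i+1} → B_{i+1}` is a cofibration for all `i`, where `A_0` and `B_0` are zero. -/
def cofibration (C : PolytopeComplex.{u, v}) (n : ℕ) : MorphismProperty (LObj C n) := fun A B φ =>
  ∀ i : Fin n, ∃ (Q : SC C) (r : A.F.obj i.succ ⟶ Q) (s : B.F.obj i.castSucc ⟶ Q)
    (d : Q ⟶ B.F.obj i.succ),
    IsPushout (A.map i.castSucc_lt_succ.le) (app φ i.castSucc) r s ∧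
      r ≫ d = app φ i.succ ∧ s ≫ d = B.map i.castSucc_lt_succ.le ∧ SC.cof C d

/-- The weak equivalences of `F_n SC(C)` that lie in `L_n SC(C)`: the levelwise ones. -/
def weakEquivalence (C : PolytopeComplex.{u, v}) (n : ℕ) : MorphismProperty (LObj C n) :=
  fun _ _ φ => ∀ i, SC.weq C (app φ i)

/-- The Waldhausen structure of `L_n SC(C)`. -/
def waldData (C : PolytopeComplex.{u, v}) (n : ℕ) : WaldData (LObj C n) :=
  .of (cofibration C n) (weakEquivalence C n)

/-- The triangle of canonical subquotients `A_{ij} = A_j/A_i`. -/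
def triangle (A : LObj C n) : Wald.SObj (SC.wald C) n where
  F :=
    { obj := fun x => cofiber (A.map x.2)
      map := fun {x y} h => quot (A.map x.2) (A.map y.2) (A.map h.le.2)
      map_id := fun x => by
        rw [map_refl]; exact quot_id
      map_comp := fun {x y z} h h' => by
        refine Eq.trans ?_ (quot_comp (x := A.map h'.le.1) (by rw [map_comp, map_comp])).symm
        rw [map_comp] }
  zero i := by
    refine isZero_of_carrier ?_
    change (cofiber (A.map (le_refl i))).carrier = ∅
    rw [map_refl, cofiber_id_carrier]
  po {i j k} h h' := by
    change SC.cof C (quot (A.map h) (A.map (h.trans h')) (A.map h')) ∧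
      IsPushout (quot (A.map h) (A.map (h.trans h')) (A.map h'))
        (quot (A.map h) (A.map (le_refl j)) (A.map (le_refl j)))
        (quot (A.map (h.trans h')) (A.map h') (A.map (le_refl k)))
        (quot (A.map (le_refl j)) (A.map h') (A.map h'))
    rw [← map_comp A h h', map_refl, map_refl]
    exact ⟨cof_quot (A.cof _), isPushout_quot _ _ _ _⟩

/-- The comparison functor `L_n SC(C) → S_n SC(C)`, which adds the canonical cofibers. -/
def toS (C : PolytopeComplex.{u, v}) (n : ℕ) : LObj C n ⥤ Wald.SObj (SC.wald C) n where
  obj := triangle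
  map {A B} φ :=
    { app := fun x => quot (A.map x.2) (B.map x.2) (app φ x.1.2)
      naturality := fun x y h => by
        change quot (A.map x.2) (A.map y.2) (A.map h.le.2) ≫ quot (A.map y.2) (B.map y.2) _ =
          quot (A.map x.2) (B.map x.2) _ ≫ quot (B.map x.2) (B.map y.2) (B.map h.le.2)
        rw [quot_comp (x := app φ y.1.1) (naturality φ _), quot_comp (x := B.map h.le.1)
          (by rw [map_comp, map_comp]), naturality] }
  map_id A := NatTrans.ext (funext fun x => quot_id)
  map_comp φ ψ := NatTrans.ext (funext fun x =>
    (quot_comp (x := app ψ x.1.1) (naturality ψ _)).symm)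

end LObj

namespace SC

open Wald

variable {n k : ℕ}

lemma sobj_ext {A B : SObj (wald C) n} (h : ∀ x, SC.carrier (A.F.obj x) = SC.carrier (B.F.obj x))
    (h' : ∀ {x y} (f : x ⟶ y), Hom.pieces (A.F.map f) = Hom.pieces (B.F.map f)) : A = B := by
  obtain ⟨F, hF, hF'⟩ := A
  obtain ⟨G, hG, hG'⟩ := B
  obtain rfl : F = G := SC.functor_ext h fun f => h' f
  rfl

lemma sobj_app_eqToHom {A B : SObj (wald C) n} (h : A = B) (x : Ar n) :
    SObj.app (eqToHom h) x = eqToHom (by rw [h]) := by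
  subst h; rfl

lemma sobj_functor_ext {X : Type*} [Category X] {G H : X ⥤ SObj (wald C) n}
    (hobj : ∀ A x, SC.carrier ((G.obj A).F.obj x) = SC.carrier ((H.obj A).F.obj x))
    (hmap : ∀ A {x y} (f : x ⟶ y), Hom.pieces ((G.obj A).F.map f) = Hom.pieces ((H.obj A).F.map f))
    (happ : ∀ {A B : X} (f : A ⟶ B) x,
      Hom.pieces (SObj.app (G.map f) x) = Hom.pieces (SObj.app (H.map f) x)) :
    G = H := by
  refine CategoryTheory.Functor.ext (fun A => sobj_ext (hobj A) (hmap A)) fun A B f =>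
    NatTrans.ext (funext fun x => SC.hom_ext ?_)
  change Hom.pieces (SObj.app (G.map f) x) = Hom.pieces
    (SObj.app (eqToHom (sobj_ext (hobj A) (hmap A))) x ≫ SObj.app (H.map f) x ≫
      SObj.app (eqToHom (sobj_ext (hobj B) (hmap B)).symm) x)
  rw [sobj_app_eqToHom, sobj_app_eqToHom]
  exact (happ f x).trans ((pieces_eqToHom_comp _ _).trans (pieces_comp_eqToHom _ _)).symm

end SC
end PolytopeComplex

namespace PolytopeComplex

variable {C : PolytopeComplex.{u, v}}

namespace LObj

open SC Wald

variable {n k : ℕ}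

lemma mem_im_restr (θ : Fin (k + 1) →o Fin (n + 1)) (A : LObj C n) {i j : Fin (k + 1)} (h : i ≤ j)
    (x : ℕ × C.P) : x ∉ im (A.map (θ.monotone h)) ↔
      x ∉ im (A.map (zero_le θ j)) ∧ x ∉ im ((restrObj θ A).map h) := by
  rw [im_restr]
  constructor
  · intro h1
    exact ⟨fun h' => h1 (im_mono A (zero_le θ i) (θ.monotone h) h'), fun h' => h1 h'.1⟩
  · rintro ⟨h1, h2⟩ h3
    exact h2 ⟨h3, h1⟩

lemma toS_naturality (θ : Fin (k + 1) →o Fin (n + 1)) :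
    restr θ ⋙ toS C k = toS C n ⋙ SObj.map θ (𝟙 (SC.wald C)) := by
  refine sobj_functor_ext (fun A x => ?_) (fun A x y f => ?_) fun {A B} φ x => ?_
  · obtain ⟨⟨i, j⟩, h⟩ := x
    ext z
    constructor
    · rintro ⟨⟨h1, h2⟩, h3⟩
      exact ⟨h1, (mem_im_restr θ A h z).2 ⟨h2, h3⟩⟩
    · rintro ⟨h1, h2⟩
      exact ⟨⟨h1, ((mem_im_restr θ A h z).1 h2).1⟩, ((mem_im_restr θ A h z).1 h2).2⟩
  · obtain ⟨⟨i, j⟩, h⟩ := x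
    obtain ⟨⟨i', j'⟩, h'⟩ := y
    refine (pieces_quot _).trans (Eq.trans ?_ (pieces_quot _).symm)
    ext p
    have h1 := Set.ext_iff.1 (pieces_restrObj_map θ A f.le.2) p
    have h2 := mem_im_restr θ A h p.src
    have h3 := mem_im_restr θ A h' p.tgt
    constructor
    · rintro ⟨a, b, c⟩
      obtain ⟨a1, a2, a3⟩ := h1.1 a
      exact ⟨a1, h2.2 ⟨a2, b⟩, h3.2 ⟨a3, c⟩⟩
    · rintro ⟨a, b, c⟩
      obtain ⟨b1, b2⟩ := h2.1 b
      obtain ⟨c1, c2⟩ := h3.1 c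
      exact ⟨h1.2 ⟨a, b1, c1⟩, b2, c2⟩
  · obtain ⟨⟨i, j⟩, h⟩ := x
    refine (pieces_quot _).trans (Eq.trans ?_ (pieces_quot _).symm)
    ext p
    have h1 := Set.ext_iff.1 (pieces_restr_map θ φ j) p
    have h2 := mem_im_restr θ A h p.src
    have h3 := mem_im_restr θ B h p.tgt
    constructor
    · rintro ⟨a, b, c⟩
      obtain ⟨a1, a2, a3⟩ := h1.1 a
      exact ⟨a1, h2.2 ⟨a2, b⟩, h3.2 ⟨a3, c⟩⟩
    · rintro ⟨a, b, c⟩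
      obtain ⟨b1, b2⟩ := h2.1 b
      obtain ⟨c1, c2⟩ := h3.1 c
      exact ⟨h1.2 ⟨a, b1, c1⟩, b2, c2⟩

end LObj

end PolytopeComplex

/-! ### Simplicial Waldhausen categories -/

/-- A simplicial category with classes of cofibrations and weak equivalences on every level. -/
structure SimplicialWald where
  cat : SimplexCategoryᵒᵖ ⥤ Cat.{w, w}
  cof : ∀ n, MorphismProperty (cat.obj n)
  weq : ∀ n, MorphismProperty (cat.obj n)

namespace SimplicialWald

variable {X Y : SimplicialWald.{w}}

/-- The Waldhausen structure of the `n`-th level. -/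
def data (X : SimplicialWald.{w}) (n : SimplexCategoryᵒᵖ) : WaldData (X.cat.obj n) :=
  .of (X.cof n) (X.weq n)

/-- `X` is a simplicial Waldhausen category: its levels are Waldhausen categories and its structure
maps are exact. -/
structure IsSimplicialWaldhausen (X : SimplicialWald.{w}) : Prop where
  waldhausen : ∀ n, IsWaldhausen (X.cof n) (X.weq n)
  exact : ∀ {n m} (f : n ⟶ m), IsExact (X.data n) (X.data m) (X.cat.map f).toFunctor

/-- A functor `F : X → Y` of simplicial categories is an exact equivalence of simplicial Waldhausen
categories: every `F_n` is exact and is an equivalence of categories with an exact inverse `G_n` (with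
unit `η` and counit `ε`), and the `G_n` assemble into a functor of simplicial Waldhausen categories, in
the sense that they commute with the structure maps up to natural isomorphisms `κ` that correspond
under `F` and `ε` to the strict commutation of `F` with the structure maps. (This condition
determines `κ`, so that `κ` is compatible with composition.) -/
structure IsExactEquivalence (X Y : SimplicialWald.{w}) (F : X.cat ⟶ Y.cat) : Prop where
  exact : ∀ n, IsExact (X.data n) (Y.data n) (F.app n).toFunctor
  exists_inverse :
    ∃ (G : ∀ n, Y.cat.obj n ⥤ X.cat.obj n)
      (η : ∀ n, 𝟭 (X.cat.obj n) ≅ (F.app n).toFunctor ⋙ G n)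
      (ε : ∀ n, G n ⋙ (F.app n).toFunctor ≅ 𝟭 (Y.cat.obj n))
      (κ : ∀ {n m} (f : n ⟶ m),
        (Y.cat.map f).toFunctor ⋙ G m ≅ G n ⋙ (X.cat.map f).toFunctor),
      (∀ n, IsExact (Y.data n) (X.data n) (G n)) ∧
      (∀ n A, (F.app n).toFunctor.map ((η n).hom.app A) ≫
        (ε n).hom.app ((F.app n).toFunctor.obj A) = 𝟙 _) ∧
      ∀ {n m} (f : n ⟶ m) (B : Y.cat.obj n),
        (F.app m).toFunctor.map ((κ f).hom.app B) ≫
          eqToHom (congrArg (fun H : X.cat.obj n ⟶ Y.cat.obj m => H.toFunctor.obj ((G n).obj B))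
            (F.naturality f)) ≫
            (Y.cat.map f).toFunctor.map ((ε n).hom.app B) =
          (ε m).hom.app ((Y.cat.map f).toFunctor.obj B)

/-- A simplicial Waldhausen category as a simplicial object. -/
def toWald (X : SimplicialWald.{w}) (hX : X.IsSimplicialWaldhausen) :
    SimplexCategoryᵒᵖ ⥤ Wald.{w} where
  obj n := ⟨X.cat.obj n, X.data n⟩
  map f := ⟨(X.cat.map f).toFunctor, hX.exact f⟩
  map_id n := Subtype.ext (congrArg Cat.Hom.toFunctor (X.cat.map_id n))
  map_comp f g := Subtype.ext (congrArg Cat.Hom.toFunctor (X.cat.map_comp f g))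

/-- A levelwise exact functor of simplicial Waldhausen categories. -/
def toWaldHom (hX : X.IsSimplicialWaldhausen) (hY : Y.IsSimplicialWaldhausen) (F : X.cat ⟶ Y.cat)
    (hF : ∀ n, IsExact (X.data n) (Y.data n) (F.app n).toFunctor) :
    X.toWald hX ⟶ Y.toWald hY where
  app n := ⟨(F.app n).toFunctor, hF n⟩
  naturality _ _ f := Subtype.ext (congrArg Cat.Hom.toFunctor (F.naturality f))

end SimplicialWald

namespace PolytopeComplex

/-- The simplicial Waldhausen category `SC(s_• C)`. -/
def sWald (C : PolytopeComplex.{u, v}) : SimplicialWald.{max u v} where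
  cat := SCs C
  cof n := SC.cof (s n.unop.len C)
  weq n := SC.weq (s n.unop.len C)

/-- The simplicial Waldhausen category `L_• SC(C)`. -/
def lWald (C : PolytopeComplex.{u, v}) : SimplicialWald.{max u v} where
  cat := LSimplicial C
  cof n := LObj.cofibration C n.unop.len
  weq n := LObj.weakEquivalence C n.unop.len

/-- The functor `F_• : SC(s_• C) → L_• SC(C)` of levelwise unions. -/
def combHom (C : PolytopeComplex.{u, v}) : (sWald C).cat ⟶ (lWald C).cat := combSimplicial C

/-- Waldhausen's simplicial Waldhausen category `S_• SC(C)`. -/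
def SSC (C : PolytopeComplex.{u, v}) : SimplexCategoryᵒᵖ ⥤ Wald.{max u v} :=
  Wald.S.obj ((Functor.const _).obj (SC.wald C))

/-- The comparison functor `L_• SC(C) → S_• SC(C)`. -/
def toSHom (C : PolytopeComplex.{u, v}) (hL : (lWald C).IsSimplicialWaldhausen)
    (h : ∀ n, IsExact (LObj.waldData C n) (Wald.SObj.data (SC.wald C) n) (LObj.toS C n)) :
    (lWald C).toWald hL ⟶ SSC C where
  app n := ⟨LObj.toS C n.unop.len, h n.unop.len⟩
  naturality _ _ f := Subtype.ext (LObj.toS_naturality f.unop.toOrderHom)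

end PolytopeComplex

namespace PolytopeComplex

variable {C D : PolytopeComplex.{u, v}}

/-! A morphism of `SC(C)` is a finite set of pieces, and the proof reads it as a partial function on
parts of members: `Car f i j t` says that `f` carries a part of `i` by the horizontal morphism `t`
onto a part of `j`. Composition of spans becomes composition of these partial functions
(`car_comp`), and morphisms that carry the same pieces are equal (`hom_ext_of_car`).

Pushouts along a cofibration `f : A ⟶ B` have an elementary description, `Glue`: the pushout
consists of the largest parts of members of `A'` whose preimages in `A` lie in the domain of `f`,
together with the members of `B` outside the image of `A`. Such a square exists (`exists_glue`), it
is a pushout (`Glue.isPushout`), and by uniqueness of pushouts the two notions agree (`glue_iff`).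
The Waldhausen axioms for `SC(C)`, including the gluing lemma, can be read off from this
description. Polytope maps preserve every clause of it (`Glue.map`), so they induce exact functors.

The functor `F_n` is an equivalence of categories. A piece between diagrams is determined by its
component at the root, which gives faithfulness. A natural family of maps of the levels comes from a
morphism of diagrams because layered maps preserve the level at which a diagram is born
(`union_full`). For essential surjectivity, every member of `A_m` is the target of a unique piece of
some `A_l ↣ A_m` starting at a member that is new in `A_l`, and the parts of one new member form a
diagram. For layered morphisms, being a cofibration is a levelwise condition (`cofibration_iff`).
Hence the Waldhausen structure of `L_n SC(C)` is that of `SC(s_n C)`, and the structure maps and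
subquotient functors are exact because on the image of `F_n` they come from polytope maps.

The functor `L_n SC(C) → S_n SC(C)` need not be full. It is faithful and essentially surjective, and
cofibrations and weak equivalences of triangles are automatically layered, so they lift. This
property, `Creates`, passes to `S_n` (`Creates.sobj`) and so to all iterates; only the Waldhausen
axioms other than the gluing lemma are needed on the way.

A natural transformation of simplicial Waldhausen categories with this property is an equivalence on
weak equivalences in each degree, but inverses cannot be expected to commute strictly with the
simplicial structure. Instead of inverses one uses the simplicial set of chains in the target whose
objects are marked by isomorphisms to objects of the image. It deformation retracts onto the nerve
of the source. Its projection to the nerve of the target is shrinkable: over every simplex it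
contracts naturally to a section. Shrinkable maps induce bijections on homotopy classes of maps to a
Kan complex, because local homotopies form a simplicial set that maps to the base by a trivial
fibration (`LocalHomotopy.rlp_boundary`), and sections of it descend maps and homotopies. -/

lemma hcomp_inv_cancel {a b c : C.P} (s : C.Hor a b) (t : C.Hor a c) :
    C.hcomp s (C.hcomp (C.hinv s) t) = t := by
  rw [← C.hassoc, C.hcomp_inv, C.id_hcomp]

lemma hcomp_left_cancel {a b c : C.P} {s : C.Hor a b} {t t' : C.Hor b c}
    (h : C.hcomp s t = C.hcomp s t') : t = t' := by
  rw [← C.id_hcomp t, ← C.id_hcomp t', ← C.inv_hcomp s, C.hassoc, C.hassoc, h]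

/-! ### Morphisms of SC(C) as partial functions on parts of members -/

namespace SC

variable {A B E : SC C}

/-- `f` carries the part `w` of the member `i` by `t` onto the part `z` of the member `j`. -/
def Car (f : A ⟶ B) (i j : ℕ × C.P) {w z : C.P} (t : C.Hor w z) : Prop :=
  ∃ p ∈ Hom.pieces f, p.src = i ∧ p.tgt = j ∧ C.Sq t p.hor

/-- The part `w` of the member `i` lies in the domain of `f`. -/
def Dom (f : A ⟶ B) (i : ℕ × C.P) (w : C.P) : Prop :=
  ∃ p ∈ Hom.pieces f, p.src = i ∧ w ≤ p.dom

variable {f f' : A ⟶ B} {g : B ⟶ E} {i j k : ℕ × C.P} {w x y z : C.P}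

lemma Car.of_sq {w' z' : C.P} {t : C.Hor w z} {t' : C.Hor w' z'} (h : Car f i j t)
    (h' : C.Sq t' t) : Car f i j t' := by
  obtain ⟨p, hp, hi, hj, hs⟩ := h
  exact ⟨p, hp, hi, hj, C.sq_trans h' hs⟩

lemma Car.dom {t : C.Hor w z} (h : Car f i j t) : Dom f i w := by
  obtain ⟨p, hp, hi, -, hs⟩ := h
  exact ⟨p, hp, hi, C.sq_left hs⟩

lemma Dom.exists_car (h : Dom f i w) : ∃ j z, ∃ t : C.Hor w z, Car f i j t := by
  obtain ⟨p, hp, hi, hw⟩ := h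
  obtain ⟨z, t, ht⟩ := sq_exists' p.hor hw
  exact ⟨p.tgt, z, t, p, hp, hi, rfl, ht⟩

lemma Dom.of_le (h : Dom f i w) (h' : x ≤ w) : Dom f i x := by
  obtain ⟨p, hp, hi, hw⟩ := h
  exact ⟨p, hp, hi, h'.trans hw⟩

lemma Car.src_mem {t : C.Hor w z} (h : Car f i j t) : i ∈ A.carrier := by
  obtain ⟨p, hp, rfl, -⟩ := h
  exact Hom.src_mem f p hp

lemma Car.tgt_mem {t : C.Hor w z} (h : Car f i j t) : j ∈ B.carrier := by
  obtain ⟨p, hp, -, rfl, -⟩ := h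
  exact Hom.tgt_mem f p hp

lemma Car.le_tgt {t : C.Hor w z} (h : Car f i j t) : z ≤ j.2 := by
  obtain ⟨p, hp, -, rfl, hs⟩ := h
  exact C.sq_right hs

lemma Car.mem_im {t : C.Hor w z} (h : Car f i j t) : j ∈ im f := by
  obtain ⟨p, hp, -, rfl, -⟩ := h
  exact ⟨p, hp, rfl⟩

lemma car_self {p : Piece C} (hp : p ∈ Hom.pieces f) : Car f p.src p.tgt p.hor :=
  ⟨p, hp, rfl, rfl, C.sq_refl _⟩

/-- Two pieces over the same member that overlap agree. -/
lemma piece_eq {p q : Piece C} (hp : p ∈ Hom.pieces f) (hq : q ∈ Hom.pieces f)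
    (hs : p.src = q.src) (h : w ≤ p.dom) (h' : w ≤ q.dom) : p = q := by
  by_contra hne
  exact Hom.disj f p hp q hq hne hs w h h'

/-- Both horizontal morphisms end at the whole member `p.tgt.2`, so uniqueness of the pullback along
a horizontal morphism forces the carrying piece to be `p` itself. -/
lemma mem_of_car {p : Piece C} (h : Car f p.src p.tgt p.hor) : p ∈ Hom.pieces f := by
  obtain ⟨q, hq, h1, h2, h3⟩ := h
  obtain ⟨a, b, c, d⟩ := p
  obtain ⟨a', b', c', d'⟩ := q
  simp only at h1 h2 h3
  subst h1 h2
  have := C.sq_unique h3 (C.sq_refl _)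
  cases this
  exact hq

/-- The working criterion for equality of morphisms: it suffices to test whole pieces, and parts of
them never have to be compared. -/
lemma hom_ext_of_car (h : ∀ p ∈ Hom.pieces f, Car f' p.src p.tgt p.hor)
    (h' : ∀ p ∈ Hom.pieces f', Car f p.src p.tgt p.hor) : f = f' := by
  apply hom_ext
  ext p
  exact ⟨fun hp => mem_of_car (h p hp), fun hp => mem_of_car (h' p hp)⟩

/-- Pulling back the second sub-map along the first shuffle is what one does to follow a part
through both morphisms; `sq_exists` and `sq_unique` translate between the two. -/
lemma car_comp {r : C.Hor w z} : Car (f ≫ g) i k r ↔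
    ∃ j y, ∃ t : C.Hor w y, ∃ t' : C.Hor y z, Car f i j t ∧ Car g j k t' ∧ r = C.hcomp t t' := by
  constructor
  · rintro ⟨_, ⟨p, hp, q, hq, e, x, t, ht, rfl⟩, rfl, rfl, hs⟩
    simp only at hs
    obtain ⟨y, t1, h1⟩ := sq_exists' t (C.sq_left hs)
    obtain ⟨z', t2, h2⟩ := sq_exists' q.hor (C.sq_right h1)
    have := sq_unique' hs (C.sq_hcomp h1 h2)
    obtain rfl : z = z' := congrArg Sigma.fst this
    obtain rfl : r = _ := eq_of_heq (Sigma.mk.inj this).2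
    exact ⟨p.tgt, y, t1, t2, ⟨p, hp, rfl, rfl, C.sq_trans h1 ht⟩, ⟨q, hq, e.symm, rfl, h2⟩, rfl⟩
  · rintro ⟨j, y, t, t', ⟨p, hp, rfl, rfl, hs⟩, ⟨q, hq, e, rfl, hs'⟩, rfl⟩
    obtain ⟨x, t0, h0⟩ := C.sq_exists p.hor (e ▸ Hom.dom_le g q hq : q.dom ≤ p.tgt.2)
    exact ⟨_, ⟨p, hp, q, hq, e.symm, x, t0, h0, rfl⟩, rfl, rfl,
      C.sq_hcomp (sq_of_le hs h0 (C.sq_left hs')) hs'⟩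

/-- Pieces over one member are disjoint, so at most one contains the given part: `Car` is a partial
function. -/
lemma Car.unique {j' : ℕ × C.P} {z' : C.P} {t : C.Hor w z} {t' : C.Hor w z'} (h : Car f i j t)
    (h' : Car f i j' t') : j = j' ∧ (⟨z, t⟩ : Σ z, C.Hor w z) = ⟨z', t'⟩ := by
  obtain ⟨p, hp, rfl, rfl, hs⟩ := h
  obtain ⟨q, hq, e, rfl, hs'⟩ := h'
  obtain rfl := piece_eq hp hq e.symm (C.sq_left hs) (C.sq_left hs')
  exact ⟨rfl, sq_unique' hs hs'⟩

lemma car_comp_iff {t : C.Hor w y} (h : Car f i j t) {r : C.Hor y z} :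
    Car (f ≫ g) i k (C.hcomp t r) ↔ Car g j k r := by
  rw [car_comp]
  constructor
  · rintro ⟨j', y', s, s', h1, h2, e⟩
    obtain ⟨rfl, e'⟩ := h.unique h1
    cases e'
    rwa [hcomp_left_cancel e]
  · intro hr
    exact ⟨j, y, t, r, h, hr, rfl⟩

lemma Car.comp {t : C.Hor w y} {r : C.Hor y z} (h : Car f i j t) (h' : Car g j k r) :
    Car (f ≫ g) i k (C.hcomp t r) := (car_comp_iff h).2 h'

/-- Horizontal morphisms are invertible, so a known first step can be cancelled from a composite. -/
lemma car_comp_iff' {t : C.Hor w y} (h : Car f i j t) {r : C.Hor w z} :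
    Car (f ≫ g) i k r ↔ Car g j k (C.hcomp (C.hinv t) r) := by
  rw [← car_comp_iff h, hcomp_inv_cancel]

lemma dom_comp {r : C.Hor w y} (h : Car f i j r) : Dom (f ≫ g) i w ↔ Dom g j y := by
  constructor
  · intro h1
    obtain ⟨k, z, t, ht⟩ := h1.exists_car
    exact ((car_comp_iff' h).1 ht).dom
  · intro h1
    obtain ⟨k, z, t, ht⟩ := h1.exists_car
    exact (h.comp ht).dom

lemma dom_of_dom_comp (h : Dom (f ≫ g) i w) : Dom f i w := by
  obtain ⟨k, z, t, ht⟩ := h.exists_car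
  obtain ⟨j, y, t, t', h1, -⟩ := car_comp.1 ht
  exact h1.dom

/-- Pulling back a part of the image. -/
lemma exists_car_of_mem_im (h : j ∈ im f) (hw : w ≤ j.2) :
    ∃ i x, ∃ t : C.Hor x w, Car f i j t := by
  obtain ⟨p, hp, rfl⟩ := h
  obtain ⟨x, t, ht⟩ := C.sq_exists p.hor hw
  exact ⟨p.src, x, t, p, hp, rfl, rfl, ht⟩

/-- The pieces of a morphism are injective on the indices of the target. -/
def Inj (f : A ⟶ B) : Prop := ∀ p ∈ Hom.pieces f, ∀ q ∈ Hom.pieces f, p.tgt = q.tgt → p = q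

lemma Inj.unique (hf : Inj f) {i' : ℕ × C.P} {w' : C.P} {t : C.Hor w z} {t' : C.Hor w' z}
    (h : Car f i j t) (h' : Car f i' j t') : i = i' ∧ (⟨w, t⟩ : Σ x, C.Hor x z) = ⟨w', t'⟩ := by
  obtain ⟨p, hp, rfl, rfl, hs⟩ := h
  obtain ⟨q, hq, rfl, e, hs'⟩ := h'
  obtain rfl := hf p hp q hq e.symm
  exact ⟨rfl, C.sq_unique hs hs'⟩

lemma Inj.src_unique (hf : Inj f) {i' : ℕ × C.P} {w' z' : C.P} {t : C.Hor w z} {t' : C.Hor w' z'}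
    (h : Car f i j t) (h' : Car f i' j t') : i = i' := by
  obtain ⟨p, hp, rfl, rfl, hs⟩ := h
  obtain ⟨q, hq, rfl, e, hs'⟩ := h'
  obtain rfl := hf p hp q hq e.symm
  rfl

/-- Morphisms are jointly epic if their images cover the target. -/
lemma eq_of_jointly_surjective {A' : SC C} {f' : A' ⟶ B} (hB : ∀ j ∈ B.carrier, j ∈ im f ∨ j ∈ im f')
    {m m' : B ⟶ E} (h : f ≫ m = f ≫ m') (h' : f' ≫ m = f' ≫ m') : m = m' := by
  -- The domain of a piece starting in the image of `f` is pulled back along `f`, where the two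
  -- composites agree, and the first step is cancelled.
  have key : ∀ {m m' : B ⟶ E} {A : SC C} {f : A ⟶ B}, f ≫ m = f ≫ m' → ∀ p ∈ Hom.pieces m,
      p.src ∈ im f → Car m' p.src p.tgt p.hor := by
    intro m m' A f h p hp hs
    obtain ⟨i, x, t, ht⟩ := exists_car_of_mem_im hs (Hom.dom_le m p hp)
    rw [← car_comp_iff ht, ← h, car_comp_iff ht]
    exact car_self hp
  refine hom_ext_of_car (fun p hp => ?_) fun p hp => ?_
  · rcases hB _ (Hom.src_mem m p hp) with hs | hs
    · exact key h p hp hs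
    · exact key h' p hp hs
  · rcases hB _ (Hom.src_mem m' p hp) with hs | hs
    · exact key h.symm p hp hs
    · exact key h'.symm p hp hs

/-! ### Pushouts along cofibrations -/

/-- An explicit description of the pushout squares along a cofibration `f : A → B`: the members of
`B'` outside the image of `A'` are those of `B` outside the image of `A`, and the parts of `A'` lying
in the domain of `A' → B'` are those which pull back to parts of `A` in the domain of `f`. -/
structure Glue {A B A' B' : SC C} (f : A ⟶ B) (g : A ⟶ A') (g' : B ⟶ B') (f' : A' ⟶ B') : Prop where
  comm : f ≫ g' = g ≫ f'
  cof : cof C f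
  inj' : Inj f'
  layered : ∀ p ∈ Hom.pieces g', p.tgt ∈ im f' → p.src ∈ im f
  full : ∀ b ∈ B.carrier, b ∉ im f → Dom g' b b.2
  inj : ∀ p ∈ Hom.pieces g', ∀ q ∈ Hom.pieces g', p.src ∉ im f → q.src ∉ im f → p.tgt = q.tgt → p = q
  surj : ∀ j ∈ B'.carrier, j ∈ im f' ∨ j ∈ im g'
  star : ∀ d ∈ A'.carrier, ∀ w ≤ d.2,
    (∀ i x, ∀ t : C.Hor x w, Car g i d t → Dom f i x) → Dom f' d w

namespace Glue

variable {A B A' B' X : SC C} {f : A ⟶ B} {g : A ⟶ A'} {g' : B ⟶ B'} {f' : A' ⟶ B'}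

/-- The pairs of a piece `s` of a leg of the pushout and a piece `q` of a leg of a cocone that give rise
to a piece of the induced morphism. -/
def descPairs (f : A ⟶ B) (g' : B ⟶ B') (f' : A' ⟶ B') (h : B ⟶ X) (k : A' ⟶ X) :
    Set (Piece C × Piece C) :=
  {e | (e.1 ∈ Hom.pieces f' ∧ e.2 ∈ Hom.pieces k ∨
    (e.1 ∈ Hom.pieces g' ∧ e.1.src ∉ im f) ∧ e.2 ∈ Hom.pieces h) ∧ e.2.src = e.1.src ∧
      e.2.dom ≤ e.1.dom}

/-- A member of the pushout comes from one leg only: `layered` keeps the pieces of `g'` that start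
outside `im f` away from `im f'`, and `inj'` and `inj` leave one piece per target. This makes the
pieces of `desc` disjoint. -/
lemma descPairs_eq (H : Glue f g g' f') {h : B ⟶ X} {k : A' ⟶ X} {e e' : Piece C × Piece C}
    (he : e ∈ descPairs f g' f' h k) (he' : e' ∈ descPairs f g' f' h k) (ht : e.1.tgt = e'.1.tgt) :
    e.1 = e'.1 ∧ ∀ w, w ≤ e.2.dom → w ≤ e'.2.dom → e.2 = e'.2 := by
  obtain ⟨he | he, hs, -⟩ := he <;> obtain ⟨he' | he', hs', -⟩ := he'
  · have := H.inj' _ he.1 _ he'.1 ht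
    exact ⟨this, fun w h1 h2 => piece_eq he.2 he'.2 (by rw [hs, hs', this]) h1 h2⟩
  · exact absurd (H.layered _ he'.1.1 (ht ▸ ⟨_, he.1, rfl⟩)) he'.1.2
  · exact absurd (H.layered _ he.1.1 (ht ▸ ⟨_, he'.1, rfl⟩)) he.1.2
  · have := H.inj _ he.1.1 _ he'.1.1 he.1.2 he'.1.2 ht
    exact ⟨this, fun w h1 h2 => piece_eq he.2 he'.2 (by rw [hs, hs', this]) h1 h2⟩

/-- The morphism out of the pushout induced by a cocone. -/
def desc (H : Glue f g g' f') (h : B ⟶ X) (k : A' ⟶ X) : B' ⟶ X where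
  pieces := {r | ∃ e ∈ descPairs f g' f' h k, ∃ w, ∃ t : C.Hor e.2.dom w, C.Sq t e.1.hor ∧
    r = ⟨e.1.tgt, e.2.tgt, w, C.hcomp (C.hinv t) e.2.hor⟩}
  finite := by
    have hfin : (descPairs f g' f' h k).Finite := by
      refine (((Hom.finite f').union (Hom.finite g')).prod
        ((Hom.finite k).union (Hom.finite h))).subset ?_
      rintro ⟨s, q⟩ ⟨h | h, -, -⟩
      · exact ⟨Or.inl h.1, Or.inl h.2⟩
      · exact ⟨Or.inr h.1.1, Or.inr h.2⟩
    refine (hfin.biUnion (t := fun e => {r | ∃ w, ∃ t : C.Hor e.2.dom w, C.Sq t e.1.hor ∧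
        r = ⟨e.1.tgt, e.2.tgt, w, C.hcomp (C.hinv t) e.2.hor⟩}) fun e _ => ?_).subset ?_
    · refine Set.Subsingleton.finite ?_
      rintro _ ⟨x, t, ht, rfl⟩ _ ⟨y, r, hr, rfl⟩
      cases sq_unique' ht hr
      rfl
    · rintro r ⟨e, he, h⟩
      simp only [Set.mem_iUnion]
      exact ⟨e, he, h⟩
  src_mem := by
    rintro _ ⟨e, ⟨he | he, -, -⟩, w, t, -, rfl⟩
    · exact Hom.tgt_mem f' _ he.1
    · exact Hom.tgt_mem g' _ he.1.1
  tgt_mem := by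
    rintro _ ⟨e, ⟨he | he, -, -⟩, w, t, -, rfl⟩
    · exact Hom.tgt_mem k e.2 he.2
    · exact Hom.tgt_mem h e.2 he.2
  dom_le := by
    rintro _ ⟨e, -, w, t, ht, rfl⟩
    exact C.sq_right ht
  disj := by
    rintro _ ⟨⟨s, q⟩, he, w, t, ht, rfl⟩ _ ⟨⟨s', q'⟩, he', w', t', ht', rfl⟩ hne hs v hv hv'
    obtain ⟨h1, h2⟩ := descPairs_eq H he he' hs
    simp only at h1 h2 ht ht' hv hv' hs t t'
    subst h1
    -- A common part of the two domains pulls back along the common piece `s` to a common part of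
    -- `q.dom` and `q'.dom`, so `q = q'`.
    obtain ⟨a, r, hr⟩ := C.sq_exists t hv
    obtain ⟨a', r', hr'⟩ := C.sq_exists t' hv'
    cases C.sq_unique (C.sq_trans hr ht) (C.sq_trans hr' ht')
    obtain rfl := h2 _ (C.sq_left hr) (C.sq_left hr')
    cases sq_unique' ht ht'
    exact hne rfl

/-- The induced morphism goes back along a leg of the pushout and then along the cocone. -/
lemma car_desc (H : Glue f g g' f') {h : B ⟶ X} {k : A' ⟶ X} {j l : ℕ × C.P} {w z : C.P}
    {τ : C.Hor w z} : Car (H.desc h k) j l τ ↔ ∃ e ∈ descPairs f g' f' h k, e.1.tgt = j ∧ e.2.tgt = l ∧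
      ∃ x, ∃ t : C.Hor x w, C.Sq t e.1.hor ∧ C.Sq (C.hcomp t τ) e.2.hor := by
  constructor
  · rintro ⟨_, ⟨e, he, v, t, ht, rfl⟩, rfl, rfl, hs⟩
    simp only at hs
    obtain ⟨x, r, hr⟩ := C.sq_exists t (C.sq_left hs)
    refine ⟨e, he, rfl, rfl, x, r, C.sq_trans hr ht, ?_⟩
    have := C.sq_hcomp hr hs
    rwa [hcomp_inv_cancel] at this
  · rintro ⟨e, he, rfl, rfl, x, t, ht, ht'⟩
    obtain ⟨v, r, hr⟩ := sq_exists' e.1.hor he.2.2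
    refine ⟨_, ⟨e, he, v, r, hr, rfl⟩, rfl, rfl, ?_⟩
    have := C.sq_hcomp (sq_inv (sq_of_le' ht hr (C.sq_left ht'))) ht'
    rwa [← C.hassoc, C.inv_hcomp, C.id_hcomp] at this

/-- This is where `star` is used: since the cocone commutes, every preimage under `g` of the domain
of a piece of `k` lies in the domain of `f`, so `f'` is defined on the whole domain of that piece.
-/
lemma fac_right (H : Glue f g g' f') {h : B ⟶ X} {k : A' ⟶ X} (e : f ≫ h = g ≫ k) :
    f' ≫ H.desc h k = k := by
  refine hom_ext_of_car (fun p hp => ?_) fun κ hκ => ?_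
  · obtain ⟨j, y, t, t', h1, h2, hh⟩ := car_comp.1 (car_self hp)
    obtain ⟨⟨s, q⟩, ⟨he | he, hs, -⟩, rfl, ht, x, t0, h0, h0'⟩ := H.car_desc.1 h2
    · obtain ⟨h3, h4⟩ := H.inj'.unique h1 (⟨s, he.1, rfl, rfl, h0⟩ : Car f' s.src s.tgt t0)
      cases h4
      rw [hh]
      exact ⟨q, he.2, hs.trans h3.symm, ht, h0'⟩
    · exact absurd (H.layered _ he.1.1 h1.mem_im) he.1.2
  · have hd : Dom f' κ.src κ.dom := by
      refine H.star _ (Hom.src_mem k κ hκ) _ (Hom.dom_le k κ hκ) fun i x τ hτ => ?_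
      have := hτ.comp (car_self hκ)
      rw [← e] at this
      exact dom_of_dom_comp this.dom
    obtain ⟨s, hs, hs', hle⟩ := hd
    obtain ⟨y, t, ht⟩ := sq_exists' s.hor hle
    rw [car_comp_iff' ⟨s, hs, hs', rfl, ht⟩, H.car_desc]
    refine ⟨(s, κ), ⟨Or.inl ⟨hs, hκ⟩, hs'.symm, hle⟩, rfl, rfl, _, t, ht, ?_⟩
    rw [hcomp_inv_cancel]
    exact C.sq_refl _

/-- By commutativity the common target lies in the image of `f'`, and `layered` applies. -/
lemma src_mem_of_tgt_mem (H : Glue f g g' f') {p q : Piece C} (hp : p ∈ Hom.pieces g')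
    (hq : q ∈ Hom.pieces g') (h : p.tgt = q.tgt) (hs : p.src ∈ im f) : q.src ∈ im f := by
  refine H.layered q hq ?_
  rw [← h]
  refine im_comp_subset g _ ?_
  rw [← H.comm]
  exact tgt_mem_im_comp hp hs

/-- Over `im f` everything can be pulled back to `A`, where the claim reduces to the other leg.
Outside `im f`, the clauses `full` and `inj` say that `g'` embeds the members of `B` whole. -/
lemma fac_left (H : Glue f g g' f') {h : B ⟶ X} {k : A' ⟶ X} (e : f ≫ h = g ≫ k) :
    g' ≫ H.desc h k = h := by
  refine hom_ext_of_car (fun p hp => ?_) fun p hp => ?_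
  · obtain ⟨j, y, t, t', h1, h2, hh⟩ := car_comp.1 (car_self hp)
    obtain ⟨⟨s, q⟩, ⟨he | he, hs, -⟩, rfl, ht, x, t0, h0, h0'⟩ := H.car_desc.1 h2
    · have hsj : s.tgt ∈ im f' := ⟨s, he.1, rfl⟩
      have hpf : p.src ∈ im f := by
        obtain ⟨ρ, hρ, hρ', hρ'', -⟩ := h1
        rw [← hρ']
        exact H.layered ρ hρ (hρ'' ▸ hsj)
      obtain ⟨i, a, r, hr⟩ := exists_car_of_mem_im hpf (Hom.dom_le _ p hp)
      rw [← car_comp_iff hr, e]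
      have h3 := hr.comp h1
      rw [H.comm] at h3
      obtain ⟨d, y', τ, τ', h4, h5, h6⟩ := car_comp.1 h3
      obtain ⟨rfl, h7⟩ := H.inj'.unique h5 (⟨s, he.1, rfl, rfl, h0⟩ : Car f' s.src s.tgt t0)
      cases h7
      have := h4.comp (⟨q, he.2, hs, ht, h0'⟩ : Car k _ p.tgt _)
      rwa [← C.hassoc, ← h6, C.hassoc, ← hh] at this
    · obtain ⟨ρ, hρ, hρ', hρ'', hρs⟩ := h1
      simp only at hρ''
      have hpf : ρ.src ∉ im f := fun h' => he.1.2 (H.src_mem_of_tgt_mem hρ he.1.1 hρ'' h')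
      obtain rfl := H.inj ρ hρ s he.1.1 hpf he.1.2 hρ''
      cases C.sq_unique hρs h0
      rw [hh]
      exact ⟨q, he.2, hs.trans hρ', ht, h0'⟩
  · by_cases hb : p.src ∈ im f
    · obtain ⟨i, a, r, hr⟩ := exists_car_of_mem_im hb (Hom.dom_le _ p hp)
      rw [← car_comp_iff hr, ← Category.assoc, H.comm, Category.assoc, H.fac_right e, ← e,
        car_comp_iff hr]
      exact car_self hp
    · obtain ⟨s, hs, hs', hle⟩ := (H.full _ (Hom.src_mem h p hp) hb).of_le (Hom.dom_le h p hp)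
      obtain ⟨y, t, ht⟩ := sq_exists' s.hor hle
      rw [car_comp_iff' ⟨s, hs, hs', rfl, ht⟩, H.car_desc]
      refine ⟨(s, p), ⟨Or.inr ⟨⟨hs, hs' ▸ hb⟩, hp⟩, hs'.symm, hle⟩, rfl, rfl, _, t, ht, ?_⟩
      rw [hcomp_inv_cancel]
      exact C.sq_refl _

lemma isPushout (H : Glue f g g' f') : IsPushout f g g' f' :=
  ⟨⟨H.comm⟩, ⟨Limits.PushoutCocone.IsColimit.mk _ (fun s => H.desc s.inl s.inr)
    (fun s => H.fac_left s.condition) (fun s => H.fac_right s.condition) fun s _ h1 h2 =>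
      eq_of_jointly_surjective H.surj (h2.trans (H.fac_right s.condition).symm)
        (h1.trans (H.fac_left s.condition).symm)⟩⟩

end Glue

/-! ### Isomorphisms -/

lemma car_id {i j : ℕ × C.P} {w z : C.P} {t : C.Hor w z} : Car (𝟙 A) i j t ↔
    i ∈ A.carrier ∧ i = j ∧ w ≤ i.2 ∧ (⟨w, C.hid w⟩ : Σ z, C.Hor w z) = ⟨z, t⟩ := by
  constructor
  · rintro ⟨_, ⟨l, hl, rfl⟩, rfl, rfl, hs⟩
    exact ⟨hl, rfl, C.sq_left hs, sq_unique' (C.sq_hid (C.sq_left hs)) hs⟩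
  · rintro ⟨hi, rfl, h, e⟩
    cases e
    exact ⟨_, ⟨i, hi, rfl⟩, rfl, rfl, C.sq_hid h⟩

lemma dom_of_isIso (f : A ⟶ B) [IsIso f] {i : ℕ × C.P} (hi : i ∈ A.carrier) : Dom f i i.2 := by
  apply dom_of_dom_comp (g := CategoryTheory.inv f)
  rw [IsIso.hom_inv_id]
  exact (car_id.2 ⟨hi, rfl, le_rfl, rfl⟩ : Car _ i i (C.hid i.2)).dom

/-- The identity `inv ≫ f = 𝟙` shows that the inverse is defined on each whole member of `B` and
that the member is hit. Two pieces of `f` with the same target become identity pieces after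
composition with the inverse, so they agree. -/
lemma weq_of_isIso (f : A ⟶ B) (hf : IsIso f) : weq C f := by
  have hB : ∀ j ∈ B.carrier, ∃ i w, ∃ t : C.Hor j.2 w, Car (CategoryTheory.inv f) j i t ∧ j ∈ im f := by
    intro j hj
    have : Car (CategoryTheory.inv f ≫ f) j j (C.hid j.2) := by
      rw [IsIso.inv_hom_id]
      exact car_id.2 ⟨hj, rfl, le_rfl, rfl⟩
    obtain ⟨i, w, t, t', h1, h2, -⟩ := car_comp.1 this
    exact ⟨i, w, t, h1, h2.mem_im⟩
  refine ⟨⟨fun i hi => ?_, fun p hp q hq h => ?_⟩, fun j hj => (hB j hj).choose_spec.choose_spec.choose_spec.2⟩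
  · obtain ⟨p, hp, hs, hle⟩ := dom_of_isIso f hi
    exact C.J.superset_covering (fun w g _ => ⟨_, ⟨p, hp, hs, rfl⟩, g.le.trans hle⟩) (C.J.top_mem _)
  · obtain ⟨ps, ⟨pn, pt⟩, pd, ph⟩ := p
    obtain ⟨qs, ⟨qn, qt⟩, qd, qh⟩ := q
    simp only at h
    cases h
    obtain ⟨i, w, t, h1, -⟩ := hB (pn, pt) (Hom.tgt_mem f _ hp)
    have h2 := (car_self hp).comp h1
    have h3 := (car_self hq).comp h1
    simp only [IsIso.hom_inv_id, car_id] at h2 h3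
    obtain ⟨-, rfl, -, h4⟩ := h2
    obtain ⟨-, rfl, -, h5⟩ := h3
    obtain rfl : pd = w := congrArg Sigma.fst h4
    obtain rfl : qd = pd := congrArg Sigma.fst h5
    have h6 : C.hcomp ph t = C.hcomp qh t :=
      (eq_of_heq (Sigma.mk.inj h4).2).symm.trans (eq_of_heq (Sigma.mk.inj h5).2)
    have h7 : ph = qh := by
      rw [← C.hcomp_id ph, ← C.hcomp_inv t, ← C.hassoc, h6, C.hassoc, C.hcomp_inv, C.hcomp_id]
    rw [h7]

/-! ### Existence of pushouts along cofibrations -/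

/-- The parts of `a` satisfying `S` are those below a member of a finite disjoint family. -/
def Refinable (a : C.P) (S : C.P → Prop) : Prop :=
  ∃ X : Set C.P, X.Finite ∧ (∀ e ∈ X, e ≤ a ∧ S e) ∧ (∀ e ∈ X, ∀ e' ∈ X, e ≠ e' → Disj e e') ∧
    ∀ w ≤ a, S w → ∃ e ∈ X, w ≤ e

lemma refinable_top (a : C.P) : Refinable a fun _ => True :=
  ⟨{a}, Set.finite_singleton a, by rintro _ rfl; exact ⟨le_rfl, trivial⟩,
    by rintro _ rfl _ rfl h; exact absurd rfl h, fun w h _ => ⟨a, rfl, h⟩⟩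

/-- The pairwise meets of the two families serve; they exist where needed because both families lie
below `a`. -/
lemma Refinable.and {a : C.P} {S T : C.P → Prop} (hS : Refinable a S) (hT : Refinable a T)
    (dS : ∀ x y, x ≤ y → y ≤ a → S y → S x) (dT : ∀ x y, x ≤ y → y ≤ a → T y → T x) :
    Refinable a fun w => S w ∧ T w := by
  obtain ⟨X, hX, h1, h2, h3⟩ := hS
  obtain ⟨Y, hY, k1, k2, k3⟩ := hT
  have glb : ∀ {x y}, x ∈ X → y ∈ Y → (∃ w, w ≤ x ∧ w ≤ y) → IsGLB {x, y} (Filtered.glb x y) :=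
    fun hx hy ⟨w, h, h'⟩ => Filtered.glb_spec (h1 _ hx).1 (k1 _ hy).1 h h'
  refine ⟨{z | ∃ x ∈ X, ∃ y ∈ Y, (∃ w, w ≤ x ∧ w ≤ y) ∧ z = Filtered.glb x y}, ?_, ?_, ?_, ?_⟩
  · refine ((hX.prod hY).image fun z => Filtered.glb z.1 z.2).subset ?_
    rintro _ ⟨x, hx, y, hy, -, rfl⟩
    exact ⟨(x, y), ⟨hx, hy⟩, rfl⟩
  · rintro _ ⟨x, hx, y, hy, hw, rfl⟩
    have hx' := (glb hx hy hw).1 (Set.mem_insert _ _)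
    have hy' := (glb hx hy hw).1 (Set.mem_insert_of_mem _ rfl)
    exact ⟨hx'.trans (h1 _ hx).1, dS _ _ hx' (h1 _ hx).1 (h1 _ hx).2,
      dT _ _ hy' (k1 _ hy).1 (k1 _ hy).2⟩
  · rintro _ ⟨x, hx, y, hy, hw, rfl⟩ _ ⟨x', hx', y', hy', hw', rfl⟩ hne v hv hv'
    have e1 : x = x' := by
      by_contra hn
      exact h2 x hx x' hx' hn v (hv.trans ((glb hx hy hw).1 (Set.mem_insert _ _)))
        (hv'.trans ((glb hx' hy' hw').1 (Set.mem_insert _ _)))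
    have e2 : y = y' := by
      by_contra hn
      exact k2 y hy y' hy' hn v (hv.trans ((glb hx hy hw).1 (Set.mem_insert_of_mem _ rfl)))
        (hv'.trans ((glb hx' hy' hw').1 (Set.mem_insert_of_mem _ rfl)))
    exact hne (by rw [e1, e2])
  · rintro w hw ⟨hs, ht⟩
    obtain ⟨x, hx, hwx⟩ := h3 w hw hs
    obtain ⟨y, hy, hwy⟩ := k3 w hw ht
    refine ⟨_, ⟨x, hx, y, hy, ⟨w, hwx, hwy⟩, rfl⟩, (glb hx hy ⟨w, hwx, hwy⟩).2 ?_⟩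
    rintro z (rfl | rfl)
    exacts [hwx, hwy]

lemma Refinable.forall {ι : Type*} {a : C.P} {S : ι → C.P → Prop} {Q : Set ι} (hQ : Q.Finite)
    (hS : ∀ q ∈ Q, Refinable a (S q)) (dS : ∀ q ∈ Q, ∀ x y, x ≤ y → y ≤ a → S q y → S q x) :
    Refinable a fun w => ∀ q ∈ Q, S q w := by
  induction Q, hQ using Set.Finite.induction_on with
  | empty => simpa using refinable_top a
  | @insert q Q _ _ ih =>
    have h := Refinable.and (hS q (Set.mem_insert _ _)) (ih (fun q hq => hS q (Set.mem_insert_of_mem _ hq))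
      fun q hq => dS q (Set.mem_insert_of_mem _ hq)) (dS q (Set.mem_insert _ _))
        (fun x y hxy ha h r hr => dS r (Set.mem_insert_of_mem _ hr) x y hxy ha (h r hr))
    simpa only [Set.mem_insert_iff, forall_eq_or_imp] using h

/-- The parts of the target of `q` which pull back into the domain of `f`. -/
def PullDom (f : A ⟶ B) (q : Piece C) (w : C.P) : Prop :=
  ∀ x, ∀ t : C.Hor x w, C.Sq t q.hor → Dom f q.src x

lemma PullDom.of_le {f : A ⟶ B} {q : Piece C} {x y : C.P} (h : x ≤ y) (hy : PullDom f q y)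
    (hq : y ≤ q.tgt.2) : PullDom f q x := by
  intro v t ht
  obtain ⟨v', t', ht'⟩ := C.sq_exists q.hor hq
  exact (hy v' t' ht').of_le (C.sq_left (sq_of_le ht ht' h))

/-- The largest such parts are the images under `q.hor` of the meets of `q.dom` with the domains of
the pieces of `f` over the same member. -/
lemma refinable_pullDom (f : A ⟶ B) {A' : SC C} {g : A ⟶ A'} {q : Piece C} (hq : q ∈ Hom.pieces g) :
    Refinable q.tgt.2 (PullDom f q) := by
  have glb : ∀ {p : Piece C}, p ∈ Hom.pieces f → p.src = q.src → (∃ v, v ≤ p.dom ∧ v ≤ q.dom) →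
      IsGLB {p.dom, q.dom} (Filtered.glb p.dom q.dom) := fun hp hs ⟨v, h, h'⟩ =>
    Filtered.glb_spec (hs ▸ Hom.dom_le f _ hp) (Hom.dom_le g q hq) h h'
  refine ⟨{z | ∃ p ∈ Hom.pieces f, p.src = q.src ∧ (∃ v, v ≤ p.dom ∧ v ≤ q.dom) ∧
    ∃ t : C.Hor (Filtered.glb p.dom q.dom) z, C.Sq t q.hor}, ?_, ?_, ?_, ?_⟩
  · refine ((Hom.finite f).biUnion (t := fun p => {z | ∃ t : C.Hor (Filtered.glb p.dom q.dom) z,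
      C.Sq t q.hor}) fun p _ => ?_).subset ?_
    · refine Set.Subsingleton.finite ?_
      rintro z ⟨t, ht⟩ z' ⟨t', ht'⟩
      exact congrArg Sigma.fst (sq_unique' ht ht')
    · rintro z ⟨p, hp, -, -, h⟩
      simp only [Set.mem_iUnion]
      exact ⟨p, hp, h⟩
  · rintro z ⟨p, hp, hs, hv, t, ht⟩
    refine ⟨C.sq_right ht, fun x t' ht' => ?_⟩
    cases C.sq_unique ht ht'
    exact ⟨p, hp, hs, (glb hp hs hv).1 (Set.mem_insert _ _)⟩
  · rintro z ⟨p, hp, hs, hv, t, ht⟩ z' ⟨p', hp', hs', hv', t', ht'⟩ hne v h h'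
    obtain ⟨a, r, hr⟩ := C.sq_exists t h
    obtain ⟨a', r', hr'⟩ := C.sq_exists t' h'
    cases C.sq_unique (C.sq_trans hr ht) (C.sq_trans hr' ht')
    obtain rfl := piece_eq hp hp' (hs.trans hs'.symm)
      ((C.sq_left hr).trans ((glb hp hs hv).1 (Set.mem_insert _ _)))
      ((C.sq_left hr').trans ((glb hp' hs' hv').1 (Set.mem_insert _ _)))
    exact hne (congrArg Sigma.fst (sq_unique' ht ht'))
  · intro w hw h
    obtain ⟨x, t, ht⟩ := C.sq_exists q.hor hw
    obtain ⟨p, hp, hs, hle⟩ := h x t ht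
    have hG := glb hp hs ⟨x, hle, C.sq_left ht⟩
    obtain ⟨z, r, hr⟩ := sq_exists' q.hor (hG.1 (Set.mem_insert_of_mem _ rfl))
    refine ⟨z, ⟨p, hp, hs, ⟨x, hle, C.sq_left ht⟩, r, hr⟩, C.sq_right (sq_of_le' ht hr (hG.2 ?_))⟩
    rintro y (rfl | rfl)
    exacts [hle, C.sq_left ht]

end SC
end PolytopeComplex

namespace PolytopeComplex

variable {C D : PolytopeComplex.{u, v}}

namespace SC

variable {A B E A' B' : SC C}

/-- These are the parts of `d` on which the clause `star` of `Glue` requires the cobase change of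
`f` to be defined. The finite family obtained here provides the members of the pushout that come
from `d`. -/
lemma exists_refinement (f : A ⟶ B) (g : A ⟶ A') (d : ℕ × C.P) : Refinable d.2 fun w =>
    ∀ q ∈ {q | q ∈ Hom.pieces g ∧ q.tgt = d}, PullDom f q w :=
  Refinable.forall ((Hom.finite g).subset fun _ h => h.1)
    (by rintro q ⟨hq, rfl⟩; exact refinable_pullDom f hq)
    (by rintro q ⟨-, rfl⟩ x y h h' hy; exact hy.of_le h h')

/-- The piece from the target of `p` to the part `e` of the target of `q`, labelled by `m`, that is
defined on the part of the source of `p` and `q` which `q` carries to `e`. -/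
def crossPieces (p q : Piece C) (m : ℕ) (e : C.P) : Set (Piece C) :=
  {r | ∃ x, ∃ t : C.Hor x e, ∃ y, ∃ s : C.Hor x y, C.Sq t q.hor ∧ C.Sq s p.hor ∧
    r = ⟨p.tgt, (m, e), y, C.hcomp (C.hinv s) t⟩}

lemma crossPieces_subsingleton (p q : Piece C) (m : ℕ) (e : C.P) :
    (crossPieces p q m e).Subsingleton := by
  rintro _ ⟨x, t, y, s, h1, h2, rfl⟩ _ ⟨x', t', y', s', h1', h2', rfl⟩
  cases C.sq_unique h1 h1'
  cases sq_unique' h2 h2'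
  rfl

/-- Every cofibration can be pushed out. -/
lemma exists_glue (f : A ⟶ B) (g : A ⟶ A') (hf : cof C f) :
    ∃ (B' : SC C) (g' : B ⟶ B') (f' : A' ⟶ B'), Glue f g g' f' := by
  choose X hX hXle hXd hXc using fun d => exists_refinement f g d
  -- All members of the pushout receive distinct labels, which makes its separation condition
  -- vacuous. The labels come from an injection of the finite index set `K` into the natural
  -- numbers.
  obtain ⟨l, m, hll, hrr, hlr⟩ : ∃ (l : ℕ × C.P → C.P → ℕ) (m : ℕ × C.P → ℕ),
      (∀ {d d' e e'}, d ∈ A'.carrier → d' ∈ A'.carrier → e ∈ X d → e' ∈ X d' → l d e = l d' e' →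
        d = d' ∧ e = e') ∧
      (∀ {b b'}, b ∈ B.carrier → b' ∈ B.carrier → m b = m b' → b = b') ∧
      (∀ {d e b}, d ∈ A'.carrier → e ∈ X d → b ∈ B.carrier → l d e ≠ m b) := by
    let K : Set (((ℕ × C.P) × C.P) ⊕ (ℕ × C.P)) :=
      {κ | (∃ d ∈ A'.carrier, ∃ e ∈ X d, κ = Sum.inl (d, e)) ∨ ∃ b ∈ B.carrier, κ = Sum.inr b}
    have hK : K.Finite := by
      have h1 : (⋃ d ∈ A'.carrier, (fun e => (Sum.inl (d, e) :
          ((ℕ × C.P) × C.P) ⊕ (ℕ × C.P))) '' X d).Finite :=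
        A'.finite.biUnion fun d _ => (hX d).image _
      refine (h1.union (B.finite.image Sum.inr)).subset ?_
      rintro κ (⟨d, hd, e, he, rfl⟩ | ⟨b, hb, rfl⟩)
      · left
        simp only [Set.mem_iUnion]
        exact ⟨d, hd, e, he, rfl⟩
      · exact Or.inr ⟨b, hb, rfl⟩
    obtain ⟨ν, hν⟩ := Set.countable_iff_exists_injOn.1 hK.countable
    refine ⟨fun d e => ν (Sum.inl (d, e)), fun b => ν (Sum.inr b), ?_, ?_, ?_⟩
    · intro d d' e e' hd hd' he he' h
      cases hν (Or.inl ⟨d, hd, e, he, rfl⟩) (Or.inl ⟨d', hd', e', he', rfl⟩) h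
      exact ⟨rfl, rfl⟩
    · intro b b' hb hb' h
      cases hν (Or.inr ⟨b, hb, rfl⟩) (Or.inr ⟨b', hb', rfl⟩) h
      rfl
    · intro d e b hd he hb h
      cases hν (Or.inl ⟨d, hd, e, he, rfl⟩) (Or.inr ⟨b, hb, rfl⟩) h
  obtain ⟨B', hB'⟩ : ∃ B' : SC C, B'.carrier = {j | (∃ d ∈ A'.carrier, ∃ e ∈ X d, j = (l d e, e)) ∨
      ∃ b ∈ B.carrier, b ∉ im f ∧ j = (m b, b.2)} := ⟨
    { carrier := {j | (∃ d ∈ A'.carrier, ∃ e ∈ X d, j = (l d e, e)) ∨ ∃ b ∈ B.carrier, b ∉ im f ∧ j = (m b, b.2)}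
      finite := by
        refine ((A'.finite.biUnion (t := fun d => (fun e => (l d e, e)) '' X d)
          fun d _ => (hX d).image _).union (B.finite.image fun b => (m b, b.2))).subset ?_
        rintro _ (⟨d, hd, e, he, rfl⟩ | ⟨b, hb, h, rfl⟩)
        · left
          simp only [Set.mem_iUnion]
          exact ⟨d, hd, e, he, rfl⟩
        · exact Or.inr ⟨b, hb, rfl⟩
      sep := by
        rintro _ (⟨d, hd, e, he, rfl⟩ | ⟨b, hb, h, rfl⟩) _ (⟨d', hd', e', he', rfl⟩ | ⟨b', hb', h', rfl⟩)
          hne hl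
        · obtain ⟨rfl, rfl⟩ := hll hd hd' he he' hl
          exact absurd rfl hne
        · exact absurd hl (hlr hd he hb')
        · exact absurd hl.symm (hlr hd' he' hb)
        · obtain rfl := hrr hb hb' hl
          exact absurd rfl hne }, rfl⟩
  -- The cobase change of `f` restricts each member `d` to its parts `e ∈ X d`.
  obtain ⟨f', hfp⟩ : ∃ f' : A' ⟶ B', Hom.pieces f' =
      {r | ∃ d ∈ A'.carrier, ∃ e ∈ X d, r = ⟨d, (l d e, e), e, C.hid e⟩} := ⟨
    { pieces := {r | ∃ d ∈ A'.carrier, ∃ e ∈ X d, r = ⟨d, (l d e, e), e, C.hid e⟩}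
      finite := by
        refine (A'.finite.biUnion (t := fun d => (fun e => (⟨d, (l d e, e), e, C.hid e⟩ : Piece C)) '' X d)
          fun d _ => (hX d).image _).subset ?_
        rintro r ⟨d, hd, e, he, rfl⟩
        simp only [Set.mem_iUnion]
        exact ⟨d, hd, e, he, rfl⟩
      src_mem := by rintro _ ⟨d, hd, e, he, rfl⟩; exact hd
      tgt_mem := by rintro _ ⟨d, hd, e, he, rfl⟩; rw [hB']; exact Or.inl ⟨d, hd, e, he, rfl⟩
      dom_le := by rintro _ ⟨d, hd, e, he, rfl⟩; exact (hXle d e he).1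
      disj := by
        rintro _ ⟨d, hd, e, he, rfl⟩ _ ⟨d', hd', e', he', rfl⟩ hne h
        obtain rfl : d = d' := h
        exact hXd d e he e' he' (by rintro rfl; exact hne rfl) }, rfl⟩
  -- Outside `im f` the members of `B` are kept whole. On the target of a piece `p` of `f` the
  -- morphism goes back along `p`, then forward along the pieces of `g` over the same member, onto
  -- the parts in `X`.
  obtain ⟨g', hgp⟩ : ∃ g' : B ⟶ B', Hom.pieces g' =
      {r | (∃ b ∈ B.carrier, b ∉ im f ∧ r = ⟨b, (m b, b.2), b.2, C.hid b.2⟩) ∨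
        ∃ p ∈ Hom.pieces f, ∃ q ∈ Hom.pieces g, p.src = q.src ∧ ∃ e ∈ X q.tgt, ∃ x, ∃ t : C.Hor x e,
          ∃ y, ∃ s : C.Hor x y, C.Sq t q.hor ∧ C.Sq s p.hor ∧
            r = ⟨p.tgt, (l q.tgt e, e), y, C.hcomp (C.hinv s) t⟩} := ⟨
    { pieces := {r | (∃ b ∈ B.carrier, b ∉ im f ∧ r = ⟨b, (m b, b.2), b.2, C.hid b.2⟩) ∨
        ∃ p ∈ Hom.pieces f, ∃ q ∈ Hom.pieces g, p.src = q.src ∧ ∃ e ∈ X q.tgt, ∃ x, ∃ t : C.Hor x e,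
          ∃ y, ∃ s : C.Hor x y, C.Sq t q.hor ∧ C.Sq s p.hor ∧
            r = ⟨p.tgt, (l q.tgt e, e), y, C.hcomp (C.hinv s) t⟩}
      finite := by
        have h1 : (⋃ p ∈ Hom.pieces f, ⋃ q ∈ Hom.pieces g, ⋃ e ∈ X q.tgt,
            crossPieces p q (l q.tgt e) e).Finite :=
          (Hom.finite f).biUnion fun p _ => (Hom.finite g).biUnion fun q _ => (hX _).biUnion fun e _ =>
            (crossPieces_subsingleton p q _ e).finite
        refine ((B.finite.image fun b => (⟨b, (m b, b.2), b.2, C.hid b.2⟩ : Piece C)).union h1).subset ?_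
        rintro r (⟨b, hb, -, rfl⟩ | ⟨p, hp, q, hq, -, e, he, h⟩)
        · exact Or.inl ⟨b, hb, rfl⟩
        · right
          simp only [Set.mem_iUnion]
          exact ⟨p, hp, q, hq, e, he, h⟩
      src_mem := by
        rintro _ (⟨b, hb, -, rfl⟩ | ⟨p, hp, q, hq, -, e, he, x, t, y, s, -, -, rfl⟩)
        exacts [hb, Hom.tgt_mem f p hp]
      tgt_mem := by
        rw [hB']
        rintro _ (⟨b, hb, h, rfl⟩ | ⟨p, hp, q, hq, -, e, he, x, t, y, s, -, -, rfl⟩)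
        exacts [Or.inr ⟨b, hb, h, rfl⟩, Or.inl ⟨_, Hom.tgt_mem g q hq, e, he, rfl⟩]
      dom_le := by
        rintro _ (⟨b, hb, -, rfl⟩ | ⟨p, hp, q, hq, -, e, he, x, t, y, s, -, h, rfl⟩)
        exacts [le_rfl, C.sq_right h]
      disj := by
        rintro _ (⟨b, hb, h, rfl⟩ | ⟨p, hp, q, hq, hs, e, he, x, t, y, s, ht, hs', rfl⟩)
          _ (⟨b', hb', h', rfl⟩ | ⟨p', hp', q', hq', hs1, e', he', x', t', y', s', ht1, hs1', rfl⟩) hne h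
        · obtain rfl : b = b' := h
          exact absurd rfl hne
        · exact absurd ⟨p', hp', h.symm⟩ ‹b ∉ im f›
        · exact absurd ⟨p, hp, h⟩ ‹b' ∉ im f›
        -- A cofibration is injective on indices, so only one `p` leads to a given member of `B`.
        -- What remains is the disjointness of the pieces of `g` and of the parts in `X`.
        · obtain rfl := hf.2 p hp p' hp' h
          rintro v (hv : v ≤ y) (hv' : v ≤ y')
          obtain ⟨a, r, hr⟩ := C.sq_exists s hv
          obtain ⟨a', r', hr'⟩ := C.sq_exists s' hv'
          cases C.sq_unique (C.sq_trans hr hs') (C.sq_trans hr' hs1')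
          obtain rfl := piece_eq hq hq' (hs.symm.trans hs1) ((C.sq_left hr).trans (C.sq_left ht))
            ((C.sq_left hr').trans (C.sq_left ht1))
          obtain ⟨z, τ, hτ⟩ := sq_exists' t (C.sq_left hr)
          obtain ⟨z', τ', hτ'⟩ := sq_exists' t' (C.sq_left hr')
          cases sq_unique' (C.sq_trans hτ ht) (C.sq_trans hτ' ht1)
          have : e = e' := by
            by_contra hn
            exact hXd _ e he e' he' hn _ (C.sq_right hτ) (C.sq_right hτ')
          subst this
          cases C.sq_unique ht ht1
          cases sq_unique' hs' hs1'
          exact hne rfl }, rfl⟩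
  have hfm : ∀ {d}, d ∈ A'.carrier → ∀ {e}, e ∈ X d →
      (⟨d, (l d e, e), e, C.hid e⟩ : Piece C) ∈ Hom.pieces f' :=
    fun hd _ he => by rw [hfp]; exact ⟨_, hd, _, he, rfl⟩
  have hgm : ∀ {b}, b ∈ B.carrier → b ∉ im f →
      (⟨b, (m b, b.2), b.2, C.hid b.2⟩ : Piece C) ∈ Hom.pieces g' :=
    fun hb h => by rw [hgp]; exact Or.inl ⟨_, hb, h, rfl⟩
  have hf' : ∀ {d j w z} {τ : C.Hor w z}, Car f' d j τ → d ∈ A'.carrier ∧ ∃ e ∈ X d, j = (l d e, e) ∧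
      w ≤ e ∧ (⟨w, C.hid w⟩ : Σ z, C.Hor w z) = ⟨z, τ⟩ := by
    rintro d j w z τ ⟨_, h0, rfl, rfl, h⟩
    rw [hfp] at h0
    obtain ⟨d, hd, e, he, rfl⟩ := h0
    exact ⟨hd, e, he, rfl, C.sq_left h, sq_unique' (C.sq_hid (C.sq_left h)) h⟩
  have him : ∀ {j}, j ∈ im f' ↔ ∃ d ∈ A'.carrier, ∃ e ∈ X d, j = (l d e, e) := by
    intro j
    simp only [im, hfp]
    constructor
    · rintro ⟨_, ⟨d, hd, e, he, rfl⟩, rfl⟩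
      exact ⟨d, hd, e, he, rfl⟩
    · rintro ⟨d, hd, e, he, rfl⟩
      exact ⟨_, ⟨d, hd, e, he, rfl⟩, rfl⟩
  refine ⟨B', g', f', ?_, hf, ?_, ?_, ?_, ?_, ?_, ?_⟩
  · refine hom_ext_of_car (fun p hp => ?_) fun p hp => ?_
    · obtain ⟨b, u, r, r', h1, ⟨_, h2, rfl, ht, h3⟩, h4⟩ := car_comp.1 (car_self hp)
      rw [hgp] at h2
      obtain h2 | h2 := h2
      · obtain ⟨b, hb, h, rfl⟩ := h2
        exact absurd h1.mem_im h
      · obtain ⟨p', hp', q, hq, hs, e, he, x, t, y, s, ht', hs', rfl⟩ := h2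
        obtain ⟨p0, hp0, hsrc, htgt, hsq⟩ := h1
        obtain rfl := hf.2 p0 hp0 p' hp' htgt
        have h5 := C.sq_hcomp (sq_of_le hsq hs' (C.sq_left h3)) h3
        rw [hcomp_inv_cancel] at h5
        refine car_comp.2 ⟨q.tgt, p.tgt.2, p.hor, C.hid _, ?_, ?_, (C.hcomp_id _).symm⟩
        · rw [h4]
          exact ⟨q, hq, hs.symm.trans hsrc, rfl, C.sq_trans h5 ht'⟩
        · exact ⟨_, hfm (Hom.tgt_mem g q hq) he, rfl, ht, C.sq_hid (C.sq_right h5)⟩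
    · obtain ⟨d, u, τ, τ', ⟨q, hq, hqs, rfl, hqh⟩, h2, h4⟩ := car_comp.1 (car_self hp)
      obtain ⟨hd, e, he, hj, hle, h3⟩ := hf' h2
      obtain ⟨x, t, ht⟩ := C.sq_exists q.hor (hXle _ e he).1
      -- By the choice of `X` the preimage of `e` under `q` lies in the domain of `f`.
      obtain ⟨p', hp', hs', hle'⟩ := (hXle _ e he).2 q ⟨hq, rfl⟩ x t ht
      obtain ⟨y, s, hs⟩ := sq_exists' p'.hor hle'
      have h5 := sq_of_le hqh ht hle
      obtain ⟨y', s', hss⟩ := sq_exists' s (C.sq_left h5)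
      have h6 := C.sq_hcomp (sq_inv hss) h5
      refine car_comp.2 ⟨p'.tgt, y', s', C.hcomp (C.hinv s') p.hor, ?_, ?_, (hcomp_inv_cancel _ _).symm⟩
      · exact ⟨p', hp', hs'.trans hqs, rfl, C.sq_trans hss hs⟩
      · have h7 : (⟨p'.tgt, (l q.tgt e, e), y, C.hcomp (C.hinv s) t⟩ : Piece C) ∈ Hom.pieces g' := by
          rw [hgp]
          exact Or.inr ⟨p', hp', q, hq, hs', e, he, x, t, y, s, ht, hs, rfl⟩
        refine ⟨_, h7, rfl, hj.symm, ?_⟩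
        rw [h4]
        cases h3
        rwa [C.hcomp_id]
  · unfold Inj
    rw [hfp]
    rintro _ ⟨d, hd, e, he, rfl⟩ _ ⟨d', hd', e', he', rfl⟩ h
    obtain ⟨rfl, rfl⟩ := hll hd hd' he he' (congrArg Prod.fst h)
    rfl
  · rw [hgp]
    rintro _ (⟨b, hb, h, rfl⟩ | ⟨p, hp, q, hq, hs, e, he, x, t, y, s, ht, hs', rfl⟩) h'
    · obtain ⟨d, hd, e, he, h2⟩ := him.1 h'
      exact absurd (congrArg Prod.fst h2).symm (hlr hd he hb)
    · exact ⟨p, hp, rfl⟩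
  · intro b hb h
    exact ⟨_, hgm hb h, rfl, le_rfl⟩
  · rw [hgp]
    rintro _ (⟨b, hb, h, rfl⟩ | ⟨p, hp, q, hq, hs, e, he, x, t, y, s, ht, hs', rfl⟩)
      _ (⟨b', hb', h', rfl⟩ | ⟨p', hp', q', hq', hs1, e', he', x', t', y', s', ht1, hs1', rfl⟩) k k' e
    · obtain rfl := hrr hb hb' (congrArg Prod.fst e)
      rfl
    · exact absurd ⟨p', hp', rfl⟩ k'
    · exact absurd ⟨p, hp, rfl⟩ k
    · exact absurd ⟨p, hp, rfl⟩ k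
  · rw [hB']
    rintro j (⟨d, hd, e, he, rfl⟩ | ⟨b, hb, h, rfl⟩)
    · exact Or.inl (him.2 ⟨d, hd, e, he, rfl⟩)
    · exact Or.inr ⟨_, hgm hb h, rfl⟩
  · intro d hd w hw h
    obtain ⟨e, he, hle⟩ := hXc d w hw (by
      rintro q ⟨hq, rfl⟩ x t ht
      exact h _ _ t ⟨q, hq, rfl, rfl, ht⟩)
    exact ⟨_, hfm hd he, rfl, hle⟩

/-! ### Covering families -/

/-- The domain of `f` covers the member `i`. -/
def CoversAt (f : A ⟶ B) (i : ℕ × C.P) : Prop :=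
  sieveOf {x | ∃ p ∈ Hom.pieces f, p.src = i ∧ p.dom = x} i.2 ∈ C.J i.2

lemma coversAt_of {f : A ⟶ B} {i : ℕ × C.P} {S : Sieve i.2} (hS : S ∈ C.J i.2)
    (h : ∀ w (k : w ⟶ i.2), S k → Dom f i w) : CoversAt f i := by
  refine C.J.superset_covering ?_ hS
  intro w k hk
  obtain ⟨p, hp, hs, hle⟩ := h w k hk
  exact ⟨_, ⟨p, hp, hs, rfl⟩, hle⟩

lemma coversAt_of_dom {f : A ⟶ B} {i : ℕ × C.P} (h : Dom f i i.2) : CoversAt f i :=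
  coversAt_of (C.J.top_mem _) fun _ k _ => h.of_le k.le

lemma dom_of_sieveOf {f : A ⟶ B} {i : ℕ × C.P} {w : C.P}
    (h : ∃ x ∈ {x | ∃ p ∈ Hom.pieces f, p.src = i ∧ p.dom = x}, w ≤ x) : Dom f i w := by
  obtain ⟨_, ⟨p, hp, hs, rfl⟩, hle⟩ := h
  exact ⟨p, hp, hs, hle⟩

/-- If the domain of `f` covers the member `i` of which `q.dom` is a part then the parts of the target
of `q` that pull back into it form a covering family. -/
lemma pullDom_mem {f : A ⟶ B} {q : Piece C} (hq : q.dom ≤ q.src.2) (h : CoversAt f q.src) :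
    ∃ S ∈ C.J q.tgt.2, ∀ w (k : w ⟶ q.tgt.2), S.arrows k → PullDom f q w := by
  refine ⟨_, C.cover_hor (C.hinv q.hor) _ (C.J.pullback_stable (homOfLE hq) h), ?_⟩
  rintro w k ⟨a, ⟨b, t, ⟨l, hl⟩, ht⟩, hle⟩ x r hr
  have h1 := sq_inv ht
  rw [hinv_hinv] at h1
  exact (dom_of_sieveOf hl).of_le (C.sq_left (sq_of_le hr h1 hle))

/-- Each piece of `g` ending at `d` transports the domain of `f` to a covering sieve of `d`. There
are finitely many such pieces, and by `star` the cobase change is defined on the intersection of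
these sieves. -/
lemma Glue.cof_right {f : A ⟶ B} {g : A ⟶ A'} {g' : B ⟶ B'} {f' : A' ⟶ B'} (H : Glue f g g' f') :
    SC.cof C f' := by
  refine ⟨fun d hd => ?_, H.inj'⟩
  have key : ∀ {Q : Set (Piece C)}, Q.Finite → (∀ q ∈ Q, q ∈ Hom.pieces g ∧ q.tgt = d) →
      ∃ S ∈ C.J d.2, ∀ w (k : w ⟶ d.2), S.arrows k → ∀ q ∈ Q, PullDom f q w := by
    intro Q hQ
    induction Q, hQ using Set.Finite.induction_on with
    | empty => exact fun _ => ⟨⊤, C.J.top_mem _, fun _ _ _ _ h => h.elim⟩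
    | @insert q Q _ _ ih =>
      intro h
      obtain ⟨S, hS, h1⟩ := ih fun q hq => h q (Set.mem_insert_of_mem _ hq)
      obtain ⟨hq, rfl⟩ := h q (Set.mem_insert _ _)
      obtain ⟨T, hT, h2⟩ := pullDom_mem (f := f) (Hom.dom_le g q hq) (H.cof.1 _ (Hom.src_mem g q hq))
      refine ⟨S ⊓ T, C.J.intersection_covering hS hT, ?_⟩
      rintro w k ⟨hk, hk'⟩ q' (rfl | hq')
      exacts [h2 w k hk', h1 w k hk q' hq']
  obtain ⟨S, hS, h⟩ := key ((Hom.finite g).subset fun _ h => h.1) fun q hq => hq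
  refine coversAt_of hS fun w k hk => H.star d hd w k.le fun i x t hc => ?_
  obtain ⟨q, hq, rfl, rfl, hs⟩ := hc
  exact h w k hk q ⟨hq, rfl⟩ x t hs

/-- Transitivity of the topology: on the domain of a piece `p` of `f`, the domain of the composite
contains the pullback along `p.hor` of the covering domain of `g`. -/
lemma coversAt_comp {f : A ⟶ B} {g : B ⟶ E} {i : ℕ × C.P} (hf : CoversAt f i)
    (hg : ∀ p ∈ Hom.pieces f, p.src = i → CoversAt g p.tgt) : CoversAt (f ≫ g) i := by
  refine C.J.transitive hf _ ?_
  rintro w k ⟨_, ⟨p, hp, rfl, rfl⟩, hle⟩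
  have h1 := C.cover_hor p.hor _ (hg p hp rfl)
  refine C.J.superset_covering ?_ (C.J.pullback_stable (homOfLE hle) h1)
  rintro y l ⟨a, ⟨b, t, ⟨m, hm⟩, ht⟩, hle'⟩
  have h2 : Car f p.src p.tgt t := ⟨p, hp, rfl, rfl, ht⟩
  obtain ⟨r, hr, hs, hd⟩ := ((dom_comp h2).2 (dom_of_sieveOf hm)).of_le hle'
  exact ⟨_, ⟨r, hr, hs, rfl⟩, hd⟩

/-- The domain of `g` covers a member of the image of `f` if that of `f ≫ g` covers a preimage. -/
lemma coversAt_of_comp {f : A ⟶ B} {g : B ⟶ E} {p : Piece C} (hp : p ∈ Hom.pieces f)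
    (h : CoversAt (f ≫ g) p.src) : CoversAt g p.tgt := by
  obtain ⟨S, hS, h1⟩ := pullDom_mem (Hom.dom_le f p hp) h
  refine coversAt_of hS fun w k hk => ?_
  obtain ⟨x, t, ht⟩ := C.sq_exists p.hor k.le
  exact (dom_comp ⟨p, hp, rfl, rfl, ht⟩).1 (h1 w k hk x t ht)

lemma Inj.comp {f : A ⟶ B} {g : B ⟶ E} (hf : Inj f) (hg : Inj g) : Inj (f ≫ g) := by
  rintro _ ⟨p, hp, q, hq, e, x, t, ht, rfl⟩ _ ⟨p', hp', q', hq', e', x', t', ht', rfl⟩ h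
  obtain rfl := hg q hq q' hq' h
  obtain rfl := hf p hp p' hp' (e.trans e'.symm)
  cases C.sq_unique ht ht'
  rfl

lemma cof_comp {f : A ⟶ B} {g : B ⟶ E} (hf : cof C f) (hg : cof C g) : cof C (f ≫ g) :=
  ⟨fun i hi => coversAt_comp (hf.1 i hi) fun p hp _ => hg.1 _ (Hom.tgt_mem f p hp),
    Inj.comp hf.2 hg.2⟩

lemma im_eq_of_weq {f : A ⟶ B} (hf : weq C f) : im f = B.carrier :=
  Set.Subset.antisymm (by rintro _ ⟨p, hp, rfl⟩; exact Hom.tgt_mem f p hp) hf.2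

lemma weq_comp {f : A ⟶ B} {g : B ⟶ E} (hf : weq C f) (hg : weq C g) : weq C (f ≫ g) := by
  refine ⟨cof_comp hf.1 hg.1, fun j hj => ?_⟩
  obtain ⟨q, hq, rfl⟩ := hg.2 j hj
  exact tgt_mem_im_comp hq (im_eq_of_weq hf ▸ Hom.src_mem g q hq)

lemma cof_of_isZero {f : A ⟶ B} (h : Limits.IsZero A) : cof C f := by
  have := carrier_of_isZero h
  refine ⟨fun i hi => ?_, fun p hp => ?_⟩
  · rw [this] at hi
    exact hi.elim
  · have hi := Hom.src_mem f p hp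
    rw [this] at hi
    exact hi.elim

/-- A morphism is a cofibration if it is one on jointly surjective parts with disjoint images. -/
lemma cof_of_cover {Y Z Q R : SC C} {s : Y ⟶ Q} {r : Z ⟶ Q} {d : Q ⟶ R} {U : Set (ℕ × C.P)}
    (hQ : ∀ j ∈ Q.carrier, j ∈ im s ∨ ∃ ρ ∈ Hom.pieces r, ρ.src ∈ U ∧ ρ.tgt = j)
    (hs : cof C (s ≫ d)) (hc : ∀ β ∈ Z.carrier, β ∈ U → CoversAt (r ≫ d) β)
    (hi : ∀ p ∈ Hom.pieces (r ≫ d), ∀ q ∈ Hom.pieces (r ≫ d), p.src ∈ U → q.src ∈ U →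
      p.tgt = q.tgt → p = q)
    (hd : ∀ q ∈ Hom.pieces (r ≫ d), q.src ∈ U → q.tgt ∉ im (s ≫ d)) : cof C d := by
  constructor
  · intro j hj
    obtain ⟨p, hp, rfl⟩ | ⟨ρ, hρ, hU, rfl⟩ := hQ j hj
    · exact coversAt_of_comp hp (hs.1 _ (Hom.src_mem s p hp))
    · exact coversAt_of_comp hρ (hc _ (Hom.src_mem r ρ hρ) hU)
  -- Two pieces of `d` whose sources are reached by `f` from `U` prolong to pieces of `f ≫ d`. Equal
  -- targets make those equal, and cancelling the piece of `f` shows that the pieces of `d` agree.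
  have key : ∀ {V : SC C} (f : V ⟶ Q) (U : Set (ℕ × C.P)), (∀ p ∈ Hom.pieces (f ≫ d),
      ∀ q ∈ Hom.pieces (f ≫ d), p.src ∈ U → q.src ∈ U → p.tgt = q.tgt → p = q) →
      ∀ p ∈ Hom.pieces d, ∀ q ∈ Hom.pieces d, p.tgt = q.tgt →
      (∃ ρ ∈ Hom.pieces f, ρ.src ∈ U ∧ ρ.tgt = p.src) →
      (∃ ρ ∈ Hom.pieces f, ρ.src ∈ U ∧ ρ.tgt = q.src) → p = q := by
    rintro V f U h ⟨_, pt, pd, ph⟩ hp ⟨_, qt, qd, qh⟩ hq e ⟨ρ, hρ, hU, rfl⟩ ⟨ρ', hρ', hU', rfl⟩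
    simp only at e
    subst e
    obtain ⟨x, t, ht⟩ := C.sq_exists ρ.hor (Hom.dom_le d _ hp)
    obtain ⟨x', t', ht'⟩ := C.sq_exists ρ'.hor (Hom.dom_le d _ hq)
    simp only at ht ht' t t'
    have h1 : Car f ρ.src ρ.tgt t := ⟨ρ, hρ, rfl, rfl, ht⟩
    have h1' : Car f ρ'.src ρ'.tgt t' := ⟨ρ', hρ', rfl, rfl, ht'⟩
    obtain ⟨a, ha, ha1, ha2, ha3⟩ := h1.comp (car_self hp)
    obtain ⟨b, hb, hb1, hb2, hb3⟩ := h1'.comp (car_self hq)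
    obtain rfl := h a ha b hb (ha1 ▸ hU) (hb1 ▸ hU') (ha2.trans hb2.symm)
    have hρρ : ρ.src = ρ'.src := ha1.symm.trans hb1
    have h2 := C.sq_unique ha3 hb3
    obtain rfl : x = x' := congrArg Sigma.fst h2
    have h3 : C.hcomp t ph = C.hcomp t' qh := eq_of_heq (Sigma.mk.inj h2).2
    rw [← hρρ] at h1'
    obtain ⟨h4, h5⟩ := h1.unique h1'
    cases h5
    rw [hcomp_left_cancel h3, h4]
  intro p hp q hq e
  -- By `hd`, pieces of `d` from outside `im s` end outside the image of `s ≫ d`; so pieces with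
  -- equal targets start either both in `im s` or both outside it.
  have hns : ∀ a ∈ Hom.pieces d, a.src ∉ im s → a.tgt ∈ im (s ≫ d) → False := by
    intro a ha h1 h2
    obtain ⟨ρ, hρ, hU, hρ'⟩ := (hQ _ (Hom.src_mem d a ha)).resolve_left h1
    obtain ⟨x, t, ht⟩ := C.sq_exists ρ.hor (hρ' ▸ Hom.dom_le d a ha : a.dom ≤ ρ.tgt.2)
    have h3 : Car r ρ.src a.src t := ⟨ρ, hρ, rfl, hρ', ht⟩
    obtain ⟨b, hb, hb1, hb2, -⟩ := h3.comp (car_self ha)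
    exact hd b hb (hb1 ▸ hU) (hb2 ▸ h2)
  by_cases h1 : p.src ∈ im s <;> by_cases h2 : q.src ∈ im s
  · obtain ⟨a, ha, ha'⟩ := h1
    obtain ⟨b, hb, hb'⟩ := h2
    exact key s Set.univ (fun p hp q hq _ _ h => hs.2 p hp q hq h) p hp q hq e
      ⟨a, ha, trivial, ha'⟩ ⟨b, hb, trivial, hb'⟩
  · exact (hns q hq h2 (e ▸ tgt_mem_im_comp hp h1)).elim
  · exact (hns p hp h1 (e ▸ tgt_mem_im_comp hq h2)).elim
  · exact key r U hi p hp q hq e ((hQ _ (Hom.src_mem d p hp)).resolve_left h1)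
      ((hQ _ (Hom.src_mem d q hq)).resolve_left h2)

/-! ### `SC(C)` is a Waldhausen category -/

/-- An isomorphism is defined everywhere and is bijective on indices, so each clause survives. -/
lemma Glue.comp_iso {f : A ⟶ B} {g : A ⟶ A'} {g' : B ⟶ B'} {f' : A' ⟶ B'} (H : Glue f g g' f')
    (e : B' ⟶ E) [IsIso e] : Glue f g (g' ≫ e) (f' ≫ e) := by
  have he := weq_of_isIso e inferInstance
  have hpc : ∀ {V : SC C} {h : V ⟶ B'} {p : Piece C}, p ∈ Hom.pieces (h ≫ e) →
      ∃ p' ∈ Hom.pieces h, ∃ q ∈ Hom.pieces e, p'.tgt = q.src ∧ p.src = p'.src ∧ p.tgt = q.tgt ∧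
        ∃ t : C.Hor p.dom q.dom, C.Sq t p'.hor := by
    rintro V h _ ⟨p', hp', q, hq, hh, x, t, ht, rfl⟩
    exact ⟨p', hp', q, hq, hh, rfl, rfl, t, ht⟩
  have hdom : ∀ {V : SC C} {h : V ⟶ B'} {i w}, Dom h i w → Dom (h ≫ e) i w := by
    intro V h i w hd
    obtain ⟨j, z, t, ht⟩ := hd.exists_car
    exact (dom_comp ht).2 ((dom_of_isIso e ht.tgt_mem).of_le ht.le_tgt)
  refine ⟨by rw [← Category.assoc, H.comm, Category.assoc], H.cof, Inj.comp H.inj' he.1.2, ?_, ?_, ?_,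
    ?_, ?_⟩
  · intro p hp h
    obtain ⟨p', hp', q, hq, h1, h2, h3, -⟩ := hpc hp
    rw [h2]
    refine H.layered p' hp' ?_
    rw [h1]
    exact src_mem_im he.1 hq (h3 ▸ h)
  · exact fun b hb h => hdom (H.full b hb h)
  · rintro _ ⟨p', hp', q', hq', h1, x, t, ht, rfl⟩ _ ⟨p, hp, q, hq, h2, y, s, hs, rfl⟩ h3 h4 h5
    obtain rfl := he.1.2 q' hq' q hq h5
    obtain rfl := H.inj p' hp' p hp h3 h4 (h1.trans h2.symm)
    cases C.sq_unique ht hs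
    rfl
  · intro j hj
    obtain ⟨q, hq, rfl⟩ := he.2 j hj
    exact (H.surj _ (Hom.src_mem e q hq)).imp (tgt_mem_im_comp hq) (tgt_mem_im_comp hq)
  · exact fun d hd w hw h => hdom (H.star d hd w hw h)

/-- The constructed square is a pushout and satisfies the clauses; any other pushout is isomorphic
to it, and the clauses are invariant under isomorphism. -/
lemma glue_iff {f : A ⟶ B} {g : A ⟶ A'} {g' : B ⟶ B'} {f' : A' ⟶ B'} :
    Glue f g g' f' ↔ cof C f ∧ IsPushout f g g' f' := by
  refine ⟨fun H => ⟨H.cof, H.isPushout⟩, fun ⟨hf, hp⟩ => ?_⟩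
  obtain ⟨B'', g'', f'', H⟩ := exists_glue f g hf
  have := H.comp_iso (H.isPushout.isoIsPushout _ _ hp).hom
  simpa using this

/-- On what comes from `C₁`, the map `d` is `c` followed by a cofibration. On the rest it is `b`
followed by `r₂`, which is total and injective outside `im i₂`. The two images are disjoint by
`layered`, so `cof_of_cover` applies. -/
lemma Glue.weq_desc {A₁ B₁ C₁ D₁ A₂ B₂ C₂ D₂ : SC C} {i₁ : A₁ ⟶ B₁} {k₁ : A₁ ⟶ C₁} {r₁ : B₁ ⟶ D₁}
    {s₁ : C₁ ⟶ D₁} {i₂ : A₂ ⟶ B₂} {k₂ : A₂ ⟶ C₂} {r₂ : B₂ ⟶ D₂} {s₂ : C₂ ⟶ D₂}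
    {a : A₁ ⟶ A₂} {b : B₁ ⟶ B₂} {c : C₁ ⟶ C₂} {d : D₁ ⟶ D₂} (H₁ : Glue i₁ k₁ r₁ s₁)
    (H₂ : Glue i₂ k₂ r₂ s₂) (hi : i₁ ≫ b = a ≫ i₂) (hr : r₁ ≫ d = b ≫ r₂) (hs : s₁ ≫ d = c ≫ s₂)
    (ha : weq C a) (hb : weq C b) (hc : weq C c) : weq C d := by
  have hs' : SC.cof C (s₁ ≫ d) := hs ▸ cof_comp hc.1 H₂.cof_right
  -- As `a` is surjective and `b` is injective on indices, `b` carries the complement of `A₁` into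
  -- that of `A₂`.
  have hnot : ∀ p ∈ Hom.pieces b, p.src ∉ im i₁ → p.tgt ∉ im i₂ := by
    intro p hp h h2
    refine h (src_mem_im hb.1 hp ?_)
    rw [hi]
    obtain ⟨q, hq, h3⟩ := h2
    rw [← h3]
    exact tgt_mem_im_comp hq (im_eq_of_weq ha ▸ Hom.src_mem _ q hq)
  refine ⟨cof_of_cover (s := s₁) (r := r₁) (U := {β | β ∉ im i₁}) ?_ hs' ?_ ?_ ?_, ?_⟩
  · intro j hj
    by_cases h : j ∈ im s₁
    · exact Or.inl h
    · obtain ⟨ρ, hρ, rfl⟩ := (H₁.surj j hj).resolve_left h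
      refine Or.inr ⟨ρ, hρ, fun h' => h ?_, rfl⟩
      have := tgt_mem_im_comp hρ h'
      rw [H₁.comm] at this
      exact im_comp_subset _ _ this
  · intro β hβ hU
    rw [hr]
    refine coversAt_comp (hb.1.1 β hβ) ?_
    rintro p hp rfl
    exact coversAt_of_dom (H₂.full _ (Hom.tgt_mem b p hp) (hnot p hp hU))
  · rw [hr]
    rintro _ ⟨p, hp, q, hq, h1, x, t, ht, rfl⟩ _ ⟨p', hp', q', hq', h1', x', t', ht', rfl⟩ h2 h3 h4
    obtain rfl := H₂.inj q hq q' hq' (h1 ▸ hnot p hp h2) (h1' ▸ hnot p' hp' h3) h4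
    obtain rfl := hb.1.2 p hp p' hp' (h1.trans h1'.symm)
    cases C.sq_unique ht ht'
    rfl
  · rw [hr, hs]
    rintro _ ⟨p, hp, q, hq, h1, x, t, ht, rfl⟩ h2 h3
    exact hnot p hp h2 (h1 ▸ H₂.layered q hq (im_comp_subset _ _ h3))
  · intro l hl
    rcases H₂.surj l hl with ⟨q, hq, rfl⟩ | ⟨q, hq, rfl⟩
    · have := tgt_mem_im_comp (f := c) hq (im_eq_of_weq hc ▸ Hom.src_mem _ q hq)
      rw [← hs] at this
      exact im_comp_subset _ _ this
    · have := tgt_mem_im_comp (f := b) hq (im_eq_of_weq hb ▸ Hom.src_mem _ q hq)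
      rw [← hr] at this
      exact im_comp_subset _ _ this

theorem isWaldhausen (C : PolytopeComplex.{u, v}) : IsWaldhausen (cof C) (weq C) where
  exists_zero := ⟨⟨∅, Set.finite_empty, fun i hi => False.elim hi⟩, isZero_of_carrier rfl⟩
  cof_of_isIso f hf := (weq_of_isIso f hf).1
  cof_comp _ _ := cof_comp
  cof_of_isZero _ := cof_of_isZero
  exists_pushout f g hf := by
    obtain ⟨B', g', f', H⟩ := exists_glue f g hf
    exact ⟨B', g', f', H.isPushout⟩
  cof_pushout h hf := (glue_iff.2 ⟨hf, h⟩).cof_right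
  weq_of_isIso := weq_of_isIso
  weq_comp _ _ := weq_comp
  gluing h₁ h₂ c₁ c₂ hi _ hr hs ha hb hc :=
    (glue_iff.2 ⟨c₁, h₁⟩).weq_desc (glue_iff.2 ⟨c₂, h₂⟩) hi hr hs ha hb hc

end SC
end PolytopeComplex

namespace PolytopeComplex

variable {C D : PolytopeComplex.{u, v}}

namespace SC

/-! ### Functors induced by morphisms of polytope complexes -/

variable {A B A' B' : SC C} (φ : PolyMap C D)

/-- Distinct members with a common label are separated, and polytope maps preserve separation. So a
label and any part of the image recover the member of `A`. -/
lemma eq_of_mem_map {l : ℕ} {x x' : C.P} {y y' w : D.P} (hx : (l, x) ∈ A.carrier)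
    (hx' : (l, x') ∈ A.carrier) (hy : y ∈ φ.obj x) (hy' : y' ∈ φ.obj x') (h : w ≤ y) (h' : w ≤ y') :
    x = x' := by
  by_contra hne
  exact (φ.sep_of_sep (A.sep _ hx _ hx' (fun h => hne (Prod.ext_iff.1 h).2) rfl) hy hy').2 w h h'

lemma eq_of_mem_map' {i i' : ℕ × C.P} {y y' w : D.P} (hi : i ∈ A.carrier) (hi' : i' ∈ A.carrier)
    (hl : i.1 = i'.1) (hy : y ∈ φ.obj i.2) (hy' : y' ∈ φ.obj i'.2) (h : w ≤ y) (h' : w ≤ y') :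
    i = i' := by
  obtain ⟨l, x⟩ := i
  obtain ⟨l', x'⟩ := i'
  obtain rfl : l = l' := hl
  exact Prod.ext rfl (eq_of_mem_map φ hi hi' hy hy' h h')

lemma exists_piece_map {f : A ⟶ B} {p : Piece C} (hp : p ∈ Hom.pieces f) {κ : HArrow D}
    (hκ : κ ∈ φ.hor p.hor) : ∃ y ∈ φ.obj p.src.2, κ.dom ≤ y ∧
      (⟨(p.src.1, y), (p.tgt.1, κ.cod), κ.dom, κ.hor⟩ : Piece D) ∈ Hom.pieces ((map φ).map f) := by
  obtain ⟨y, hy, h⟩ := φ.mono (Hom.dom_le f p hp) _ (φ.hor_dom_mem _ κ hκ)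
  exact ⟨y, hy, h, p, hp, y, hy, κ, hκ, h, rfl⟩

/-- Forwards, the label and the overlap recover the member of `B`. Backwards, `φ.hor` is onto the
components of its target, so a piece ending at `x` has a component ending at `y`. -/
lemma mem_im_map {f : A ⟶ B} {l : ℕ} {x : C.P} {y : D.P} (hx : (l, x) ∈ B.carrier)
    (hy : y ∈ φ.obj x) : (l, y) ∈ im ((map φ).map f) ↔ (l, x) ∈ im f := by
  constructor
  · rintro ⟨_, ⟨p, hp, u, hu, q, hq, -, rfl⟩, e⟩
    obtain ⟨e1, e2⟩ := Prod.ext_iff.1 e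
    simp only at e1 e2
    refine ⟨p, hp, eq_of_mem_map' φ (Hom.tgt_mem f p hp) hx e1 (φ.hor_cod_mem _ q hq) hy le_rfl e2.le⟩
  · rintro ⟨p, hp, e⟩
    obtain ⟨κ, ⟨hκ, h⟩, -⟩ := φ.hor_cod p.hor y (by rw [e]; exact hy)
    obtain ⟨u, -, -, hu⟩ := exists_piece_map φ hp hκ
    exact ⟨_, hu, Prod.ext (congrArg Prod.fst e : p.tgt.1 = l) h⟩

lemma dom_map {f : A ⟶ B} {l : ℕ} {x z : C.P} {y n w : D.P} (hy : y ∈ φ.obj x)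
    (h : Dom f (l, x) z) (hn : n ∈ φ.obj z) (hwn : w ≤ n) (hwy : w ≤ y) :
    Dom ((map φ).map f) (l, y) w := by
  obtain ⟨p, hp, hs, hle⟩ := h
  obtain ⟨n', hn', hle'⟩ := φ.mono hle n hn
  obtain ⟨κ, ⟨hκ, rfl⟩, -⟩ := φ.hor_dom p.hor n' hn'
  obtain ⟨u, hu, h1, h2⟩ := exists_piece_map φ hp hκ
  refine ⟨_, h2, ?_, hwn.trans hle'⟩
  rw [hs] at hu ⊢
  rw [φ.eq_of_le hu hy ((hwn.trans hle').trans h1) hwy]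

/-- The restriction to sources in `U` lets one argument serve both for an injective morphism and for
`g'` outside `im f` in `Glue.map`. A target in the image determines in turn the target, the piece,
the horizontal component and the source. -/
lemma Inj.map_aux {f : A ⟶ B} {U : Set (ℕ × C.P)} (hf : ∀ p ∈ Hom.pieces f, ∀ q ∈ Hom.pieces f,
    p.src ∈ U → q.src ∈ U → p.tgt = q.tgt → p = q) {p q : Piece C} {r s : Piece D}
    (hp : p ∈ Hom.pieces f) (hq : q ∈ Hom.pieces f) (hpU : p.src ∈ U) (hqU : q.src ∈ U)
    (hr : ∃ u ∈ φ.obj p.src.2, ∃ κ ∈ φ.hor p.hor, κ.dom ≤ u ∧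
      r = ⟨(p.src.1, u), (p.tgt.1, κ.cod), κ.dom, κ.hor⟩)
    (hs : ∃ u ∈ φ.obj q.src.2, ∃ κ ∈ φ.hor q.hor, κ.dom ≤ u ∧
      s = ⟨(q.src.1, u), (q.tgt.1, κ.cod), κ.dom, κ.hor⟩) (e : r.tgt = s.tgt) : r = s := by
  obtain ⟨u, hu, κ, hκ, hle, rfl⟩ := hr
  obtain ⟨u', hu', κ', hκ', hle', rfl⟩ := hs
  obtain ⟨e1, e2⟩ := Prod.ext_iff.1 e
  simp only at e1 e2
  obtain rfl := hf p hp q hq hpU hqU (eq_of_mem_map' φ (Hom.tgt_mem f p hp) (Hom.tgt_mem f q hq) e1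
    (φ.hor_cod_mem _ κ hκ) (φ.hor_cod_mem _ κ' hκ') le_rfl e2.le)
  obtain rfl := φ.hor_ext_cod hκ hκ' e2
  obtain rfl := φ.eq_of_le hu hu' hle hle'
  rfl

lemma Inj.map {f : A ⟶ B} (hf : Inj f) : Inj ((map φ).map f) := by
  rintro r ⟨p, hp, hr⟩ s ⟨q, hq, hs⟩ e
  exact Inj.map_aux φ (U := Set.univ) (fun p hp q hq _ _ h => hf p hp q hq h) hp hq trivial trivial
    hr hs e

lemma cof_map {f : A ⟶ B} (hf : cof C f) : cof D ((map φ).map f) := by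
  refine ⟨?_, Inj.map φ hf.2⟩
  rintro ⟨l, y⟩ ⟨x, hx, hy⟩
  refine coversAt_of (φ.cover _ (hf.1 _ hx) y hy) ?_
  rintro w k ⟨n, ⟨z, ⟨m, hm⟩, hn⟩, hle⟩
  exact dom_map φ hy (dom_of_sieveOf hm) hn hle k.le

lemma weq_map {f : A ⟶ B} (hf : weq C f) : weq D ((map φ).map f) := by
  refine ⟨cof_map φ hf.1, ?_⟩
  rintro ⟨l, y⟩ ⟨x, hx, hy⟩
  have := im_eq_of_weq hf
  exact (mem_im_map φ hx hy).2 (this ▸ hx)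

/-- All clauses but `star` transfer member by member. For `star`, the given part of the image of `x`
has to be bounded by a member of the image of some part `y` of `x` whose preimages lie in the domain
of `f`; it is found because `φ` preserves vertical pullbacks. -/
lemma Glue.map {f : A ⟶ B} {g : A ⟶ A'} {g' : B ⟶ B'} {f' : A' ⟶ B'} (H : Glue f g g' f') :
    Glue ((map φ).map f) ((map φ).map g) ((map φ).map g') ((map φ).map f') where
  comm := by rw [← Functor.map_comp, H.comm, Functor.map_comp]
  cof := cof_map φ H.cof
  inj' := Inj.map φ H.inj'
  layered := by
    rintro _ ⟨p, hp, u, hu, κ, hκ, -, rfl⟩ h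
    exact (mem_im_map φ (Hom.src_mem g' p hp) hu).2
      (H.layered p hp ((mem_im_map φ (Hom.tgt_mem g' p hp) (φ.hor_cod_mem _ κ hκ)).1 h))
  full := by
    rintro ⟨l, y⟩ ⟨x, hx, hy⟩ h
    rw [mem_im_map φ hx hy] at h
    exact dom_map φ hy (H.full _ hx h) hy le_rfl le_rfl
  inj := by
    rintro r ⟨p, hp, hr⟩ s ⟨q, hq, hs⟩ h1 h2 e
    refine Inj.map_aux φ (U := {β | β ∉ im f}) (fun p hp q hq h h' e => H.inj p hp q hq h h' e) hp hq
      (fun h => h1 ?_) (fun h => h2 ?_) hr hs e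
    · obtain ⟨u, hu, -, -, -, rfl⟩ := hr
      exact (mem_im_map φ (Hom.src_mem g' p hp) hu).2 h
    · obtain ⟨u, hu, -, -, -, rfl⟩ := hs
      exact (mem_im_map φ (Hom.src_mem g' q hq) hu).2 h
  surj := by
    rintro ⟨l, y⟩ ⟨x, hx, hy⟩
    rw [mem_im_map φ hx hy, mem_im_map φ hx hy]
    exact H.surj _ hx
  star := by
    rintro ⟨l, v⟩ ⟨x, hx, hv⟩ w (hw : w ≤ v) h
    -- For one piece `q`, the preimage `x'` of `w` lies in the images of both `p.dom` and `q.dom`,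
    -- hence in the image of a common part `m` of the two. The part `y` is where `q` carries `m`.
    have single : ∀ q ∈ Hom.pieces g, q.tgt = (l, x) →
        ∃ y ≤ q.tgt.2, PullDom f q y ∧ ∃ n ∈ φ.obj y, w ≤ n := by
      rintro q hq e
      obtain ⟨κ, ⟨hκ, rfl⟩, -⟩ := φ.hor_cod q.hor v (by rw [e]; exact hv)
      obtain ⟨u, hu, hκu, hκp⟩ := exists_piece_map φ hq hκ
      obtain ⟨x', t, ht⟩ := D.sq_exists κ.hor hw
      obtain ⟨_, ⟨p, hp, u0, hu0, n, hn, -, rfl⟩, e1, hle⟩ :=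
        h (q.src.1, u) x' t ⟨_, hκp, rfl, by rw [e], ht⟩
      obtain ⟨e1, e2⟩ := Prod.ext_iff.1 e1
      simp only at e1 e2 hle
      have e3 := eq_of_mem_map' φ (Hom.src_mem f p hp) (Hom.src_mem g q hq) e1 hu0 hu le_rfl e2.le
      obtain ⟨m, hm, hm', n2, hn2, hle2⟩ := φ.meet (e3 ▸ Hom.dom_le f p hp : p.dom ≤ q.src.2)
        (Hom.dom_le g q hq) _ (φ.hor_dom_mem _ n hn) _ (φ.hor_dom_mem _ κ hκ) x' hle (D.sq_left ht)
      obtain ⟨y, s, hs⟩ := sq_exists' q.hor hm'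
      obtain ⟨κ2, ⟨hκ2, rfl⟩, -⟩ := φ.hor_dom s n2 hn2
      obtain ⟨n3, hn3, hle3⟩ := φ.mono hm' _ hn2
      obtain rfl := φ.eq_of_le hn3 (φ.hor_dom_mem _ κ hκ) (hle2.trans hle3) (D.sq_left ht)
      refine ⟨y, C.sq_right hs, fun a r hr => ?_, κ2.cod, φ.hor_cod_mem _ κ2 hκ2,
        D.sq_right (sq_of_le' ht (φ.hor_sq hs _ hκ2 _ hκ hle3) hle2)⟩
      cases C.sq_unique hr hs
      exact ⟨p, hp, e3, hm⟩
    -- The parts found for the finitely many pieces are intersected by `φ.meet`; if there is no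
    -- piece, all of `x` serves.
    have key : ∀ {Q : Set (Piece C)}, Q.Finite → (∀ q ∈ Q, q ∈ Hom.pieces g ∧ q.tgt = (l, x)) →
        ∃ y ≤ x, (∀ q ∈ Q, PullDom f q y) ∧ ∃ n ∈ φ.obj y, w ≤ n := by
      intro Q hQ
      induction Q, hQ using Set.Finite.induction_on with
      | empty => exact fun _ => ⟨x, le_rfl, fun _ h => h.elim, v, hv, hw⟩
      | @insert q Q _ _ ih =>
        intro hQ
        obtain ⟨y, hy, h1, n, hn, hwn⟩ := ih fun q hq => hQ q (Set.mem_insert_of_mem _ hq)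
        obtain ⟨hq, hqt⟩ := hQ q (Set.mem_insert _ _)
        obtain ⟨y', hy', h1', n', hn', hwn'⟩ := single q hq hqt
        have hy'' : y' ≤ x := by rw [hqt] at hy'; exact hy'
        obtain ⟨m, hm, hm', n2, hn2, hle2⟩ := φ.meet hy hy'' n hn n' hn' w hwn hwn'
        refine ⟨m, hm.trans hy, ?_, n2, hn2, hle2⟩
        rintro r (rfl | hr)
        · exact h1'.of_le hm' hy'
        · refine (h1 r hr).of_le hm ?_
          rw [(hQ r (Set.mem_insert_of_mem _ hr)).2]
          exact hy
    obtain ⟨y, hy, h1, n, hn, hwn⟩ := key ((Hom.finite g).subset fun _ h => h.1) fun q hq => hq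
    refine dom_map φ hv (H.star (l, x) hx y hy ?_) hn hwn hw
    rintro _ a t ⟨q, hq, rfl, hqt, hs⟩
    exact h1 q ⟨hq, hqt⟩ a t hs

/-- The functors induced by morphisms of polytope complexes are exact. -/
theorem isExact_map : IsExact (waldData C) (waldData D) (map φ) where
  zero h := isZero_of_carrier (by
    refine Set.eq_empty_of_forall_notMem ?_
    rintro ⟨l, y⟩ ⟨x, hx, -⟩
    rw [carrier_of_isZero h] at hx
    exact hx)
  cof _ := cof_map φ
  weq _ := weq_map φ
  po _ _ _ _ h := glue_iff.1 ((glue_iff.2 h).map φ)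

end SC
end PolytopeComplex

/-! ### Full faithfulness of F_n -/

namespace PolytopeComplex

variable {C : PolytopeComplex.{u, v}}

namespace SC

variable {A B E : SC C}

/-- A morphism given by a bijection of indices and horizontal morphisms is an isomorphism. -/
lemma isIso_of_bijective (f : A ⟶ B) (hi : Inj f)
    (ht : ∀ i ∈ A.carrier, ∃ j, ∃ t : C.Hor i.2 j.2, Car f i j t)
    (hs : ∀ j ∈ B.carrier, ∃ i, ∃ t : C.Hor i.2 j.2, Car f i j t) : IsIso f := by
  let g : B ⟶ A :=
    { pieces := {r | ∃ i j, ∃ t : C.Hor i.2 j.2, Car f i j t ∧ r = ⟨j, i, j.2, C.hinv t⟩}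
      finite := by
        refine ((A.finite.prod B.finite).biUnion (t := fun ij => {r | ∃ t : C.Hor ij.1.2 ij.2.2,
          Car f ij.1 ij.2 t ∧ r = ⟨ij.2, ij.1, ij.2.2, C.hinv t⟩}) fun ij _ => ?_).subset ?_
        · refine Set.Subsingleton.finite ?_
          rintro _ ⟨t, h, rfl⟩ _ ⟨t', h', rfl⟩
          cases (h.unique h').2
          rfl
        · rintro r ⟨i, j, t, h, rfl⟩
          simp only [Set.mem_iUnion]
          exact ⟨(i, j), ⟨h.src_mem, h.tgt_mem⟩, t, h, rfl⟩
      src_mem := by rintro _ ⟨i, j, t, h, rfl⟩; exact h.tgt_mem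
      tgt_mem := by rintro _ ⟨i, j, t, h, rfl⟩; exact h.src_mem
      dom_le := by rintro _ ⟨i, j, t, h, rfl⟩; exact le_rfl
      disj := by
        rintro _ ⟨i, j, t, h, rfl⟩ _ ⟨i', j', t', h', rfl⟩ hne (e : j = j')
        subst e
        obtain rfl := hi.src_unique h h'
        cases (h.unique h').2
        exact absurd rfl hne }
  have hg : ∀ {i j} {t : C.Hor i.2 j.2}, Car f i j t → Car g j i (C.hinv t) := fun h =>
    ⟨_, ⟨_, _, _, h, rfl⟩, rfl, rfl, C.sq_refl _⟩
  have key : ∀ {V : SC C} {m : V ⟶ V}, (∀ i ∈ V.carrier, Car m i i (C.hid i.2)) → m = 𝟙 V := by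
    intro V m h
    refine hom_ext_of_car (fun p hp => ?_) ?_
    · obtain ⟨h1, h2⟩ := (car_self hp).unique
        ((h _ (Hom.src_mem m p hp)).of_sq (C.sq_hid (Hom.dom_le m p hp)))
      exact car_id.2 ⟨Hom.src_mem m p hp, h1.symm, Hom.dom_le m p hp, h2.symm⟩
    · rintro _ ⟨i, hi, rfl⟩
      exact h i hi
  refine ⟨g, key fun i h => ?_, key fun j h => ?_⟩
  · obtain ⟨j, t, h1⟩ := ht i h
    have := h1.comp (hg h1)
    rwa [C.hcomp_inv] at this
  · obtain ⟨i, t, h1⟩ := hs j h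
    have := (hg h1).comp h1
    rwa [C.inv_hcomp] at this

end SC

namespace Forest

open SC

variable {n : ℕ} {T T' : (s n C).P}

/-- The pullback of a diagram along a horizontal morphism to its root. -/
lemma exists_pull (T' : (s n C).P) {a : C.P} (t : C.Hor a (root T')) :
    ∃ R, ∃ h : (s n C).Hor R T', (⟨root R, under h⟩ : Σ x, C.Hor x (root T')) = ⟨a, t⟩ := by
  let L : ℕ → Set C.P := fun l => {z | ∃ y ∈ lev T' l, ∃ r : C.Hor z y, C.Sq r t}
  have hL : ∀ l, ∀ y ∈ lev T' l, ∃ z ∈ L l, ∃ r : C.Hor z y, C.Sq r t := by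
    intro l y hy
    obtain ⟨z, r, hr⟩ := C.sq_exists t (le_root hy)
    exact ⟨z, ⟨y, hy, r, hr⟩, r, hr⟩
  have hr : L (born T') = {a} := by
    ext z
    constructor
    · rintro ⟨y, hy, r, hr⟩
      rw [lev_born] at hy
      obtain rfl := hy
      cases C.sq_unique hr (C.sq_refl t)
      rfl
    · rintro rfl
      exact ⟨_, root_mem T', t, C.sq_refl t⟩
  have hfin : ∀ l, (L l).Finite := by
    intro l
    refine ((lev_finite T' l).biUnion (t := fun y => {z | ∃ r : C.Hor z y, C.Sq r t})
      fun y _ => ?_).subset ?_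
    · refine Set.Subsingleton.finite ?_
      rintro z ⟨r, hr⟩ z' ⟨r', hr'⟩
      cases C.sq_unique hr hr'
      rfl
    · rintro z ⟨y, hy, h⟩
      simp only [Set.mem_iUnion]
      exact ⟨y, hy, h⟩
  have hsep : ∀ l, ∀ x ∈ L l, ∀ y ∈ L l, x ≠ y → Sep x y := by
    rintro l x ⟨x', hx', r, hr⟩ y ⟨y', hy', r', hr'⟩ hne
    refine ⟨⟨a, C.sq_left hr, C.sq_left hr'⟩, fun w hw hw' => hne ?_⟩
    obtain ⟨z, q, hq⟩ := sq_exists' r hw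
    obtain ⟨z', q', hq'⟩ := sq_exists' r' hw'
    cases sq_unique' (C.sq_trans hq hr) (C.sq_trans hq' hr')
    obtain rfl := eq_of_le hx' hy' (C.sq_right hq) (C.sq_right hq')
    cases C.sq_unique hr hr'
    rfl
  have hle : ∀ l, born T' ≤ l → ∀ y ∈ L (l + 1), ∃ x ∈ L l, y ≤ x := by
    rintro l hl y ⟨y', hy', r, hr⟩
    obtain ⟨x', hx', h⟩ := exists_le hl (Nat.le_succ l) hy'
    obtain ⟨x, hx, q, hq⟩ := hL l x' hx'
    exact ⟨x, hx, C.sq_left (sq_of_le hr hq h)⟩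
  have hcov : ∀ l, born T' ≤ l → l < n → ∀ x ∈ L l, sieveOf (L (l + 1)) x ∈ C.J x := by
    rintro l hl hln x ⟨x', hx', r, hr⟩
    refine C.J.superset_covering ?_ (C.cover_hor r _ (lev_cover (Nat.le_succ l) hln hx'))
    rintro w k ⟨c, ⟨b, q, ⟨m, y', hy', hle'⟩, hq⟩, hwc⟩
    obtain ⟨y, hy, q', hq'⟩ := hL (l + 1) y' hy'
    exact ⟨y, hy, hwc.trans (C.sq_left (sq_of_le (C.sq_trans hq hr) hq' hle'))⟩
  obtain ⟨h, hh⟩ := exists_hor (T := ofLev (born T') (one_le_born T') (born_le T') a L hr hfin hsep hle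
    hcov) (T' := T') born_ofLev t (by
      intro l y hy
      exact (mem_lev_ofLev.1 hy).2.2) (by
      intro l y' hy'
      obtain ⟨z, hz, h⟩ := hL l y' hy'
      exact ⟨z, mem_lev_ofLev.2 ⟨born_le_of_mem hy', le_of_mem hy', hz⟩, h⟩)
  exact ⟨_, h, by rw [hh]; rfl⟩

variable {A B : SC (s n C)}

lemma car_trans {l l' i : ℕ} {x y w : C.P} (hT : (i, T) ∈ A.carrier) (hx : x ∈ lev T l)
    (hy : y ∈ lev T l') (hyx : y ≤ x) (hw : w ≤ y) : Car (trans A l l') (i, x) (i, y) (C.hid w) :=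
  ⟨_, ⟨i, T, hT, x, hx, y, hy, hyx, rfl⟩, rfl, rfl, C.sq_hid hw⟩

/-- Transition maps keep labels and act by identities: a carried part stays the same, and only the
member it is regarded as a part of changes. -/
lemma car_trans_elim {l l' : ℕ} {i j : ℕ × C.P} {w z : C.P} {t : C.Hor w z}
    (h : Car (trans A l l') i j t) : j.1 = i.1 ∧ w ≤ j.2 ∧ j.2 ≤ i.2 ∧
      (∃ T, (i.1, T) ∈ A.carrier ∧ i.2 ∈ lev T l ∧ j.2 ∈ lev T l') ∧
      (⟨w, C.hid w⟩ : Σ z, C.Hor w z) = ⟨z, t⟩ := by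
  obtain ⟨_, ⟨i, T, hT, x, hx, y, hy, hyx, rfl⟩, rfl, rfl, hs⟩ := h
  exact ⟨rfl, C.sq_left hs, hyx, ⟨T, hT, hx, hy⟩, sq_unique' (C.sq_hid (C.sq_left hs)) hs⟩

lemma born_dom {f : A ⟶ B} {p : Piece (s n C)} (hp : p ∈ Hom.pieces f) :
    born p.dom = born p.src.2 := (le_iff.1 (Hom.dom_le f p hp)).1

lemma born_tgt {f : A ⟶ B} {p : Piece (s n C)} (hp : p ∈ Hom.pieces f) :
    born p.tgt.2 = born p.src.2 := (born_eq_of_hor p.hor).symm.trans (born_dom hp)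

/-- Two pieces over the same diagram whose roots overlap agree. -/
lemma piece_eq_of_root {f : A ⟶ B} {p q : Piece (s n C)} (hp : p ∈ Hom.pieces f)
    (hq : q ∈ Hom.pieces f) (h : p.src = q.src) {w : C.P} (hw : w ≤ root p.dom)
    (hw' : w ≤ root q.dom) : p = q := by
  by_contra hne
  exact disj_root ⟨⟨p.src.2, Hom.dom_le f p hp, h ▸ Hom.dom_le f q hq⟩, Hom.disj f p hp q hq hne h⟩
    w hw hw'

lemma car_union {f : A ⟶ B} {p : Piece (s n C)} (hp : p ∈ Hom.pieces f) {l : ℕ} {a : C.P}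
    (ha : a ∈ lev p.dom l) : ∃ x ∈ lev p.src.2 l, a ≤ x ∧ ∃ b ∈ lev p.tgt.2 l, ∃ t : C.Hor a b,
      C.Sq t (under p.hor) ∧
      (⟨(p.src.1, x), (p.tgt.1, b), a, t⟩ : Piece C) ∈ Hom.pieces ((union n C l).map f) := by
  obtain ⟨x, hx, hax⟩ := (le_iff.1 (Hom.dom_le f p hp)).2 _ _ ha
  obtain ⟨b, hb, t, ht⟩ := carries p.hor l ha
  exact ⟨x, hx, hax, b, hb, t, ht, (mem_union_map f).2 ⟨p, hp, x, hx, a, ha, b, hb, t, ht, hax, rfl⟩⟩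

/-- Each element of a level of `p.dom` yields a piece of `f'` over the same diagrams with that
element in its domain. All these pieces coincide with the one found at the root, since their roots
overlap. Pieces are compared in one direction only, so the levels are too. -/
lemma lev_subset_of_union {f f' : A ⟶ B} (h : ∀ l ≤ n, Hom.pieces ((union n C l).map f) ⊆
    Hom.pieces ((union n C l).map f')) {p : Piece (s n C)} (hp : p ∈ Hom.pieces f) :
    ∃ p' ∈ Hom.pieces f', p'.src = p.src ∧ p'.tgt = p.tgt ∧ root p'.dom = root p.dom ∧
      (∀ l, lev p.dom l ⊆ lev p'.dom l) ∧ C.Sq (under p.hor) (under p'.hor) := by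
  have key : ∀ l, ∀ a ∈ lev p.dom l, ∃ p' ∈ Hom.pieces f', p'.src = p.src ∧ p'.tgt = p.tgt ∧
      a ∈ lev p'.dom l ∧ ∃ b, ∃ t : C.Hor a b, C.Sq t (under p.hor) ∧ C.Sq t (under p'.hor) := by
    intro l a ha
    obtain ⟨x, hx, hax, b, hb, t, ht, hm⟩ := car_union hp ha
    obtain ⟨p', hp', x', hx', a', ha', b', hb', t', ht', -, e⟩ :=
      (mem_union_map f').1 (h l (le_of_mem ha) hm)
    rw [Piece.mk.injEq] at e
    obtain ⟨e5, e6, rfl, e4⟩ := e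
    obtain ⟨e1, rfl⟩ := Prod.mk.inj e5
    obtain ⟨e2, rfl⟩ := Prod.mk.inj e6
    clear e5 e6
    obtain rfl := eq_of_heq e4
    refine ⟨p', hp', Prod.ext e1.symm ?_, Prod.ext e2.symm ?_, ha', _, t, ht, ht'⟩
    · have h1 := Hom.src_mem f p hp
      have h2 := Hom.src_mem f' p' hp'
      rw [← Prod.mk.eta (p := p.src)] at h1
      rw [← Prod.mk.eta (p := p'.src), ← e1] at h2
      exact label_unique h2 h1 (le_root hx') (le_root hx)
    · have h1 := Hom.tgt_mem f p hp
      have h2 := Hom.tgt_mem f' p' hp'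
      rw [← Prod.mk.eta (p := p.tgt)] at h1
      rw [← Prod.mk.eta (p := p'.tgt), ← e2] at h2
      exact label_unique h2 h1 (le_root hb') (le_root hb)
  obtain ⟨p', hp', h1, h2, h3, b, t, ht, ht'⟩ := key _ _ (root_mem p.dom)
  have hroot : root p'.dom = root p.dom := by
    have hb : born p.dom = born p'.dom := by rw [born_dom hp, born_dom hp', h1]
    rw [hb, lev_born] at h3
    exact h3.symm
  refine ⟨p', hp', h1, h2, hroot, fun l a ha => ?_, ?_⟩
  · obtain ⟨q, hq, k1, k2, k3, -⟩ := key l a ha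
    obtain rfl := piece_eq_of_root hp' hq (h1.trans k1.symm) (hroot ▸ le_root ha) (le_root k3)
    exact k3
  · cases sq_unique' ht (C.sq_refl _)
    exact ht'

/-- Passing from `f` to `f'` and back returns to the same piece, so the inclusions of levels are
equalities. -/
lemma union_faithful {f f' : A ⟶ B} (h : ∀ l ≤ n, Hom.pieces ((union n C l).map f) ⊆
    Hom.pieces ((union n C l).map f')) (h' : ∀ l ≤ n, Hom.pieces ((union n C l).map f') ⊆
    Hom.pieces ((union n C l).map f)) : Hom.pieces f ⊆ Hom.pieces f' := by
  intro p hp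
  obtain ⟨p', hp', h1, h2, h3, h4, h5⟩ := lev_subset_of_union h hp
  obtain ⟨q, hq, k1, k2, k3, k4, -⟩ := lev_subset_of_union h' hp'
  obtain rfl := piece_eq_of_root hp hq (k1.trans h1).symm le_rfl (k3.trans h3).ge
  have hd : p.dom = p'.dom := ext fun l => Set.Subset.antisymm (h4 l) (k4 l)
  obtain ⟨a, b, c, d⟩ := p
  obtain ⟨a', b', c', d'⟩ := p'
  simp only at h1 h2 hd h5
  subst h1 h2 hd
  have : under d = under d' := by
    have := sq_unique' h5 (C.sq_refl _)
    exact eq_of_heq (Sigma.mk.inj this).2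
  obtain rfl := under_inj this
  exact hp'

instance comb_faithful (n : ℕ) : (comb n C).Faithful where
  map_injective {A B f f'} e := by
    have h : ∀ l ≤ n, (union n C l).map f = (union n C l).map f' := fun l hl =>
      congrArg (fun ψ => LObj.app ψ ⟨l, Nat.lt_succ_of_le hl⟩) e
    exact SC.hom_ext (Set.Subset.antisymm (union_faithful (fun l hl => (h l hl ▸ le_rfl))
      fun l hl => (h l hl ▸ le_rfl)) (union_faithful (fun l hl => (h l hl ▸ le_rfl))
      fun l hl => (h l hl ▸ le_rfl)))

/-- The piece of the union of the levels at which the source of `r` is born. -/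
def rootPiece (r : Piece (s n C)) : Piece C :=
  ⟨(r.src.1, root r.src.2), (r.tgt.1, root r.tgt.2), root r.dom, under r.hor⟩

/-- The domain of a piece is the pullback of its target diagram along the root component, which
therefore determines the piece. -/
lemma eq_of_rootPiece {r r' : Piece (s n C)} (hs : r.src = r'.src) (ht : r.tgt = r'.tgt)
    (h : rootPiece r = rootPiece r') : r = r' := by
  obtain ⟨a, b, c, d⟩ := r
  obtain ⟨a', b', c', d'⟩ := r'
  simp only at hs ht
  subst hs ht
  rw [rootPiece, rootPiece, Piece.mk.injEq] at h
  obtain ⟨-, -, h1, h2⟩ := h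
  simp only at h1 h2
  have key : ∀ {c c' : (s n C).P} (d : (s n C).Hor c b.2) (d' : (s n C).Hor c' b.2) {x x' : C.P}
      {t : C.Hor x (root b.2)} {t' : C.Hor x' (root b.2)}, x = x' → t ≍ t' → under d ≍ t →
      root c = x → under d' ≍ t' → root c' = x' → ∀ l, lev c l ⊆ lev c' l := by
    rintro c c' d d' x x' t t' rfl h3 h4 rfl h5 h6 l z hz
    obtain rfl := eq_of_heq h3
    obtain rfl := eq_of_heq h4
    obtain ⟨y, hy, r, hr⟩ := carries d l hz
    obtain ⟨z', hz', r', hr'⟩ := carries' d' l hy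
    have h7 : (⟨root c', under d'⟩ : Σ x, C.Hor x (root b.2)) = ⟨root c, under d⟩ :=
      Sigma.ext h6 h5
    have h8 : C.Sq r' (under d) := by
      have : ∀ σ σ' : Σ x, C.Hor x (root b.2), σ = σ' → C.Sq r' σ.2 → C.Sq r' σ'.2 := by
        rintro σ _ rfl h; exact h
      exact this _ _ h7 hr'
    cases C.sq_unique hr h8
    exact hz'
  have hc : c = c' := ext fun l => Set.Subset.antisymm (key d d' h1 h2 HEq.rfl rfl HEq.rfl rfl l)
    (key d' d h1.symm h2.symm HEq.rfl rfl HEq.rfl rfl l)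
  subst hc
  obtain rfl := under_inj (eq_of_heq h2)
  rfl

/-- A family of maps of the levelwise unions that is natural and layered comes from a morphism of
families of diagrams. -/
lemma union_full (ψ : ∀ l ≤ n, (union n C l).obj A ⟶ (union n C l).obj B)
    (hn : ∀ l l' (h : l ≤ l') (hl : l' ≤ n),
      trans A l l' ≫ ψ l' hl = ψ l (h.trans hl) ≫ trans B l l')
    (hl : ∀ l l', l ≤ l' → ∀ hl : l' ≤ n, ∀ p ∈ Hom.pieces (ψ l' hl), p.src ∉ im (trans A l l') →
      p.tgt ∉ im (trans B l l')) :
    ∃ f : A ⟶ B, ∀ l hl, (union n C l).map f = ψ l hl := by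
  -- As pieces are determined by their root components, `f` has to consist of the pieces whose root
  -- component occurs in `ψ` at the level of birth.
  let S : Set (Piece (s n C)) := {r | r.src ∈ A.carrier ∧ r.tgt ∈ B.carrier ∧ r.dom ≤ r.src.2 ∧
    rootPiece r ∈ Hom.pieces (ψ (born r.src.2) (born_le _))}
  have htgt : ∀ r ∈ S, ∀ r' ∈ S, r.src = r'.src → ∀ w, w ≤ root r.dom → w ≤ root r'.dom → r = r' := by
    rintro ⟨rs, rt, rd, rh⟩ ⟨h1, h2, h3, h4⟩ ⟨_, rt', rd', rh'⟩ ⟨h1', h2', h3', h4'⟩ (rfl : rs = _) w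
      hw hw'
    have e := piece_eq h4 h4' rfl hw hw'
    have e' := e
    rw [rootPiece, rootPiece, Piece.mk.injEq] at e'
    obtain ⟨e1, e2⟩ := Prod.mk.inj e'.2.1
    obtain ⟨i, T⟩ := rt
    obtain ⟨i', T'⟩ := rt'
    simp only at e1 e2 h2 h2'
    subst e1
    obtain rfl := label_unique h2 h2' le_rfl e2.le
    exact eq_of_rootPiece rfl rfl e
  let f : A ⟶ B :=
    { pieces := S
      finite := by
        have hfin : (⋃ l, ⋃ hl : l ≤ n, Hom.pieces (ψ l hl)).Finite := by
          refine ((Set.finite_Iic n).biUnion (t := fun l => ⋃ hl : l ≤ n, Hom.pieces (ψ l hl))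
            fun l hl => ?_).subset (Set.iUnion_subset fun l => Set.iUnion_subset fun hl => ?_)
          · exact Set.finite_iUnion fun _ => Hom.finite _
          · exact (Set.subset_iUnion (fun hl => Hom.pieces (ψ l hl)) hl).trans
              (Set.subset_biUnion_of_mem (u := fun l => ⋃ hl : l ≤ n, Hom.pieces (ψ l hl)) hl)
        refine Set.Finite.of_finite_image (f := fun r => (r.src, r.tgt, rootPiece r))
          ((A.finite.prod (B.finite.prod hfin)).subset ?_) ?_
        · rintro _ ⟨r, ⟨h1, h2, -, h4⟩, rfl⟩
          refine ⟨h1, h2, ?_⟩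
          simp only [Set.mem_iUnion]
          exact ⟨_, _, h4⟩
        · intro r _ r' _ e
          simp only [Prod.mk.injEq] at e
          exact eq_of_rootPiece e.1 e.2.1 e.2.2
      src_mem := fun r h => h.1
      tgt_mem := fun r h => h.2.1
      dom_le := fun r h => h.2.2.1
      disj := fun r hr r' hr' hne e w hw hw' =>
        hne (htgt r hr r' hr' e (root w) (root_le hw) (root_le hw')) }
  refine ⟨f, fun l hln => SC.hom_ext_of_car ?_ ?_⟩
  · intro p hp
    obtain ⟨r, ⟨h1, h2, h3, h4⟩, x, hx, a, ha, c, hc, t, ht, hax, rfl⟩ := (mem_union_map f).1 hp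
    have hb := born_le_of_mem hx
    have h5 : Car (ψ _ (born_le _)) (r.src.1, root r.src.2) (r.tgt.1, root r.tgt.2) t :=
      ⟨_, h4, rfl, rfl, ht⟩
    have hbt : born r.src.2 = born r.tgt.2 := (le_iff.1 h3).1.symm.trans (born_eq_of_hor r.hor)
    -- Naturality of `ψ` between the level of birth and level `l` forces `ψ l` to carry the
    -- component of `r` at level `l` in the same way.
    have h6 := h5.comp (car_trans (l := born r.src.2) (l' := l) h2 (hbt ▸ root_mem _) hc (le_root hc)
      le_rfl)
    rw [C.hcomp_id, ← hn _ _ hb hln] at h6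
    obtain ⟨⟨i, y⟩, z, s, s', k1, k2, k3⟩ := car_comp.1 h6
    obtain ⟨e1, k4, -, ⟨T, hT, -, hy⟩, k5⟩ := car_trans_elim k1
    simp only at e1 k4 hT hy
    obtain rfl := e1
    cases k5
    obtain rfl := label_unique hT h1 (k4.trans (le_root hy)) (hax.trans (le_root hx))
    obtain rfl := eq_of_le hy hx k4 hax
    rw [C.id_hcomp] at k3
    rw [← k3] at k2
    exact k2
  · rintro ⟨⟨i, x⟩, ⟨j, c⟩, a, q⟩ hq
    obtain ⟨T, hT, hx⟩ := mem_union.1 (Hom.src_mem _ _ hq)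
    obtain ⟨T', hT', hc⟩ := mem_union.1 (Hom.tgt_mem _ _ hq)
    have hax : a ≤ x := Hom.dom_le _ _ hq
    have hb := born_le_of_mem hx
    -- Naturality shows that `T'` is born no later than `T`. For the converse, layeredness is
    -- applied at level `born T - 1`: there `T` is not yet born, so neither is `T'`.
    have hbT : born T' = born T := by
      apply le_antisymm
      · have h1 := (mem_im_trans hb hT hx).2 le_rfl
        have h2 := tgt_mem_im_comp hq h1
        rw [hn _ _ hb hln] at h2
        exact (mem_im_trans hb hT' hc).1 (im_comp_subset _ _ h2)
      · have h0 := one_le_born T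
        have h1 := hl (born T - 1) l (by omega) hln _ hq
        rw [mem_im_trans (by omega) hT hx, mem_im_trans (by omega) hT' hc] at h1
        have := h1 (by omega)
        omega
    have h1 := (car_trans hT (root_mem T) hx (le_root hx) hax).comp (car_self hq)
    rw [C.id_hcomp, hn _ _ hb hln] at h1
    obtain ⟨⟨j', y⟩, z, s, s', k1, k2, k3⟩ := car_comp.1 h1
    obtain ⟨e1, k4, k6, ⟨T'', hT'', hy, hc'⟩, k5⟩ := car_trans_elim k2
    simp only at e1 k4 hT'' hy hc' k6
    obtain rfl := e1
    cases k5
    obtain rfl := label_unique hT'' hT' (le_root hc') (le_root hc)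
    rw [← hbT, lev_born] at hy
    obtain rfl := hy
    rw [C.hcomp_id] at k3
    obtain rfl : q = s := k3
    obtain ⟨⟨_, _, d, t⟩, ht, rfl, rfl, hs⟩ := k1
    simp only at hs t
    -- The domain of the required piece is the pullback of the target diagram along the root
    -- component. Naturality at every level places it below `T`.
    obtain ⟨R, h, e⟩ := exists_pull T'' t
    cases e
    have hRT : R ≤ T := by
      refine le_iff.2 ⟨(born_eq_of_hor h).trans hbT, fun m y hy => ?_⟩
      obtain ⟨y', hy', r, hr⟩ := carries h m hy
      have hbm : born T ≤ m := hbT ▸ born_le_of_mem hy'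
      have h2 : Car (ψ _ _) (i, root T) (j, root T'') r := ⟨_, ht, rfl, rfl, hr⟩
      have h3 := h2.comp (car_trans (l := born T) (l' := m) hT'' (hbT ▸ root_mem _) hy' (le_root hy')
        le_rfl)
      rw [C.hcomp_id, ← hn _ _ hbm (le_of_mem hy)] at h3
      obtain ⟨⟨i', y''⟩, z, s, s', k1, -, -⟩ := car_comp.1 h3
      obtain ⟨e1, k9, -, ⟨T0, hT0, h0, h0'⟩, -⟩ := car_trans_elim k1
      simp only at e1 k9 hT0 h0'
      subst e1
      obtain rfl := label_unique hT0 hT (le_root h0) (le_refl _)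
      exact ⟨y'', h0', k9⟩
    have hS : (⟨(i, T), (j, T''), R, h⟩ : Piece (s n C)) ∈ Hom.pieces f := ⟨hT, hT', hRT, ht⟩
    obtain ⟨a', ha', t', ht'⟩ := carries' h l hc
    have hc1 : Car (union n C l |>.map f) (i, x) (j, c) q := by
      cases C.sq_unique hs ht'
      exact SC.car_self ((mem_union_map f).2 ⟨_, hS, x, hx, _, ha', c, hc, q, ht', hax, rfl⟩)
    exact hc1

instance comb_full (n : ℕ) : (comb n C).Full where
  map_surjective {A B} φ := by
    obtain ⟨f, hf⟩ := union_full (A := A) (B := B)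
      (fun l hl => LObj.app φ ⟨l, Nat.lt_succ_of_le hl⟩)
      (fun l l' h hl => LObj.naturality φ (i := ⟨l, Nat.lt_succ_of_le (h.trans hl)⟩)
        (j := ⟨l', Nat.lt_succ_of_le hl⟩) h)
      (fun l l' h hl => LObj.layered_iff.1 φ.2 ⟨l, Nat.lt_succ_of_le (h.trans hl)⟩
        ⟨l', Nat.lt_succ_of_le hl⟩ h)
    exact ⟨f, LObj.hom_ext fun l => hf l (Nat.le_of_lt_succ l.2)⟩

end Forest
end PolytopeComplex

/-! ### Essential surjectivity of F_n -/

namespace PolytopeComplex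

variable {C : PolytopeComplex.{u, v}}

namespace SC

variable {A B E : SC C}

/-- The part of `p.dom` on which `f ≫ g` is defined covers `p.dom` if `g` covers the target of `p`. -/
lemma dom_comp_mem {f : A ⟶ B} {g : B ⟶ E} {p : Piece C} (hp : p ∈ Hom.pieces f)
    (hg : CoversAt g p.tgt) : ∃ S ∈ C.J p.dom, ∀ w (k : w ⟶ p.dom), S.arrows k → Dom (f ≫ g) p.src w := by
  refine ⟨_, C.cover_hor p.hor _ hg, ?_⟩
  rintro y l ⟨a, ⟨b, t, ⟨m, hm⟩, ht⟩, hle⟩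
  exact ((dom_comp ⟨p, hp, rfl, rfl, ht⟩).2 (dom_of_sieveOf hm)).of_le hle

end SC

namespace LObj

open SC

variable {n : ℕ} {A B : LObj C n}

/-- A member of `B_k` coming from `B_i` is hit from `A_i`, because level `i` is surjective on
indices; by injectivity at level `k` the piece ending there starts in the image of `A_i`. -/
lemma layered_of_weq (φ : A.F ⟶ B.F) (h : ∀ i, SC.weq C (φ.app i)) : Layered φ := by
  refine layered_iff.2 fun i k hik p hp hs ht => hs (src_mem_im (h k).1 hp ?_)
  have e : A.map hik ≫ φ.app k = φ.app i ≫ B.map hik := φ.naturality _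
  rw [e]
  obtain ⟨q, hq, h1⟩ := ht
  rw [← h1]
  exact tgt_mem_im_comp hq (im_eq_of_weq (h i) ▸ Hom.src_mem _ q hq)

/-- The inverse natural transformation is layered too, since its components are isomorphisms and
hence weak equivalences. -/
lemma isIso_of_app (φ : A ⟶ B) (h : ∀ i, IsIso (app φ i)) : IsIso φ := by
  have : ∀ i, IsIso (φ.1.app i) := h
  have : IsIso φ.1 := NatIso.isIso_of_isIso_app _
  refine ⟨⟨CategoryTheory.inv φ.1, layered_of_weq _ fun i => ?_⟩, Subtype.ext ?_, Subtype.ext ?_⟩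
  · rw [NatIso.isIso_inv_app]
    exact weq_of_isIso _ inferInstance
  · exact IsIso.hom_inv_id φ.1
  · exact IsIso.inv_hom_id φ.1

instance (φ : A ⟶ B) [IsIso φ] (i : Fin (n + 1)) : IsIso (app φ i) :=
  ⟨app (CategoryTheory.inv φ) i, by rw [← app_comp, IsIso.hom_inv_id, app_id],
    by rw [← app_comp, IsIso.inv_hom_id, app_id]⟩

/-- The member `x` of `A_l` does not come from an earlier level. -/
def New (A : LObj C n) (l : Fin (n + 1)) (x : ℕ × C.P) : Prop :=
  x ∈ (A.F.obj l).carrier ∧ ∀ k (h : k < l), x ∉ im (A.map h.le)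

/-- If `l < l'`, the common target comes from `A_l` by way of `A_{l'}`; injectivity of `A_{l'} →
A_m` then puts `p'.src` into the image of `A_l`, so it is not new. -/
lemma New.level_le {l l' m : Fin (n + 1)} {h : l ≤ m} {h' : l' ≤ m}
    {p p' : Piece C} (hp : p ∈ Hom.pieces (A.map h)) (hp' : p' ∈ Hom.pieces (A.map h'))
    (e : p.tgt = p'.tgt) (hx : New A l' p'.src) : l' ≤ l := by
  by_contra hlt
  rw [not_le] at hlt
  refine hx.2 l hlt (src_mem_im (A.cof h') hp' ?_)
  have := map_comp A hlt.le h'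
  rw [← e]
  change p.tgt ∈ im (A.map hlt.le ≫ A.map h')
  rw [this]
  exact ⟨p, hp, rfl⟩

lemma New.unique {l l' m : Fin (n + 1)} {h : l ≤ m} {h' : l' ≤ m}
    {p p' : Piece C} (hp : p ∈ Hom.pieces (A.map h)) (hp' : p' ∈ Hom.pieces (A.map h'))
    (e : p.tgt = p'.tgt) (hx : New A l p.src) (hx' : New A l' p'.src) : l = l' ∧ p = p' := by
  obtain rfl := le_antisymm (New.level_le hp' hp e.symm hx)
    (New.level_le hp hp' e hx')
  exact ⟨rfl, (A.cof h).2 p hp p' hp' e⟩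

/-- The level is the least one whose image in `A_m` contains the member. -/
lemma exists_new {m : Fin (n + 1)} {z : ℕ × C.P} (hz : z ∈ (A.F.obj m).carrier) :
    ∃ (l : Fin (n + 1)) (h : l ≤ m), ∃ p ∈ Hom.pieces (A.map h), p.tgt = z ∧ New A l p.src := by
  obtain ⟨l, ⟨h, p, hp, rfl⟩, hmin⟩ := WellFounded.has_min (wellFounded_lt (α := Fin (n + 1)))
    {l | ∃ h : l ≤ m, z ∈ im (A.map h)} ⟨m, le_rfl, by rw [map_refl, im_map_id]; exact hz⟩
  refine ⟨l, h, p, hp, rfl, Hom.src_mem _ p hp, fun k hk hs => hmin k ⟨hk.le.trans h, ?_⟩ hk⟩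
  rw [← map_comp A hk.le h]
  exact tgt_mem_im_comp hp hs

end LObj

namespace Forest

open SC LObj

variable {n : ℕ}

/-- The diagram of the parts of a member of the `l`-th family of a sequence of cofibrations. -/
lemma exists_forest (A : LObj C n) (l : Fin (n + 1)) (x : ℕ × C.P) (hx : x ∈ (A.F.obj l).carrier) :
    ∃ T : (s n C).P, born T = l ∧ root T = x.2 ∧ ∀ (m : Fin (n + 1)) (y : C.P), y ∈ lev T m ↔
      ∃ h : l ≤ m, ∃ p ∈ Hom.pieces (A.map h), p.src = x ∧ p.dom = y := by
  have hl : 1 ≤ (l : ℕ) := by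
    by_contra h0
    obtain rfl : l = 0 := Fin.val_eq_zero_iff.1 (by omega)
    rw [A.zero] at hx
    exact hx
  let L : ℕ → Set C.P := fun m => {y | ∃ (hm : m < n + 1) (h : l ≤ ⟨m, hm⟩),
    ∃ p ∈ Hom.pieces (A.map h), p.src = x ∧ p.dom = y}
  have hr : L l = {x.2} := by
    ext y
    constructor
    · rintro ⟨hm, h, p, hp, hs, rfl⟩
      rw [map_refl] at hp
      obtain ⟨i, hi, rfl⟩ := hp
      exact congrArg Prod.snd hs
    · rintro rfl
      exact ⟨l.2, le_rfl, _, by rw [map_refl]; exact ⟨x, hx, rfl⟩, rfl, rfl⟩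
  have hfin : ∀ m, (L m).Finite := by
    intro m
    by_cases hm : m < n + 1
    · by_cases h : l ≤ ⟨m, hm⟩
      · refine ((Hom.finite (A.map h)).image Piece.dom).subset ?_
        rintro y ⟨_, _, p, hp, _, rfl⟩
        exact ⟨p, hp, rfl⟩
      · exact Set.finite_empty.subset (by rintro y ⟨_, h', -⟩; exact (h h').elim)
    · exact Set.finite_empty.subset (by rintro y ⟨h', -⟩; exact (hm h').elim)
  have hsep : ∀ m, ∀ y ∈ L m, ∀ z ∈ L m, y ≠ z → Sep y z := by
    rintro m _ ⟨_, h, p, hp, rfl, rfl⟩ _ ⟨_, _, q, hq, hs, rfl⟩ hne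
    refine ⟨⟨p.src.2, Hom.dom_le _ p hp, hs ▸ Hom.dom_le _ q hq⟩, ?_⟩
    exact Hom.disj _ p hp q hq (by rintro rfl; exact hne rfl) hs.symm
  have hle : ∀ m, (l : ℕ) ≤ m → ∀ y ∈ L (m + 1), ∃ z ∈ L m, y ≤ z := by
    rintro m hlm _ ⟨hm, h, p, hp, hs, rfl⟩
    have hlm' : l ≤ ⟨m, by omega⟩ := hlm
    have hmm : (⟨m, by omega⟩ : Fin (n + 1)) ≤ ⟨m + 1, hm⟩ := Nat.le_succ m
    have hd : Dom (A.map h) x p.dom := ⟨p, hp, hs, le_rfl⟩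
    rw [← map_comp A hlm' hmm] at hd
    obtain ⟨q, hq, h1, h2⟩ := dom_of_dom_comp hd
    exact ⟨q.dom, ⟨_, hlm', q, hq, h1, rfl⟩, h2⟩
  have hcov : ∀ m, (l : ℕ) ≤ m → m < n → ∀ y ∈ L m, sieveOf (L (m + 1)) y ∈ C.J y := by
    rintro m hlm hmn _ ⟨hm, h, p, hp, rfl, rfl⟩
    have hmm : (⟨m, hm⟩ : Fin (n + 1)) ≤ ⟨m + 1, by omega⟩ := Nat.le_succ m
    obtain ⟨S, hS, h1⟩ := dom_comp_mem (g := A.map hmm) hp ((A.cof hmm).1 _ (Hom.tgt_mem _ p hp))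
    rw [map_comp A h hmm] at h1
    refine C.J.superset_covering ?_ hS
    intro w k hk
    obtain ⟨q, hq, hs, hle⟩ := h1 w k hk
    exact ⟨q.dom, ⟨_, _, q, hq, hs, rfl⟩, hle⟩
  refine ⟨ofLev l hl (Nat.le_of_lt_succ l.2) x.2 L hr hfin hsep hle hcov, born_ofLev, rfl, fun m y => ?_⟩
  rw [mem_lev_ofLev]
  constructor
  · rintro ⟨_, _, _, h, h'⟩
    exact ⟨h, h'⟩
  · rintro ⟨h, h'⟩
    exact ⟨h, Nat.le_of_lt_succ m.2, m.2, h, h'⟩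

/-- Each member of `A_m` is the target of exactly one piece, among all maps `A_l → A_m`, that starts
at a new member. Grouping these pieces by their source gives one diagram per new member, with the
domains of the pieces as levels. The map `ψ m` carries each domain to the target of its piece, so it
is bijective on indices with horizontal components. -/
lemma exists_comb_iso (A : LObj C n) : ∃ (X : SC (s n C)) (ψ : (comb n C).obj X ⟶ A), IsIso ψ := by
  choose T hTb hTr hT using fun (a : {a : Fin (n + 1) × (ℕ × C.P) // New A a.1 a.2}) =>
    exists_forest A a.1.1 a.1.2 a.2.1
  have hfin : {a : Fin (n + 1) × (ℕ × C.P) | New A a.1 a.2}.Finite := by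
    refine (Set.finite_iUnion (f := fun l => (fun x => (l, x)) '' (A.F.obj l).carrier)
      fun l => (A.F.obj l).finite.image _).subset ?_
    rintro ⟨l, x⟩ h
    exact Set.mem_iUnion.2 ⟨l, x, h.1, rfl⟩
  -- Different diagrams get different labels, so that the separation condition on `X` is vacuous.
  obtain ⟨ν, hν⟩ := Set.countable_iff_exists_injOn.1 hfin.countable
  obtain ⟨X, hX⟩ : ∃ X : SC (s n C), X.carrier =
      Set.range fun a : {a : Fin (n + 1) × (ℕ × C.P) // New A a.1 a.2} => (ν a.1, T a) := by
    have : Finite {a : Fin (n + 1) × (ℕ × C.P) // New A a.1 a.2} := hfin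
    refine ⟨⟨_, Set.finite_range _, ?_⟩, rfl⟩
    rintro _ ⟨a, rfl⟩ _ ⟨b, rfl⟩ hne e
    obtain rfl : a = b := Subtype.ext (hν a.2 b.2 e)
    exact absurd rfl hne
  have hun : ∀ {m : Fin (n + 1)} {i : ℕ × C.P}, i ∈ ((union n C m).obj X).carrier →
      ∃ l x, ∃ h : l ≤ m, New A l x ∧ ∃ p ∈ Hom.pieces (A.map h), p.src = x ∧ i = (ν (l, x), p.dom) := by
    rintro m ⟨i, y⟩ hi
    obtain ⟨R, hR, hy⟩ := mem_union.1 hi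
    rw [hX] at hR
    obtain ⟨⟨⟨l, x⟩, hx⟩, e⟩ := hR
    obtain ⟨rfl, rfl⟩ := Prod.mk.inj e
    obtain ⟨h, p, hp, hs, rfl⟩ := (hT _ _ _).1 hy
    exact ⟨l, x, h, hx, p, hp, hs, rfl⟩
  have hmem : ∀ {l x} (hx : New A l x), (ν (l, x), T ⟨(l, x), hx⟩) ∈ X.carrier := fun {l x} hx =>
    hX ▸ ⟨⟨(l, x), hx⟩, rfl⟩
  have hlab : ∀ {l x} (hx : New A l x) {R}, (ν (l, x), R) ∈ X.carrier → R = T ⟨(l, x), hx⟩ := by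
    intro l x hx R hR
    rw [hX] at hR
    obtain ⟨⟨a, ha⟩, e⟩ := hR
    obtain ⟨e1, rfl⟩ := Prod.mk.inj e
    obtain rfl := hν ha hx e1
    rfl
  have hψ : ∀ m : Fin (n + 1), ∃ ψ : (union n C m).obj X ⟶ A.F.obj m, Hom.pieces ψ =
      {r | ∃ (l : Fin (n + 1)) (h : l ≤ m), ∃ p ∈ Hom.pieces (A.map h), New A l p.src ∧
        r = ⟨(ν (l, p.src), p.dom), p.tgt, p.dom, p.hor⟩} := by
    intro m
    refine ⟨⟨_, ?_, ?_, ?_, ?_, ?_⟩, rfl⟩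
    · refine (Set.finite_iUnion (f := fun l : Fin (n + 1) => ⋃ h : l ≤ m,
        (fun p : Piece C => (⟨(ν (l, p.src), p.dom), p.tgt, p.dom, p.hor⟩ : Piece C)) ''
          Hom.pieces (A.map h)) fun l => Set.finite_iUnion fun h => (Hom.finite _).image _).subset ?_
      rintro r ⟨l, h, p, hp, -, rfl⟩
      simp only [Set.mem_iUnion]
      exact ⟨l, h, p, hp, rfl⟩
    · rintro _ ⟨l, h, p, hp, hx, rfl⟩
      exact mem_union.2 ⟨_, hmem hx, (hT _ _ _).2 ⟨h, p, hp, rfl, rfl⟩⟩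
    · rintro _ ⟨l, h, p, hp, hx, rfl⟩
      exact Hom.tgt_mem _ p hp
    · rintro _ ⟨l, h, p, hp, hx, rfl⟩
      exact le_rfl
    · rintro _ ⟨l, h, p, hp, hx, rfl⟩ _ ⟨l', h', p', hp', hx', rfl⟩ hne e
      obtain ⟨e1, e2⟩ := Prod.mk.inj e
      have e3 := hν hx hx' e1
      obtain ⟨rfl, e4⟩ := Prod.mk.inj e3
      obtain rfl := piece_eq hp hp' e4 le_rfl e2.le
      exact absurd rfl hne
  choose ψ hψ using hψ
  have hcar : ∀ {m l : Fin (n + 1)} {x : ℕ × C.P} (h : l ≤ m) (_ : New A l x) {p : Piece C}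
      (_ : p ∈ Hom.pieces (A.map h)) (_ : p.src = x) {a b : C.P} {t : C.Hor a b},
      C.Sq t p.hor → Car (ψ m) (ν (l, x), p.dom) p.tgt t := by
    rintro m l _ h hx p hp rfl a b t ht
    exact ⟨⟨(ν (l, p.src), p.dom), p.tgt, p.dom, p.hor⟩, by rw [hψ]; exact ⟨l, h, p, hp, hx, rfl⟩, rfl,
      rfl, ht⟩
  have hiso : ∀ m, IsIso (ψ m) := by
    intro m
    refine isIso_of_bijective (ψ m) ?_ ?_ ?_
    · intro r hr r' hr' e
      rw [hψ] at hr hr'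
      obtain ⟨l, h, p, hp, hx, rfl⟩ := hr
      obtain ⟨l', h', p', hp', hx', rfl⟩ := hr'
      obtain ⟨rfl, rfl⟩ := New.unique hp hp' e hx hx'
      rfl
    · intro i hi
      obtain ⟨l, x, h, hx, p, hp, hs, rfl⟩ := hun hi
      exact ⟨p.tgt, p.hor, hcar h hx hp hs (C.sq_refl _)⟩
    · intro z hz
      obtain ⟨l, h, p, hp, rfl, hx⟩ := exists_new hz
      exact ⟨_, p.hor, hcar h hx hp rfl (C.sq_refl _)⟩
  -- Both composites consist of the pieces of `A_l → A_{m'}` from new members, seen through the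
  -- factorization over `A_m`.
  have hnat : ∀ {m m' : Fin (n + 1)} (h : m ≤ m'), trans X m m' ≫ ψ m' = ψ m ≫ A.map h := by
    intro m m' h
    refine hom_ext_of_car (fun r hr => ?_) fun r hr => ?_
    · obtain ⟨j, y, t, t', h1, ⟨r0, hr0, rfl, h3, h4⟩, h2⟩ := car_comp.1 (SC.car_self hr)
      rw [hψ] at hr0
      obtain ⟨l, hl, p0, hp0, hx, rfl⟩ := hr0
      obtain ⟨e1, k1, k2, ⟨R, hR, hi, hj⟩, k5⟩ := car_trans_elim h1
      simp only at e1 k1 k2 h3 h4 hj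
      rw [← e1] at hR
      obtain rfl := hlab hx hR
      obtain ⟨hlm, p1, hp1, hs1, hd1⟩ := (hT _ _ _).1 hi
      simp only at hs1 hlm hp1
      cases k5
      rw [C.id_hcomp] at h2
      obtain rfl : r.hor = t' := h2
      have h5 : Car (A.map hl) p0.src r.tgt r.hor := ⟨p0, hp0, rfl, h3, h4⟩
      rw [← map_comp A hlm h] at h5
      obtain ⟨j1, z, q, q', k3, k4, k6⟩ := car_comp.1 h5
      obtain ⟨p2, hp2, hs2, rfl, hq2⟩ := k3
      obtain rfl := piece_eq hp2 hp1 (hs2.trans hs1.symm) (C.sq_left hq2) (hd1 ▸ k1.trans k2)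
      rw [k6]
      refine Car.comp (j := p2.tgt) ?_ k4
      have := hcar hlm hx hp2 hs2 hq2
      rwa [hd1, show (ν (l, p0.src), r.src.2) = r.src from Prod.ext e1 rfl] at this
    · obtain ⟨j, y, q, q', ⟨r0, hr0, hi, rfl, h3⟩, h4, h2⟩ := car_comp.1 (SC.car_self hr)
      rw [hψ] at hr0
      obtain ⟨l, hl, p1, hp1, hx, rfl⟩ := hr0
      simp only at hi h3 h4
      have h5 := Car.comp (⟨p1, hp1, rfl, rfl, h3⟩ : Car (A.map hl) p1.src p1.tgt q) h4
      rw [map_comp A hl h, ← h2] at h5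
      obtain ⟨p0, hp0, hs0, ht0, h6⟩ := h5
      have hlev := (hT ⟨(l, p1.src), hx⟩ m' p0.dom).2 ⟨_, p0, hp0, hs0, rfl⟩
      have hlev' := (hT ⟨(l, p1.src), hx⟩ m p1.dom).2 ⟨_, p1, hp1, rfl, rfl⟩
      obtain ⟨y1, hy1, hle1⟩ := exists_le (born_le_of_mem hlev') h hlev
      obtain rfl := eq_of_le hy1 hlev' ((C.sq_left h6).trans hle1) (C.sq_left h3)
      have h7 := (car_trans (hmem hx) hlev' hlev hle1 (C.sq_left h6)).comp (hcar (hl.trans h) hx hp0 hs0 h6)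
      rw [C.id_hcomp, hi, ht0] at h7
      exact h7
  let Ψ : ((comb n C).obj X).F ⟶ A.F := { app := ψ, naturality := fun _ _ h => hnat h.le }
  exact ⟨X, ⟨Ψ, layered_of_weq Ψ fun i => weq_of_isIso _ (hiso i)⟩, isIso_of_app _ hiso⟩

instance comb_essSurj (n : ℕ) : (comb n C).EssSurj where
  mem_essImage A := by
    obtain ⟨X, ψ, h⟩ := exists_comb_iso A
    exact ⟨X, ⟨asIso ψ⟩⟩

instance comb_isEquivalence (n : ℕ) : (comb n C).IsEquivalence where

end Forest
end PolytopeComplex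

/-! ### Waldhausen categories and equivalences -/

section

variable {E E' E'' : Type*} [Category E] [Category E'] [Category E'']

lemma CategoryTheory.Limits.IsZero.of_map (G : E ⥤ E') [G.Full] [G.Faithful] {X : E}
    (h : Limits.IsZero (G.obj X)) : Limits.IsZero X where
  unique_to Y := by
    obtain ⟨u⟩ := h.unique_to (G.obj Y)
    exact ⟨⟨⟨G.preimage u.default⟩, fun f => G.map_injective (by
      exact (u.uniq _).trans (u.uniq _).symm)⟩⟩
  unique_from Y := by
    obtain ⟨u⟩ := h.unique_from (G.obj Y)
    exact ⟨⟨⟨G.preimage u.default⟩, fun f => G.map_injective (by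
      exact (u.uniq _).trans (u.uniq _).symm)⟩⟩

lemma CategoryTheory.Limits.IsZero.map_equivalence (G : E ⥤ E') [G.IsEquivalence] {X : E}
    (h : Limits.IsZero X) : Limits.IsZero (G.obj X) :=
  .of_map G.inv (h.of_iso (G.asEquivalence.unitIso.app X).symm)

/-- A Waldhausen structure pulls back along an equivalence. -/
theorem IsWaldhausen.pullback {cof weq : MorphismProperty E} {cof' weq' : MorphismProperty E'}
    (h : IsWaldhausen cof weq) (G : E' ⥤ E) [G.IsEquivalence]
    (hc : ∀ {A B : E'} (f : A ⟶ B), cof' f ↔ cof (G.map f))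
    (hw : ∀ {A B : E'} (f : A ⟶ B), weq' f ↔ weq (G.map f)) : IsWaldhausen cof' weq' where
  exists_zero := by
    obtain ⟨Z, hZ⟩ := h.exists_zero
    exact ⟨G.objPreimage Z, .of_map G (hZ.of_iso (G.objObjPreimageIso Z))⟩
  cof_of_isIso f _ := (hc f).2 (h.cof_of_isIso _ inferInstance)
  cof_comp f g hf hg := by
    rw [hc] at hf hg ⊢
    rw [G.map_comp]
    exact h.cof_comp _ _ hf hg
  cof_of_isZero f hZ := (hc f).2 (h.cof_of_isZero _ (hZ.map_equivalence G))
  exists_pushout f g hf := by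
    obtain ⟨P, g', f', hp⟩ := h.exists_pushout (G.map f) (G.map g) ((hc f).1 hf)
    let e := G.objObjPreimageIso P
    refine ⟨G.objPreimage P, G.preimage (g' ≫ e.inv), G.preimage (f' ≫ e.inv), ?_⟩
    refine IsPushout.of_map G (G.map_injective ?_) ?_
    · rw [G.map_comp, G.map_comp, G.map_preimage, G.map_preimage, ← Category.assoc, hp.w,
        Category.assoc]
    · rw [G.map_preimage, G.map_preimage]
      exact hp.of_iso (Iso.refl _) (Iso.refl _) (Iso.refl _) e.symm (by simp) (by simp) (by simp)
        (by simp)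
  cof_pushout hp hf := (hc _).2 (h.cof_pushout (hp.map G) ((hc _).1 hf))
  weq_of_isIso f _ := (hw f).2 (h.weq_of_isIso _ inferInstance)
  weq_comp f g hf hg := by
    rw [hw] at hf hg ⊢
    rw [G.map_comp]
    exact h.weq_comp _ _ hf hg
  gluing h₁ h₂ c₁ c₂ e₁ e₂ e₃ e₄ ha hb hc' := by
    rw [hc] at c₁ c₂
    rw [hw] at ha hb hc' ⊢
    refine h.gluing (h₁.map G) (h₂.map G) c₁ c₂ ?_ ?_ ?_ ?_ ha hb hc' <;> simp only [← G.map_comp, *]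

lemma IsExact.comp {W : WaldData E} {W' : WaldData E'} {W'' : WaldData E''} {F : E ⥤ E'} {G : E' ⥤ E''}
    (hF : IsExact W W' F) (hG : IsExact W' W'' G) : IsExact W W'' (F ⋙ G) where
  zero h := hG.zero (hF.zero h)
  cof _ h := hG.cof _ (hF.cof _ h)
  weq _ h := hG.weq _ (hF.weq _ h)
  po _ _ _ _ h := hG.po _ _ _ _ (hF.po _ _ _ _ h)

lemma IsWaldhausen.cof_iso {cof weq : MorphismProperty E} (h : IsWaldhausen cof weq) {A B A' B' : E}
    {f : A ⟶ B} {f' : A' ⟶ B'} (a : A' ≅ A) (b : B ≅ B') (e : f' = a.hom ≫ f ≫ b.hom) (hf : cof f) :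
    cof f' := by
  rw [e]
  exact h.cof_comp _ _ (h.cof_of_isIso _ inferInstance)
    (h.cof_comp _ _ hf (h.cof_of_isIso _ inferInstance))

lemma IsWaldhausen.weq_iso {cof weq : MorphismProperty E} (h : IsWaldhausen cof weq) {A B A' B' : E}
    {f : A ⟶ B} {f' : A' ⟶ B'} (a : A' ≅ A) (b : B ≅ B') (e : f' = a.hom ≫ f ≫ b.hom) (hf : weq f) :
    weq f' := by
  rw [e]
  exact h.weq_comp _ _ (h.weq_of_isIso _ inferInstance)
    (h.weq_comp _ _ hf (h.weq_of_isIso _ inferInstance))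

lemma IsExact.of_iso {W : WaldData E} {cof weq : MorphismProperty E'} (h : IsWaldhausen cof weq)
    {F F' : E ⥤ E'} (e : F ≅ F') (hF : IsExact W (.of cof weq) F) : IsExact W (.of cof weq) F' where
  zero hA := (hF.zero hA).of_iso (e.app _).symm
  cof f hf := h.cof_iso (e.app _).symm (e.app _) (by simp) (hF.cof f hf)
  weq f hf := h.weq_iso (e.app _).symm (e.app _) (by simp) (hF.weq f hf)
  po f g g' f' hp := by
    obtain ⟨h1, h2⟩ := hF.po f g g' f' hp
    exact ⟨h.cof_iso (e.app _).symm (e.app _) (by simp) h1,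
      h2.of_iso (e.app _) (e.app _) (e.app _) (e.app _) (by simp) (by simp) (by simp) (by simp)⟩

/-- Zero objects and pushouts are preserved by any equivalence; only the two classes of morphisms
need attention. -/
lemma IsExact.of_isEquivalence {cof weq : MorphismProperty E} {cof' weq' : MorphismProperty E'}
    (F : E ⥤ E') [F.IsEquivalence] (hc : ∀ {A B : E} (f : A ⟶ B), cof f → cof' (F.map f))
    (hw : ∀ {A B : E} (f : A ⟶ B), weq f → weq' (F.map f)) :
    IsExact (.of cof weq) (.of cof' weq') F where
  zero h := h.map_equivalence F
  cof := hc
  weq := hw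
  po _ _ _ _ h := ⟨hc _ h.1, h.2.map F⟩

end

/-! ### Exact inverses and their compatibility with the simplicial structure -/

namespace SimplicialWald

/-- The first factor has the shape of a component of `κ'` below, with identities left by associators
and unitors. The morphism `u` comes with an equation because it is a component of an `eqToHom`
between functors. -/
lemma zigzag_cancel {M : Type*} [Category M] {a b c d : M} (p : a ⟶ b) (q : b ⟶ c) (u : c ⟶ d)
    (h : c = d) (hu : u = eqToHom h) (h' : d = c) (q' : c ⟶ b) (hq : q ≫ q' = 𝟙 b) :
    (𝟙 a ≫ p ≫ 𝟙 b ≫ 𝟙 b ≫ q ≫ 𝟙 c ≫ u ≫ 𝟙 d) ≫ eqToHom h' ≫ q' = p := by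
  subst h hu
  simp [hq]

variable {X Y : SimplicialWald.{w}}

/-- Since `F_m` is fully faithful, the required compatibility can serve as the definition of `κ`:
its image under `F_m` is the counit in degree `m`, the inverse counit in degree `n` and the strict
commutation of `F`, composed. -/
lemma isExactEquivalence_of_isEquivalence (F : X.cat ⟶ Y.cat)
    (hF : ∀ n, (F.app n).toFunctor.IsEquivalence)
    (hX : ∀ n, IsExact (X.data n) (Y.data n) (F.app n).toFunctor)
    (hY : ∀ n, IsExact (Y.data n) (X.data n) (F.app n).toFunctor.inv) : IsExactEquivalence X Y F := by
  refine ⟨hX, ?_⟩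
  have hnat : ∀ {n m} (f : n ⟶ m), (X.cat.map f).toFunctor ⋙ (F.app m).toFunctor =
      (F.app n).toFunctor ⋙ (Y.cat.map f).toFunctor := fun f =>
    congrArg Cat.Hom.toFunctor (F.naturality f)
  let ε := fun n => (F.app n).toFunctor.asEquivalence.counitIso
  let κ' : ∀ {n m} (f : n ⟶ m), ((Y.cat.map f).toFunctor ⋙ (F.app m).toFunctor.inv) ⋙
      (F.app m).toFunctor ≅ ((F.app n).toFunctor.inv ⋙ (X.cat.map f).toFunctor) ⋙
      (F.app m).toFunctor := fun {n m} f =>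
    Functor.associator _ _ _ ≪≫ Functor.isoWhiskerLeft _ (ε m) ≪≫ Functor.rightUnitor _ ≪≫
      (Functor.leftUnitor _).symm ≪≫ Functor.isoWhiskerRight (ε n).symm _ ≪≫ Functor.associator _ _ _ ≪≫
      Functor.isoWhiskerLeft _ (eqToIso (hnat f).symm) ≪≫ (Functor.associator _ _ _).symm
  refine ⟨fun n => (F.app n).toFunctor.inv, fun n => (F.app n).toFunctor.asEquivalence.unitIso,
    ε, fun {n m} f => Functor.fullyFaithfulCancelRight (F.app m).toFunctor (κ' f), hY, fun n A => ?_,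
    fun {n m} f B => ?_⟩
  · exact (F.app n).toFunctor.asEquivalence.functor_unitIso_comp A
  · simp only [Functor.fullyFaithfulCancelRight_hom_app, Functor.map_preimage]
    refine zigzag_cancel _ _ ((eqToHom (hnat f).symm).app ((F.app n).toFunctor.inv.obj B)) (congrArg
      (fun H : X.cat.obj n ⥤ Y.cat.obj m => H.obj ((F.app n).toFunctor.inv.obj B)) (hnat f).symm)
      (eqToHom_app _ _) _ _ ?_
    exact (Functor.map_comp _ _ _).symm.trans ((congrArg _ (Iso.inv_hom_id_app (ε n) B)).trans
      (CategoryTheory.Functor.map_id _ _))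

end SimplicialWald

/-! ### The Waldhausen structure of L_n SC(C) -/

namespace PolytopeComplex

variable {C : PolytopeComplex.{u, v}}

open SC

namespace LObj

variable {n : ℕ} {A B : LObj C n}

/-- The latching map is `B_i ↣ B_{i+1}` on the part coming from `B_i`, and `φ` on the members of
`A_{i+1}` outside `A_i`. Layeredness says that these two parts have disjoint images, so
`cof_of_cover` applies. -/
lemma cofibration_of_app {φ : A ⟶ B} (h : ∀ i, SC.cof C (app φ i)) : cofibration C n φ := by
  intro i
  obtain ⟨Q, r, s, H⟩ := exists_glue (A.map i.castSucc_lt_succ.le) (app φ i.castSucc) (A.cof _)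
  have e := naturality φ i.castSucc_lt_succ.le
  have hr := H.fac_left e
  have hs := H.fac_right e
  refine ⟨Q, r, s, H.desc _ _, H.isPushout, hr, hs, ?_⟩
  refine cof_of_cover (s := s) (r := r) (U := {β | β ∉ im (A.map i.castSucc_lt_succ.le)}) ?_ ?_ ?_ ?_ ?_
  · intro j hj
    by_cases h : j ∈ im s
    · exact Or.inl h
    · obtain ⟨ρ, hρ, rfl⟩ := (H.surj j hj).resolve_left h
      refine Or.inr ⟨ρ, hρ, fun h' => h ?_, rfl⟩
      have := tgt_mem_im_comp hρ h'
      rw [H.comm] at this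
      exact im_comp_subset _ _ this
  · rw [hs]
    exact B.cof _
  · intro β hβ _
    rw [hr]
    exact (h _).1 β hβ
  · rw [hr]
    exact fun p hp q hq _ _ h' => (h _).2 p hp q hq h'
  · rw [hr, hs]
    exact layered_iff.1 φ.2 _ _ _

/-- Conversely, `φ_{i+1}` is a cobase change of `φ_i` followed by the latching map, and the
induction starts at `A_0 = 0`. -/
lemma cofibration_iff {φ : A ⟶ B} : cofibration C n φ ↔ ∀ i, SC.cof C (app φ i) := by
  refine ⟨fun h i => ?_, cofibration_of_app⟩
  induction i using Fin.induction with
  | zero => exact SC.cof_of_isZero (isZero_of_carrier A.zero)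
  | succ i ih =>
    obtain ⟨Q, r, s, d, hp, hr, -, hd⟩ := h i
    rw [← hr]
    exact SC.cof_comp ((isWaldhausen C).cof_pushout hp.flip ih) hd

end LObj

namespace Forest

variable {n : ℕ} {A B : SC (s n C)}

lemma rootPiece_mem {f : A ⟶ B} {p : Piece (s n C)} (hp : p ∈ Hom.pieces f) :
    rootPiece p ∈ Hom.pieces ((union n C (born p.tgt.2)).map f) := by
  refine (mem_union_map f).2 ⟨p, hp, root p.src.2, ?_, root p.dom, ?_, root p.tgt.2, root_mem _,
    under p.hor, C.sq_refl _, root_le (Hom.dom_le f p hp), rfl⟩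
  · rw [born_tgt hp]; exact root_mem _
  · rw [born_tgt hp, ← born_dom hp]; exact root_mem _

lemma mk_label_unique {i j : ℕ × (s n C).P} (hi : i ∈ A.carrier) (hj : j ∈ A.carrier) (h : i.1 = j.1)
    {w : C.P} (hw : w ≤ root i.2) (hw' : w ≤ root j.2) : i = j := by
  obtain ⟨l, T⟩ := i
  obtain ⟨l', T'⟩ := j
  obtain rfl : l = l' := h
  rw [label_unique hi hj hw hw']

/-- Covering families of `s_n C` are levelwise by definition. Injectivity on indices is tested on
root components, which determine pieces. -/
lemma cof_of_union {f : A ⟶ B} (h : ∀ l ≤ n, SC.cof C ((union n C l).map f)) :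
    SC.cof (s n C) f := by
  constructor
  · rintro ⟨i, T⟩ hT
    refine mem_J_iff.2 fun l x hx => ?_
    refine C.J.superset_covering ?_ ((h l (le_of_mem hx)).1 (i, x) (mem_union.2 ⟨T, hT, hx⟩))
    rintro w k ⟨_, ⟨r, hr, hs, rfl⟩, hle⟩
    obtain ⟨p, hp, x', hx', a, ha, b, hb, t, ht, hax, rfl⟩ := (mem_union_map f).1 hr
    obtain ⟨e1, rfl⟩ := Prod.mk.inj hs
    have e2 : p.src = (i, T) := mk_label_unique (Hom.src_mem f p hp) hT e1 (le_root hx') (le_root hx)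
    have hle' : p.dom ≤ T := by
      have := Hom.dom_le f p hp
      rwa [e2] at this
    exact ⟨a, ⟨p.dom, ⟨homOfLE hle', p.dom, ⟨p, hp, e2, rfl⟩, le_rfl⟩, ha⟩, hle⟩
  · intro p hp q hq e
    have hq' := rootPiece_mem hq
    rw [← e] at hq'
    have e1 := (h _ (born_le _)).2 _ (rootPiece_mem hp) _ hq' (congrArg (fun j => (j.1, root j.2)) e)
    have e2 := e1
    rw [rootPiece, rootPiece, Piece.mk.injEq] at e2
    obtain ⟨e3, e4⟩ := Prod.mk.inj e2.1
    exact eq_of_rootPiece (mk_label_unique (Hom.src_mem f p hp) (Hom.src_mem f q hq) e3 le_rfl e4.le) e e1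

/-- A diagram is hit as soon as its root is hit at the level of birth. -/
lemma weq_of_union {f : A ⟶ B} (h : ∀ l ≤ n, SC.weq C ((union n C l).map f)) :
    SC.weq (s n C) f := by
  refine ⟨cof_of_union fun l hl => (h l hl).1, ?_⟩
  rintro ⟨i, T⟩ hT
  obtain ⟨r, hr, e⟩ := (h _ (born_le T)).2 (i, root T) (mem_union.2 ⟨T, hT, root_mem T⟩)
  obtain ⟨p, hp, x', hx', a, ha, b, hb, t, ht, hax, rfl⟩ := (mem_union_map f).1 hr
  obtain ⟨e1, rfl⟩ := Prod.mk.inj e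
  exact ⟨p, hp, mk_label_unique (Hom.tgt_mem f p hp) hT e1 (le_root hb) le_rfl⟩

lemma cofibration_comb_iff {f : A ⟶ B} :
    LObj.cofibration C n ((comb n C).map f) ↔ SC.cof (s n C) f := by
  rw [LObj.cofibration_iff]
  exact ⟨fun h => cof_of_union fun l hl => h ⟨l, Nat.lt_succ_of_le hl⟩, fun h _ => SC.cof_map _ h⟩

lemma weakEquivalence_comb_iff {f : A ⟶ B} :
    LObj.weakEquivalence C n ((comb n C).map f) ↔ SC.weq (s n C) f :=
  ⟨fun h => weq_of_union fun l hl => h ⟨l, Nat.lt_succ_of_le hl⟩, fun h _ => SC.weq_map _ h⟩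

end Forest

namespace LObj

open Forest

variable {n k : ℕ} {A B : LObj C n}

lemma cofibration_iso {A' B' : LObj C n} {f : A ⟶ B} {f' : A' ⟶ B'} (a : A' ≅ A) (b : B ≅ B')
    (e : f' = a.hom ≫ f ≫ b.hom) (hf : cofibration C n f) : cofibration C n f' := by
  rw [cofibration_iff] at hf ⊢
  intro i
  rw [e]
  exact SC.cof_comp (weq_of_isIso (app a.hom i) inferInstance).1
    (SC.cof_comp (hf i) (weq_of_isIso (app b.hom i) inferInstance).1)

lemma weakEquivalence_iso {A' B' : LObj C n} {f : A ⟶ B} {f' : A' ⟶ B'} (a : A' ≅ A) (b : B ≅ B')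
    (e : f' = a.hom ≫ f ≫ b.hom) (hf : weakEquivalence C n f) : weakEquivalence C n f' := by
  intro i
  rw [e]
  exact SC.weq_comp (weq_of_isIso (app a.hom i) inferInstance)
    (SC.weq_comp (hf i) (weq_of_isIso (app b.hom i) inferInstance))

/-- The counit identifies `f` with the image under `F_n` of its image under the inverse. -/
lemma cofibration_inv_iff {f : A ⟶ B} :
    cofibration C n f ↔ SC.cof (s n C) ((comb n C).inv.map f) := by
  let ε := (comb n C).asEquivalence.counitIso
  rw [← cofibration_comb_iff]
  exact ⟨cofibration_iso (ε.app A) (ε.app B).symm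
    ((Iso.eq_comp_inv (ε.app B)).2 (ε.hom.naturality f)|>.trans (Category.assoc _ _ _)),
    cofibration_iso (ε.app A).symm (ε.app B)
      ((Iso.eq_inv_comp (ε.app A)).2 (ε.hom.naturality f).symm)⟩

lemma weakEquivalence_inv_iff {f : A ⟶ B} :
    weakEquivalence C n f ↔ SC.weq (s n C) ((comb n C).inv.map f) := by
  let ε := (comb n C).asEquivalence.counitIso
  rw [← weakEquivalence_comb_iff]
  exact ⟨weakEquivalence_iso (ε.app A) (ε.app B).symm
    ((Iso.eq_comp_inv (ε.app B)).2 (ε.hom.naturality f)|>.trans (Category.assoc _ _ _)),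
    weakEquivalence_iso (ε.app A).symm (ε.app B)
      ((Iso.eq_inv_comp (ε.app A)).2 (ε.hom.naturality f).symm)⟩

/-- The structure is transported from `SC(s_n C)`, so no pushout has to be computed among layered
morphisms. -/
theorem isWaldhausen (C : PolytopeComplex.{u, v}) (n : ℕ) :
    IsWaldhausen (cofibration C n) (weakEquivalence C n) :=
  (SC.isWaldhausen (s n C)).pullback (comb n C).inv (fun _ => cofibration_inv_iff)
    fun _ => weakEquivalence_inv_iff

lemma isExact_comb (C : PolytopeComplex.{u, v}) (n : ℕ) :
    IsExact (SC.waldData (s n C)) (waldData C n) (comb n C) :=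
  .of_isEquivalence _ (fun _ => cofibration_comb_iff.2) fun _ => weakEquivalence_comb_iff.2

lemma isExact_inv (C : PolytopeComplex.{u, v}) (n : ℕ) :
    IsExact (waldData C n) (SC.waldData (s n C)) (comb n C).inv :=
  .of_isEquivalence _ (fun _ => cofibration_inv_iff.1) fun _ => weakEquivalence_inv_iff.1

/-- A functor on `L_n SC(C)` is exact if its composite with `F_n` is. -/
lemma isExact_of_comb {E : Type*} [Category E] {cof weq : MorphismProperty E} (h : IsWaldhausen cof weq)
    (H : LObj C n ⥤ E) (hH : IsExact (SC.waldData (s n C)) (.of cof weq) (comb n C ⋙ H)) :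
    IsExact (waldData C n) (.of cof weq) H :=
  .of_iso h ((Functor.associator _ _ _).symm ≪≫
    Functor.isoWhiskerRight (comb n C).asEquivalence.counitIso H ≪≫ H.leftUnitor)
    ((isExact_inv C n).comp hH)

/-- On the image of `F_n`, restriction is the functor induced by a polytope map followed by `F_k`,
by the strict naturality of `F`. -/
lemma isExact_restr (θ : Fin (k + 1) →o Fin (n + 1)) :
    IsExact (waldData C n) (waldData C k) (LObj.restr θ) := by
  refine isExact_of_comb (isWaldhausen C k) _ ?_
  rw [← comb_naturality]
  exact (SC.isExact_map _).comp (isExact_comb C k)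

/-- The `l`-th term of a sequence. -/
def ev (C : PolytopeComplex.{u, v}) (l : Fin (n + 1)) : LObj C n ⥤ SC C where
  obj A := A.F.obj l
  map φ := app φ l

/-- Composed with `F_n`, evaluation is the union of the `l`-th levels, which is induced by a
polytope map. -/
lemma isExact_ev (l : Fin (n + 1)) : IsExact (waldData C n) (SC.waldData C) (ev C l) :=
  isExact_of_comb (SC.isWaldhausen C) _ (SC.isExact_map (level n C l))

end LObj

theorem isSimplicialWaldhausen_sWald (C : PolytopeComplex.{u, v}) :
    (sWald C).IsSimplicialWaldhausen where
  waldhausen n := SC.isWaldhausen (s n.unop.len C)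
  exact f := SC.isExact_map (Forest.restr f.unop.toOrderHom C)

theorem isSimplicialWaldhausen_lWald (C : PolytopeComplex.{u, v}) :
    (lWald C).IsSimplicialWaldhausen where
  waldhausen n := LObj.isWaldhausen C n.unop.len
  exact f := LObj.isExact_restr f.unop.toOrderHom

theorem isExactEquivalence_combHom (C : PolytopeComplex.{u, v}) :
    SimplicialWald.IsExactEquivalence (sWald C) (lWald C) (combHom C) :=
  SimplicialWald.isExactEquivalence_of_isEquivalence _
    (fun n => inferInstanceAs (Forest.comb n.unop.len C).IsEquivalence)
    (fun n => LObj.isExact_comb C n.unop.len) fun n => LObj.isExact_inv C n.unop.len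

end PolytopeComplex

/-! ### Exactness of the comparison with Waldhausen's construction -/

namespace PolytopeComplex.LObj

open SC Wald

variable {C : PolytopeComplex.{u, v}} {n : ℕ}

/-- The monotone map `{0, 1, 2} → {0, …, n}` with values `i ≤ j ≤ k`. -/
def triple {i j k : Fin (n + 1)} (h : i ≤ j) (h' : j ≤ k) : Fin 3 →o Fin (n + 1) where
  toFun := ![i, j, k]
  monotone' := by
    refine Fin.monotone_iff_le_succ.2 fun l => ?_
    fin_cases l
    · exact h
    · exact h'

/-- The subquotient `A_j/A_i`. -/
def subquotient (C : PolytopeComplex.{u, v}) (x : Ar n) : LObj C n ⥤ SC C :=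
  restr (triple x.2 le_rfl) ⋙ ev C 1

lemma isExact_subquotient (x : Ar n) : IsExact (waldData C n) (SC.waldData C) (subquotient C x) :=
  (isExact_restr _).comp (isExact_ev _)

/-- Zero objects, weak equivalences and pushouts of triangles are entrywise, and each entry is a
restriction followed by an evaluation, both of which are exact. -/
theorem isExact_toS (C : PolytopeComplex.{u, v}) (n : ℕ) :
    IsExact (waldData C n) (SObj.data (SC.wald C) n) (toS C n) := by
  have hcof : ∀ {A B : LObj C n} (φ : A ⟶ B), cofibration C n φ → SObj.cof ((toS C n).map φ) := by
    intro A B φ hφ i j k h h'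
    -- The restricted sequence is `0 ↣ A_j/A_i ↣ A_k/A_i`, whose latching condition at index `1` is
    -- the condition on triangles for `i ≤ j ≤ k`.
    obtain ⟨Q, r, s, d, h1, h2, h3, h4⟩ := (isExact_restr (triple h h')).cof φ hφ 1
    exact ⟨Q, r, s, d, ⟨((restr (triple h h')).obj A).cof (Fin.castSucc_lt_succ (i := 1)).le, h1⟩, h2, h3, h4⟩
  exact ⟨fun hA x => (isExact_subquotient x).zero hA, hcof,
    fun φ hφ x => (isExact_subquotient x).weq φ hφ,
    fun f g g' f' h => ⟨hcof f h.1, fun x => (isExact_subquotient x).po f g g' f' h⟩⟩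

end PolytopeComplex.LObj

/-! ### The levels of the `S_•`-construction -/

/-- Pushout squares are stable under pushouts in the category of squares. -/
lemma CategoryTheory.IsPushout.of_cube {E : Type*} [Category E] {A B A' B' : Fin 4 → E}
    {f : ∀ x, A x ⟶ B x} {g : ∀ x, A x ⟶ A' x} {g' : ∀ x, B x ⟶ B' x} {f' : ∀ x, A' x ⟶ B' x}
    (h : ∀ x, IsPushout (f x) (g x) (g' x) (f' x))
    {a₁ : A 0 ⟶ A 1} {a₂ : A 0 ⟶ A 2} {a₃ : A 1 ⟶ A 3} {a₄ : A 2 ⟶ A 3}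
    {b₁ : B 0 ⟶ B 1} {b₂ : B 0 ⟶ B 2} {b₃ : B 1 ⟶ B 3} {b₄ : B 2 ⟶ B 3}
    {c₁ : A' 0 ⟶ A' 1} {c₂ : A' 0 ⟶ A' 2} {c₃ : A' 1 ⟶ A' 3} {c₄ : A' 2 ⟶ A' 3}
    {d₁ : B' 0 ⟶ B' 1} {d₂ : B' 0 ⟶ B' 2} {d₃ : B' 1 ⟶ B' 3} {d₄ : B' 2 ⟶ B' 3}
    (ha : IsPushout a₁ a₂ a₃ a₄) (hb : IsPushout b₁ b₂ b₃ b₄) (hc : IsPushout c₁ c₂ c₃ c₄)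
    (hf₃ : a₃ ≫ f 3 = f 1 ≫ b₃) (hf₄ : a₄ ≫ f 3 = f 2 ≫ b₄)
    (hg₃ : a₃ ≫ g 3 = g 1 ≫ c₃) (hg₄ : a₄ ≫ g 3 = g 2 ≫ c₄)
    (hg'₁ : b₁ ≫ g' 1 = g' 0 ≫ d₁) (hg'₂ : b₂ ≫ g' 2 = g' 0 ≫ d₂) (hg'₃ : b₃ ≫ g' 3 = g' 1 ≫ d₃)
    (hg'₄ : b₄ ≫ g' 3 = g' 2 ≫ d₄) (hf'₁ : c₁ ≫ f' 1 = f' 0 ≫ d₁) (hf'₂ : c₂ ≫ f' 2 = f' 0 ≫ d₂)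
    (hf'₃ : c₃ ≫ f' 3 = f' 1 ≫ d₃) (hf'₄ : c₄ ≫ f' 3 = f' 2 ≫ d₄) : IsPushout d₁ d₂ d₃ d₄ := by
  have w : d₁ ≫ d₃ = d₂ ≫ d₄ := by
    refine (h 0).hom_ext ?_ ?_
    · rw [← reassoc_of% hg'₁, ← reassoc_of% hg'₂, ← hg'₃, ← hg'₄, hb.w_assoc]
    · rw [← reassoc_of% hf'₁, ← reassoc_of% hf'₂, ← hf'₃, ← hf'₄, hc.w_assoc]
  -- A map out of `B' 3` is a compatible pair of maps out of `B 3` and `A' 3`. These come from the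
  -- pushout squares of the `b` and the `c`, and their compatibility is tested on the square of the
  -- `a`.
  refine ⟨⟨w⟩, ⟨Limits.PushoutCocone.IsColimit.mk _ (fun s => (h 3).desc
    (hb.desc (g' 1 ≫ s.inl) (g' 2 ≫ s.inr) ?_) (hc.desc (f' 1 ≫ s.inl) (f' 2 ≫ s.inr) ?_) ?_)
    (fun s => (h 1).hom_ext ?_ ?_) (fun s => (h 2).hom_ext ?_ ?_)
    fun s m h₁ h₂ => (h 3).hom_ext (hb.hom_ext ?_ ?_) (hc.hom_ext ?_ ?_)⟩⟩
  · rw [reassoc_of% hg'₁, reassoc_of% hg'₂, s.condition]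
  · rw [reassoc_of% hf'₁, reassoc_of% hf'₂, s.condition]
  · refine ha.hom_ext ?_ ?_
    · rw [reassoc_of% hf₃, reassoc_of% hg₃, hb.inl_desc, hc.inl_desc, (h 1).w_assoc]
    · rw [reassoc_of% hf₄, reassoc_of% hg₄, hb.inr_desc, hc.inr_desc, (h 2).w_assoc]
  · rw [← reassoc_of% hg'₃, (h 3).inl_desc, hb.inl_desc]
  · rw [← reassoc_of% hf'₃, (h 3).inr_desc, hc.inl_desc]
  · rw [← reassoc_of% hg'₄, (h 3).inl_desc, hb.inr_desc]
  · rw [← reassoc_of% hf'₄, (h 3).inr_desc, hc.inr_desc]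
  · rw [(h 3).inl_desc, hb.inl_desc, reassoc_of% hg'₃, h₁]
  · rw [(h 3).inl_desc, hb.inr_desc, reassoc_of% hg'₄, h₂]
  · rw [(h 3).inr_desc, hc.inl_desc, reassoc_of% hf'₃, h₁]
  · rw [(h 3).inr_desc, hc.inr_desc, reassoc_of% hf'₄, h₂]

namespace Wald

/-- The axioms of a Waldhausen category apart from the gluing lemma, with the zero objects and
pushout squares the categorical ones. -/
structure HasCofibrations (E : Wald.{w}) : Prop where
  exists_zero : ∃ Z : E.carrier, Limits.IsZero Z
  zero_iff : ∀ {A : E.carrier}, E.data.zero A ↔ Limits.IsZero A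
  cof_of_isIso : ∀ {A B : E.carrier} (f : A ⟶ B) [IsIso f], E.data.cof f
  cof_comp : ∀ {A B D : E.carrier} (f : A ⟶ B) (g : B ⟶ D), E.data.cof f → E.data.cof g →
    E.data.cof (f ≫ g)
  cof_of_isZero : ∀ {Z A : E.carrier} (f : Z ⟶ A), Limits.IsZero Z → E.data.cof f
  exists_pushout : ∀ {A B A' : E.carrier} (f : A ⟶ B) (g : A ⟶ A'), E.data.cof f →
    ∃ (B' : E.carrier) (g' : B ⟶ B') (f' : A' ⟶ B'), IsPushout f g g' f'
  cof_pushout : ∀ {A B A' B' : E.carrier} {f : A ⟶ B} {g : A ⟶ A'} {g' : B ⟶ B'} {f' : A' ⟶ B'},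
    IsPushout f g g' f' → E.data.cof f → E.data.cof f'
  po_iff : ∀ {A B A' B' : E.carrier} {f : A ⟶ B} {g : A ⟶ A'} {g' : B ⟶ B'} {f' : A' ⟶ B'},
    E.data.po f g g' f' ↔ E.data.cof f ∧ IsPushout f g g' f'
  weq_of_isIso : ∀ {A B : E.carrier} (f : A ⟶ B) [IsIso f], E.data.weq f
  weq_comp : ∀ {A B D : E.carrier} (f : A ⟶ B) (g : B ⟶ D), E.data.weq f → E.data.weq g →
    E.data.weq (f ≫ g)

lemma HasCofibrations.of_isWaldhausen {E : Type w} [Category.{w} E] {cof weq : MorphismProperty E}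
    (h : IsWaldhausen cof weq) : HasCofibrations ⟨E, .of cof weq⟩ where
  exists_zero := h.exists_zero
  zero_iff := Iff.rfl
  cof_of_isIso f _ := h.cof_of_isIso f inferInstance
  cof_comp := h.cof_comp
  cof_of_isZero := h.cof_of_isZero
  exists_pushout := h.exists_pushout
  cof_pushout := h.cof_pushout
  po_iff := Iff.rfl
  weq_of_isIso f _ := h.weq_of_isIso f inferInstance
  weq_comp := h.weq_comp

namespace SObj

variable {E : Wald.{w}} {n : ℕ}

/-- The underlying diagram. -/
def forget (E : Wald.{w}) (n : ℕ) : SObj E n ⥤ (Ar n ⥤ E.carrier) where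
  obj A := A.F
  map φ := φ

instance : (forget E n).Full := ⟨fun φ => ⟨φ, rfl⟩⟩
instance : (forget E n).Faithful := ⟨fun h => h⟩

lemma hom_ext {A B : SObj E n} {φ ψ : A ⟶ B} (h : ∀ x, app φ x = app ψ x) : φ = ψ :=
  NatTrans.ext (funext h)

lemma naturality {A B : SObj E n} (φ : A ⟶ B) {x y : Ar n} (f : x ⟶ y) :
    A.F.map f ≫ app φ y = app φ x ≫ B.F.map f := NatTrans.naturality φ f

instance {A B : SObj E n} (φ : A ⟶ B) [IsIso φ] (x : Ar n) : IsIso (app φ x) :=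
  inferInstanceAs (IsIso (((forget E n).map φ).app x))

/-- The isomorphism on `(i, j)`-th terms -/
def appIso {A B : SObj E n} (φ : A ≅ B) (x : Ar n) : A.F.obj x ≅ B.F.obj x :=
  ((forget E n).mapIso φ).app x

lemma isPushout_of_app {A B A' B' : SObj E n} {f : A ⟶ B} {g : A ⟶ A'} {g' : B ⟶ B'} {f' : A' ⟶ B'}
    (h : ∀ x, IsPushout (app f x) (app g x) (app g' x) (app f' x)) : IsPushout f g g' f' := by
  have h1 : f ≫ g' = g ≫ f' := hom_ext fun x => (h x).w
  exact IsPushout.of_map (forget E n) h1 (IsPushout.of_forall_isPushout_app h)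

end SObj

namespace HasCofibrations

variable {E : Wald.{w}} {n : ℕ}

/-- Two pushouts of the same span differ by an isomorphism, so the choice of the latching object is
irrelevant. -/
lemma cof_desc (hE : HasCofibrations E) {A B A' Q Q' D : E.carrier} {f : A ⟶ B} {g : A ⟶ A'}
    {r : B ⟶ Q} {s : A' ⟶ Q} {r' : B ⟶ Q'} {s' : A' ⟶ Q'} {d : Q ⟶ D} {d' : Q' ⟶ D}
    (h : IsPushout f g r s) (h' : IsPushout f g r' s') (e₁ : r ≫ d = r' ≫ d') (e₂ : s ≫ d = s' ≫ d')
    (hd : E.data.cof d) : E.data.cof d' := by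
  have : d' = (h'.isoIsPushout _ _ h).hom ≫ d := h'.hom_ext (by simp [e₁]) (by simp [e₂])
  rw [this]
  exact hE.cof_comp _ _ (hE.cof_of_isIso _) hd

lemma isZero (hE : HasCofibrations E) (A : SObj E n) (i : Fin (n + 1)) :
    Limits.IsZero (A.F.obj (.mk (le_refl i))) := hE.zero_iff.1 (A.zero i)

lemma cof_map (hE : HasCofibrations E) (A : SObj E n) {i j k : Fin (n + 1)} {h : i ≤ j} (h' : j ≤ k) :
    E.data.cof (A.F.map (Ar.hom (h := h) (h' := h.trans h') le_rfl h')) := (hE.po_iff.1 (A.po h h')).1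

lemma cof_app (hE : HasCofibrations E) {A B : SObj E n} {φ : A ⟶ B} (hφ : SObj.cof φ) (x : Ar n) :
    E.data.cof (SObj.app φ x) := by
  obtain ⟨⟨i, k⟩, h⟩ := x
  obtain ⟨Q, r, s, d, h1, h2, -, h4⟩ := hφ (le_refl i) h
  rw [← h2]
  exact hE.cof_comp _ _ (hE.cof_pushout (hE.po_iff.1 h1).2.flip (hE.cof_of_isZero _ (hE.isZero A i))) h4

lemma cof_of_isPushout (hE : HasCofibrations E) {A B : SObj E n} {φ : A ⟶ B}
    (H : ∀ {i j k : Fin (n + 1)} (h : i ≤ j) (h' : j ≤ k),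
      ∃ (Q : E.carrier) (r : A.F.obj (.mk (h.trans h')) ⟶ Q) (s : B.F.obj (.mk h) ⟶ Q)
        (d : Q ⟶ B.F.obj (.mk (h.trans h'))),
        IsPushout (A.F.map (Ar.hom le_rfl h')) (SObj.app φ (.mk h)) r s ∧
          r ≫ d = SObj.app φ (.mk (h.trans h')) ∧ s ≫ d = B.F.map (Ar.hom le_rfl h') ∧
            E.data.cof d) : SObj.cof φ := by
  intro i j k h h'
  obtain ⟨Q, r, s, d, h1, h2⟩ := H h h'
  exact ⟨Q, r, s, d, hE.po_iff.2 ⟨hE.cof_map A h', h1⟩, h2⟩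

lemma cof_of_forall (hE : HasCofibrations E) {A B : SObj E n} {φ : A ⟶ B}
    (H : ∀ {i j k : Fin (n + 1)} (h : i ≤ j) (h' : j ≤ k) (Q : E.carrier)
      (r : A.F.obj (.mk (h.trans h')) ⟶ Q) (s : B.F.obj (.mk h) ⟶ Q)
      (d : Q ⟶ B.F.obj (.mk (h.trans h'))),
      IsPushout (A.F.map (Ar.hom le_rfl h')) (SObj.app φ (.mk h)) r s →
        r ≫ d = SObj.app φ (.mk (h.trans h')) → s ≫ d = B.F.map (Ar.hom le_rfl h') →
          E.data.cof d) : SObj.cof φ := by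
  refine hE.cof_of_isPushout fun {i j k} h h' => ?_
  obtain ⟨Q, r, s, hQ⟩ := hE.exists_pushout _ (SObj.app φ (.mk h)) (hE.cof_map A h')
  have e := SObj.naturality φ (Ar.hom (h := h) (h' := h.trans h') le_rfl h')
  exact ⟨Q, r, s, hQ.desc _ _ e, hQ, hQ.inl_desc _ _ _, hQ.inr_desc _ _ _,
    H h h' Q r s _ hQ (hQ.inl_desc _ _ _) (hQ.inr_desc _ _ _)⟩

lemma sobj_cof_of_isIso (hE : HasCofibrations E) {A B : SObj E n} (φ : A ⟶ B) [IsIso φ] :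
    SObj.cof φ :=
  hE.cof_of_isPushout fun _ h' => ⟨_, SObj.app φ _, B.F.map (Ar.hom le_rfl h'), 𝟙 _,
    .of_vert_isIso ⟨SObj.naturality φ _⟩, Category.comp_id _, Category.comp_id _, hE.cof_of_isIso _⟩

/-- The latching map of the composite factors as a cobase change of the latching map of `φ` followed
by the latching map of `ψ`. -/
lemma sobj_cof_comp (hE : HasCofibrations E) {A B D : SObj E n} {φ : A ⟶ B} {ψ : B ⟶ D}
    (hφ : SObj.cof φ) (hψ : SObj.cof ψ) : SObj.cof (φ ≫ ψ) := by
  refine hE.cof_of_isPushout fun {i j k} h h' => ?_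
  obtain ⟨Q₁, r₁, s₁, d₁, h1, h2, h3, h4⟩ := hφ h h'
  obtain ⟨Q₂, r₂, s₂, d₂, h5, h6, h7, h8⟩ := hψ h h'
  replace h1 := hE.po_iff.1 h1
  replace h5 := (hE.po_iff.1 h5).2
  obtain ⟨Q₃, t, s₃, hQ⟩ := hE.exists_pushout s₁ (SObj.app ψ (.mk h)) (hE.cof_pushout h1.2 h1.1)
  have e : s₁ ≫ d₁ ≫ r₂ = SObj.app ψ (.mk h) ≫ s₂ := by rw [reassoc_of% h3, h5.w]
  -- The square defining `Q₂` is pasted from the one defining `Q₃` and this one, so `Q₃ ⟶ Q₂` is a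
  -- cobase change of `d₁`.
  have hu : IsPushout d₁ t r₂ (hQ.desc _ _ e) := by
    refine IsPushout.of_left ?_ (hQ.inl_desc _ _ e).symm hQ
    rw [hQ.inr_desc, h3]
    exact h5
  refine ⟨Q₃, r₁ ≫ t, s₃, hQ.desc _ _ e ≫ d₂, h1.2.paste_vert hQ, ?_, ?_,
    hE.cof_comp _ _ (hE.cof_pushout hu h4) h8⟩
  · rw [Category.assoc, hQ.inl_desc_assoc, Category.assoc, h6, reassoc_of% h2]
    rfl
  · rw [hQ.inr_desc_assoc, h7]

/-- The latching map of a cobase change is a cobase change of the latching map: the square from `d`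
to `d'` is obtained by pasting and cancelling pushouts. -/
lemma cof_corner (hE : HasCofibrations E) {A₀ A₁ B₀ B₁ A'₀ A'₁ B'₀ B'₁ Q R : E.carrier}
    {a : A₀ ⟶ A₁} {b : B₀ ⟶ B₁} {a' : A'₀ ⟶ A'₁} {b' : B'₀ ⟶ B'₁}
    {f₀ : A₀ ⟶ B₀} {g₀ : A₀ ⟶ A'₀} {g'₀ : B₀ ⟶ B'₀} {f'₀ : A'₀ ⟶ B'₀}
    {f₁ : A₁ ⟶ B₁} {g₁ : A₁ ⟶ A'₁} {g'₁ : B₁ ⟶ B'₁} {f'₁ : A'₁ ⟶ B'₁}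
    (h₀ : IsPushout f₀ g₀ g'₀ f'₀) (h₁ : IsPushout f₁ g₁ g'₁ f'₁)
    (hg : a ≫ g₁ = g₀ ≫ a') (hg' : b ≫ g'₁ = g'₀ ≫ b') {r : A₁ ⟶ Q} {s : B₀ ⟶ Q} {d : Q ⟶ B₁}
    (hQ : IsPushout a f₀ r s) (hr : r ≫ d = f₁) (hs : s ≫ d = b) (hd : E.data.cof d)
    {r' : A'₁ ⟶ R} {s' : B'₀ ⟶ R} {d' : R ⟶ B'₁}
    (hR : IsPushout a' f'₀ r' s') (hr' : r' ≫ d' = f'₁) (hs' : s' ≫ d' = b') : E.data.cof d' := by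
  have e : a ≫ g₁ ≫ r' = f₀ ≫ g'₀ ≫ s' := by rw [reassoc_of% hg, hR.w, h₀.w_assoc]
  have h1 : IsPushout r g₁ (hQ.desc _ _ e) r' := by
    refine IsPushout.of_top ?_ (hQ.inl_desc _ _ e) hQ.flip
    rw [hQ.inr_desc, hg]
    exact h₀.paste_vert hR.flip
  have h2 : IsPushout d (hQ.desc _ _ e) g'₁ d' := by
    refine IsPushout.of_left (by rw [hr, hr']; exact h₁) ?_ h1
    refine hQ.hom_ext ?_ ?_
    · rw [reassoc_of% hr, hQ.inl_desc_assoc, h₁.w, Category.assoc, hr']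
    · rw [reassoc_of% hs, hQ.inr_desc_assoc, Category.assoc, hs', hg']
  exact hE.cof_pushout h2 hd

lemma exists_pushout_functor {J M : Type*} [Category J] [Category M] {A B A' : J ⥤ M} (f : A ⟶ B)
    (g : A ⟶ A') (h : ∀ x, ∃ (P : M) (r : B.obj x ⟶ P) (s : A'.obj x ⟶ P),
      IsPushout (f.app x) (g.app x) r s) :
    ∃ (F : J ⥤ M) (g' : B ⟶ F) (f' : A' ⟶ F),
      ∀ x, IsPushout (f.app x) (g.app x) (g'.app x) (f'.app x) := by
  choose P r s hP using h
  have e : ∀ {x y} (t : x ⟶ y), f.app x ≫ B.map t ≫ r y = g.app x ≫ A'.map t ≫ s y := fun {x y} t => by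
    rw [← f.naturality_assoc, ← g.naturality_assoc, (hP y).w]
  refine ⟨{ obj := P
            map := fun t => (hP _).desc _ _ (e t)
            map_id := fun x => (hP x).hom_ext (by simp) (by simp)
            map_comp := fun t t' => (hP _).hom_ext (by simp) (by simp) },
    { app := r, naturality := fun x y t => by simp },
    { app := s, naturality := fun x y t => by simp }, hP⟩

/-- The pushout is formed entrywise. The diagonal stays zero since `f` is an isomorphism there, the
latching maps are cofibrations by `cof_corner`, and the cofiber sequences persist because pushouts
commute with pushouts (`IsPushout.of_cube`). -/
lemma sobj_exists_pushout (hE : HasCofibrations E) {A B A' : SObj E n} (f : A ⟶ B) (g : A ⟶ A')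
    (hf : SObj.cof f) : ∃ (B' : SObj E n) (g' : B ⟶ B') (f' : A' ⟶ B'), SObj.cof f' ∧
      ∀ x, IsPushout (SObj.app f x) (SObj.app g x) (SObj.app g' x) (SObj.app f' x) := by
  obtain ⟨F, g', f', hP⟩ := exists_pushout_functor (A := A.F) f g fun x =>
    hE.exists_pushout _ _ (hE.cof_app hf x)
  have hzero : ∀ i, Limits.IsZero (F.obj (.mk (le_refl i))) := fun i => by
    have h1 : IsIso (NatTrans.app f (.mk (le_refl i))) := (hE.isZero A i).isIso (hE.isZero B i) _
    have h2 : IsIso (f'.app (.mk (le_refl i))) := (hP (.mk (le_refl i))).isIso_inr_of_isIso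
    exact (hE.isZero A' i).of_iso (asIso (f'.app _)).symm
  have key : ∀ {i j k : Fin (n + 1)} (h : i ≤ j) (h' : j ≤ k), ∃ (R : E.carrier)
      (r : A'.F.obj (.mk (h.trans h')) ⟶ R) (s : F.obj (.mk h) ⟶ R)
      (d : R ⟶ F.obj (.mk (h.trans h'))), IsPushout (A'.F.map (Ar.hom le_rfl h')) (f'.app (.mk h)) r s ∧
        r ≫ d = f'.app (.mk (h.trans h')) ∧ s ≫ d = F.map (Ar.hom le_rfl h') ∧ E.data.cof d := by
    intro i j k h h'
    obtain ⟨R, r, s, hR⟩ := hE.exists_pushout _ (f'.app (.mk h)) (hE.cof_map A' h')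
    have e := f'.naturality (Ar.hom (h := h) (h' := h.trans h') le_rfl h')
    obtain ⟨Q, r₁, s₁, d₁, h1, h2, h3, h4⟩ := hf h h'
    exact ⟨R, r, s, hR.desc _ _ e, hR, hR.inl_desc _ _ _, hR.inr_desc _ _ _,
      hE.cof_corner (hP _) (hP _) (SObj.naturality g _) (g'.naturality _) (hE.po_iff.1 h1).2 h2 h3 h4 hR
        (hR.inl_desc _ _ _) (hR.inr_desc _ _ _)⟩
  refine ⟨⟨F, fun i => hE.zero_iff.2 (hzero i), fun {i j k} h h' => hE.po_iff.2 ⟨?_, ?_⟩⟩, g', f',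
    hE.cof_of_isPushout key, hP⟩
  · obtain ⟨R, r, s, d, h1, h2, h3, h4⟩ := key h h'
    rw [← h3]
    exact hE.cof_comp _ _ (hE.cof_pushout h1 (hE.cof_map A' h')) h4
  · let x : Fin 4 → Ar n := ![.mk h, .mk (h.trans h'), .mk (le_refl j), .mk h']
    exact IsPushout.of_cube (f := fun i => NatTrans.app f (x i)) (g := fun i => NatTrans.app g (x i))
      (g' := fun i => g'.app (x i)) (f' := fun i => f'.app (x i)) (fun i => hP (x i))
      (hE.po_iff.1 (A.po h h')).2 (hE.po_iff.1 (B.po h h')).2 (hE.po_iff.1 (A'.po h h')).2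
      (f.naturality _) (f.naturality _) (g.naturality _) (g.naturality _) (g'.naturality _)
      (g'.naturality _) (g'.naturality _) (g'.naturality _) (f'.naturality _) (f'.naturality _)
      (f'.naturality _) (f'.naturality _)

/-- The entrywise pushout is a pushout, and every other one is isomorphic to it. -/
lemma sobj_isPushout_iff (hE : HasCofibrations E) {A B A' B' : SObj E n} {f : A ⟶ B} {g : A ⟶ A'}
    {g' : B ⟶ B'} {f' : A' ⟶ B'} (hf : SObj.cof f) : IsPushout f g g' f' ↔
      ∀ x, IsPushout (SObj.app f x) (SObj.app g x) (SObj.app g' x) (SObj.app f' x) := by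
  refine ⟨fun h x => ?_, SObj.isPushout_of_app⟩
  obtain ⟨P, r, s, -, hP⟩ := hE.sobj_exists_pushout f g hf
  let e := (SObj.isPushout_of_app hP).isoIsPushout _ _ h
  refine (hP x).of_iso (Iso.refl _) (Iso.refl _) (Iso.refl _) (SObj.appIso e x) ?_ ?_ ?_ ?_
  · simp
  · simp
  · exact (congrArg (SObj.app · x) ((SObj.isPushout_of_app hP).inl_isoIsPushout_hom _ _ h)).trans
      (Category.id_comp _).symm
  · exact (congrArg (SObj.app · x) ((SObj.isPushout_of_app hP).inr_isoIsPushout_hom _ _ h)).trans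
      (Category.id_comp _).symm

lemma sobj_cof_pushout (hE : HasCofibrations E) {A B A' B' : SObj E n} {f : A ⟶ B} {g : A ⟶ A'}
    {g' : B ⟶ B'} {f' : A' ⟶ B'} (h : IsPushout f g g' f') (hf : SObj.cof f) : SObj.cof f' := by
  obtain ⟨P, r, s, hs, hP⟩ := hE.sobj_exists_pushout f g hf
  rw [← (SObj.isPushout_of_app hP).inr_isoIsPushout_hom _ _ h]
  exact hE.sobj_cof_comp hs (hE.sobj_cof_of_isIso _)

/-- A zero object of `S_n E` -/
lemma exists_sobj_zero (hE : HasCofibrations E) (n : ℕ) :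
    ∃ Z : SObj E n, ∀ x, Limits.IsZero (Z.F.obj x) := by
  obtain ⟨Z, hZ⟩ := hE.exists_zero
  exact ⟨⟨(Functor.const _).obj Z, fun _ => hE.zero_iff.2 hZ, fun _ _ => hE.po_iff.2
    ⟨hE.cof_of_isIso (𝟙 Z), IsPushout.of_id_fst (f := 𝟙 Z)⟩⟩, fun _ => hZ⟩

lemma isZero_sobj_iff (hE : HasCofibrations E) {A : SObj E n} :
    Limits.IsZero A ↔ ∀ x, Limits.IsZero (A.F.obj x) := by
  have key : ∀ {A : SObj E n}, (∀ x, Limits.IsZero (A.F.obj x)) → Limits.IsZero A := fun h =>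
    .of_map (SObj.forget E n) (Functor.isZero _ h)
  refine ⟨fun h x => ?_, key⟩
  obtain ⟨Z, hZ⟩ := hE.exists_sobj_zero n
  exact (hZ x).of_iso (SObj.appIso (h.iso (key hZ)) x)

/-- These axioms suffice for lifting through `S_n` and for comparing nerves, so the construction can
be iterated without a gluing lemma for `S_n E`. -/
theorem sobj (hE : HasCofibrations E) (n : ℕ) : HasCofibrations ⟨SObj E n, SObj.data E n⟩ where
  exists_zero := by
    obtain ⟨Z, hZ⟩ := hE.exists_sobj_zero n
    exact ⟨Z, hE.isZero_sobj_iff.2 hZ⟩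
  zero_iff := by
    intro A
    exact (forall_congr' fun _ => hE.zero_iff).trans hE.isZero_sobj_iff.symm
  cof_of_isIso f _ := hE.sobj_cof_of_isIso f
  cof_comp _ _ := hE.sobj_cof_comp
  cof_of_isZero := by
    intro Z A f hZ
    replace hZ := hE.isZero_sobj_iff.1 hZ
    change SObj.cof f
    refine hE.cof_of_isPushout fun {i j k} h h' => ⟨A.F.obj (.mk h), (hZ _).to_ _, 𝟙 _,
      A.F.map (Ar.hom le_rfl h'), ?_, (hZ _).eq_of_src _ _, Category.id_comp _, hE.cof_map A h'⟩
    have : IsIso (Z.F.map (Ar.hom (h := h) (h' := h.trans h') le_rfl h')) := (hZ _).isIso (hZ _) _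
    exact .of_horiz_isIso ⟨(hZ _).eq_of_src _ _⟩
  exists_pushout f g hf := by
    obtain ⟨P, r, s, -, hP⟩ := hE.sobj_exists_pushout f g hf
    exact ⟨P, r, s, SObj.isPushout_of_app hP⟩
  cof_pushout := hE.sobj_cof_pushout
  po_iff := by
    intro A B A' B' f g g' f'
    exact and_congr_right fun hf => (forall_congr' fun x =>
      hE.po_iff.trans (and_iff_right (hE.cof_app hf x))).trans (hE.sobj_isPushout_iff hf).symm
  weq_of_isIso := by
    intro A B f hf x
    have : IsIso (SObj.app f x) := inferInstance
    exact hE.weq_of_isIso _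
  weq_comp _ _ hf hg x := hE.weq_comp _ _ (hf x) (hg x)

end HasCofibrations
end Wald

/-! ### Functors that create cofibrations and weak equivalences -/

namespace Wald

/-- A faithful, essentially surjective exact functor through which all cofibrations and weak
equivalences between objects of its image factor. -/
structure Creates {E E' : Wald.{w}} (G : E ⟶ E') : Prop where
  faithful : G.1.Faithful
  essSurj : G.1.EssSurj
  cof : ∀ {A B : E.carrier} (g : G.1.obj A ⟶ G.1.obj B), E'.data.cof g →
    ∃ f : A ⟶ B, E.data.cof f ∧ G.1.map f = g
  weq : ∀ {A B : E.carrier} (g : G.1.obj A ⟶ G.1.obj B), E'.data.weq g →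
    ∃ f : A ⟶ B, E.data.weq f ∧ G.1.map f = g

namespace Creates

variable {E E' E'' : Wald.{w}} {G : E ⟶ E'} {n : ℕ}

lemma comp {H : E' ⟶ E''} (hG : Creates G) (hH : Creates H) : Creates (G ≫ H) where
  faithful := by
    have := hG.faithful
    have := hH.faithful
    exact inferInstanceAs (G.1 ⋙ H.1).Faithful
  essSurj := by
    have := hG.essSurj
    have := hH.essSurj
    exact inferInstanceAs (G.1 ⋙ H.1).EssSurj
  cof g hg := by
    obtain ⟨f, h, rfl⟩ := hH.cof g hg
    obtain ⟨f, hf, rfl⟩ := hG.cof f h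
    exact ⟨f, hf, rfl⟩
  weq g hg := by
    obtain ⟨f, h, rfl⟩ := hH.weq g hg
    obtain ⟨f, hf, rfl⟩ := hG.weq f h
    exact ⟨f, hf, rfl⟩

lemma map_injective (hG : Creates G) {A B : E.carrier} {f g : A ⟶ B} (h : G.1.map f = G.1.map g) :
    f = g :=
  have := hG.faithful
  G.1.map_injective h

/-- An isomorphism and its inverse are cofibrations, so both lift; by faithfulness the lifts are
inverse to each other. -/
lemma exists_iso (hG : Creates G) (hE' : HasCofibrations E') {A B : E.carrier}
    (e : G.1.obj A ≅ G.1.obj B) : ∃ e' : A ≅ B, G.1.map e'.hom = e.hom := by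
  obtain ⟨f, -, hf⟩ := hG.cof e.hom (hE'.cof_of_isIso _)
  obtain ⟨g, -, hg⟩ := hG.cof e.inv (hE'.cof_of_isIso _)
  exact ⟨⟨f, g, hG.map_injective (by rw [G.1.map_comp, hf, hg, e.hom_inv_id, G.1.map_id]),
    hG.map_injective (by rw [G.1.map_comp, hf, hg, e.inv_hom_id, G.1.map_id])⟩, hf⟩

lemma cof_of_map (hG : Creates G) {A B : E.carrier} {f : A ⟶ B} (h : E'.data.cof (G.1.map f)) :
    E.data.cof f := by
  obtain ⟨f', hf', e⟩ := hG.cof _ h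
  rwa [hG.map_injective e] at hf'

lemma isIso_of_map (hG : Creates G) (hE' : HasCofibrations E') {A B : E.carrier} (f : A ⟶ B)
    [IsIso (G.1.map f)] : IsIso f := by
  obtain ⟨e, he⟩ := hG.exists_iso hE' (asIso (G.1.map f))
  rw [← hG.map_injective he]
  infer_instance

lemma isZero_of_map (hG : Creates G) (hE : HasCofibrations E) (hE' : HasCofibrations E')
    {A : E.carrier} (h : Limits.IsZero (G.1.obj A)) : Limits.IsZero A := by
  obtain ⟨Z, hZ⟩ := hE.exists_zero
  obtain ⟨e, -⟩ := hG.exists_iso hE' (h.iso (hE'.zero_iff.1 (G.2.zero (hE.zero_iff.2 hZ))))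
  exact hZ.of_iso e

lemma isPushout_map (hE : HasCofibrations E) (hE' : HasCofibrations E')
    {A B A' B' : E.carrier} {f : A ⟶ B} {g : A ⟶ A'} {g' : B ⟶ B'} {f' : A' ⟶ B'}
    (h : IsPushout f g g' f') (hf : E.data.cof f) :
    IsPushout (G.1.map f) (G.1.map g) (G.1.map g') (G.1.map f') :=
  (hE'.po_iff.1 (G.2.po _ _ _ _ (hE.po_iff.2 ⟨hf, h⟩))).2

/-- The pushout in `E` is preserved by the exact functor `G`, so `G` makes the comparison map an
isomorphism, and `G` reflects isomorphisms. -/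
lemma isPushout_of_map (hG : Creates G) (hE : HasCofibrations E) (hE' : HasCofibrations E')
    {A B A' B' : E.carrier} {f : A ⟶ B} {g : A ⟶ A'} {g' : B ⟶ B'} {f' : A' ⟶ B'} (hf : E.data.cof f)
    (h : IsPushout (G.1.map f) (G.1.map g) (G.1.map g') (G.1.map f')) : IsPushout f g g' f' := by
  obtain ⟨P, r, s, hP⟩ := hE.exists_pushout f g hf
  have hGP := isPushout_map (G := G) hE hE' hP hf
  have w : f ≫ g' = g ≫ f' := hG.map_injective (by rw [G.1.map_comp, G.1.map_comp, h.w])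
  have e : G.1.map (hP.desc _ _ w) = (hGP.isoIsPushout _ _ h).hom := by
    refine hGP.hom_ext ?_ ?_
    · rw [← G.1.map_comp, hP.inl_desc, hGP.inl_isoIsPushout_hom]
    · rw [← G.1.map_comp, hP.inr_desc, hGP.inr_isoIsPushout_hom]
  have : IsIso (G.1.map (hP.desc _ _ w)) := by rw [e]; infer_instance
  have := hG.isIso_of_map hE' (hP.desc _ _ w)
  exact hP.of_iso (Iso.refl _) (Iso.refl _) (Iso.refl _) (asIso (hP.desc _ _ w)) (by simp) (by simp)
    (by simp) (by simp)

/-- Entries are lifted one by one. Every map of a triangle is a composite of a cofibration, which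
lifts by assumption, and a quotient map, which lifts as a pushout of a lifted cofibration.
Faithfulness turns the lifts into a functor. -/
lemma sobj_essSurj (hG : Creates G) (hE : HasCofibrations E) (hE' : HasCofibrations E') :
    (SObj.map (OrderHom.id (α := Fin (n + 1))) G).EssSurj where
  mem_essImage B := by
    have := hG.essSurj
    let a := fun x => G.1.objPreimage (B.F.obj x)
    let e : ∀ x, G.1.obj (a x) ≅ B.F.obj x := fun x => G.1.objObjPreimageIso _
    have hcof : ∀ {x y : Ar n} (t : x ⟶ y), E'.data.cof (B.F.map t) →
        ∃ f : a x ⟶ a y, E.data.cof f ∧ G.1.map f = (e x).hom ≫ B.F.map t ≫ (e y).inv := fun t ht =>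
      hG.cof _ (hE'.cof_comp _ _ (hE'.cof_of_isIso _) (hE'.cof_comp _ _ ht (hE'.cof_of_isIso _)))
    have hzero : ∀ i, Limits.IsZero (a (.mk (le_refl i))) := fun i =>
      hG.isZero_of_map hE hE' ((hE'.isZero B i).of_iso (e _))
    -- The map `B_{ik} → B_{jk}` need not be a cofibration, so it is not lifted directly: the lift
    -- of `B_{ij} ↣ B_{ik}` has a cofiber in `E`, and the isomorphism of its image with the lifted
    -- `B_{jk}` is created.
    have hquot : ∀ {i j k : Fin (n + 1)} (h : i ≤ j) (h' : j ≤ k),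
        ∃ f : a (.mk (h.trans h')) ⟶ a (.mk h'), G.1.map f =
          (e _).hom ≫ B.F.map (Ar.hom h le_rfl) ≫ (e _).inv := fun {i j k} h h' => by
      obtain ⟨f, hf, hf'⟩ := hcof _ (hE'.cof_map B (h := h) h')
      obtain ⟨P, r, s, hP⟩ := hE.exists_pushout f ((hzero j).from_ _) hf
      have h1 := isPushout_map (G := G) hE hE' hP hf
      have h2 : IsPushout (G.1.map f) (G.1.map ((hzero j).from_ _))
          ((e _).hom ≫ B.F.map (Ar.hom h le_rfl)) ((e _).hom ≫ B.F.map (Ar.hom le_rfl h')) :=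
        (hE'.po_iff.1 (B.po h h')).2.of_iso (e _).symm (e _).symm (e _).symm (Iso.refl _)
          (by rw [hf']; simp) ((((hE'.isZero B j).of_iso (e _)).eq_of_tgt _ _)) (by simp) (by simp)
      obtain ⟨t, ht⟩ := hG.exists_iso hE' (h1.isoIsPushout _ _ h2 ≪≫ (e _).symm)
      refine ⟨r ≫ t.hom, ?_⟩
      rw [G.1.map_comp, ht, Iso.trans_hom, h1.inl_isoIsPushout_hom_assoc, Category.assoc]
      rfl
    -- The arrow `(i, j) → (i', j')` factors through `(i, j')`.
    have hlift : ∀ {x y : Ar n} (t : x ⟶ y),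
        ∃ f : a x ⟶ a y, G.1.map f = (e x).hom ≫ B.F.map t ≫ (e y).inv := by
      rintro ⟨⟨i, j⟩, h⟩ ⟨⟨i', j'⟩, h'⟩ t
      obtain ⟨f, -, hf⟩ := hcof _ (hE'.cof_map B (h := h) t.le.2)
      obtain ⟨g, hg⟩ := hquot t.le.1 h'
      refine ⟨f ≫ g, ?_⟩
      rw [G.1.map_comp, hf, hg, Category.assoc, Category.assoc, Iso.inv_hom_id_assoc, ← B.F.map_comp_assoc]
      rfl
    choose f hf using @hlift
    let F : Ar n ⥤ E.carrier :=
      { obj := a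
        map := f
        map_id := fun x => hG.map_injective (by rw [hf, B.F.map_id, G.1.map_id]; simp)
        map_comp := fun t t' => hG.map_injective (by rw [G.1.map_comp, hf, hf, hf, B.F.map_comp]; simp) }
    have hF : ∀ {x y : Ar n} (t : x ⟶ y), G.1.map (F.map t) ≫ (e y).hom = (e x).hom ≫ B.F.map t :=
      fun t => (congrArg (· ≫ (e _).hom) (hf t)).trans (by simp)
    have hF' : ∀ {x y : Ar n} (t : x ⟶ y), B.F.map t ≫ (e y).inv = (e x).inv ≫ G.1.map (F.map t) :=
      fun t => by rw [Iso.comp_inv_eq, Category.assoc, hF, Iso.inv_hom_id_assoc]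
    let A : SObj E n :=
      { F := F
        zero := fun i => hE.zero_iff.2 (hzero i)
        po := fun {i j k} h h' => by
          have h1 : E.data.cof (F.map (Ar.hom (h := h) (h' := h.trans h') le_rfl h')) := by
            refine hG.cof_of_map ?_
            change E'.data.cof (G.1.map (f _))
            rw [hf]
            exact hE'.cof_comp _ _ (hE'.cof_of_isIso _)
              (hE'.cof_comp _ _ (hE'.cof_map B h') (hE'.cof_of_isIso _))
          refine hE.po_iff.2 ⟨h1, hG.isPushout_of_map hE hE' h1 ?_⟩
          exact (hE'.po_iff.1 (B.po h h')).2.of_iso (e _).symm (e _).symm (e _).symm (e _).symm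
            (hF' _) (hF' _) (hF' _) (hF' _) }
    let φ : Ar.map OrderHom.id ⋙ A.F ⋙ G.1 ≅ B.F :=
      NatIso.ofComponents (F := Ar.map OrderHom.id ⋙ A.F ⋙ G.1) (G := B.F) (fun x => e x) fun t => hF t
    exact ⟨A, ⟨⟨φ.hom, φ.inv, φ.hom_inv_id, φ.inv_hom_id⟩⟩⟩

/-- Cofibrations and weak equivalences of triangles are in particular entrywise ones, so they lift
entrywise, and the lifts are natural by faithfulness. Cofibrations also require the latching maps to
be cofibrations, which `G` reflects. -/
lemma sobj (hG : Creates G) (hE : HasCofibrations E) (hE' : HasCofibrations E') (n : ℕ) :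
    Creates (E := ⟨SObj E n, SObj.data E n⟩) (E' := ⟨SObj E' n, SObj.data E' n⟩)
      ⟨SObj.map OrderHom.id G, SObj.isExact_map _ G⟩ := by
  have hlift : ∀ {A B : SObj E n} (g : (SObj.map OrderHom.id G).obj A ⟶ (SObj.map OrderHom.id G).obj B),
      (∀ x, ∃ f : A.F.obj x ⟶ B.F.obj x, G.1.map f = SObj.app g x) →
      ∃ f : A ⟶ B, (SObj.map OrderHom.id G).map f = g := by
    intro A B g h
    choose f hf using h
    refine ⟨NatTrans.mk (F := A.F) (G := B.F) f fun x y t => hG.map_injective ?_, SObj.hom_ext fun x => hf x⟩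
    rw [G.1.map_comp, G.1.map_comp, hf, hf]
    exact SObj.naturality g t
  refine ⟨⟨fun {A B f g} h => SObj.hom_ext fun x => hG.map_injective (congrArg (SObj.app · x) h)⟩,
    hG.sobj_essSurj hE hE', fun {A B} g hg => ?_, fun {A B} g hg => ?_⟩
  · obtain ⟨f, rfl⟩ := hlift g fun x => by
      obtain ⟨f, -, hf⟩ := hG.cof (A := A.F.obj x) (B := B.F.obj x) _ (hE'.cof_app hg x)
      exact ⟨f, hf⟩
    refine ⟨f, hE.cof_of_forall fun {i j k} h h' Q r s d hQ hr hs => hG.cof_of_map ?_, rfl⟩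
    obtain ⟨Q', r', s', d', h1, h2, h3, h4⟩ := hg h h'
    refine hE'.cof_desc (hE'.po_iff.1 h1).2 (isPushout_map (G := G) hE hE' hQ (hE.cof_map A h')) ?_ ?_ h4
    · exact h2.trans ((congrArg G.1.map hr).symm.trans (G.1.map_comp _ _))
    · exact h3.trans ((congrArg G.1.map hs).symm.trans (G.1.map_comp _ _))
  · obtain ⟨f, rfl⟩ := hlift g fun x => by
      obtain ⟨f, -, hf⟩ := hG.weq (A := A.F.obj x) (B := B.F.obj x) _ (hg x)
      exact ⟨f, hf⟩
    refine ⟨f, fun x => ?_, rfl⟩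
    obtain ⟨f', h1, h2⟩ := hG.weq (A := A.F.obj x) (B := B.F.obj x) _ (hg x)
    rwa [hG.map_injective h2] at h1

end Creates
end Wald

/-! ### The functors SC(s_n C) → L_n SC(C) → S_n SC(C) create cofibrations and weak equivalences -/

namespace PolytopeComplex

variable {C : PolytopeComplex.{u, v}}

open SC Wald

namespace LObj

variable {n : ℕ}

instance {A B : SC C} (f : A ⟶ B) : IsSplitEpi (proj f) := ⟨⟨⟨incl f, incl_proj⟩⟩⟩

lemma im_map_zero (A : LObj C n) (j : Fin (n + 1)) : im (A.map (Fin.zero_le j)) = ∅ := by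
  refine Set.eq_empty_of_forall_notMem ?_
  rintro _ ⟨p, hp, rfl⟩
  have := Hom.src_mem _ p hp
  rw [A.zero] at this
  exact this

/-- The canonical isomorphism `A_j ≅ A_j/A_0`. -/
def projIso (A : LObj C n) (j : Fin (n + 1)) : A.F.obj j ≅ cofiber (A.map (Fin.zero_le j)) where
  hom := proj _
  inv := incl _
  hom_inv_id := by
    apply SC.hom_ext
    rw [pieces_proj_comp]
    ext p
    constructor
    · rintro ⟨i, hi, rfl⟩
      exact ⟨i, hi.1, rfl⟩
    · rintro ⟨i, hi, rfl⟩
      exact ⟨i, ⟨hi, by rw [im_map_zero]; exact fun h => h⟩, rfl⟩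
  inv_hom_id := incl_proj

/-- The morphism of subquotients underlying a morphism of triangles -/
def subquotientMap {A B : LObj C n} (g : triangle A ⟶ triangle B) {i j : Fin (n + 1)} (h : i ≤ j) :
    cofiber (A.map h) ⟶ cofiber (B.map h) := SObj.app g (.mk h)

lemma quot_subquotientMap {A B : LObj C n} (g : triangle A ⟶ triangle B) {i j i' j' : Fin (n + 1)}
    (h : i ≤ j) (h' : i' ≤ j') (hi : i ≤ i') (hj : j ≤ j') :
    quot (A.map h) (A.map h') (A.map hj) ≫ subquotientMap g h' =
      subquotientMap g h ≫ quot (B.map h) (B.map h') (B.map hj) :=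
  SObj.naturality g (Ar.hom hi hj)

lemma proj_quot_map (A : LObj C n) {i j i' j' : Fin (n + 1)} (h : i ≤ j) (h' : i' ≤ j') (hi : i ≤ i')
    (hj : j ≤ j') : proj (A.map h) ≫ quot (A.map h) (A.map h') (A.map hj) = A.map hj ≫ proj (A.map h') :=
  proj_quot (x := A.map hi) (by rw [map_comp, map_comp])

/-- The morphism on terms underlying a morphism of triangles -/
def ofTriangle {A B : LObj C n} (g : triangle A ⟶ triangle B) : A.F ⟶ B.F where
  app j := (projIso A j).hom ≫ subquotientMap g (Fin.zero_le j) ≫ (projIso B j).inv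
  naturality {j k} h := by
    have h1 := quot_subquotientMap g (Fin.zero_le j) (Fin.zero_le k) le_rfl h.le
    have h2 : (projIso A j).hom ≫ _ = _ ≫ (projIso A k).hom :=
      A.proj_quot_map (Fin.zero_le j) (Fin.zero_le k) le_rfl h.le
    have h3 : (projIso B j).hom ≫ _ = _ ≫ (projIso B k).hom :=
      B.proj_quot_map (Fin.zero_le j) (Fin.zero_le k) le_rfl h.le
    change A.map h.le ≫ _ = _ ≫ B.map h.le
    rw [← Category.assoc, ← h2, Category.assoc, reassoc_of% h1, Category.assoc, Category.assoc]
    congr 2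
    rw [Iso.comp_inv_eq, Category.assoc, Iso.eq_inv_comp, h3]

/-- The projections `A_j → A_j/A_i` are split epimorphisms, so a morphism of triangles is determined
by its first row. -/
lemma quot_ofTriangle {A B : LObj C n} (g : triangle A ⟶ triangle B) {i j : Fin (n + 1)} (h : i ≤ j) :
    quot (A.map h) (B.map h) ((ofTriangle g).app j) = subquotientMap g h := by
  have h1 := quot_subquotientMap g (Fin.zero_le j) h (Fin.zero_le i) le_rfl
  have h2 : A.map h ≫ (ofTriangle g).app j = (ofTriangle g).app i ≫ B.map h :=
    (ofTriangle g).naturality (homOfLE h)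
  have h3 : ∀ (D : LObj C n), (projIso D j).hom ≫ quot _ _ (D.map le_rfl) = proj (D.map h) := fun D =>
    (D.proj_quot_map (Fin.zero_le j) h (Fin.zero_le i) le_rfl).trans
      (by rw [map_refl, Category.id_comp])
  rw [← cancel_epi (proj (A.map h)), proj_quot h2, ← h3 A, Category.assoc, h1, ← h3 B]
  simp [ofTriangle]

/-- Suppose a piece from `A_k` and a piece from `B_i` end at the same member of `B_k`. Both factor
through the latching object, whose map to `B_k` is injective on indices, so they pass through the
same member of it. The clause `layered` of `Glue` then says that the former starts in the image of
`A_i`. -/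
lemma layered_ofTriangle {A B : LObj C n} (g : triangle A ⟶ triangle B) (hg : SObj.cof g) :
    Layered (ofTriangle g) := by
  refine layered_iff.2 fun i k h p hp hs ⟨q, hq, e⟩ => ?_
  obtain ⟨Q, r, s, d, h1, h2, h3, h4⟩ : ∃ (Q : SC C) (r : cofiber (A.map (Fin.zero_le k)) ⟶ Q)
      (s : cofiber (B.map (Fin.zero_le i)) ⟶ Q) (d : Q ⟶ cofiber (B.map (Fin.zero_le k))),
      Glue (quot (A.map (Fin.zero_le i)) (A.map (Fin.zero_le k)) (A.map h))
        (subquotientMap g (Fin.zero_le i)) r s ∧ r ≫ d = subquotientMap g (Fin.zero_le k) ∧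
        s ≫ d = quot _ _ (B.map h) ∧ SC.cof C d := by
    obtain ⟨Q, r, s, d, h1, h2, h3, h4⟩ := hg (Fin.zero_le i) h
    exact ⟨Q, r, s, d, glue_iff.2 h1, h2, h3, h4⟩
  have hp' : p ∈ Hom.pieces (r ≫ d) := by
    rw [h2]
    change p ∈ Hom.pieces (proj _ ≫ subquotientMap g (Fin.zero_le k) ≫ incl _) at hp
    rwa [pieces_proj_comp, pieces_comp_incl] at hp
  have hq' : q ∈ Hom.pieces (s ≫ d) := by
    rw [h3, pieces_quot, im_map_zero, im_map_zero]
    exact ⟨hq, fun h => h, fun h => h⟩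
  rw [pieces_comp] at hp' hq'
  obtain ⟨a, ha, b, hb, hab, x, t, ht, rfl⟩ := hp'
  obtain ⟨a', ha', b', hb', hab', x', t', ht', rfl⟩ := hq'
  obtain rfl := h4.2 b hb b' hb' e.symm
  obtain ⟨c, hc, hc'⟩ := h1.layered a ha ⟨a', ha', hab'.trans hab.symm⟩
  rw [pieces_quot] at hc
  exact hs ⟨c, hc.1, hc'⟩

lemma app_injective_of_triangle {A B : LObj C n} {φ ψ : A ⟶ B} (h : (toS C n).map φ = (toS C n).map ψ) :
    φ = ψ := by
  refine hom_ext fun j => ?_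
  have h1 : quot (A.map (Fin.zero_le j)) (B.map (Fin.zero_le j)) (app φ j) =
      quot (A.map (Fin.zero_le j)) (B.map (Fin.zero_le j)) (app ψ j) :=
    congrArg (SObj.app · (.mk (Fin.zero_le j))) h
  have h2 := congrArg (proj _ ≫ ·) h1
  simp only [proj_quot (naturality _ (Fin.zero_le j))] at h2
  exact (cancel_mono (projIso B j).hom).1 h2

/-- The first row of a triangle. -/
def ofSObj (B : SObj (SC.wald C) n) : LObj C n where
  F :=
    { obj := fun j => B.F.obj (.mk (Fin.zero_le j))
      map := fun h => B.F.map (Ar.hom le_rfl h.le)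
      map_id := fun _ => B.F.map_id _
      map_comp := fun _ _ => B.F.map_comp _ _ }
  zero := carrier_of_isZero (B.zero 0)
  cof h := (B.po (Fin.zero_le _) h).1

/-- A triangle is determined by its first row. -/
lemma nonempty_iso_ofSObj (B : SObj (SC.wald C) n) : Nonempty (triangle (ofSObj B) ≅ B) := by
  let A := ofSObj B
  have h1 : ∀ x : Ar n, IsPushout (A.map x.2) (B.F.map (Ar.hom (h := Fin.zero_le x.1.1)
      (h' := le_refl x.1.1) (Fin.zero_le _) le_rfl)) (proj (A.map x.2)) ((B.zero x.1.1).to_ _) := fun x =>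
    isPushout_proj (carrier_of_isZero (B.zero x.1.1)) _ _
  have h2 : ∀ x : Ar n, IsPushout (A.map x.2) (B.F.map (Ar.hom (h := Fin.zero_le x.1.1)
      (h' := le_refl x.1.1) (Fin.zero_le _) le_rfl)) (B.F.map (Ar.hom (h := Fin.zero_le x.1.2)
      (h' := x.2) (Fin.zero_le _) le_rfl)) (B.F.map (Ar.hom le_rfl x.2)) := fun x =>
    (B.po (Fin.zero_le x.1.1) x.2).2
  let e : ∀ x, (triangle A).F.obj x ≅ B.F.obj x := fun x => (h1 x).isoIsPushout _ _ (h2 x)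
  have he : ∀ x : Ar n, proj (A.map x.2) ≫ (e x).hom = B.F.map (Ar.hom (h := Fin.zero_le x.1.2)
      (h' := x.2) (Fin.zero_le _) le_rfl) := fun x => (h1 x).inl_isoIsPushout_hom _ _ (h2 x)
  let φ : (triangle A).F ≅ B.F := NatIso.ofComponents e fun {x y} t => by
    refine (cancel_epi (X := A.F.obj x.1.2) (Y := cofiber (A.map x.2)) (Z := B.F.obj y)
      (proj (A.map x.2))).1 ?_
    refine (Category.assoc _ _ _).symm.trans ((congrArg (· ≫ (e y).hom)
      (A.proj_quot_map x.2 y.2 t.le.1 t.le.2)).trans ((Category.assoc _ _ _).trans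
      ((congrArg _ (he y)).trans (Eq.trans ?_ ((congrArg (· ≫ B.F.map t) (he x)).symm.trans
      (Category.assoc _ _ _))))))
    exact (B.F.map_comp _ _).symm.trans (B.F.map_comp (Ar.hom (h := Fin.zero_le x.1.2) (h' := x.2)
      (Fin.zero_le _) le_rfl) t)
  exact ⟨⟨φ.hom, φ.inv, φ.hom_inv_id, φ.inv_hom_id⟩⟩

/-- The Waldhausen category `L_n SC(C)`. -/
abbrev wald (C : PolytopeComplex.{u, v}) (n : ℕ) : Wald.{max u v} := ⟨LObj C n, waldData C n⟩

lemma hasCofibrations_sc (C : PolytopeComplex.{u, v}) : HasCofibrations (SC.wald C) :=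
  .of_isWaldhausen (SC.isWaldhausen C)

/-- A morphism of triangles need not come from a layered one, so fullness cannot be used.
Cofibrations and weak equivalences do, by `layered_ofTriangle` and `layered_of_weq`, and nothing
else has to be lifted. -/
theorem creates_toS (C : PolytopeComplex.{u, v}) (n : ℕ) :
    Creates (E := wald C n) (E' := ⟨SObj (SC.wald C) n, SObj.data (SC.wald C) n⟩)
      ⟨toS C n, isExact_toS C n⟩ where
  faithful := ⟨app_injective_of_triangle⟩
  essSurj := ⟨fun B => ⟨ofSObj B, nonempty_iso_ofSObj B⟩⟩
  cof {A B} g hg := by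
    refine ⟨⟨ofTriangle g, layered_ofTriangle g hg⟩, cofibration_of_app fun j => ?_,
      SObj.hom_ext fun x => quot_ofTriangle g x.2⟩
    exact SC.cof_comp (weq_of_isIso (projIso A j).hom inferInstance).1
      (SC.cof_comp ((hasCofibrations_sc C).cof_app hg (.mk (Fin.zero_le j)))
        (weq_of_isIso (projIso (n := n) B j).inv inferInstance).1)
  weq {A B} g hg := by
    have h : ∀ j, SC.weq C ((ofTriangle g).app j) := fun j =>
      SC.weq_comp (weq_of_isIso (projIso A j).hom inferInstance)
        (SC.weq_comp (hg _) (weq_of_isIso (projIso (n := n) B j).inv inferInstance))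
    exact ⟨⟨ofTriangle g, layered_of_weq _ h⟩, h, SObj.hom_ext fun x => quot_ofTriangle g x.2⟩

lemma exists_comb_map {A B : SC (s n C)} (g : (Forest.comb n C).obj A ⟶ (Forest.comb n C).obj B) :
    ∃ f : A ⟶ B, (Forest.comb n C).map f = g := (Forest.comb n C).map_surjective g

theorem creates_comb (C : PolytopeComplex.{u, v}) (n : ℕ) :
    Creates (E := SC.wald (s n C)) (E' := wald C n) ⟨Forest.comb n C, isExact_comb C n⟩ where
  faithful := inferInstanceAs (Forest.comb n C).Faithful
  essSurj := inferInstanceAs (Forest.comb n C).EssSurj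
  cof g hg := by
    obtain ⟨f, rfl⟩ := exists_comb_map g
    exact ⟨f, Forest.cofibration_comb_iff.1 hg, rfl⟩
  weq g hg := by
    obtain ⟨f, rfl⟩ := exists_comb_map g
    exact ⟨f, Forest.weakEquivalence_comb_iff.1 hg, rfl⟩

end LObj

end PolytopeComplex

/-! ### Iteration of the S_•-construction -/

namespace Wald

/-- Since `iterS (q + 1)` applies `S` first, the induction has to vary `X` and `Y`. -/
theorem creates_iterS (q : ℕ) {X Y : SimplexCategoryᵒᵖ ⥤ Wald.{w}} (α : X ⟶ Y)
    (hX : ∀ n, HasCofibrations (X.obj n)) (hY : ∀ n, HasCofibrations (Y.obj n))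
    (hα : ∀ n, Creates (α.app n)) :
    (∀ n, HasCofibrations (((iterS q).obj X).obj n)) ∧ (∀ n, HasCofibrations (((iterS q).obj Y).obj n)) ∧
      ∀ n, Creates (((iterS q).map α).app n) := by
  induction q generalizing X Y with
  | zero => exact ⟨hX, hY, hα⟩
  | succ q ih =>
    exact ih (S.map α) (fun n => (hX n).sobj _) (fun n => (hY n).sobj _)
      fun n => (hα n).sobj (hX n) (hY n) _

end Wald

/-! ### Homotopies of maps of simplicial sets -/

namespace SSet

open Simplicial MonoidalCategory Opposite HomotopicalAlgebra
open scoped modelCategoryQuillen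

/-- Maps defined by cases on simplices are described below by their graphs, for which naturality and
consistency on overlaps are easily stated. -/
lemma exists_hom_of_graph {X Z : SSet.{w}} (G : ∀ n, X.obj n → Z.obj n → Prop)
    (h : ∀ n x, ∃ z, G n x z) (h' : ∀ n x z z', G n x z → G n x z' → z = z')
    (hnat : ∀ {n m} (φ : n ⟶ m) x z, G n x z → G m (X.map φ x) (Z.map φ z)) :
    ∃ f : X ⟶ Z, ∀ n x, G n x (f.app n x) := by
  choose F hF using h
  refine ⟨{ app := fun n => ↾(F n), naturality := fun n m φ => ?_ }, hF⟩
  ext x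
  exact h' _ _ _ _ (hF _ _) (hnat φ x _ (hF _ _))

/-- The horn `Λ[1, 1]` is the vertex `1`, the end of the interval at which homotopies are prescribed
on all of `X`. -/
lemma mem_horn_one_iff {n : SimplexCategoryᵒᵖ} (t : (Δ[1] : SSet.{w}).obj n) :
    t ∈ (horn.{w} 1 1).obj n ↔ t = stdSimplex.const 1 1 n := by
  obtain ⟨f, rfl⟩ := stdSimplex.objEquiv.symm.surjective t
  rw [mem_horn_iff]
  constructor
  · intro h
    refine congrArg stdSimplex.objEquiv.symm (SimplexCategory.Hom.ext _ _ (OrderHom.ext _ _ (funext fun k => ?_)))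
    by_contra h1
    refine h (Set.eq_univ_of_forall fun i => ?_)
    have h2 : ∀ j : Fin 2, j ≠ 1 → j = 0 := by decide
    by_cases hi : i = 1
    · exact Or.inr hi
    · exact Or.inl ⟨k, (h2 _ h1).trans (h2 _ hi).symm⟩
  · intro h h1
    have h2 : (0 : Fin 2) ∈ Set.univ := trivial
    rw [← h1, h] at h2
    obtain ⟨k, hk⟩ | h2 := h2
    · exact absurd (show (1 : Fin 2) = 0 from hk) (by decide)
    · exact absurd (show (0 : Fin 2) = 1 from h2) (by decide)

lemma stdSimplex_const_ne (n : SimplexCategoryᵒᵖ) :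
    (stdSimplex.const 1 0 n : (Δ[1] : SSet.{w}).obj n) ≠ stdSimplex.const 1 1 n := fun h =>
  absurd (congrArg (fun t => stdSimplex.asOrderHom t 0) h) (show (0 : Fin 2) ≠ 1 by decide)

/-- The homotopy extension property, for a homotopy on a subcomplex which is given by its graph. -/
lemma exists_homotopy_extension {X Z : SSet.{w}} [KanComplex Z] (f : X ⟶ Z)
    (G : ∀ n, X.obj n → (Δ[1] : SSet.{w}).obj n → Z.obj n → Prop)
    (hfun : ∀ {n x t z z'}, G n x t z → G n x t z' → z = z')
    (hnat : ∀ {n m} (φ : n ⟶ m) {x t z}, G n x t z → G m (X.map φ x) ((Δ[1] : SSet.{w}).map φ t) (Z.map φ z))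
    (hdom : ∀ {n x t z} t', G n x t z → ∃ z', G n x t' z')
    (hf : ∀ {n x z}, G n x (stdSimplex.const 1 1 n) z → z = f.app n x) :
    ∃ K : X ⊗ Δ[1] ⟶ Z, (∀ n x, K.app n (x, stdSimplex.const 1 1 n) = f.app n x) ∧
      ∀ {n x t z}, G n x t z → K.app n (x, t) = z := by
  let B : X.Subcomplex :=
    { obj := fun n => {x | ∃ t z, G n x t z}
      map := fun φ x ⟨t, z, h⟩ => ⟨_, _, hnat φ h⟩ }
  -- This is `X × {1} ∪ B × Δ[1]`, whose inclusion into `X × Δ[1]` is anodyne.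
  let U := B.unionProd (horn.{w} 1 1)
  have hU : anodyneExtensions U.ι := anodyneExtensions_unionProd_ι _ _ (anodyneExtensions.horn_ι _)
  obtain ⟨k, hk⟩ := exists_hom_of_graph (X := U.toSSet) (Z := Z)
    (fun n x z => G n x.1.1 x.1.2 z ∨ (x.1.2 = stdSimplex.const 1 1 n ∧ z = f.app n x.1.1)) (by
      rintro n ⟨⟨x, t⟩, h⟩
      rcases (Subcomplex.mem_unionProd_iff _ _ _).1 h with h | ⟨t', z, h⟩
      · exact ⟨_, Or.inr ⟨(mem_horn_one_iff _).1 h, rfl⟩⟩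
      · obtain ⟨z', h⟩ := hdom t h
        exact ⟨z', Or.inl h⟩) (by
      rintro n ⟨⟨x, t⟩, h⟩ z z' (h1 | ⟨h1, rfl⟩) (h2 | ⟨h2, rfl⟩)
      · exact hfun h1 h2
      · obtain rfl : t = _ := h2
        exact hf h1
      · obtain rfl : t = _ := h1
        exact (hf h2).symm
      · rfl) (by
      rintro n m φ ⟨⟨x, t⟩, h⟩ z (h1 | ⟨h1, rfl⟩)
      · exact Or.inl (hnat φ h1)
      · obtain rfl : t = _ := h1
        exact Or.inr ⟨rfl, (NatTrans.naturality_apply f φ x).symm⟩)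
  have : HasLiftingProperty U.ι (Limits.terminal.from Z) :=
    hU _ (mem_fibrations (Limits.terminal.from Z))
  have sq : CommSq k U.ι (Limits.terminal.from Z) (Limits.terminal.from _) := ⟨Subsingleton.elim _ _⟩
  have hl : ∀ {n} (x : (X ⊗ Δ[1] : SSet.{w}).obj n) (h : x ∈ U.obj n), sq.lift.app n x = k.app n ⟨x, h⟩ :=
    fun {n} x h => ConcreteCategory.congr_hom (NatTrans.congr_app sq.fac_left n) ⟨x, h⟩
  refine ⟨sq.lift, fun n x => ?_, fun {n x t z} h => ?_⟩
  · have hx : (x, stdSimplex.const 1 1 n) ∈ U.obj n :=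
      (Subcomplex.mem_unionProd_iff _ _ _).2 (Or.inl ((mem_horn_one_iff _).2 rfl))
    rw [hl _ hx]
    obtain h | ⟨-, h⟩ := hk n ⟨_, hx⟩
    · exact hf h
    · exact h
  · have hx : (x, t) ∈ U.obj n := (Subcomplex.mem_unionProd_iff _ _ _).2 (Or.inr ⟨t, z, h⟩)
    rw [hl _ hx]
    obtain h' | ⟨h1, h'⟩ := hk n ⟨_, hx⟩
    · exact hfun h' h
    · obtain rfl : t = _ := h1
      exact h'.trans (hf h).symm

end SSet

/-! ### Shrinkable maps and local homotopies -/

namespace SSet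

open Simplicial MonoidalCategory Opposite HomotopicalAlgebra
open scoped modelCategoryQuillen

variable {M Y Z : SSet.{w}}

/-- A map of simplicial sets whose pullback to every simplex of the target has a section which is a
deformation retract over that simplex. -/
structure IsShrinkable (q : M ⟶ Y) : Prop where
  exists_contraction : ∀ (k : SimplexCategoryᵒᵖ) (y : Y.obj k), ∃ (s : M.obj k)
    (c : ∀ n, (k ⟶ n) → M.obj n → (Δ[1] : SSet.{w}).obj n → M.obj n), q.app k s = y ∧
      ∀ n (φ : k ⟶ n) (x : M.obj n), q.app n x = Y.map φ y →
        (∀ t, q.app n (c n φ x t) = Y.map φ y) ∧ c n φ x (stdSimplex.const 1 0 n) = x ∧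
          c n φ x (stdSimplex.const 1 1 n) = M.map φ s ∧
            ∀ m (ψ : n ⟶ m) t, M.map ψ (c n φ x t) =
              c m (φ ≫ ψ) (M.map ψ x) ((Δ[1] : SSet.{w}).map ψ t)

/-- An `n`-simplex `y` of `Y` together with an `n`-simplex `h` of `Z` and a homotopy on the pullback
of `M` to `y` from the constant map with value `h` to the restriction of `g`. -/
structure LocalHomotopy (q : M ⟶ Y) (g : M ⟶ Z) (n : SimplexCategoryᵒᵖ) : Type w where
  y : Y.obj n
  h : Z.obj n
  H : ∀ m (φ : n ⟶ m) (x : M.obj m), q.app m x = Y.map φ y → (Δ[1] : SSet.{w}).obj m → Z.obj m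
  nat : ∀ {m m'} (φ : n ⟶ m) (ψ : m ⟶ m') (x : M.obj m) (e : q.app m x = Y.map φ y)
    (e' : q.app m' (M.map ψ x) = Y.map (φ ≫ ψ) y) (t : (Δ[1] : SSet.{w}).obj m),
    Z.map ψ (H m φ x e t) = H m' (φ ≫ ψ) (M.map ψ x) e' ((Δ[1] : SSet.{w}).map ψ t)
  zero : ∀ m (φ : n ⟶ m) (x : M.obj m) (e : q.app m x = Y.map φ y),
    H m φ x e (stdSimplex.const 1 0 m) = Z.map φ h
  one : ∀ m (φ : n ⟶ m) (x : M.obj m) (e : q.app m x = Y.map φ y),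
    H m φ x e (stdSimplex.const 1 1 m) = g.app m x

namespace LocalHomotopy

variable {q : M ⟶ Y} {g : M ⟶ Z} {n : SimplexCategoryᵒᵖ}

lemma ext' {d d' : LocalHomotopy q g n} (hy : d.y = d'.y) (hh : d.h = d'.h)
    (hH : ∀ m (φ : n ⟶ m) (x : M.obj m) e e' t, d.H m φ x e t = d'.H m φ x e' t) : d = d' := by
  obtain ⟨y, h, H, _, _, _⟩ := d
  obtain ⟨y', h', H', _, _, _⟩ := d'
  obtain rfl : y = y' := hy
  obtain rfl : h = h' := hh
  obtain rfl : H = H' := by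
    funext m φ x e t
    exact hH m φ x e e t
  rfl

/-- The function `H` takes a proof depending on its other arguments, so these cannot simply be
rewritten. -/
lemma H_congr {d d' : LocalHomotopy q g n} (hd : d = d') {m : SimplexCategoryᵒᵖ} {φ φ' : n ⟶ m}
    (hφ : φ = φ') {x x' : M.obj m} (hx : x = x') (e : q.app m x = Y.map φ d.y)
    (e' : q.app m x' = Y.map φ' d'.y) (t : (Δ[1] : SSet.{w}).obj m) :
    d.H m φ x e t = d'.H m φ' x' e' t := by
  subst hd hφ hx
  rfl

/-- Restriction of local homotopies. -/
def restrict {m : SimplexCategoryᵒᵖ} (ψ : n ⟶ m) (d : LocalHomotopy q g n) : LocalHomotopy q g m where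
  y := Y.map ψ d.y
  h := Z.map ψ d.h
  H m' φ x e t := d.H m' (ψ ≫ φ) x (by rw [e, CategoryTheory.Functor.map_comp_apply]) t
  nat φ χ x e e' t := by
    rw [d.nat (ψ ≫ φ) χ x _ (by rw [e', CategoryTheory.Functor.map_comp_apply, CategoryTheory.Functor.map_comp_apply,
      CategoryTheory.Functor.map_comp_apply])]
    exact H_congr rfl (Category.assoc _ _ _) rfl _ _ _
  zero m φ x e := by rw [d.zero, CategoryTheory.Functor.map_comp_apply]
  one m φ x e := d.one _ _ _ _

variable (q g)

/-- The simplicial set of local homotopies. -/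
def toSSet : SSet.{w} where
  obj := LocalHomotopy q g
  map ψ := ↾(restrict ψ)
  map_id _ := by
    ext d
    refine ext' (CategoryTheory.Functor.map_id_apply Y _ _) (CategoryTheory.Functor.map_id_apply Z _ _) fun m φ x e e' t => ?_
    exact H_congr rfl (Category.id_comp _) rfl _ _ _
  map_comp ψ χ := by
    ext d
    refine ext' (CategoryTheory.Functor.map_comp_apply Y _ _ _) (CategoryTheory.Functor.map_comp_apply Z _ _ _)
      fun m φ x e e' t => ?_
    exact H_congr rfl (Category.assoc _ _ _) rfl _ _ _

/-- The underlying simplex of `Y`. -/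
def proj : toSSet q g ⟶ Y where
  app _ := ↾fun d => d.y
  naturality _ _ _ := rfl

variable {q g}

/-- Given local homotopies over the boundary of a simplex `y`, homotopy extension is used twice.
First, the boundary homotopies along the section `s` are extended over the simplex, starting from
`g` on `s` at time `1`; this gives `J`, and `J` at time `0` supplies the new simplex of `Z`. Second,
on the pullback `W` of `M` the homotopy `J` along the section is dragged back along the contraction
`c`, keeping the prescribed values over the boundary and at both ends; this gives `K`. -/
lemma rlp_boundary (hq : IsShrinkable q) [KanComplex Z] (k : ℕ) :
    HasLiftingProperty (boundary.{w} k).ι (proj q g) where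
  sq_hasLift {a b} sq := by
    let A := boundary.{w} k
    let a' : ∀ {m} (x : (Δ[k] : SSet.{w}).obj m), x ∈ A.obj m → LocalHomotopy q g m := fun x hx => a.app _ ⟨x, hx⟩
    have hA : ∀ {m m'} (ψ : m ⟶ m') {x : (Δ[k] : SSet.{w}).obj m}, x ∈ A.obj m →
        (Δ[k] : SSet.{w}).map ψ x ∈ A.obj m' := fun {_ _} ψ {_} hx => A.map ψ hx
    have ha' : ∀ {m m'} (ψ : m ⟶ m') (x : (Δ[k] : SSet.{w}).obj m) hx hx',
        a' ((Δ[k] : SSet.{w}).map ψ x) hx' = restrict ψ (a' x hx) := fun ψ x hx hx' =>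
      NatTrans.naturality_apply a ψ (⟨x, hx⟩ : A.obj _)
    let y := yonedaEquiv b
    let hm : ∀ {m}, (Δ[k] : SSet.{w}).obj m → (op ⦋k⦌ ⟶ m) := fun x => (stdSimplex.objEquiv x).op
    have hb : ∀ {m} (x : (Δ[k] : SSet.{w}).obj m), b.app m x = Y.map (hm x) y := fun x => by
      conv_lhs => rw [← yonedaEquiv.symm_apply_apply b]
      rfl
    have hab : ∀ {m} (x : (Δ[k] : SSet.{w}).obj m) hx, (a' x hx).y = b.app m x := fun {m} x hx => by
      have h := ConcreteCategory.congr_hom (NatTrans.congr_app sq.w m) (⟨x, hx⟩ : A.toSSet.obj m)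
      exact h
    have hay : ∀ {m} (x : (Δ[k] : SSet.{w}).obj m) hx, (a' x hx).y = Y.map (hm x) y := fun {m} x hx =>
      (hab x hx).trans (hb x)
    have hay' : ∀ {m} (x : (Δ[k] : SSet.{w}).obj m) hx {v : M.obj m}, q.app m v = Y.map (hm x) y →
        q.app m v = Y.map (𝟙 m) (a' x hx).y := fun x hx v hv => by
      rw [hv, CategoryTheory.Functor.map_id_apply, hay]
    have ha'H : ∀ {m m'} (ψ : m ⟶ m') (x : (Δ[k] : SSet.{w}).obj m) hx hx' (v : M.obj m) (v' : M.obj m') e e'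
        (t : (Δ[1] : SSet.{w}).obj m), v' = M.map ψ v →
        (a' ((Δ[k] : SSet.{w}).map ψ x) hx').H m' (𝟙 m') v' e' ((Δ[1] : SSet.{w}).map ψ t) =
          Z.map ψ ((a' x hx).H m (𝟙 m) v e t) := by
      rintro m m' ψ x hx hx' v _ e e' t rfl
      rw [(a' x hx).nat (𝟙 m) ψ v e (by rw [NatTrans.naturality_apply, e,
        ← CategoryTheory.Functor.map_comp_apply]) t]
      exact (H_congr (ha' ψ x hx hx') rfl rfl e' (by rw [← ha' ψ x hx hx', e']) _).trans
        (H_congr (d := a' x hx) rfl (by simp) rfl _ _ _)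
    obtain ⟨s, c, hs, hc⟩ := hq.exists_contraction _ y
    have hqs : ∀ {m} (φ : op ⦋k⦌ ⟶ m), q.app m (M.map φ s) = Y.map φ y := fun φ => by
      rw [NatTrans.naturality_apply, hs]
    -- the homotopy along the section
    obtain ⟨J, hJ1, hJ⟩ := exists_homotopy_extension (yonedaEquiv.symm s ≫ g)
      (fun m x t z => ∃ hx e, z = (a' x hx).H m (𝟙 m) (M.map (hm x) s) e t)
      (by rintro m x t z z' ⟨hx, e, rfl⟩ ⟨hx', e', rfl⟩; rfl)
      (by
        rintro m m' ψ x t z ⟨hx, e, rfl⟩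
        exact ⟨hA ψ hx, hay' _ _ (hqs _), (ha'H ψ x hx _ _ _ _ _ _
          (CategoryTheory.Functor.map_comp_apply M _ _ _)).symm⟩)
      (by rintro m x t z t' ⟨hx, e, rfl⟩; exact ⟨_, hx, e, rfl⟩)
      (by rintro m x z ⟨hx, e, rfl⟩; exact (a' x hx).one _ _ _ _)
    have hJA : ∀ {m} (x : (Δ[k] : SSet.{w}).obj m) hx t e, J.app m (x, t) =
      (a' x hx).H m (𝟙 m) (M.map (hm x) s) e t := fun x hx t e => hJ ⟨hx, e, rfl⟩
    have hJ0 : ∀ {m} (x : (Δ[k] : SSet.{w}).obj m) hx, J.app m (x, stdSimplex.const 1 0 m) = (a' x hx).h :=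
      fun x hx => by
        rw [hJA x hx _ (hay' _ _ (hqs _)), (a' x hx).zero, CategoryTheory.Functor.map_id_apply]
    have hJnat : ∀ {m m'} (ψ : m ⟶ m') (x : (Δ[k] : SSet.{w}).obj m) (t : (Δ[1] : SSet.{w}).obj m),
        Z.map ψ (J.app m (x, t)) = J.app m' ((Δ[k] : SSet.{w}).map ψ x, (Δ[1] : SSet.{w}).map ψ t) :=
      fun {m m'} ψ x t => (NatTrans.naturality_apply J ψ ((x, t) : (Δ[k] ⊗ Δ[1] : SSet.{w}).obj m)).symm
    -- the pullback of `M`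
    let W : (Δ[k] ⊗ M : SSet.{w}).Subcomplex :=
      { obj := fun m => {v | q.app m v.2 = Y.map (hm v.1) y}
        map := fun {m m'} ψ v hv => by
          change q.app m' (M.map ψ v.2) = Y.map (hm v.1 ≫ ψ) y
          rw [NatTrans.naturality_apply, CategoryTheory.Functor.map_comp_apply]
          exact congrArg _ hv }
    -- The second interval is the time `τ` of the contraction. At `τ = 1`, where `c` reaches the
    -- section, `K` is `J`. It is prescribed for all `τ` over the boundary by the given homotopies,
    -- at `t = 0` by `J`, and at `t = 1` by `g`, the first and the last evaluated at the contracted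
    -- point.
    obtain ⟨K, hK1, hK⟩ := exists_homotopy_extension (X := W.toSSet ⊗ Δ[1])
      ((W.ι ≫ CartesianMonoidalCategory.fst _ _) ▷ Δ[1] ≫ J)
      (fun m v τ z => (∃ hx e, z = (a' v.1.1.1 hx).H m (𝟙 m) (c m (hm v.1.1.1) v.1.1.2 τ) e v.2) ∨
        (v.2 = stdSimplex.const 1 0 m ∧ z = J.app m (v.1.1.1, stdSimplex.const 1 0 m)) ∨
        (v.2 = stdSimplex.const 1 1 m ∧ z = g.app m (c m (hm v.1.1.1) v.1.1.2 τ)))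
      (by
        have h12 : ∀ {m} (x : (Δ[k] : SSet.{w}).obj m) hx v e, (a' x hx).H m (𝟙 m) v e (stdSimplex.const 1 0 m) =
            J.app m (x, stdSimplex.const 1 0 m) := fun x hx v e => by
          rw [(a' x hx).zero, CategoryTheory.Functor.map_id_apply, hJ0]
        rintro m ⟨⟨⟨x, v⟩, hv⟩, t⟩ τ z z' h h'
        rcases h with ⟨hx, e, rfl⟩ | ⟨h1, rfl⟩ | ⟨h1, rfl⟩ <;>
          rcases h' with ⟨hx', e', rfl⟩ | ⟨h2, rfl⟩ | ⟨h2, rfl⟩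
        · rfl
        · obtain rfl : t = _ := h2; exact h12 _ _ _ _
        · obtain rfl : t = _ := h2; exact (a' x hx).one _ _ _ _
        · obtain rfl : t = _ := h1; exact (h12 _ _ _ _).symm
        · rfl
        · exact absurd (h1.symm.trans h2) (stdSimplex_const_ne m)
        · obtain rfl : t = _ := h1; exact ((a' x hx').one _ _ _ _).symm
        · exact absurd (h2.symm.trans h1) (stdSimplex_const_ne m)
        · rfl)
      (by
        rintro m m' ψ ⟨⟨⟨x, v⟩, hv⟩, t⟩ τ z h
        have hcn := ((hc m (hm x) v hv).2.2.2 m' ψ τ)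
        rcases h with ⟨hx, e, rfl⟩ | ⟨h1, rfl⟩ | ⟨h1, rfl⟩
        · refine Or.inl ⟨hA ψ hx, ?_, (ha'H ψ x hx _ _ _ e _ t hcn.symm).symm⟩
          refine hay' _ _ ?_
          exact ((hc m' (hm x ≫ ψ) (M.map ψ v) (by
            rw [NatTrans.naturality_apply, CategoryTheory.Functor.map_comp_apply]
            exact congrArg _ hv)).1 _)
        · obtain rfl : t = _ := h1
          exact Or.inr (Or.inl ⟨rfl, hJnat ψ x _⟩)
        · obtain rfl : t = _ := h1
          refine Or.inr (Or.inr ⟨rfl, ?_⟩)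
          rw [← NatTrans.naturality_apply, hcn]
          rfl)
      (by
        rintro m ⟨⟨⟨x, v⟩, hv⟩, t⟩ τ z τ' h
        rcases h with ⟨hx, e, rfl⟩ | ⟨h1, rfl⟩ | ⟨h1, rfl⟩
        · exact ⟨_, Or.inl ⟨hx, hay' _ _ ((hc _ _ v hv).1 _), rfl⟩⟩
        · exact ⟨_, Or.inr (Or.inl ⟨h1, rfl⟩)⟩
        · exact ⟨_, Or.inr (Or.inr ⟨h1, rfl⟩)⟩)
      (by
        rintro m ⟨⟨⟨x, v⟩, hv⟩, t⟩ z h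
        have hc1 : c m (hm x) v (stdSimplex.const 1 1 m) = M.map (hm x) s := (hc _ _ v hv).2.2.1
        change z = J.app m (x, t)
        rcases h with ⟨hx, e, rfl⟩ | ⟨h1, rfl⟩ | ⟨h1, rfl⟩
        · rw [hJA x hx t (hay' _ _ (hqs _))]
          exact H_congr rfl rfl hc1 _ _ _
        · obtain rfl : t = _ := h1
          rfl
        · obtain rfl : t = _ := h1
          rw [hJ1]
          exact congrArg _ hc1)
    let X : ∀ {m}, (op ⦋k⦌ ⟶ m) → (Δ[k] : SSet.{w}).obj m := fun φ => stdSimplex.objEquiv.symm φ.unop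
    have hX : ∀ {m} (x : (Δ[k] : SSet.{w}).obj m), X (hm x) = x := fun x => Equiv.symm_apply_apply _ _
    have hXmap : ∀ {m m'} (φ : op ⦋k⦌ ⟶ m) (ψ : m ⟶ m'), (Δ[k] : SSet.{w}).map ψ (X φ) = X (φ ≫ ψ) :=
      fun φ ψ => rfl
    have hKnat : ∀ {m m'} (φ : op ⦋k⦌ ⟶ m) (ψ : m ⟶ m') (v : M.obj m) (e : q.app m v = Y.map φ y)
        (e' : q.app m' (M.map ψ v) = Y.map (φ ≫ ψ) y) (t : (Δ[1] : SSet.{w}).obj m),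
        Z.map ψ (K.app m ((⟨(X φ, v), e⟩, t), stdSimplex.const 1 0 m)) =
          K.app m' ((⟨(X (φ ≫ ψ), M.map ψ v), e'⟩, (Δ[1] : SSet.{w}).map ψ t), stdSimplex.const 1 0 m') :=
      fun {m m'} φ ψ v e e' t => (NatTrans.naturality_apply K ψ
        (((⟨(X φ, v), e⟩, t), stdSimplex.const 1 0 m) : ((W.toSSet ⊗ Δ[1]) ⊗ Δ[1] : SSet.{w}).obj m)).symm
    -- The lift is `K` at `τ = 0`, where the contraction is still the identity, so that its end at
    -- `t = 1` is `g` itself and over the boundary it is the given data.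
    let d : LocalHomotopy q g (op ⦋k⦌) :=
      { y := y
        h := J.app _ (X (𝟙 _), stdSimplex.const 1 0 _)
        H := fun m φ v e t => K.app m ((⟨(X φ, v), e⟩, t), stdSimplex.const 1 0 m)
        nat := fun {m m'} φ ψ v e e' t => hKnat φ ψ v e e' t
        zero := fun m φ v e => by
          refine (hK (x := (⟨(X φ, v), e⟩, stdSimplex.const 1 0 m)) (Or.inr (Or.inl ⟨rfl, rfl⟩))).trans
            (Eq.trans ?_ (hJnat φ (X (𝟙 _)) (stdSimplex.const 1 0 _)).symm)
          rw [hXmap, Category.id_comp]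
          rfl
        one := fun m φ v e => by
          exact (hK (x := (⟨(X φ, v), e⟩, stdSimplex.const 1 1 m)) (Or.inr (Or.inr ⟨rfl, rfl⟩))).trans
            (congrArg _ (hc m φ v e).2.1) }
    have hd : ∀ {m} (x : (Δ[k] : SSet.{w}).obj m) hx, restrict (hm x) d = a' x hx := fun {m} x hx => by
      refine ext' (hay x hx).symm ?_ ?_
      · refine (hJnat (hm x) (X (𝟙 _)) _).trans ?_
        rw [hXmap, Category.id_comp, hX]
        exact hJ0 x hx
      · intro m' φ v e e' t
        have e₁ : q.app m' v = Y.map (𝟙 m') (a' _ (hA φ hx)).y := by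
          rw [ha' φ x hx, CategoryTheory.Functor.map_id_apply]
          exact e'
        refine Eq.trans (b := (a' _ (hA φ hx)).H m' (𝟙 m') v e₁ t) ?_ ?_
        · have e₂ : X (hm x ≫ φ) = (Δ[k] : SSet.{w}).map φ x := by rw [← hXmap, hX]
          have e₃ : q.app m' v = Y.map (hm (X (hm x ≫ φ))) y := by
            rw [e]
            exact (CategoryTheory.Functor.map_comp_apply Y _ _ _).symm
          have e₄ : X (hm x ≫ φ) ∈ A.obj m' := by rw [e₂]; exact hA φ hx
          refine (hK (x := (⟨(X (hm x ≫ φ), v), e₃⟩, t)) (Or.inl ⟨e₄, ?_, rfl⟩)).trans ?_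
          · rw [(hc m' _ v e₃).2.1]
            exact hay' _ _ e₃
          · refine H_congr ?_ rfl (hc m' _ v e₃).2.1 _ _ _
            congr 1
        · exact H_congr (ha' φ x hx _) rfl rfl _ (by rw [e₁, ha' φ x hx]) _ |>.trans
            (H_congr (d := a' x hx) rfl (Category.comp_id φ) rfl _ _ _)
    refine ⟨⟨⟨yonedaEquiv.symm d, ?_, ?_⟩⟩⟩
    · ext m ⟨x, hx⟩
      exact hd x hx
    · exact (yonedaEquiv_symm_comp _ _).trans (yonedaEquiv.symm_apply_apply b)

end LocalHomotopy

end SSet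

/-! ### Descent of maps and homotopies along shrinkable maps -/

namespace SSet

open Simplicial MonoidalCategory Opposite HomotopicalAlgebra
open scoped modelCategoryQuillen

variable {X M Y Z : SSet.{w}}

lemma nonempty_homotopy {f g : X ⟶ Z} (K : X ⊗ Δ[1] ⟶ Z)
    (h₀ : ∀ n x, K.app n (x, stdSimplex.const 1 0 n) = f.app n x)
    (h₁ : ∀ n x, K.app n (x, stdSimplex.const 1 1 n) = g.app n x) : Nonempty (Homotopy f g) :=
  ⟨{ h := K
     h₀ := by
      ext n x
      exact h₀ n x
     h₁ := by
      ext n x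
      exact h₁ n x
     rel := by
      ext n ⟨⟨x, hx⟩, _⟩
      exact hx.elim }⟩

lemma exists_of_homotopy {f g : X ⟶ Z} (H : Homotopy f g) : ∃ K : X ⊗ Δ[1] ⟶ Z,
    (∀ n x, K.app n (x, stdSimplex.const 1 0 n) = f.app n x) ∧
      ∀ n x, K.app n (x, stdSimplex.const 1 1 n) = g.app n x :=
  ⟨H.h, fun n x => ConcreteCategory.congr_hom (NatTrans.congr_app H.h₀ n) x,
    fun n x => ConcreteCategory.congr_hom (NatTrans.congr_app H.h₁ n) x⟩

namespace LocalHomotopy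

variable {q : M ⟶ Y} {g : M ⟶ Z}

/-- The projection lifts against boundary inclusions, hence against all monomorphisms. The predicate
`R` describes a section over a subcomplex of `Y`, which is extended to all of `Y`. -/
lemma exists_section (hq : IsShrinkable q) [KanComplex Z]
    (R : ∀ {n}, LocalHomotopy q g n → Prop)
    (hR : ∀ {n} {d d' : LocalHomotopy q g n}, R d → R d' → d.y = d'.y → d = d')
    (hmap : ∀ {n m} (φ : n ⟶ m) {d : LocalHomotopy q g n}, R d → R (restrict φ d)) :
    ∃ σ : Y ⟶ toSSet q g, (∀ {n} (y : Y.obj n), (σ.app n y : LocalHomotopy q g n).y = y) ∧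
      ∀ {n} (d : LocalHomotopy q g n), R d → σ.app n d.y = d := by
  let B : Y.Subcomplex :=
    { obj := fun n => {y | ∃ d : LocalHomotopy q g n, R d ∧ d.y = y}
      map := by
        rintro n m φ _ ⟨d, hd, rfl⟩
        exact ⟨_, hmap φ hd, rfl⟩ }
  obtain ⟨k, hk⟩ := exists_hom_of_graph (X := B.toSSet) (Z := toSSet q g)
    (fun n x d => R (n := n) d ∧ LocalHomotopy.y d = x.1) (fun n x => x.2)
    (fun n x d d' h h' => hR h.1 h'.1 (h.2.trans h'.2.symm))
    (fun {n m} φ x d h => ⟨hmap φ h.1, congrArg (Y.map φ) h.2⟩)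
  have h1 : (MorphismProperty.monomorphisms SSet.{w}).rlp (proj q g) := by
    rw [rlp_monomorphisms]
    rintro _ _ _ ⟨n⟩
    exact rlp_boundary hq n
  have : HasLiftingProperty B.ι (proj q g) := h1 _ (inferInstanceAs (Mono B.ι))
  have sq : CommSq k B.ι (proj q g) (𝟙 Y) := ⟨by
    ext n x
    exact (hk n x).2⟩
  refine ⟨sq.lift, fun {n} y => ?_, fun {n} d hd => ?_⟩
  · have h2 := ConcreteCategory.congr_hom (NatTrans.congr_app sq.fac_right n) y
    exact h2
  have hx : d.y ∈ B.obj n := ⟨d, hd, rfl⟩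
  have h2 := ConcreteCategory.congr_hom (NatTrans.congr_app sq.fac_left n) (⟨d.y, hx⟩ : B.toSSet.obj n)
  exact h2.trans (hR (hk n ⟨_, hx⟩).1 hd (hk n ⟨_, hx⟩).2)

end LocalHomotopy

namespace IsShrinkable

variable {q : M ⟶ Y}

/-- For a section of the local homotopies, its `h`-components form a map out of `Y`, and its
homotopies, evaluated at the identity, form the homotopy. Nothing is prescribed, so `R` is empty. -/
lemma exists_descent (hq : IsShrinkable q) [KanComplex Z] (g : M ⟶ Z) :
    ∃ h : Y ⟶ Z, Nonempty (Homotopy (q ≫ h) g) := by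
  obtain ⟨σ, hσ, -⟩ := LocalHomotopy.exists_section (g := g) hq (fun _ => False) (fun h => h.elim)
    (fun _ _ h => h)
  let s : ∀ {n}, Y.obj n → LocalHomotopy q g n := fun {n} y => σ.app n y
  have hs : ∀ {n m} (φ : n ⟶ m) (y : Y.obj n), s (Y.map φ y) = LocalHomotopy.restrict φ (s y) :=
    fun φ y => NatTrans.naturality_apply σ φ y
  have he : ∀ {n} (x : M.obj n), q.app n x = Y.map (𝟙 n) (s (q.app n x)).y := fun x => by
    rw [CategoryTheory.Functor.map_id_apply]
    exact (hσ _).symm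
  let K : M ⊗ Δ[1] ⟶ Z :=
    { app := fun n => ↾fun x => (s (q.app n x.1)).H n (𝟙 n) x.1 (he _) x.2
      naturality := fun n m φ => by
        ext ⟨x, t⟩
        have e : s (q.app m (M.map φ x)) = LocalHomotopy.restrict φ (s (q.app n x)) := by
          rw [NatTrans.naturality_apply, hs]
        refine (LocalHomotopy.H_congr e rfl rfl (he _) (by rw [← e]; exact he _) _).trans ?_
        refine Eq.trans ?_ ((s (q.app n x)).nat (𝟙 n) φ x (he _) (by
          rw [NatTrans.naturality_apply, Category.id_comp]
          exact congrArg (Y.map φ) (hσ _).symm) t).symm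
        exact LocalHomotopy.H_congr rfl ((Category.comp_id _).trans (Category.id_comp _).symm) rfl _ _ _ }
  refine ⟨{ app := fun n => ↾fun y => (s y).h
            naturality := fun n m φ => by
              ext y
              exact congrArg LocalHomotopy.h (hs φ y) }, nonempty_homotopy K (fun n x => ?_) fun n x => ?_⟩
  · exact ((s (q.app n x)).zero n (𝟙 n) x (he _)).trans (CategoryTheory.Functor.map_id_apply Z _ _)
  · exact (s (q.app n x)).one n (𝟙 n) x (he _)

lemma whiskerRight (hq : IsShrinkable q) (T : SSet.{w}) : IsShrinkable (q ▷ T) where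
  exists_contraction k y := by
    obtain ⟨s, c, hs, hc⟩ := hq.exists_contraction k y.1
    refine ⟨(s, y.2), fun n φ x t => (c n φ x.1 t, x.2), Prod.ext hs rfl, ?_⟩
    rintro n φ ⟨x, t'⟩ hx
    obtain rfl : t' = T.map φ y.2 := congrArg Prod.snd hx
    obtain ⟨h1, h2, h3, h4⟩ := hc n φ x (congrArg Prod.fst hx)
    exact ⟨fun t => Prod.ext (h1 t) rfl, Prod.ext h2 rfl, Prod.ext h3 rfl,
      fun m ψ t => Prod.ext (h4 m ψ t) rfl⟩

/-- A section is taken for `q ▷ Δ[1]` and the given homotopy `Θ`. Over the two ends of the interval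
it is prescribed to be the constant local homotopy at `h` or `h'`, so its `h`-components form a
homotopy from `h` to `h'`. -/
lemma homotopy_descent (hq : IsShrinkable q) [KanComplex Z] {h h' : Y ⟶ Z}
    (H : Homotopy (q ≫ h) (q ≫ h')) : Nonempty (Homotopy h h') := by
  obtain ⟨Θ, h₀, h₁⟩ := exists_of_homotopy H
  have hΘ : ∀ {n m} (φ : n ⟶ m) (x : (M ⊗ Δ[1] : SSet.{w}).obj n),
      Θ.app m ((M ⊗ Δ[1] : SSet.{w}).map φ x) = Z.map φ (Θ.app n x) := fun φ x =>
    NatTrans.naturality_apply Θ φ x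
  obtain ⟨σ, -, hσ⟩ := LocalHomotopy.exists_section (g := Θ) (hq.whiskerRight Δ[1])
    (fun {n} d => ((d.y.2 = stdSimplex.const 1 0 n ∧ d.h = h.app n d.y.1) ∨
      (d.y.2 = stdSimplex.const 1 1 n ∧ d.h = h'.app n d.y.1)) ∧
        ∀ m φ x e t, d.H m φ x e t = Θ.app m x)
    (by
      rintro n d d' ⟨hd, hH⟩ ⟨hd', hH'⟩ hy
      refine LocalHomotopy.ext' hy ?_ fun m φ x e e' t => (hH _ _ _ _ _).trans (hH' _ _ _ _ _).symm
      have hy1 := congrArg Prod.fst hy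
      have hy2 := congrArg Prod.snd hy
      rcases hd with ⟨h1, h2⟩ | ⟨h1, h2⟩ <;> rcases hd' with ⟨h3, h4⟩ | ⟨h3, h4⟩
      · exact h2.trans ((congrArg (h.app n) hy1).trans h4.symm)
      · exact absurd (h1.symm.trans (hy2.trans h3)) (stdSimplex_const_ne n)
      · exact absurd (h3.symm.trans (hy2.symm.trans h1)) (stdSimplex_const_ne n)
      · exact h2.trans ((congrArg (h'.app n) hy1).trans h4.symm))
    (by
      rintro n m φ d ⟨hd, hH⟩
      refine ⟨?_, fun m φ x e t => hH _ _ _ _ _⟩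
      rcases hd with ⟨h1, h2⟩ | ⟨h1, h2⟩
      · exact Or.inl ⟨congrArg ((Δ[1] : SSet.{w}).map φ) h1,
          (congrArg (Z.map φ) h2).trans (NatTrans.naturality_apply h φ _).symm⟩
      · exact Or.inr ⟨congrArg ((Δ[1] : SSet.{w}).map φ) h1,
          (congrArg (Z.map φ) h2).trans (NatTrans.naturality_apply h' φ _).symm⟩)
  -- Over an end `Θ` factors through `q`, so the constant local homotopy is available there, and it
  -- satisfies the prescription.
  have hend : ∀ {n} (y : Y.obj n) (t : (Δ[1] : SSet.{w}).obj n) (z : Z.obj n)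
      (hz : (t = stdSimplex.const 1 0 n ∧ z = h.app n y) ∨ (t = stdSimplex.const 1 1 n ∧ z = h'.app n y)),
      LocalHomotopy.h (σ.app n (y, t)) = z := by
    intro n y t z hz
    have hz' : ∀ m (φ : n ⟶ m) (x : (M ⊗ Δ[1] : SSet.{w}).obj m),
        (q ▷ Δ[1]).app m x = (Y ⊗ Δ[1] : SSet.{w}).map φ (y, t) → Θ.app m x = Z.map φ z := by
      rintro m φ ⟨x, t'⟩ hx
      have hx1 : q.app m x = Y.map φ y := congrArg Prod.fst hx
      obtain rfl : t' = (Δ[1] : SSet.{w}).map φ t := congrArg Prod.snd hx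
      rcases hz with ⟨rfl, rfl⟩ | ⟨rfl, rfl⟩
      · refine (h₀ m x).trans ((congrArg (h.app m) hx1).trans ?_)
        exact NatTrans.naturality_apply h φ _
      · refine (h₁ m x).trans ((congrArg (h'.app m) hx1).trans ?_)
        exact NatTrans.naturality_apply h' φ _
    exact congrArg LocalHomotopy.h (hσ
      { y := (y, t)
        h := z
        H := fun m φ x e t => Θ.app m x
        nat := fun φ ψ x e e' t => (hΘ ψ x).symm
        zero := hz'
        one := fun _ _ _ _ => rfl } ⟨hz, fun _ _ _ _ _ => rfl⟩)
  refine nonempty_homotopy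
    { app := fun n => ↾fun y => LocalHomotopy.h (σ.app n y)
      naturality := fun n m φ => by
        ext y
        exact congrArg LocalHomotopy.h (NatTrans.naturality_apply σ φ y) } (fun n y => ?_) fun n y => ?_
  · exact hend y _ _ (Or.inl ⟨rfl, rfl⟩)
  · exact hend y _ _ (Or.inr ⟨rfl, rfl⟩)

end IsShrinkable

end SSet

open MonoidalCategory Simplicial in
/-- A section up to homotopy of a deformation retraction followed by a shrinkable map is a weak
homotopy equivalence. -/
lemma isWeakHomotopyEquiv_comp {X M Y : SSet.{w}} (i : X ⟶ M) (q : M ⟶ Y) (hq : SSet.IsShrinkable q)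
    (r : M ⟶ X) (hr : i ≫ r = 𝟙 X) (H : SSet.Homotopy (𝟙 M) (r ≫ i)) : IsWeakHomotopyEquiv (i ≫ q) := by
  intro Z _
  have hr' : ∀ {n} x, r.app n (i.app n x) = x := fun {n} x =>
    ConcreteCategory.congr_hom (NatTrans.congr_app hr n) x
  refine ⟨fun g => ?_, fun h h' ⟨θ⟩ => ?_⟩
  -- The map `r ≫ g` descends up to homotopy, and restricting this homotopy along `i` recovers `g`,
  -- because `i ≫ r` is the identity.
  · obtain ⟨h, ⟨K⟩⟩ := hq.exists_descent (r ≫ g)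
    obtain ⟨K, h₀, h₁⟩ := SSet.exists_of_homotopy K
    refine ⟨h, SSet.nonempty_homotopy (MonoidalCategory.whiskerRight i _ ≫ K) (fun n x => h₀ n _)
      fun n x => (h₁ n _).trans (congrArg (g.app n) (hr' x))⟩
  · obtain ⟨θ, h₀, h₁⟩ := SSet.exists_of_homotopy θ
    obtain ⟨l, l₀, l₁⟩ := SSet.exists_of_homotopy H
    -- Precomposed with `r`, the homotopy `θ` joins `q ≫ h` and `q ≫ h'` only after restriction
    -- along `r ≫ i`. Homotopy extension moves its ends back along `l` to the identity of `M`.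
    obtain ⟨K, -, hK⟩ := SSet.exists_homotopy_extension (MonoidalCategory.whiskerRight r _ ≫ θ)
      (fun n x τ z => (x.2 = SSet.stdSimplex.const 1 0 n ∧ z = h.app n (q.app n (l.app n (x.1, τ)))) ∨
        (x.2 = SSet.stdSimplex.const 1 1 n ∧ z = h'.app n (q.app n (l.app n (x.1, τ)))))
      (by
        rintro n x τ z z' (⟨h1, rfl⟩ | ⟨h1, rfl⟩) (⟨h2, rfl⟩ | ⟨h2, rfl⟩)
        · rfl
        · exact absurd (h1.symm.trans h2) (SSet.stdSimplex_const_ne n)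
        · exact absurd (h2.symm.trans h1) (SSet.stdSimplex_const_ne n)
        · rfl)
      (by
        rintro n m φ ⟨x, t⟩ τ z hz
        have hl : l.app m (M.map φ x, (Δ[1]).map φ τ) = M.map φ (l.app n (x, τ)) :=
          NatTrans.naturality_apply l φ ((x, τ) : (M ⊗ Δ[1] : SSet.{w}).obj n)
        rcases hz with ⟨h1, rfl⟩ | ⟨h1, rfl⟩
        · obtain rfl : t = _ := h1
          refine Or.inl ⟨rfl, ?_⟩
          rw [← NatTrans.naturality_apply, ← NatTrans.naturality_apply, ← hl]
          rfl
        · obtain rfl : t = _ := h1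
          refine Or.inr ⟨rfl, ?_⟩
          rw [← NatTrans.naturality_apply, ← NatTrans.naturality_apply, ← hl]
          rfl)
      (by
        rintro n x τ z τ' (⟨h1, -⟩ | ⟨h1, -⟩)
        · exact ⟨_, Or.inl ⟨h1, rfl⟩⟩
        · exact ⟨_, Or.inr ⟨h1, rfl⟩⟩)
      (by
        rintro n ⟨x, t⟩ z (⟨h1, rfl⟩ | ⟨h1, rfl⟩)
        · obtain rfl : t = _ := h1
          exact (congrArg (fun y => h.app n (q.app n y)) (l₁ n x)).trans (h₀ n (r.app n x)).symm
        · obtain rfl : t = _ := h1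
          exact (congrArg (fun y => h'.app n (q.app n y)) (l₁ n x)).trans (h₁ n (r.app n x)).symm)
    obtain ⟨Θ⟩ : Nonempty (SSet.Homotopy (q ≫ h) (q ≫ h')) := SSet.nonempty_homotopy (SSet.ι₀ ≫ K)
      (fun n x => (hK (x := (x, SSet.stdSimplex.const 1 0 n)) (Or.inl ⟨rfl, rfl⟩)).trans
        (congrArg (fun y => h.app n (q.app n y)) (l₀ n x)))
      (fun n x => (hK (x := (x, SSet.stdSimplex.const 1 1 n)) (Or.inr ⟨rfl, rfl⟩)).trans
        (congrArg (fun y => h'.app n (q.app n y)) (l₀ n x)))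
    exact hq.homotopy_descent Θ

/-! ### Maps that create weak equivalences are weak homotopy equivalences on nerves -/

namespace Wald

/-- An object `c` of the target of `G` with an isomorphism to an object of the image of `G`. -/
structure Marking {E E' : Wald.{w}} (G : E ⟶ E') : Type w where
  a : E.carrier
  b : E'.carrier
  hab : G.1.obj a = b
  c : E'.carrier
  e : b ≅ c

namespace Marking

variable {E E' E₁ E₁' : Wald.{w}} {G : E ⟶ E'} {G₁ : E₁ ⟶ E₁'}

/-- The isomorphism of a marking, with the objects replaced by equal ones. -/
def iso (p : Marking G) {A : E.carrier} {C : E'.carrier} (hA : p.a = A) (hC : p.c = C) : G.1.obj A ≅ C :=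
  eqToIso (by rw [← hA, p.hab]) ≪≫ p.e ≪≫ eqToIso hC

/-- The trivial marking of an object of the image. -/
def ofEq {a : E.carrier} {b : E'.carrier} (h : G.1.obj a = b) : Marking G := ⟨a, b, h, b, Iso.refl b⟩

lemma ofEq_congr {a a' : E.carrier} {b b' : E'.carrier} {h : G.1.obj a = b} {h' : G.1.obj a' = b'}
    (ha : a = a') (hb : b = b') : ofEq h = ofEq h' := by
  subst ha hb
  rfl

/-- The image of a marking. -/
def map (p : Marking G) (u : E ⟶ E₁) (v : E' ⟶ E₁') (h : u ≫ G₁ = G ≫ v) : Marking G₁ where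
  a := u.1.obj p.a
  b := v.1.obj p.b
  hab := (Functor.congr_obj (congrArg Subtype.val h) p.a).trans (congrArg v.1.obj p.hab)
  c := v.1.obj p.c
  e := v.1.mapIso p.e

lemma comm_ofEq {A A' : E.carrier} (f : A ⟶ A') :
    G.1.map f ≫ ((ofEq (G := G) (rfl : G.1.obj A' = _)).iso rfl rfl).hom =
      ((ofEq (G := G) (rfl : G.1.obj A = _)).iso rfl rfl).hom ≫ G.1.map f := by
  change _ ≫ 𝟙 _ ≫ 𝟙 _ ≫ 𝟙 _ = (𝟙 _ ≫ 𝟙 _ ≫ 𝟙 _) ≫ _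
  simp

lemma map_ofEq {a : E.carrier} {b : E'.carrier} (hab : G.1.obj a = b) (u : E ⟶ E₁) (v : E' ⟶ E₁')
    (h : u ≫ G₁ = G ≫ v) : (ofEq hab).map u v h =
      ofEq (G := G₁) ((Functor.congr_obj (congrArg Subtype.val h) a).trans (congrArg v.1.obj hab)) := by
  unfold ofEq map
  congr 1
  exact v.1.mapIso_refl b

lemma iso_map (p : Marking G) (u : E ⟶ E₁) (v : E' ⟶ E₁') (h : u ≫ G₁ = G ≫ v) {A : E.carrier}
    {C : E'.carrier} (hA : p.a = A) (hC : p.c = C) :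
    (p.map u v h).iso (congrArg u.1.obj hA) (congrArg v.1.obj hC) =
      eqToIso (Functor.congr_obj (congrArg Subtype.val h) A) ≪≫ v.1.mapIso (p.iso hA hC) := by
  subst hA hC
  ext
  simp [iso, map, eqToHom_map]
  rfl

lemma comm_map {p p' : Marking G} {A A' : E.carrier} {C C' : E'.carrier} {f : A ⟶ A'} {g : C ⟶ C'}
    {hA : p.a = A} {hA' : p'.a = A'} {hC : p.c = C} {hC' : p'.c = C'}
    (e : G.1.map f ≫ (p'.iso hA' hC').hom = (p.iso hA hC).hom ≫ g) {u : E ⟶ E₁} {v : E' ⟶ E₁'}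
    (h : u ≫ G₁ = G ≫ v) :
    G₁.1.map (u.1.map f) ≫ ((p'.map u v h).iso (congrArg u.1.obj hA') (congrArg v.1.obj hC')).hom =
      ((p.map u v h).iso (congrArg u.1.obj hA) (congrArg v.1.obj hC)).hom ≫ v.1.map g := by
  have h1 : G₁.1.map (u.1.map f) = eqToHom (Functor.congr_obj (congrArg Subtype.val h) A) ≫
      v.1.map (G.1.map f) ≫ eqToHom (Functor.congr_obj (congrArg Subtype.val h) A').symm :=
    Functor.congr_hom (congrArg Subtype.val h) f
  have h2 := congrArg v.1.map e
  rw [v.1.map_comp, v.1.map_comp] at h2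
  rw [iso_map p u v h hA hC, iso_map p' u v h hA' hC', h1]
  simp only [Iso.trans_hom, eqToIso.hom, Functor.mapIso_hom, Category.assoc, eqToHom_trans_assoc,
    eqToHom_refl, Category.id_comp, h2]

/-- The isomorphisms of the markings can be cancelled. Equality is heterogeneous because the
endpoints agree only by equations. -/
lemma heq_of_comm {p p' : Marking G} {A A' : E.carrier} {C C' D D' : E'.carrier} {f : A ⟶ A'}
    {g : C ⟶ C'} {k : D ⟶ D'} {hA : p.a = A} {hA' : p'.a = A'} {hC : p.c = C} {hC' : p'.c = C'}
    {hD : p.c = D} {hD' : p'.c = D'}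
    (e : G.1.map f ≫ (p'.iso hA' hC').hom = (p.iso hA hC).hom ≫ g)
    (e' : G.1.map f ≫ (p'.iso hA' hD').hom = (p.iso hA hD).hom ≫ k) : g ≍ k := by
  subst hA hA' hC hC' hD hD'
  exact heq_of_eq ((cancel_epi _).1 (e.symm.trans e'))

lemma heq_of_comm' (hG : Creates G) {p p' : Marking G} {A A' B B' : E.carrier} {C C' : E'.carrier}
    {f : A ⟶ A'} {g : B ⟶ B'} {k : C ⟶ C'} {hA : p.a = A} {hA' : p'.a = A'} {hB : p.a = B} {hB' : p'.a = B'}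
    {hC : p.c = C} {hC' : p'.c = C'}
    (e : G.1.map f ≫ (p'.iso hA' hC').hom = (p.iso hA hC).hom ≫ k)
    (e' : G.1.map g ≫ (p'.iso hB' hC').hom = (p.iso hB hC).hom ≫ k) : f ≍ g := by
  subst hA hA' hB hB' hC hC'
  exact heq_of_eq (hG.map_injective ((cancel_mono _).1 (e.trans e'.symm)))

/-- A marking keeps `b` next to `a` with an equation, and an isomorphism starting at `b`. This makes
the image of a marking strictly functorial, here and in `map_comp`, with no transport of the
isomorphism. -/
lemma map_id (p : Marking G) {u : E ⟶ E} {v : E' ⟶ E'} (h : u ≫ G = G ≫ v) (hu : u = 𝟙 E) (hv : v = 𝟙 E') :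
    p.map u v h = p := by
  subst hu hv
  rfl

lemma map_comp (p : Marking G) {E₂ E₂' : Wald.{w}} {G₂ : E₂ ⟶ E₂'} {u : E ⟶ E₁} {v : E' ⟶ E₁'}
    (h : u ≫ G₁ = G ≫ v) {u' : E₁ ⟶ E₂} {v' : E₁' ⟶ E₂'} (h' : u' ≫ G₂ = G₁ ≫ v')
    {u'' : E ⟶ E₂} {v'' : E' ⟶ E₂'} (h'' : u'' ≫ G₂ = G ≫ v'') (hu : u'' = u ≫ u') (hv : v'' = v ≫ v') :
    p.map u'' v'' h'' = (p.map u v h).map u' v' h' := by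
  subst hu hv
  rfl

end Marking

lemma chain_ext {E : Wald.{w}} {n : SimplexCategoryᵒᵖ} {A A' : nwFunctor.obj (n, E)}
    (h : ∀ j, A.1.obj j = A'.1.obj j) (h' : ∀ {i j} (k : i ⟶ j), A.1.map k ≍ A'.1.map k) : A = A' :=
  Subtype.ext (Functor.hext h fun _ _ => h')

/-- A chain of weak equivalences in the target of `G` with markings of its objects, and the chain in the
source of `G` which they determine. -/
structure MarkedChain {E E' : Wald.{w}} (G : E ⟶ E') (n : SimplexCategoryᵒᵖ) : Type w where
  A : nwFunctor.obj (n, E)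
  F : nwFunctor.obj (n, E')
  p : Fin (n.unop.len + 1) → Marking G
  hA : ∀ j, (p j).a = A.1.obj j
  hC : ∀ j, (p j).c = F.1.obj j
  comm : ∀ {i j} (k : i ⟶ j), G.1.map (A.1.map k) ≫ ((p j).iso (hA j) (hC j)).hom =
    ((p i).iso (hA i) (hC i)).hom ≫ F.1.map k

namespace MarkedChain

variable {E E' E₁ E₁' : Wald.{w}} {G : E ⟶ E'} {G₁ : E₁ ⟶ E₁'} {n m : SimplexCategoryᵒᵖ}

/-- The chain `F` is the conjugate of the image of `A` by the isomorphisms of the markings. -/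
lemma ext_A {x x' : MarkedChain G n} (hA : x.A = x'.A) (hp : x.p = x'.p) : x = x' := by
  obtain ⟨A, F, p, hA₁, hC, comm⟩ := x
  obtain ⟨A', F', p', hA', hC', comm'⟩ := x'
  obtain rfl : A = A' := hA
  obtain rfl : p = p' := hp
  obtain rfl : F = F' := chain_ext (fun j => (hC j).symm.trans (hC' j)) fun {i j} k =>
    Marking.heq_of_comm (comm k) (comm' k)
  rfl

/-- The markings and `F` determine the image of `A`, and `G` is faithful. -/
lemma ext_F (hG : Creates G) {x x' : MarkedChain G n} (hF : x.F = x'.F) (hp : x.p = x'.p) : x = x' := by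
  obtain ⟨A, F, p, hA₁, hC, comm⟩ := x
  obtain ⟨A', F', p', hA', hC', comm'⟩ := x'
  obtain rfl : F = F' := hF
  obtain rfl : p = p' := hp
  obtain rfl : A = A' := chain_ext (fun j => (hA₁ j).symm.trans (hA' j)) fun {i j} k =>
    Marking.heq_of_comm' hG (comm k) (comm' k)
  rfl

/-- The image of the chain is conjugated by the isomorphisms of the markings, which are weak
equivalences. -/
lemma exists_of_A (hE' : HasCofibrations E') (A : nwFunctor.obj (n, E)) (p : Fin (n.unop.len + 1) → Marking G)
    (hA : ∀ j, (p j).a = A.1.obj j) : ∃ x : MarkedChain G n, x.A = A ∧ x.p = p := by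
  refine ⟨⟨A, ⟨{ obj := fun j => (p j).c
                 map := fun {i j} k => ((p i).iso (hA i) rfl).inv ≫ G.1.map (A.1.map k) ≫
                  ((p j).iso (hA j) rfl).hom
                 map_id := by simp
                 map_comp := by simp }, fun k => ?_⟩, p, hA, fun _ => rfl, ?_⟩, rfl, rfl⟩
  · exact hE'.weq_comp _ _ (hE'.weq_of_isIso _) (hE'.weq_comp _ _ (G.2.weq _ (A.2 k)) (hE'.weq_of_isIso _))
  · simp

/-- After conjugation by the markings, the maps of `F` are weak equivalences between objects of the
image, so they lift; faithfulness makes the lifts functorial. -/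
lemma exists_of_F (hE' : HasCofibrations E') (hG : Creates G) (F : nwFunctor.obj (n, E'))
    (p : Fin (n.unop.len + 1) → Marking G)
    (hC : ∀ j, (p j).c = F.1.obj j) : ∃ x : MarkedChain G n, x.F = F ∧ x.p = p := by
  have h : ∀ {i j} (k : i ⟶ j), ∃ f : (p i).a ⟶ (p j).a, E.data.weq f ∧ G.1.map f =
      ((p i).iso rfl (hC i)).hom ≫ F.1.map k ≫ ((p j).iso rfl (hC j)).inv := fun k =>
    hG.weq _ (hE'.weq_comp _ _ (hE'.weq_of_isIso _) (hE'.weq_comp _ _ (F.2 k) (hE'.weq_of_isIso _)))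
  choose f hf hf' using @h
  refine ⟨⟨⟨{ obj := fun j => (p j).a
              map := fun {i j} k => f k
              map_id := fun i => hG.map_injective (by simp [hf'])
              map_comp := fun k l => hG.map_injective (by simp [hf']) }, fun k => hf k⟩, F, p,
    fun _ => rfl, hC, fun k => ?_⟩, rfl, rfl⟩
  simp [hf']

/-- The image of a marked chain. -/
def map (f : n ⟶ m) (u : E ⟶ E₁) (v : E' ⟶ E₁') (h : u ≫ G₁ = G ≫ v) (x : MarkedChain G n) :
    MarkedChain G₁ m where
  A := nwFunctor.map (X := (n, E)) (Y := (m, E₁)) (f, u) x.A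
  F := nwFunctor.map (X := (n, E')) (Y := (m, E₁')) (f, v) x.F
  p j := (x.p (f.unop.toOrderHom j)).map u v h
  hA _ := congrArg u.1.obj (x.hA _)
  hC _ := congrArg v.1.obj (x.hC _)
  comm k := Marking.comm_map (x.comm (f.unop.toOrderHom.monotone.functor.map k)) h

end MarkedChain

open Simplicial MonoidalCategory Opposite

variable {X Y : SimplexCategoryᵒᵖ ⥤ Wald.{w}} (α : X ⟶ Y)

/-- The simplicial set of marked chains. -/
def markedNerve : SSet.{w} where
  obj n := MarkedChain (α.app n) n
  map f := ↾(MarkedChain.map f (X.map f) (Y.map f) (α.naturality f))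
  map_id n := by
    ext x
    refine MarkedChain.ext_A ?_ (funext fun j => ?_)
    · exact CategoryTheory.Functor.map_id_apply (nw.obj X) n x.A
    · exact Marking.map_id _ (α.naturality _) (X.map_id n) (Y.map_id n)
  map_comp f g := by
    ext x
    refine MarkedChain.ext_A ?_ (funext fun j => ?_)
    · exact CategoryTheory.Functor.map_comp_apply (nw.obj X) f g x.A
    · exact Marking.map_comp _ (α.naturality f) (α.naturality g) (α.naturality _) (X.map_comp f g) (Y.map_comp f g)

namespace markedNerve

/-- The map which sends a marked chain to its source. -/
def source : markedNerve α ⟶ nw.obj X where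
  app _ := ↾fun x => x.A
  naturality _ _ _ := rfl

/-- The map which sends a marked chain to its target. -/
def target : markedNerve α ⟶ nw.obj Y where
  app _ := ↾fun x => x.F
  naturality _ _ _ := rfl

/-- The trivial marking of the image of a chain. -/
def trivial : nw.obj X ⟶ markedNerve α where
  app n := ↾fun A =>
    { A := A
      F := (nw.map α).app n A
      p := fun j => Marking.ofEq (b := ((α.app n).1.obj (A.1.obj j))) rfl
      hA := fun _ => rfl
      hC := fun _ => rfl
      comm := fun k => Marking.comm_ofEq (A.1.map k) }
  naturality n m f := by
    ext A
    refine MarkedChain.ext_A rfl (funext fun j => ?_)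
    refine Eq.trans ?_ (Marking.map_ofEq _ _ _ (α.naturality f)).symm
    refine Marking.ofEq_congr rfl ?_
    exact Functor.congr_obj (congrArg Subtype.val (α.naturality f)) _

variable {α}

/-- The coordinate of a simplex of the interval at a vertex. -/
abbrev coord {n : SimplexCategoryᵒᵖ} (t : (Δ[1] : SSet.{w}).obj n) (j : Fin (n.unop.len + 1)) : Fin 2 :=
  SSet.stdSimplex.asOrderHom t j

/-- The source chain is kept, and the marking of a vertex is kept or made trivial according to its
coordinate in the interval. The target chain is then determined. -/
lemma nonempty_homotopy (hY : ∀ n, HasCofibrations (Y.obj n)) :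
    Nonempty (SSet.Homotopy (𝟙 (markedNerve α)) (source α ≫ trivial α)) := by
  obtain ⟨l, hl⟩ := SSet.exists_hom_of_graph (X := markedNerve α ⊗ Δ[1]) (Z := markedNerve α)
    (fun n (x : MarkedChain (α.app n) n × (Δ[1] : SSet.{w}).obj n) z => MarkedChain.A z = x.1.A ∧ MarkedChain.p z = fun j =>
      if coord x.2 j = 0 then x.1.p j else .ofEq (x.1.p j).hab)
    (fun n x => MarkedChain.exists_of_A (hY _) (MarkedChain.A x.1) _ fun j => by
      split_ifs
      · exact MarkedChain.hA x.1 j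
      · exact MarkedChain.hA x.1 j)
    (fun n x z z' h h' => MarkedChain.ext_A (h.1.trans h'.1.symm) (h.2.trans h'.2.symm))
    (by
      rintro n m φ ⟨x, t⟩ z ⟨h1, h2⟩
      refine ⟨congrArg ((nw.obj X).map φ) h1, funext fun j => ?_⟩
      refine (congrArg (fun p => Marking.map (p (φ.unop.toOrderHom j)) _ _ (α.naturality φ)) h2).trans ?_
      refine (apply_ite (fun p => Marking.map p _ _ (α.naturality φ)) _ _ _).trans ?_
      rw [Marking.map_ofEq]
      rfl)
  refine SSet.nonempty_homotopy l (fun n x => ?_) fun n x => ?_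
  · exact MarkedChain.ext_A (hl n (x, _)).1 (hl n (x, _)).2
  · refine MarkedChain.ext_A (hl n (x, _)).1 ((hl n (x, _)).2.trans (funext fun j => ?_))
    refine Marking.ofEq_congr (MarkedChain.hA x j) ?_
    rw [← (MarkedChain.p x j).hab, MarkedChain.hA x j]
    rfl

/-- Essential surjectivity marks the vertices of the chain `y`, which gives the section. The
contraction keeps the target chain and replaces given markings by the chosen ones at the vertices
with coordinate `1`; the source chain follows by `exists_of_F`. -/
lemma isShrinkable (hY : ∀ n, HasCofibrations (Y.obj n)) (hα : ∀ n, Creates (α.app n)) :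
    SSet.IsShrinkable (target α) where
  exists_contraction k y := by
    have hs : ∀ j, ∃ p : Marking (α.app k), p.c = y.1.obj j := fun j => by
      have := (hα k).essSurj
      exact ⟨⟨_, _, rfl, _, (α.app k).1.objObjPreimageIso (y.1.obj j)⟩, rfl⟩
    choose p hp using hs
    obtain ⟨s, hs, -⟩ := MarkedChain.exists_of_F (hY k) (hα k) y p hp
    -- The contraction must be a total function; for chains that do not lie over `φ`, `x` itself
    -- serves as a dummy value.
    have hc : ∀ n (φ : k ⟶ n) (x : MarkedChain (α.app n) n) (t : (Δ[1] : SSet.{w}).obj n),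
        ∃ z : MarkedChain (α.app n) n, x.F = (nw.obj Y).map φ y → z.F = x.F ∧ z.p = fun j =>
          if coord t j = 0 then x.p j else MarkedChain.p ((markedNerve α).map φ s) j := by
      intro n φ x t
      by_cases hx : x.F = (nw.obj Y).map φ y
      · obtain ⟨z, hz⟩ := MarkedChain.exists_of_F (hY n) (hα n) x.F (fun j =>
          if coord t j = 0 then x.p j else MarkedChain.p ((markedNerve α).map φ s) j) (fun j => by
            split_ifs
            · exact x.hC j
            · refine (MarkedChain.hC ((markedNerve α).map φ s) j).trans ?_
              rw [hx, ← hs]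
              rfl)
        exact ⟨z, fun _ => hz⟩
      · exact ⟨x, fun h => absurd h hx⟩
    choose c hc using hc
    refine ⟨s, c, hs, fun n φ x hx => ?_⟩
    have hFs : ∀ {n} (φ : k ⟶ n), MarkedChain.F ((markedNerve α).map φ s) = (nw.obj Y).map φ y := fun φ =>
      congrArg ((nw.obj Y).map φ) hs
    refine ⟨fun t => (hc n φ x t hx).1.trans hx, ?_, ?_, fun m ψ t => ?_⟩
    · exact MarkedChain.ext_F (hα n) (hc n φ x _ hx).1 (hc n φ x _ hx).2
    · exact MarkedChain.ext_F (hα n) ((hc n φ x _ hx).1.trans (hx.trans (hFs φ).symm)) (hc n φ x _ hx).2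
    · have hx' : MarkedChain.F ((markedNerve α).map ψ x) = (nw.obj Y).map (φ ≫ ψ) y := by
        rw [CategoryTheory.Functor.map_comp_apply]
        exact congrArg ((nw.obj Y).map ψ) hx
      obtain ⟨h1, h2⟩ := hc n φ x t hx
      obtain ⟨h3, h4⟩ := hc m (φ ≫ ψ) ((markedNerve α).map ψ x) ((Δ[1] : SSet.{w}).map ψ t) hx'
      refine MarkedChain.ext_F (hα m) ((congrArg ((nw.obj Y).map ψ) h1).trans h3.symm)
        (Eq.trans (funext fun j => ?_) h4.symm)
      refine (congrArg (fun p => Marking.map (p (ψ.unop.toOrderHom j)) _ _ (α.naturality ψ)) h2).trans ?_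
      refine (apply_ite (fun p => Marking.map p _ _ (α.naturality ψ)) _ _ _).trans ?_
      exact congrArg (fun z : (markedNerve α).obj m => if coord t (ψ.unop.toOrderHom j) = 0 then
        MarkedChain.p ((markedNerve α).map ψ x) j else MarkedChain.p z j)
        (CategoryTheory.Functor.map_comp_apply (markedNerve α) φ ψ s).symm

end markedNerve

/-- A map of simplicial Waldhausen categories which creates cofibrations and weak equivalences in each
degree induces a weak homotopy equivalence. -/
theorem isWeakHomotopyEquiv_nw_map (hY : ∀ n, HasCofibrations (Y.obj n)) (hα : ∀ n, Creates (α.app n)) :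
    IsWeakHomotopyEquiv (nw.map α) := by
  obtain ⟨H⟩ := markedNerve.nonempty_homotopy (α := α) hY
  exact isWeakHomotopyEquiv_comp (markedNerve.trivial α) (markedNerve.target α)
    (markedNerve.isShrinkable hY hα) (markedNerve.source α) rfl H

end Wald

/-! ### Assembly of the proposition -/

theorem mainTheorem6 (C : PolytopeComplex.{u, v}) :
    ∃ (hs : (PolytopeComplex.sWald C).IsSimplicialWaldhausen)
      (hL : (PolytopeComplex.lWald C).IsSimplicialWaldhausen)
      (hF : SimplicialWald.IsExactEquivalence (PolytopeComplex.sWald C) (PolytopeComplex.lWald C)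
        (PolytopeComplex.combHom C))
      (hS : ∀ n, IsExact (PolytopeComplex.LObj.waldData C n)
        (Wald.SObj.data (PolytopeComplex.SC.wald C) n) (PolytopeComplex.LObj.toS C n)),
      ∀ q : ℕ,
        IsWeakHomotopyEquiv (Wald.nw.map ((Wald.iterS q).map
          (SimplicialWald.toWaldHom hs hL (PolytopeComplex.combHom C) hF.exact))) ∧
        IsWeakHomotopyEquiv (Wald.nw.map ((Wald.iterS q).map
          (SimplicialWald.toWaldHom hs hL (PolytopeComplex.combHom C) hF.exact ≫
            PolytopeComplex.toSHom C hL hS))) := by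
  have hX : ∀ n, Wald.HasCofibrations
      (((PolytopeComplex.sWald C).toWald (PolytopeComplex.isSimplicialWaldhausen_sWald C)).obj n) :=
    fun n => .of_isWaldhausen (PolytopeComplex.SC.isWaldhausen (PolytopeComplex.s n.unop.len C))
  have hY : ∀ n, Wald.HasCofibrations
      (((PolytopeComplex.lWald C).toWald (PolytopeComplex.isSimplicialWaldhausen_lWald C)).obj n) :=
    fun n => .of_isWaldhausen (PolytopeComplex.LObj.isWaldhausen C n.unop.len)
  have hZ : ∀ n, Wald.HasCofibrations ((PolytopeComplex.SSC C).obj n) :=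
    fun n => (PolytopeComplex.LObj.hasCofibrations_sc C).sobj _
  have hF : ∀ n, Wald.Creates ((SimplicialWald.toWaldHom
      (PolytopeComplex.isSimplicialWaldhausen_sWald C) (PolytopeComplex.isSimplicialWaldhausen_lWald C)
      (PolytopeComplex.combHom C) (PolytopeComplex.isExactEquivalence_combHom C).exact).app n) :=
    fun n => PolytopeComplex.LObj.creates_comb C n.unop.len
  have hS : ∀ n, Wald.Creates ((PolytopeComplex.toSHom C (PolytopeComplex.isSimplicialWaldhausen_lWald C)
      (PolytopeComplex.LObj.isExact_toS C)).app n) :=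
    fun n => PolytopeComplex.LObj.creates_toS C n.unop.len
  refine ⟨PolytopeComplex.isSimplicialWaldhausen_sWald C, PolytopeComplex.isSimplicialWaldhausen_lWald C,
    PolytopeComplex.isExactEquivalence_combHom C, PolytopeComplex.LObj.isExact_toS C, fun q => ⟨?_, ?_⟩⟩
  · obtain ⟨-, h₁, h₂⟩ := Wald.creates_iterS q _ hX hY hF
    exact Wald.isWeakHomotopyEquiv_nw_map _ h₁ h₂
  -- Creation is closed under composition, so the composite to `S_• SC(C)` is treated directly,
  -- without a two-out-of-three property of weak equivalences.
  · obtain ⟨-, h₁, h₂⟩ := Wald.creates_iterS q (SimplicialWald.toWaldHom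
      (PolytopeComplex.isSimplicialWaldhausen_sWald C) (PolytopeComplex.isSimplicialWaldhausen_lWald C)
      (PolytopeComplex.combHom C) (PolytopeComplex.isExactEquivalence_combHom C).exact ≫
        PolytopeComplex.toSHom C _ (PolytopeComplex.LObj.isExact_toS C)) hX hZ
        fun n => (hF n).comp (hS n)
    exact Wald.isWeakHomotopyEquiv_nw_map _ h₁ h₂
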